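/- Let $M$ be a smooth $n$-dimensional manifold with boundary ($n\ge 1$; Hausdorff, second countable), and let $x\in C^\infty(M)$ be a boundary defining function with $0\le x\le 1/2$ everywhere. Fix a Riemannian b-metric on $M$, let $|\zeta|$ denote the induced norm on the fibers of the b-cotangent bundle ${}^bT^*M$, and let $\rho\in C^\infty({}^bT^*M)$ satisfy $0<\rho<1/2$ everywhere and $\rho=|\zeta|^{-1}$ for $|\zeta|\ge 4$. For $s,\ell\in\mathbb R$ let $H^{s+\ell\log}(\mathbb R^n)$ be the space of $u\in\mathscr S'(\mathbb R^n)$ with $\langle\xi\rangle^s\langle\log\langle\xi\rangle\rangle^\ell\hat u\in L^2$. Let $H^{s+\ell\log}_{b,\mathrm{loc}}(M)$ be the space of (extendible) distributions $u$ on $M$ such that, for every chart of $M$ with values $(x_0,y)$ in $[0,\infty)\times\mathbb R^{n-1}$ and every $\chi\in C^\infty_c(M)$ supported in the chart domain, $\chi u$ is in the coordinates $(-\log x_0,y)$ an element of $H^{s+\ell\log}(\mathbb R^n)$; put $H^{s+\ell\log,\,r+j\log}_{b,\mathrm{loc}}=x^r\log^{-j}(x^{-1})\,H^{s+\ell\log}_{b,\mathrm{loc}}$,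 and write $u\in H^{-\infty,\,r+j\log}_{b,\mathrm{loc}}$ if, locally, $u$ lies in $H^{m,\,r+j\log}_{b}$ for some $m\in\mathbb R$. Let $\Psi_b^{m+\ell\log}(M)$ be the space of b-pseudodifferential operators with conormal coefficients whose local symbols (in the coordinates $(-\log x_0,y)$ and the dual fiber coordinates $\zeta$) lie in $S^{m+\ell\log}$, i.e. satisfy the uniform symbol estimates of order $m$ with an extra factor $\langle\log\langle\zeta\rangle\rangle^\ell$, and whose Schwartz kernels vanish to infinite order at the side faces of the b-double space. Let $\ell,v,\mu>0$, and let $A$ be a quantization of $$a=\log^\ell\bigl(x^{-v}\rho^{-\mu}\bigr),$$ i.e. a properly supported operator in $\log^\ell(x^{-1})\circ\Psi_b^{\ell\log}(M)$ whose local symbols equal $a$ modulo $\log^\ell(x^{-1})\,S^{-1+\ell\log}$. Let $s,r\in\mathbb R$. Then: 1. If $u\in H^{-\infty,\,r+\ell\log}_{b,\mathrm{loc}}(M)$ and $Au\in H^{s,r}_{b,\mathrm{loc}}(M)$, then $u\in H^{s+\alpha\ell\log,\;r+(1-\alpha)\ell\log}_{b,\mathrm{loc}}(M)$ for every $\alpha\in[0,1]$.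 2. Conversely, if $u\in H^{s+\ell\log,\,r}_{b,\mathrm{loc}}(M)\cap H^{s,\,r+\ell\log}_{b,\mathrm{loc}}(M)$, then $Au\in H^{s,r}_{b,\mathrm{loc}}(M)$; in particular, in this case also $u\in H^{s+\alpha\ell\log,\;r+(1-\alpha)\ell\log}_{b,\mathrm{loc}}(M)$ for every $\alpha\in[0,1]$. -/

import Mathlib

open scoped Manifold ContDiff Topology SchwartzMap FourierTransform

noncomputable section

/-! ### Japanese brackets and logarithmic Sobolev spaces on `ℝⁿ` -/

/-- The Japanese bracket `⟨t⟩ = (1 + t²)^{1/2}`; `⟨ξ⟩` for a vector is `japanese ‖ξ‖`. -/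
def japanese (t : ℝ) : ℝ := Real.sqrt (1 + t ^ 2)

/-- The weight `⟨ξ⟩^s ⟨log ⟨ξ⟩⟩^ℓ`. -/
def logWeight {E : Type*} [NormedAddCommGroup E] (s ℓ : ℝ) (ξ : E) : ℝ :=
  japanese ‖ξ‖ ^ s * japanese (Real.log (japanese ‖ξ‖)) ^ ℓ

/-- `T ∈ H^{s + ℓ log}(ℝⁿ)`: `T` is a tempered distribution with
`⟨ξ⟩^s ⟨log ⟨ξ⟩⟩^ℓ T̂ = h ∈ L²`. -/
def MemHLog {n : ℕ} (s ℓ : ℝ) (T : 𝓢'(EuclideanSpace ℝ (Fin n), ℂ)) : Prop :=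
  ∃ h : EuclideanSpace ℝ (Fin n) → ℂ, MeasureTheory.MemLp h 2 MeasureTheory.volume ∧
    ∀ φ : 𝓢(EuclideanSpace ℝ (Fin n), ℂ),
      (𝓕 T) φ = ∫ ξ, ((logWeight s ℓ ξ)⁻¹ : ℝ) * h ξ * φ ξ

/-! ### Logarithmic coordinates

Near a boundary point a manifold with boundary has coordinates `(x₀, y)` with `x₀ ≥ 0`; on the
interior we pass to `(t, y)` with `t = -log x₀`. The b-vector fields `-x₀ ∂_{x₀}`, `∂_y` are the
coordinate vector fields of `(t, y)`, and fibre coordinates on the b-cotangent bundle are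
dual to `(t, y)`. -/

/-- `(x₀, y) ↦ (-log x₀, y)`. -/
def logPt {n : ℕ} [NeZero n] (z : EuclideanSpace ℝ (Fin n)) : EuclideanSpace ℝ (Fin n) :=
  WithLp.toLp 2 (Function.update z.ofLp 0 (-Real.log (z 0)))

/-- `(t, y) ↦ (e^{-t}, y)`. -/
def expPt {n : ℕ} [NeZero n] (w : EuclideanSpace ℝ (Fin n)) : EuclideanSpace ℝ (Fin n) :=
  WithLp.toLp 2 (Function.update w.ofLp 0 (Real.exp (-(w 0))))

/-- A function of `(t, y)`, written as a function of `(x₀, y)` and extended by zero to `x₀ ≤ 0`. -/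
def pullLog {n : ℕ} [NeZero n] (g : EuclideanSpace ℝ (Fin n) → ℂ) :
    EuclideanSpace ℝ (Fin n) → ℂ :=
  fun z => if 0 < z 0 then g (logPt z) else 0

/-- Test functions of the half space `{x₀ ≥ 0}`, written in logarithmic coordinates: in the
coordinates `(x₀, y)` they are smooth, vanish to infinite order at `x₀ = 0`, and have compact
support, contained in `V`. (A function that vanishes for `x₀ ≤ 0` and is smooth on all of `ℝⁿ`
vanishes to infinite order at `x₀ = 0`.) -/
def IsBTest {n : ℕ} [NeZero n] (V : Set (EuclideanSpace ℝ (Fin n)))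
    (g : EuclideanSpace ℝ (Fin n) → ℂ) : Prop :=
  ContDiff ℝ ∞ (pullLog g) ∧ HasCompactSupport (pullLog g) ∧ tsupport (pullLog g) ⊆ V

section Manifold

variable {n : ℕ} [NeZero n] {M : Type*} [TopologicalSpace M]

/-- A chart in logarithmic coordinates, `p ↦ (t, y)`. -/
def logChart (κ : OpenPartialHomeomorph M (EuclideanHalfSpace n)) (p : M) :
    EuclideanSpace ℝ (Fin n) :=
  logPt (κ.extend (𝓡∂ n) p)

/-- The inverse of a chart in logarithmic coordinates. -/
def logInv (κ : OpenPartialHomeomorph M (EuclideanHalfSpace n))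
    (w : EuclideanSpace ℝ (Fin n)) : M :=
  (κ.extend (𝓡∂ n)).symm (expPt w)

/-- The open subset of `ℝⁿ` parametrizing the interior points of a chart domain through
logarithmic coordinates. -/
def logDomain (κ : OpenPartialHomeomorph M (EuclideanHalfSpace n)) :
    Set (EuclideanSpace ℝ (Fin n)) :=
  {w | expPt w ∈ (κ.extend (𝓡∂ n)).target}

/-- The points of `logDomain κ` lying in the domain of a second chart `κ'`. -/
def logOverlap (κ κ' : OpenPartialHomeomorph M (EuclideanHalfSpace n)) :
    Set (EuclideanSpace ℝ (Fin n)) :=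
  {w | w ∈ logDomain κ ∧ logInv κ w ∈ κ'.source}

/-- The transition map from `κ` to `κ'` in logarithmic coordinates. -/
def logTrans (κ κ' : OpenPartialHomeomorph M (EuclideanHalfSpace n))
    (w : EuclideanSpace ℝ (Fin n)) : EuclideanSpace ℝ (Fin n) :=
  logChart κ' (logInv κ w)

/-- The derivative of the transition map in logarithmic coordinates: the matrix of the change of
b-frames. -/
def logJac (κ κ' : OpenPartialHomeomorph M (EuclideanHalfSpace n))
    (w : EuclideanSpace ℝ (Fin n)) :
    EuclideanSpace ℝ (Fin n) →L[ℝ] EuclideanSpace ℝ (Fin n) :=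
  fderiv ℝ (logTrans κ κ') w

open scoped Classical in
/-- The product of a function `θ` on `M` (in the coordinates of `κ`) with a function `g` of
logarithmic coordinates, extended by zero outside the domain of the coordinates. -/
def chartMul (κ : OpenPartialHomeomorph M (EuclideanHalfSpace n)) (θ : M → ℝ)
    (g : EuclideanSpace ℝ (Fin n) → ℂ) : EuclideanSpace ℝ (Fin n) → ℂ :=
  fun w => if w ∈ logDomain κ then (θ (logInv κ w) : ℂ) * g w else 0

open scoped Classical in
/-- Transport of a test function (viewed as a test density `g |dt dy|`) from the logarithmic
coordinates of `κ` to those of `κ'`. -/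
def transferDensity (κ κ' : OpenPartialHomeomorph M (EuclideanHalfSpace n))
    (g : EuclideanSpace ℝ (Fin n) → ℂ) : EuclideanSpace ℝ (Fin n) → ℂ :=
  fun w' => if w' ∈ logOverlap κ' κ then
    ((|(logJac κ' κ w').det| : ℝ) : ℂ) * g (logTrans κ' κ w') else 0

end Manifold

section Bundle

variable (n : ℕ) [NeZero n] (M : Type*) [TopologicalSpace M]
  [ChartedSpace (EuclideanHalfSpace n) M]

/-- (Complex valued, extendible) distributions on a manifold with boundary, i.e. continuous linear
functionals on the densities of compact support that are smooth and vanish to infinite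
order at the boundary. Such a distribution is given by its coordinate representations: for each
chart `κ` of the maximal smooth atlas, `pairing κ g = "∫ u g dt dy"` for test functions `g`
supported in the chart, and the representations transform as densities require. The values of
`pairing κ g` for other `κ` and `g` are meaningless and never used. -/
structure BDistribution where
  pairing : OpenPartialHomeomorph M (EuclideanHalfSpace n) →
    (EuclideanSpace ℝ (Fin n) → ℂ) → ℂ
  map_add : ∀ κ ∈ IsManifold.maximalAtlas (𝓡∂ n) ∞ M, ∀ g₁ g₂ : EuclideanSpace ℝ (Fin n) → ℂ,
    IsBTest (κ.extend (𝓡∂ n)).target g₁ → IsBTest (κ.extend (𝓡∂ n)).target g₂ →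
      pairing κ (g₁ + g₂) = pairing κ g₁ + pairing κ g₂
  map_smul : ∀ κ ∈ IsManifold.maximalAtlas (𝓡∂ n) ∞ M, ∀ (c : ℂ)
    (g : EuclideanSpace ℝ (Fin n) → ℂ), IsBTest (κ.extend (𝓡∂ n)).target g →
      pairing κ (c • g) = c * pairing κ g
  continuous : ∀ κ ∈ IsManifold.maximalAtlas (𝓡∂ n) ∞ M,
    ∀ K : Set (EuclideanSpace ℝ (Fin n)), IsCompact K → K ⊆ (κ.extend (𝓡∂ n)).target →
      ∃ (N : ℕ) (C : ℝ), ∀ g : EuclideanSpace ℝ (Fin n) → ℂ, IsBTest K g →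
        ∀ B : ℝ, (∀ k ≤ N, ∀ z, ‖iteratedFDeriv ℝ k (pullLog g) z‖ ≤ B) →
          ‖pairing κ g‖ ≤ C * B
  compat : ∀ κ ∈ IsManifold.maximalAtlas (𝓡∂ n) ∞ M,
    ∀ κ' ∈ IsManifold.maximalAtlas (𝓡∂ n) ∞ M, ∀ g : EuclideanSpace ℝ (Fin n) → ℂ,
      IsBTest ((κ.extend (𝓡∂ n)).target ∩ (κ.extend (𝓡∂ n)).symm ⁻¹' κ'.source) g →
        pairing κ g = pairing κ' (transferDensity κ κ' g)

/-- A Riemannian b-metric: in each chart, a positive definite symmetric form in the b-frame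
`-x₀ ∂_{x₀}, ∂_y`, with coefficients that are smooth up to the boundary, and transforming as
a metric does. -/
structure BMetric where
  coeff : OpenPartialHomeomorph M (EuclideanHalfSpace n) → EuclideanSpace ℝ (Fin n) →
    (EuclideanSpace ℝ (Fin n) →L[ℝ] EuclideanSpace ℝ (Fin n) →L[ℝ] ℝ)
  smooth : ∀ κ ∈ IsManifold.maximalAtlas (𝓡∂ n) ∞ M,
    ContDiffOn ℝ ∞ (coeff κ) (κ.extend (𝓡∂ n)).target
  symm : ∀ κ ∈ IsManifold.maximalAtlas (𝓡∂ n) ∞ M, ∀ z ∈ (κ.extend (𝓡∂ n)).target,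
    ∀ a b, coeff κ z a b = coeff κ z b a
  pos : ∀ κ ∈ IsManifold.maximalAtlas (𝓡∂ n) ∞ M, ∀ z ∈ (κ.extend (𝓡∂ n)).target,
    ∀ a, a ≠ 0 → 0 < coeff κ z a a
  compat : ∀ κ ∈ IsManifold.maximalAtlas (𝓡∂ n) ∞ M,
    ∀ κ' ∈ IsManifold.maximalAtlas (𝓡∂ n) ∞ M, ∀ w ∈ logOverlap κ κ', ∀ a b,
      coeff κ (expPt w) a b =
        coeff κ' (expPt (logTrans κ κ' w)) (logJac κ κ' w a) (logJac κ κ' w b)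

end Bundle

section Objects

variable {n : ℕ} [NeZero n] {M : Type*} [TopologicalSpace M]
  [ChartedSpace (EuclideanHalfSpace n) M]

/-- The norm on covectors `a ↦ ζ · a` dual to a positive definite form `B`. -/
def dualNorm (B : EuclideanSpace ℝ (Fin n) →L[ℝ] EuclideanSpace ℝ (Fin n) →L[ℝ] ℝ)
    (ζ : EuclideanSpace ℝ (Fin n)) : ℝ :=
  sSup {c : ℝ | ∃ a : EuclideanSpace ℝ (Fin n), B a a ≤ 1 ∧ c = inner ℝ ζ a}

/-- A smooth function `ρ` on the b-cotangent bundle with `0 < ρ < 1/2` everywhere and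
`ρ = |ζ|⁻¹` for `|ζ| ≥ 4`, where `|ζ|` is the norm dual to the b-metric `g`. In a chart, `ρ` is
a function of the base point `z = (x₀, y)` and of the fibre coordinates `ζ`. -/
structure BInvNorm (g : BMetric n M) where
  val : OpenPartialHomeomorph M (EuclideanHalfSpace n) → EuclideanSpace ℝ (Fin n) →
    EuclideanSpace ℝ (Fin n) → ℝ
  smooth : ∀ κ ∈ IsManifold.maximalAtlas (𝓡∂ n) ∞ M,
    ContDiffOn ℝ ∞ (fun q : EuclideanSpace ℝ (Fin n) × EuclideanSpace ℝ (Fin n) => val κ q.1 q.2)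
      ((κ.extend (𝓡∂ n)).target ×ˢ Set.univ)
  compat : ∀ κ ∈ IsManifold.maximalAtlas (𝓡∂ n) ∞ M,
    ∀ κ' ∈ IsManifold.maximalAtlas (𝓡∂ n) ∞ M, ∀ w ∈ logOverlap κ κ', ∀ ζ',
      val κ (expPt w) (ContinuousLinearMap.adjoint (logJac κ κ' w) ζ') =
        val κ' (expPt (logTrans κ κ' w)) ζ'
  pos : ∀ κ ∈ IsManifold.maximalAtlas (𝓡∂ n) ∞ M, ∀ z ∈ (κ.extend (𝓡∂ n)).target,
    ∀ ζ, 0 < val κ z ζ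
  lt_half : ∀ κ ∈ IsManifold.maximalAtlas (𝓡∂ n) ∞ M, ∀ z ∈ (κ.extend (𝓡∂ n)).target,
    ∀ ζ, val κ z ζ < 1 / 2
  eq_inv : ∀ κ ∈ IsManifold.maximalAtlas (𝓡∂ n) ∞ M, ∀ z ∈ (κ.extend (𝓡∂ n)).target,
    ∀ ζ, 4 ≤ dualNorm (g.coeff κ z) ζ → val κ z ζ = (dualNorm (g.coeff κ z) ζ)⁻¹

variable (n) in
/-- `x` is a boundary defining function of `M` with `x ≤ 1/2` everywhere. -/
structure IsBoundaryDefining (x : M → ℝ) : Prop where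
  smooth : ContMDiff (𝓡∂ n) 𝓘(ℝ, ℝ) ∞ x
  nonneg : ∀ p, 0 ≤ x p
  le_half : ∀ p, x p ≤ 1 / 2
  zero_iff : ∀ p, x p = 0 ↔ p ∈ (𝓡∂ n).boundary M
  deriv_ne_zero : ∀ p ∈ (𝓡∂ n).boundary M, mfderiv (𝓡∂ n) 𝓘(ℝ, ℝ) x p ≠ 0

/-- `χ ∈ C_c^∞` with support in the domain of `κ` (the support may meet the boundary of `M`). -/
structure IsCutoff (κ : OpenPartialHomeomorph M (EuclideanHalfSpace n)) (χ : M → ℝ) : Prop where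
  smooth : ContMDiff (𝓡∂ n) 𝓘(ℝ, ℝ) ∞ χ
  compact : HasCompactSupport χ
  subset : tsupport χ ⊆ κ.source

/-! ### Local weighted b-Sobolev spaces -/

/-- `χ u ∈ x^r log^{-j}(x⁻¹) H_b^{s + ℓ log}` in the chart `κ`: in logarithmic coordinates,
`χ x^{-r} log^j(x⁻¹) u` is (the restriction of) an element `T` of `H^{s + ℓ log}(ℝⁿ)`. -/
def MemHbAt (x : M → ℝ) (s ℓ r j : ℝ) (u : BDistribution n M)
    (κ : OpenPartialHomeomorph M (EuclideanHalfSpace n)) (χ : M → ℝ) : Prop :=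
  ∃ T : 𝓢'(EuclideanSpace ℝ (Fin n), ℂ), MemHLog s ℓ T ∧
    ∀ φ : 𝓢(EuclideanSpace ℝ (Fin n), ℂ), IsBTest Set.univ (fun w => φ w) →
      u.pairing κ (chartMul κ (fun p => χ p * (x p ^ (-r) * Real.log ((x p)⁻¹) ^ j))
        (fun w => φ w)) = T φ

/-- `u ∈ H_{b,loc}^{s + ℓ log, r + j log}(M)`. -/
def MemHbLoc (x : M → ℝ) (s ℓ r j : ℝ) (u : BDistribution n M) : Prop :=
  ∀ κ ∈ IsManifold.maximalAtlas (𝓡∂ n) ∞ M, ∀ χ : M → ℝ, IsCutoff κ χ →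
    MemHbAt x s ℓ r j u κ χ

/-- `u ∈ H_{b,loc}^{-∞, r + j log}(M)`: locally, `u` lies in `H_b^{m, r + j log}` for some `m`. -/
def MemHbLocNegInf (x : M → ℝ) (r j : ℝ) (u : BDistribution n M) : Prop :=
  ∀ κ ∈ IsManifold.maximalAtlas (𝓡∂ n) ∞ M, ∀ χ : M → ℝ, IsCutoff κ χ →
    ∃ m : ℝ, MemHbAt x m 0 r j u κ χ

/-! ### Symbols, kernels and quantization -/

/-- The class `⟨t⟩^j S^{m + ℓ log}` of conormal symbols in logarithmic coordinates `w = (t, y)`,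
with `ζ` dual to `w`: all derivatives satisfy
`|∂_w^q ∂_ζ^k b| ≤ C_{qk} ⟨t⟩^j ⟨ζ⟩^{m - k} ⟨log ⟨ζ⟩⟩^ℓ`. -/
def IsLogSymbol (m ℓ j : ℝ) (b : EuclideanSpace ℝ (Fin n) → EuclideanSpace ℝ (Fin n) → ℂ) :
    Prop :=
  ContDiff ℝ ∞ (fun q : EuclideanSpace ℝ (Fin n) × EuclideanSpace ℝ (Fin n) => b q.1 q.2) ∧
  ∀ q k : ℕ, ∃ C : ℝ, ∀ w ζ : EuclideanSpace ℝ (Fin n),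
    ‖iteratedFDeriv ℝ q (fun w' => iteratedFDeriv ℝ k (b w') ζ) w‖ ≤
      C * japanese (w 0) ^ j * logWeight (m - k) ℓ ζ

/-- The transpose of the b-quantization of `b`, cut off near the diagonal by `ψ`: the
operator with Schwartz kernel
`(2π)⁻ⁿ ∫ e^{i (w - w')·ζ} b(w, ζ) dζ ψ(w - w')` in logarithmic coordinates, integrated
against `f` in the first variable. -/
def opTranspose (b : EuclideanSpace ℝ (Fin n) → EuclideanSpace ℝ (Fin n) → ℂ)
    (ψ : EuclideanSpace ℝ (Fin n) → ℝ) (f : EuclideanSpace ℝ (Fin n) → ℂ)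
    (w' : EuclideanSpace ℝ (Fin n)) : ℂ :=
  (((2 * Real.pi) ^ n)⁻¹ : ℝ) * ∫ ζ : EuclideanSpace ℝ (Fin n), ∫ w : EuclideanSpace ℝ (Fin n),
    Complex.exp (Complex.I * (inner ℝ (w - w') ζ : ℝ)) * b w ζ * (ψ (w - w') : ℂ) * f w

/-- Schwartz kernels of residual operators in `log^j(x⁻¹) Ψ_b^{-∞}`, from the chart `κ'` to the
chart `κ`: smooth, with support over compact subsets of the two chart domains, and with all
b-derivatives decaying superexponentially in `t - t'`, i.e. to infinite order at the side
faces `x/x' → 0` and `x/x' → ∞`. -/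
def IsResidualKernel (j : ℝ) (κ κ' : OpenPartialHomeomorph M (EuclideanHalfSpace n))
    (K : EuclideanSpace ℝ (Fin n) → EuclideanSpace ℝ (Fin n) → ℂ) : Prop :=
  ContDiff ℝ ∞ (fun q : EuclideanSpace ℝ (Fin n) × EuclideanSpace ℝ (Fin n) => K q.1 q.2) ∧
  (∃ S S' : Set M, IsCompact S ∧ S ⊆ κ.source ∧ IsCompact S' ∧ S' ⊆ κ'.source ∧
    ∀ w w', K w w' ≠ 0 →
      (w ∈ logDomain κ ∧ logInv κ w ∈ S) ∧ (w' ∈ logDomain κ' ∧ logInv κ' w' ∈ S')) ∧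
  ∀ (k N : ℕ), ∃ C : ℝ, ∀ w w' : EuclideanSpace ℝ (Fin n),
    ‖iteratedFDeriv ℝ k (fun q : EuclideanSpace ℝ (Fin n) × EuclideanSpace ℝ (Fin n) => K q.1 q.2)
      (w, w')‖ ≤ C * japanese (w 0) ^ j * Real.exp (-(N * |w 0 - w' 0|))

/-- The symbol `a = log^ℓ(x^{-v} ρ^{-μ})` in the chart `κ`, as a function of the logarithmic
coordinates `w` and the dual coordinates `ζ`. -/
def doubleLogSymbol (x : M → ℝ) {g : BMetric n M} (ρ : BInvNorm g) (ℓ v μ : ℝ)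
    (κ : OpenPartialHomeomorph M (EuclideanHalfSpace n))
    (w ζ : EuclideanSpace ℝ (Fin n)) : ℝ :=
  Real.log (x (logInv κ w) ^ (-v) * ρ.val κ (expPt w) ζ ^ (-μ)) ^ ℓ

/-- `A` is a quantization of `a = log^ℓ(x^{-v} ρ^{-μ})`: a properly supported operator in the class
`log^ℓ(x⁻¹) Ψ_b^{ℓ log}(M)` with principal symbol `a`.

In each chart `κ`, for cutoffs `χ` and `χ'` with `χ' = 1` near the support of `χ`,
the operator `χ A` is the sum of the b-quantization (acting on `χ' u`) of a symbol
`b ∈ log^ℓ(x⁻¹) S^{ℓ log}` that equals `χ a` modulo `log^ℓ(x⁻¹) S^{-1 + ℓ log}`, and of finitely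
many residual operators, going from charts `κᵢ` to `κ`. -/
def IsQuantization (x : M → ℝ) {g : BMetric n M} (ρ : BInvNorm g) (ℓ v μ : ℝ)
    (A : BDistribution n M → BDistribution n M) : Prop :=
  ∀ κ ∈ IsManifold.maximalAtlas (𝓡∂ n) ∞ M, ∀ χ χ' : M → ℝ, IsCutoff κ χ → IsCutoff κ χ' →
    (∀ᶠ p in 𝓝ˢ (tsupport χ), χ' p = 1) →
    ∃ (b : EuclideanSpace ℝ (Fin n) → EuclideanSpace ℝ (Fin n) → ℂ)
      (ψ : EuclideanSpace ℝ (Fin n) → ℝ) (N : ℕ)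
      (κs : Fin N → OpenPartialHomeomorph M (EuclideanHalfSpace n))
      (K : Fin N → EuclideanSpace ℝ (Fin n) → EuclideanSpace ℝ (Fin n) → ℂ),
      IsLogSymbol 0 ℓ ℓ b ∧
      (∀ w ζ, b w ζ ≠ 0 → w ∈ logDomain κ ∧ logInv κ w ∈ tsupport χ) ∧
      IsLogSymbol (-1) ℓ ℓ (fun w ζ => b w ζ -
        chartMul κ χ (fun w' => (doubleLogSymbol x ρ ℓ v μ κ w' ζ : ℂ)) w) ∧
      ContDiff ℝ ∞ ψ ∧ HasCompactSupport ψ ∧ (∀ᶠ w in 𝓝 0, ψ w = 1) ∧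
      (∀ i, κs i ∈ IsManifold.maximalAtlas (𝓡∂ n) ∞ M ∧ IsResidualKernel ℓ κ (κs i) (K i)) ∧
      ∀ (u : BDistribution n M) (f : EuclideanSpace ℝ (Fin n) → ℂ), IsBTest Set.univ f →
        (A u).pairing κ (chartMul κ χ f) =
          u.pairing κ (chartMul κ χ' (opTranspose b ψ f)) +
            ∑ i, u.pairing (κs i) (fun w' => ∫ w, K i w w' * f w)

end Objects

end

noncomputable section


/-! ### Japanese brackets and moderate weights -/

/-! Membership in the weighted spaces is dual to an estimate. By Hahn–Banach and Riesz
(`exists_memHLog_of_bound`, with converse `MemHLog.bound`), `u` is of order `s + ℓ log` and weight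
`r + j log` on the support of a cutoff `χ` exactly when `φ ↦ ⟨u, χ x^{-r} log^j(x⁻¹) φ⟩`, on test
functions, is bounded by the `L²` norm of `⟨ξ⟩^{-s} ⟨log⟨ξ⟩⟩^{-ℓ} φ̂`. Since `A` is described
through its transpose, everything reduces to weighted `L²` bounds for operators acting on test
functions.

Put `X = log x⁻¹` and `R = log ρ⁻¹`. In logarithmic coordinates `X ~ ⟨t⟩` and `R ~ ⟨log⟨ζ⟩⟩`, with
bounds on all derivatives in `w = (t, y)`, and `a = (vX + μR)^ℓ ~ (X + R)^ℓ`. As `X^{(1-α)ℓ} R^{αℓ}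
≤ (X + R)^ℓ`, the quotient `q = χ X^{(1-α)ℓ} / a` is a symbol of order `-αℓ log`
(`isLocSym_quotient`). The transpose of `A` composed with the quantization `Q` of `q` is
multiplication by `χ X^{(1-α)ℓ}`, up to residual terms and an error of size `X^ℓ` and order `-1 + ℓ
log`. Hence `⟨u, χ x^{-r} X^{(1-α)ℓ} φ⟩` is `⟨Au, x^{-r} Qφ⟩` minus an error term and residual
terms. The first pairing has the regularity claimed for `u`. The error gains almost one derivative
and costs the weight `log^ℓ(x⁻¹)`, which is what the a priori assumption on `u` provides
(`MemHbAt.improve`). With `α = 0` the conclusion has that same weight, so the step can be repeated,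
half a derivative at a time, until order `s` is reached (`MemHbAt.iterate`); one last step uses the
given `α`.

Conversely `a ≤ C (X^ℓ + R^ℓ)`, so `χ a` splits into a part of size `X^ℓ` and order `0` and a part
of size `1` and order `ℓ log` (`exists_splitting`); each of the two assumptions on `u` handles one
part. The last claim combines the two directions.

The operator bounds avoid the symbol calculus. A weighted norm of `φ̂` is equivalent to a phase
space norm of the windowed Fourier transform of `φ` (`stftSq_le`, `le_stftSq`), and an operator
whose windowed transform is controlled by a kernel decaying off the diagonal is bounded by a Schur
test (`wsq_le_of_stft_le`). In the composition above the transpose evaluates `b` at its input and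
`Q` evaluates `q` at its output, so both are taken at the same middle point `w`: the amplitude is
exactly `b(w,ζ) q(w,η)`, and `b(w,ζ) - b(w,η)` is one order lower at the price of a power of `1 + |ζ
- η|`. Integration by parts in the three position variables (`norm_integral_tripleKernel_le`)
produces decay in `ξ - ζ` and `ζ - η` that pays for this power. Thus only derivatives in `w` and a
single derivative in `ζ` are used. Residual kernels are bounded between all weighted spaces
(`wsq_resOp_le`). The weights `e^{-rt} ⟨t⟩^j` change by at most an exponential of `|t - t'|` between
two points, so conjugation by them is harmless for kernels near the diagonal and for kernels of
superexponential decay. -/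

lemma one_le_japanese (t : ℝ) : 1 ≤ japanese t := by
  unfold japanese
  rw [Real.one_le_sqrt]
  nlinarith [sq_nonneg t]

lemma japanese_pos (t : ℝ) : 0 < japanese t := lt_of_lt_of_le one_pos (one_le_japanese t)

lemma japanese_sq (t : ℝ) : japanese t ^ 2 = 1 + t ^ 2 := by
  unfold japanese
  exact Real.sq_sqrt (by positivity)

lemma abs_le_japanese (t : ℝ) : |t| ≤ japanese t := by
  apply abs_le_of_sq_le_sq _ (japanese_pos t).le
  rw [japanese_sq]; linarith

lemma japanese_le_one_add (t : ℝ) : japanese t ≤ 1 + |t| := by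
  have h := japanese_sq t
  have := japanese_pos t
  have h2 := abs_nonneg t
  have h3 := sq_abs t
  nlinarith

lemma continuous_japanese : Continuous japanese := by
  unfold japanese; fun_prop

lemma japanese_mono {a b : ℝ} (h : |a| ≤ |b|) : japanese a ≤ japanese b := by
  unfold japanese
  apply Real.sqrt_le_sqrt
  have := sq_le_sq.mpr h
  linarith

lemma japanese_le_add (a b : ℝ) : japanese a ≤ japanese b + |a - b| := by
  have h1 := japanese_sq a
  have h2 := japanese_sq b
  have h3 := abs_le_japanese b
  have h4 := japanese_pos b
  have h5 := abs_nonneg (a - b)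
  have h6 := sq_abs (a - b)
  have h7 : (a - b) * b ≤ |a - b| * japanese b :=
    (le_abs_self _).trans (by rw [abs_mul]; gcongr)
  refine abs_le_of_sq_le_sq' ?_ (by positivity) |>.2
  nlinarith

lemma japanese_le_mul (a b : ℝ) : japanese a ≤ japanese b * (1 + |a - b|) := by
  have := japanese_le_add a b
  nlinarith [one_le_japanese b, abs_nonneg (a - b)]

/-- The logarithm turns the factor `c` into a summand `log c`, and `1 + log c ≤ c`. With `c = 1 + |ξ
- η|` this makes `⟨log⟨ξ⟩⟩` a moderate weight. -/
lemma japanese_log_le_mul {a b c : ℝ} (ha : 1 ≤ a) (hb : 1 ≤ b) (hc : 1 ≤ c) (h1 : a ≤ b * c) :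
    japanese (Real.log a) ≤ japanese (Real.log b) * c := by
  have hla := Real.log_nonneg ha
  have hlb := Real.log_nonneg hb
  have hlc := Real.log_nonneg hc
  have e1 : Real.log a ≤ Real.log b + Real.log c := by
    rw [← Real.log_mul (by positivity) (by positivity)]
    exact Real.log_le_log (by positivity) h1
  have e2 : japanese (Real.log a) ≤ japanese (Real.log b + Real.log c) :=
    japanese_mono (by rw [abs_of_nonneg hla, abs_of_nonneg (by positivity)]; exact e1)
  have e3 := japanese_le_mul (Real.log b + Real.log c) (Real.log b)
  rw [add_sub_cancel_left, abs_of_nonneg hlc] at e3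
  have e4 : 1 + Real.log c ≤ c := by
    have := Real.log_le_sub_one_of_pos (show 0 < c by positivity); linarith
  exact e2.trans (e3.trans (by gcongr; exact (japanese_pos _).le))

section Weights

variable {E : Type*} [NormedAddCommGroup E]

/-- A positive continuous function that grows at most polynomially under translation. -/
structure Moderate (M : E → ℝ) : Prop where
  cont : Continuous M
  pos : ∀ ξ, 0 < M ξ
  bound : ∃ (C : ℝ) (N : ℕ), 0 < C ∧ ∀ ξ η, M ξ ≤ C * M η * (1 + ‖ξ - η‖) ^ N

lemma Moderate.mul {M M' : E → ℝ} (h : Moderate M) (h' : Moderate M') :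
    Moderate (fun ξ => M ξ * M' ξ) := by
  obtain ⟨C, N, hC, hb⟩ := h.bound
  obtain ⟨C', N', hC', hb'⟩ := h'.bound
  refine ⟨h.cont.mul h'.cont, fun ξ => mul_pos (h.pos ξ) (h'.pos ξ), C * C', N + N', by positivity,
    fun ξ η => ?_⟩
  have := mul_le_mul (hb ξ η) (hb' ξ η) (h'.pos ξ).le
    (by have := h.pos η; positivity)
  calc _ ≤ _ := this
    _ = _ := by ring

lemma Moderate.rpow {M : E → ℝ} (h : Moderate M) (s : ℝ) : Moderate (fun ξ => M ξ ^ s) := by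
  obtain ⟨C, N, hC, hb⟩ := h.bound
  refine ⟨h.cont.rpow_const (fun ξ => Or.inl (h.pos ξ).ne'), fun ξ => Real.rpow_pos_of_pos (h.pos ξ) s,
    C ^ |s|, ⌈N * |s|⌉₊, by positivity, fun ξ η => ?_⟩
  have key : ∀ ξ η, M ξ ^ |s| ≤ C ^ |s| * M η ^ |s| * (1 + ‖ξ - η‖) ^ ⌈N * |s|⌉₊ := by
    intro ξ η
    have h1 : (1:ℝ) ≤ 1 + ‖ξ - η‖ := by linarith [norm_nonneg (ξ - η)]
    have h0 := h.pos η
    calc M ξ ^ |s| ≤ (C * M η * (1 + ‖ξ - η‖) ^ N) ^ |s| :=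
          Real.rpow_le_rpow (h.pos ξ).le (hb ξ η) (abs_nonneg s)
      _ = C ^ |s| * M η ^ |s| * (1 + ‖ξ - η‖) ^ (N * |s|) := by
          rw [Real.mul_rpow (by positivity) (by positivity), Real.mul_rpow hC.le h0.le,
            ← Real.rpow_natCast, ← Real.rpow_mul (by positivity)]
      _ ≤ _ := by
          gcongr
          rw [← Real.rpow_natCast]
          exact Real.rpow_le_rpow_of_exponent_le h1 (Nat.le_ceil _)
  rcases le_total 0 s with hs | hs
  · have := key ξ η
    rwa [abs_of_nonneg hs] at this ⊢
  -- For negative exponents the bound for `|s|` is inverted, with the two points exchanged.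
  · have h2 := key η ξ
    have e : ∀ ξ, M ξ ^ s = (M ξ ^ |s|)⁻¹ := fun ξ => by
      rw [abs_of_nonpos hs, Real.rpow_neg (h.pos ξ).le, inv_inv]
    have p1 : 0 < M ξ ^ |s| := Real.rpow_pos_of_pos (h.pos ξ) _
    have p2 : 0 < M η ^ |s| := Real.rpow_pos_of_pos (h.pos η) _
    rw [e, e, inv_le_iff_one_le_mul₀ p1]
    rw [norm_sub_rev] at h2
    calc (1:ℝ) = (M η ^ |s|)⁻¹ * M η ^ |s| := by field_simp
      _ ≤ (M η ^ |s|)⁻¹ * (C ^ |s| * M ξ ^ |s| * (1 + ‖ξ - η‖) ^ ⌈N * |s|⌉₊) := by gcongr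
      _ = _ := by ring

lemma moderate_japanese : Moderate (fun ξ : E => japanese ‖ξ‖) := by
  refine ⟨continuous_japanese.comp continuous_norm, fun ξ => japanese_pos _, 1, 1, one_pos,
    fun ξ η => ?_⟩
  rw [one_mul, pow_one]
  refine (japanese_le_mul _ ‖η‖).trans ?_
  gcongr
  · exact (japanese_pos _).le
  · exact abs_norm_sub_norm_le ξ η

lemma moderate_logJapanese : Moderate (fun ξ : E => japanese (Real.log (japanese ‖ξ‖))) := by
  refine ⟨continuous_japanese.comp ((continuous_japanese.comp continuous_norm).log
    (fun ξ => (japanese_pos _).ne')), fun ξ => japanese_pos _, 1, 1, one_pos,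
    fun ξ η => ?_⟩
  rw [one_mul, pow_one]
  refine japanese_log_le_mul (one_le_japanese _) (one_le_japanese _)
    (by linarith [norm_nonneg (ξ - η)]) ?_
  refine (japanese_le_mul _ ‖η‖).trans ?_
  gcongr
  · exact (japanese_pos _).le
  · exact abs_norm_sub_norm_le ξ η

lemma moderate_logWeight (s ℓ : ℝ) : Moderate (logWeight s ℓ : E → ℝ) :=
  (moderate_japanese.rpow s).mul (moderate_logJapanese.rpow ℓ)

lemma logWeight_pos (s ℓ : ℝ) (ξ : E) : 0 < logWeight s ℓ ξ := (moderate_logWeight s ℓ).pos ξ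

lemma logWeight_mul (s ℓ s' ℓ' : ℝ) (ξ : E) :
    logWeight s ℓ ξ * logWeight s' ℓ' ξ = logWeight (s + s') (ℓ + ℓ') ξ := by
  unfold logWeight
  rw [Real.rpow_add (japanese_pos _), Real.rpow_add (japanese_pos _)]; ring

lemma logWeight_inv (s ℓ : ℝ) (ξ : E) : (logWeight s ℓ ξ)⁻¹ = logWeight (-s) (-ℓ) ξ := by
  unfold logWeight
  rw [Real.rpow_neg (japanese_pos _).le, Real.rpow_neg (japanese_pos _).le, mul_inv]

lemma logWeight_neg (s ℓ : ℝ) (ξ : E) : logWeight s ℓ (-ξ) = logWeight s ℓ ξ := by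
  unfold logWeight; rw [norm_neg]

lemma logWeight_mono {s ℓ s' ℓ' : ℝ} (hs : s ≤ s') (hℓ : ℓ ≤ ℓ') (ξ : E) :
    logWeight s ℓ ξ ≤ logWeight s' ℓ' ξ := by
  unfold logWeight
  gcongr
  · exact (Real.rpow_pos_of_pos (japanese_pos _) _).le
  · exact (Real.rpow_pos_of_pos (japanese_pos _) _).le
  · exact one_le_japanese _
  · exact one_le_japanese _

/-- From `log t ≤ t^δ / δ`, raised to the power `k` with `δ` so small that `δ k ≤ ε`. -/
lemma logJapanese_rpow_le {ε : ℝ} (hε : 0 < ε) (k : ℝ) :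
    ∃ C > 0, ∀ ξ : E, japanese (Real.log (japanese ‖ξ‖)) ^ k ≤ C * japanese ‖ξ‖ ^ ε := by
  -- A positive upper bound for `k`, so that `ε / K` is a positive exponent.
  set K := max k 1 with hK
  have hKpos : 0 < K := lt_of_lt_of_le one_pos (le_max_right _ _)
  set δ := min 1 (ε / K) with hδ
  have hδ0 : 0 < δ := by positivity
  refine ⟨(1 + δ⁻¹) ^ K, by positivity, fun ξ => ?_⟩
  have hJ := one_le_japanese ‖ξ‖
  have h1 : japanese (Real.log (japanese ‖ξ‖)) ≤ (1 + δ⁻¹) * japanese ‖ξ‖ ^ δ := by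
    refine (japanese_le_one_add _).trans ?_
    rw [abs_of_nonneg (Real.log_nonneg hJ)]
    have h2 := Real.log_le_rpow_div (japanese_pos ‖ξ‖).le hδ0
    have h3 : 1 ≤ japanese ‖ξ‖ ^ δ := Real.one_le_rpow hJ hδ0.le
    rw [div_eq_mul_inv] at h2
    nlinarith
  calc _ ≤ japanese (Real.log (japanese ‖ξ‖)) ^ K :=
        Real.rpow_le_rpow_of_exponent_le (one_le_japanese _) (le_max_left _ _)
    _ ≤ ((1 + δ⁻¹) * japanese ‖ξ‖ ^ δ) ^ K := Real.rpow_le_rpow (japanese_pos _).le h1 hKpos.le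
    _ = (1 + δ⁻¹) ^ K * japanese ‖ξ‖ ^ (δ * K) := by
        rw [Real.mul_rpow (by positivity) (by positivity), ← Real.rpow_mul (by positivity)]
    _ ≤ _ := by
        gcongr 2
        calc δ * K ≤ ε / K * K := by gcongr; exact min_le_right _ _
          _ = ε := by field_simp

/-- An arbitrarily small power dominates logarithms. -/
lemma logWeight_le_of_lt {s s' : ℝ} (hs : s < s') (ℓ ℓ' : ℝ) :
    ∃ C > 0, ∀ ξ : E, logWeight s ℓ ξ ≤ C * logWeight s' ℓ' ξ := by
  obtain ⟨C, hC, h⟩ := logJapanese_rpow_le (E := E) (sub_pos.mpr hs) (ℓ - ℓ')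
  refine ⟨C, hC, fun ξ => ?_⟩
  have h1 := h ξ
  have := logWeight_mul (s' - s) 0 s ℓ' ξ
  have e : logWeight s ℓ ξ = japanese (Real.log (japanese ‖ξ‖)) ^ (ℓ - ℓ') * logWeight s ℓ' ξ := by
    unfold logWeight
    rw [Real.rpow_sub (japanese_pos _)]
    have := (Real.rpow_pos_of_pos (japanese_pos (Real.log (japanese ‖ξ‖))) ℓ').ne'
    field_simp
  rw [e]
  have e2 : logWeight s' ℓ' ξ = japanese ‖ξ‖ ^ (s' - s) * logWeight s ℓ' ξ := by
    rw [show s' = (s' - s) + s by ring, show ℓ' = 0 + ℓ' by ring, ← logWeight_mul]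
    simp [logWeight]
  rw [e2, ← mul_assoc]
  have := logWeight_pos s ℓ' ξ
  gcongr

lemma moderate_const_pow (N : ℕ) : Moderate (fun ξ : E => (1 + ‖ξ‖) ^ N) := by
  refine ⟨by fun_prop, fun ξ => by positivity, 1, N, one_pos, fun ξ η => ?_⟩
  rw [one_mul, ← mul_pow]
  gcongr
  have := norm_sub_norm_le ξ η
  nlinarith [norm_nonneg η, norm_nonneg (ξ - η)]

lemma Moderate.le_pow {M : E → ℝ} (h : Moderate M) :
    ∃ (C : ℝ) (N : ℕ), 0 < C ∧ ∀ ξ, M ξ ≤ C * (1 + ‖ξ‖) ^ N := by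
  obtain ⟨C, N, hC, hb⟩ := h.bound
  refine ⟨C * M 0, N, mul_pos hC (h.pos 0), fun ξ => ?_⟩
  simpa using hb ξ 0

end Weights

/-- Needed because the two conventions for the Fourier transform differ by the factor `-2π` in the
fibre variable. Negative exponents follow by scaling with `c⁻¹`. -/
lemma logWeight_smul_le {E : Type*} [NormedAddCommGroup E] [NormedSpace ℝ E] (s ℓ : ℝ) {c : ℝ}
    (hc : c ≠ 0) : ∃ C > 0, ∀ ξ : E, logWeight s ℓ (c • ξ) ≤ C * logWeight s ℓ ξ := by
  have J : ∀ c : ℝ, ∀ ξ : E, japanese ‖c • ξ‖ ≤ japanese ‖ξ‖ * (1 + |c|) := fun c ξ => by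
    have h1 := japanese_sq ‖ξ‖
    have h2 := japanese_sq ‖c • ξ‖
    have := japanese_pos ‖ξ‖
    rw [norm_smul, Real.norm_eq_abs] at h2 ⊢
    refine abs_le_of_sq_le_sq' ?_ (by positivity) |>.2
    rw [h2, mul_pow, mul_pow, h1]
    nlinarith [abs_nonneg c, norm_nonneg ξ, mul_nonneg (abs_nonneg c) (sq_nonneg ‖ξ‖)]
  have L : ∀ c : ℝ, ∀ ξ : E, japanese (Real.log (japanese ‖c • ξ‖)) ≤
      japanese (Real.log (japanese ‖ξ‖)) * (1 + |c|) := fun c ξ =>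
    japanese_log_le_mul (one_le_japanese _) (one_le_japanese _)
      (by linarith [abs_nonneg c]) (J c ξ)
  have key : ∀ (f : E → ℝ), (∀ ξ, 0 < f ξ) → (∀ c : ℝ, ∀ ξ : E, f (c • ξ) ≤ f ξ * (1 + |c|)) →
      ∀ s : ℝ, ∃ C > 0, ∀ ξ, f (c • ξ) ^ s ≤ C * f ξ ^ s := by
    intro f hf h s
    rcases le_total 0 s with hs | hs
    · refine ⟨(1 + |c|) ^ s, by positivity, fun ξ => ?_⟩
      have := Real.rpow_le_rpow (hf _).le (h c ξ) hs
      rwa [Real.mul_rpow (hf _).le (by positivity), mul_comm] at this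
    · refine ⟨(1 + |c⁻¹|) ^ (-s), by positivity, fun ξ => ?_⟩
      have h1 := h c⁻¹ (c • ξ)
      rw [smul_smul, inv_mul_cancel₀ hc, one_smul] at h1
      have := Real.rpow_le_rpow (hf _).le h1 (neg_nonneg.mpr hs)
      rw [Real.mul_rpow (hf _).le (by positivity), Real.rpow_neg (hf _).le,
        Real.rpow_neg (hf _).le] at this
      have p1 := Real.rpow_pos_of_pos (hf ξ) s
      have p2 := Real.rpow_pos_of_pos (hf (c • ξ)) s
      rw [inv_le_iff_one_le_mul₀ p1] at this
      calc f (c • ξ) ^ s = f (c • ξ) ^ s * 1 := by ring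
        _ ≤ f (c • ξ) ^ s * (((f (c • ξ) ^ s)⁻¹ * (1 + |c⁻¹|) ^ (-s)) * f ξ ^ s) := by gcongr
        _ = _ := by field_simp
  obtain ⟨C, hC, h⟩ := key (fun ξ => japanese ‖ξ‖) (fun ξ => japanese_pos _) J s
  obtain ⟨C', hC', h'⟩ := key (fun ξ => japanese (Real.log (japanese ‖ξ‖)))
    (fun ξ => japanese_pos _) L ℓ
  refine ⟨C * C', by positivity, fun ξ => ?_⟩
  unfold logWeight
  calc _ ≤ (C * japanese ‖ξ‖ ^ s) * (C' * japanese (Real.log (japanese ‖ξ‖)) ^ ℓ) :=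
        mul_le_mul (h ξ) (h' ξ) (Real.rpow_pos_of_pos (japanese_pos _) _).le
          (by have := Real.rpow_pos_of_pos (japanese_pos ‖ξ‖) s; positivity)
    _ = _ := by ring

noncomputable section

open scoped ENNReal NNReal


/-! ### Duality: logarithmic Sobolev regularity through bounds on test functions -/

open MeasureTheory in
lemma lintegral_mul_sq_le {α : Type*} [MeasurableSpace α] {μ : Measure α} {f g : α → ℝ≥0∞}
    (hf : AEMeasurable f μ) (hg : AEMeasurable g μ) :
    (∫⁻ a, f a * g a ∂μ) ^ 2 ≤ (∫⁻ a, f a ^ 2 ∂μ) * ∫⁻ a, g a ^ 2 ∂μ := by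
  have h := ENNReal.lintegral_mul_le_Lp_mul_Lq μ Real.HolderConjugate.two_two hf hg
  have e : ∀ x : ℝ≥0∞, (x ^ (1 / 2 : ℝ)) ^ 2 = x := fun x => by
    rw [← ENNReal.rpow_natCast, ← ENNReal.rpow_mul]; norm_num
  calc (∫⁻ a, f a * g a ∂μ) ^ 2 ≤
        ((∫⁻ a, f a ^ (2:ℝ) ∂μ) ^ (1 / 2 : ℝ) * (∫⁻ a, g a ^ (2:ℝ) ∂μ) ^ (1 / 2 : ℝ)) ^ 2 := by
        gcongr; exact h
    _ = _ := by
        rw [mul_pow, e, e]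
        simp only [ENNReal.rpow_ofNat]

/-- The squared weighted `L²` norm `∫ M(ξ)² |φ̂(ξ)|² dξ`. -/
def wsq {n : ℕ} (M : EuclideanSpace ℝ (Fin n) → ℝ) (φ : EuclideanSpace ℝ (Fin n) → ℂ) : ℝ≥0∞ :=
  ∫⁻ ξ, ENNReal.ofReal (M ξ) ^ 2 * ‖𝓕 φ ξ‖ₑ ^ 2

section Riesz

open MeasureTheory

variable {n : ℕ}

local notation "E" => EuclideanSpace ℝ (Fin n)

lemma wsq_mono {M M' : E → ℝ} {C : ℝ} (hC : 0 ≤ C) (h : ∀ ξ, M ξ ≤ C * M' ξ)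
    (φ : E → ℂ) : wsq M φ ≤ ENNReal.ofReal C ^ 2 * wsq M' φ := by
  unfold wsq
  rw [← lintegral_const_mul' _ _ (by finiteness)]
  refine lintegral_mono fun ξ => ?_
  rw [← mul_assoc, ← mul_pow (ENNReal.ofReal C), ← ENNReal.ofReal_mul hC]
  gcongr
  exact h ξ

lemma wsq_fourierInv {M : E → ℝ} (hM : ∀ ξ, M (-ξ) = M ξ) (φ : E → ℂ) :
    wsq M φ = ∫⁻ ξ, ENNReal.ofReal (M ξ) ^ 2 * ‖𝓕⁻ φ ξ‖ₑ ^ 2 := by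
  unfold wsq
  rw [← lintegral_neg_eq_self]
  refine lintegral_congr fun ξ => ?_
  rw [hM, Real.fourierInv_eq_fourier_neg]

lemma hasTemperateGrowth_one_add_norm_sq_pow (k : ℕ) :
    Function.HasTemperateGrowth (fun ξ : E => (((1 + ‖ξ‖ ^ 2) ^ k : ℝ) : ℂ)) := by
  have : Function.HasTemperateGrowth (fun ξ : E => ((1 + ‖ξ‖ ^ 2) ^ k : ℝ)) :=
    ((Function.HasTemperateGrowth.const 1).add
      (Function.hasTemperateGrowth_norm_sq (H := E))).pow k
  exact Function.HasTemperateGrowth.comp Function.Complex.hasTemperateGrowth_ofReal this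

lemma Moderate.le_sq_pow {M : E → ℝ} (h : Moderate M) :
    ∃ (C : ℝ) (k : ℕ), 0 < C ∧ ∀ ξ, M ξ ≤ C * (1 + ‖ξ‖ ^ 2) ^ k := by
  obtain ⟨C, N, hC, hb⟩ := h.le_pow
  refine ⟨C * 2 ^ N, N, by positivity, fun ξ => (hb ξ).trans ?_⟩
  rw [mul_assoc, ← mul_pow]
  gcongr
  nlinarith [sq_nonneg (‖ξ‖ - 1)]

lemma Moderate.memLp_mul {M : E → ℝ} (h : Moderate M) (f : 𝓢(E, ℂ)) :
    MemLp (fun ξ => (M ξ : ℂ) * f ξ) 2 volume := by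
  obtain ⟨C, k, hC, hb⟩ := h.le_sq_pow
  have h1 := (SchwartzMap.smulLeftCLM ℂ (fun ξ : E => (((1 + ‖ξ‖ ^ 2) ^ k : ℝ) : ℂ)) f).memLp 2
  refine h1.of_le_mul (c := C) ?_ (Filter.Eventually.of_forall fun ξ => ?_)
  · exact ((Complex.continuous_ofReal.comp h.cont).mul f.continuous).aestronglyMeasurable
  · rw [SchwartzMap.smulLeftCLM_apply_apply (hasTemperateGrowth_one_add_norm_sq_pow k), norm_mul,
      norm_smul, Complex.norm_real, Complex.norm_real, Real.norm_of_nonneg (h.pos ξ).le,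
      Real.norm_of_nonneg (by positivity), ← mul_assoc]
    gcongr
    exact hb ξ

/-- Dividing `M` by a large power of `1 + |ξ|²` leaves a bounded factor, hence an `L²` function; the
power is restored as a multiplier of temperate growth. -/
lemma exists_tempered_of_memLp {M : E → ℝ} (hM : Moderate M) {h : E → ℂ}
    (hh : MemLp h 2 volume) :
    ∃ T : 𝓢'(E, ℂ), ∀ φ : 𝓢(E, ℂ), T φ = ∫ ξ, (M ξ : ℂ) * h ξ * φ ξ := by
  obtain ⟨C, k, hC, hb⟩ := hM.le_sq_pow
  have hpos : ∀ ξ : E, (0:ℝ) < (1 + ‖ξ‖ ^ 2) ^ k := fun ξ => by positivity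
  set h1 : E → ℂ := fun ξ => ((M ξ / (1 + ‖ξ‖ ^ 2) ^ k : ℝ) : ℂ) * h ξ with hh1
  have m1 : MemLp h1 2 volume := by
    refine hh.of_le_mul (c := C) ?_ (Filter.Eventually.of_forall fun ξ => ?_)
    · refine Continuous.aestronglyMeasurable ?_ |>.mul hh.aestronglyMeasurable
      exact Complex.continuous_ofReal.comp (hM.cont.div (by fun_prop) fun ξ => (hpos ξ).ne')
    · rw [hh1, norm_mul, Complex.norm_real, Real.norm_of_nonneg (div_nonneg (hM.pos ξ).le (hpos ξ).le)]
      gcongr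
      rw [div_le_iff₀ (hpos ξ)]
      exact hb ξ
  refine ⟨TemperedDistribution.smulLeftCLM ℂ (fun ξ : E => (((1 + ‖ξ‖ ^ 2) ^ k : ℝ) : ℂ))
    (Lp.toTemperedDistribution m1.toLp), fun φ => ?_⟩
  rw [TemperedDistribution.smulLeftCLM_apply_apply, Lp.toTemperedDistribution_apply]
  refine integral_congr_ae ?_
  filter_upwards [m1.coeFn_toLp] with ξ hξ
  rw [SchwartzMap.smulLeftCLM_apply_apply (hasTemperateGrowth_one_add_norm_sq_pow k), hξ, hh1]
  have : (((1 + ‖ξ‖ ^ 2) ^ k : ℝ) : ℂ) ≠ 0 := by exact_mod_cast (hpos ξ).ne'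
  simp only [smul_eq_mul]
  push_cast at this ⊢
  field_simp

/-- Cauchy–Schwarz after writing `T φ` as the pairing of `T̂` with the inverse transform of `φ`; the
weight is even, so the sign of the frequency is irrelevant. -/
lemma MemHLog.bound {s ℓ : ℝ} {T : 𝓢'(E, ℂ)} (hT : MemHLog s ℓ T) :
    ∃ C : ℝ≥0∞, C ≠ ⊤ ∧ ∀ φ : 𝓢(E, ℂ), ‖T φ‖ₑ ^ 2 ≤ C * wsq (logWeight (-s) (-ℓ)) φ := by
  obtain ⟨h, hh, hT⟩ := hT
  refine ⟨∫⁻ ξ, ‖h ξ‖ₑ ^ 2, ?_, fun φ => ?_⟩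
  · have := hh.eLpNorm_lt_top
    rw [eLpNorm_lt_top_iff_lintegral_rpow_enorm_lt_top (by simp) (by simp)] at this
    simpa using this.ne
  have e : T φ = (𝓕 T) (𝓕⁻ φ) := by
    rw [TemperedDistribution.fourier_apply, FourierTransform.fourier_fourierInv_eq]
  rw [e, hT, wsq_fourierInv (logWeight_neg _ _)]
  have : ∀ ξ, ((logWeight s ℓ ξ)⁻¹ : ℝ) * h ξ * (𝓕⁻ φ) ξ
      = h ξ * ((logWeight (-s) (-ℓ) ξ : ℂ) * (𝓕⁻ φ) ξ) := fun ξ => by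
    rw [logWeight_inv]; ring
  simp_rw [this]
  have hm := ((moderate_logWeight (-s) (-ℓ)).memLp_mul (𝓕⁻ φ)).aestronglyMeasurable.enorm
  have h1 := lintegral_mul_sq_le hh.aestronglyMeasurable.enorm hm
  have h2 : ∀ ξ, ‖(logWeight (-s) (-ℓ) ξ : ℂ) * (𝓕⁻ φ) ξ‖ₑ ^ 2
      = ENNReal.ofReal (logWeight (-s) (-ℓ) ξ) ^ 2 * ‖𝓕⁻ (φ : E → ℂ) ξ‖ₑ ^ 2 := fun ξ => by
    rw [enorm_mul, mul_pow, SchwartzMap.fourierInv_coe]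
    congr 2
    rw [← ofReal_norm, Complex.norm_real, Real.norm_of_nonneg (logWeight_pos _ _ ξ).le]
  simp_rw [h2] at h1
  refine le_trans ?_ h1
  gcongr
  refine (enorm_integral_le_lintegral_enorm _).trans (le_of_eq ?_)
  simp_rw [enorm_mul]

/-- The bound says that `L` factors through the map `e` sending `φ` to the weighted inverse Fourier
transform in `L²`. Hahn–Banach extends it from the range of `e`, and Riesz represents the extension.
The functional is only required on a subspace `V`, because a distribution on `M` can only be paired
with functions flat at the boundary. -/
lemma exists_memHLog_of_bound {s ℓ : ℝ} (V : Submodule ℂ 𝓢(E, ℂ)) (L : V →ₗ[ℂ] ℂ)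
    {C : ℝ≥0∞} (hC : C ≠ ⊤)
    (hL : ∀ φ : V, ‖L φ‖ₑ ^ 2 ≤ C * wsq (logWeight (-s) (-ℓ)) (φ : 𝓢(E, ℂ))) :
    ∃ T : 𝓢'(E, ℂ), MemHLog s ℓ T ∧ ∀ φ : V, L φ = T φ := by
  set W : E → ℝ := logWeight (-s) (-ℓ) with hW
  have hWm : Moderate W := moderate_logWeight _ _
  let e : V →ₗ[ℂ] Lp ℂ 2 (volume : Measure E) :=
    { toFun := fun φ => (hWm.memLp_mul (𝓕⁻ (φ : 𝓢(E, ℂ)))).toLp _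
      map_add' := fun φ ψ => by
        rw [← MemLp.toLp_add]
        refine MemLp.toLp_congr _ _ (Filter.Eventually.of_forall fun ξ => ?_)
        simp [FourierTransform.fourierInv_add, mul_add]
      map_smul' := fun c φ => by
        rw [RingHom.id_apply, ← MemLp.toLp_const_smul]
        refine MemLp.toLp_congr _ _ (Filter.Eventually.of_forall fun ξ => ?_)
        simp [FourierTransform.fourierInv_smul]
        ring }
  have he : ∀ φ : V, ‖e φ‖ₑ ^ 2 = wsq W (φ : 𝓢(E, ℂ)) := by
    intro φ
    rw [wsq_fourierInv (fun ξ => logWeight_neg _ _ ξ)]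
    have : ‖e φ‖ₑ = eLpNorm (fun ξ => (W ξ : ℂ) * (𝓕⁻ (φ : 𝓢(E, ℂ))) ξ) 2 volume := by
      simp only [e, LinearMap.coe_mk, AddHom.coe_mk, Lp.enorm_toLp]
    rw [this, ← ENNReal.rpow_ofNat, show (2:ℝ) = ((2:ℝ≥0∞)).toReal by simp,
      eLpNorm_eq_lintegral_rpow_enorm_toReal (by simp) (by simp), ← ENNReal.rpow_mul]
    simp only [ENNReal.toReal_ofNat, ENNReal.rpow_ofNat]
    norm_num
    refine lintegral_congr fun ξ => ?_
    rw [mul_pow, SchwartzMap.fourierInv_coe]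
    congr 2
    rw [← ofReal_norm, Complex.norm_real, Real.norm_of_nonneg (hWm.pos ξ).le]
  have hb : ∃ K : ℝ, ∀ φ : V, ‖L φ‖ ≤ K * ‖e φ‖ := by
    refine ⟨Real.sqrt C.toReal, fun φ => ?_⟩
    have h1 := hL φ
    rw [← he] at h1
    have h2 := ENNReal.toReal_mono (ENNReal.mul_ne_top hC (by simp)) h1
    simp only [ENNReal.toReal_pow, ENNReal.toReal_mul, toReal_enorm] at h2
    refine abs_le_of_sq_le_sq' ?_ (by positivity) |>.2
    rw [mul_pow, Real.sq_sqrt ENNReal.toReal_nonneg]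
    exact h2
  -- `L.compLeftInverse e` is the functional `e φ ↦ L φ` on the range of `e`; the bound `hb` makes
  -- it well defined and continuous even without injectivity of `e`.
  obtain ⟨g, hg, -⟩ := exists_extension_norm_eq (LinearMap.range e) (L.compLeftInverse e)
  have hgL : ∀ φ : V, g (e φ) = L φ := fun φ => by
    have := hg ⟨e φ, ⟨φ, rfl⟩⟩
    rw [← LinearMap.compLeftInverse_apply_of_bdd L e hb φ (e φ) rfl]
    exact this
  set h0 := (InnerProductSpace.toDual ℂ (Lp ℂ 2 (volume : Measure E))).symm g with hh0
  -- Conjugation turns the sesquilinear pairing of `L²` into the bilinear one used for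
  -- distributions.
  have hm : MemLp (fun ξ => (starRingEnd ℂ) (h0 ξ)) 2 volume := (Lp.memLp h0).star
  obtain ⟨T0, hT0⟩ := exists_tempered_of_memLp hWm hm
  refine ⟨𝓕⁻ T0, ⟨fun ξ => (starRingEnd ℂ) (h0 ξ), hm, fun φ => ?_⟩, fun φ => ?_⟩
  · rw [FourierTransform.fourier_fourierInv_eq, hT0]
    refine integral_congr_ae (Filter.Eventually.of_forall fun ξ => ?_)
    simp only [logWeight_inv]
    rfl
  · rw [TemperedDistribution.fourierInv_apply, hT0, ← hgL]
    have : g (e φ) = inner ℂ h0 (e φ) := by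
      rw [hh0, ← InnerProductSpace.toDual_apply_apply, LinearIsometryEquiv.apply_symm_apply]
    rw [this, L2.inner_def]
    refine integral_congr_ae ?_
    filter_upwards [(hWm.memLp_mul (𝓕⁻ (φ : 𝓢(E, ℂ)))).coeFn_toLp] with ξ hξ
    have e1 : (e φ : E → ℂ) ξ = (W ξ : ℂ) * (𝓕⁻ (φ : 𝓢(E, ℂ))) ξ := hξ
    rw [e1]
    simp only [RCLike.inner_apply]
    ring

end Riesz

noncomputable section

open scoped ENNReal NNReal


/-! ### The windowed Fourier transform -/

section STFT

open MeasureTheory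

variable {n : ℕ}

local notation "E" => EuclideanSpace ℝ (Fin n)

/-- The windowed Fourier transform of `φ` with window `θ`. -/
def stft (θ φ : E → ℂ) (τ ξ : E) : ℂ := 𝓕 (fun w => θ (w - τ) * φ w) ξ

lemma measurable_stft (θ φ : 𝓢(E, ℂ)) : Measurable (fun p : E × E => ‖stft θ φ p.1 p.2‖ₑ) := by
  have h : Continuous (fun q : (E × E) × E =>
      Real.fourierChar (-(inner ℝ q.2 q.1.2)) • (θ (q.2 - q.1.1) * φ q.2)) := by
    have := θ.continuous
    have := φ.continuous
    have := Real.continuous_fourierChar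
    fun_prop
  have h2 := (h.stronglyMeasurable.integral_prod_right' (ν := (volume : Measure E)))
  exact h2.measurable.enorm

/-- For fixed `ξ` the windowed transform is, up to a phase, a Fourier transform in the position `τ`:
write `φ` as the transform of its inverse transform and move the transform onto the window. This
opens the way to Plancherel in `τ`. -/
lemma stft_eq_fourier (θ φ : 𝓢(E, ℂ)) (τ ξ : E) :
    stft θ φ τ ξ = Real.fourierChar (-(inner ℝ τ ξ)) •
      𝓕 (fun η => 𝓕 φ (-η) * 𝓕 θ (η + ξ)) τ := by
  set ψ : 𝓢(E, ℂ) := 𝓕⁻ φ with hψ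
  have hψe : ∀ η, ψ η = 𝓕 φ (-η) := fun η => by
    rw [hψ, SchwartzMap.fourierInv_coe, Real.fourierInv_eq_fourier_neg, SchwartzMap.fourier_coe]
  have hφ : φ = 𝓕 ψ := by rw [hψ, FourierTransform.fourier_fourierInv_eq]
  set f : E → ℂ := fun w => Real.fourierChar (-(inner ℝ w ξ)) • θ (w - τ) with hf
  have hfi : Integrable f := by
    have h1 : Integrable (fun w => θ (w - τ)) := θ.integrable.comp_sub_right τ
    refine h1.norm.mono' ?_ (Filter.Eventually.of_forall fun w => ?_)
    · have := θ.continuous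
      have := Real.continuous_fourierChar
      exact Continuous.aestronglyMeasurable (by rw [hf]; fun_prop)
    · simp [hf, Circle.norm_smul]
  have h1 : stft θ φ τ ξ = ∫ w, 𝓕 (ψ : E → ℂ) w • f w := by
    unfold stft
    rw [Real.fourier_eq]
    refine integral_congr_ae (Filter.Eventually.of_forall fun w => ?_)
    have : φ w = 𝓕 (ψ : E → ℂ) w := by
      conv_lhs => rw [hφ]
      rw [SchwartzMap.fourier_coe]
    simp only [hf, this, smul_eq_mul, Circle.smul_def]
    ring
  have h2 : ∫ w, 𝓕 (ψ : E → ℂ) w • f w = ∫ η, ψ η • 𝓕 f η :=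
    VectorFourier.integral_fourierIntegral_smul_eq_flip (L := innerₗ E)
      Real.continuous_fourierChar continuous_inner ψ.integrable hfi |>.trans (by
        rw [flip_innerₗ]; rfl)
  have h3 : ∀ η, 𝓕 f η = Real.fourierChar (-(inner ℝ τ (η + ξ))) • 𝓕 θ (η + ξ) := fun η => by
    rw [SchwartzMap.fourier_coe, Real.fourier_eq, Real.fourier_eq,
      ← integral_add_right_eq_self _ τ]
    simp only [Circle.smul_def]
    rw [← integral_smul]
    refine integral_congr_ae (Filter.Eventually.of_forall fun w => ?_)
    simp only [hf, smul_eq_mul, Circle.smul_def, add_sub_cancel_right, inner_add_right,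
      inner_add_left, neg_add, AddChar.map_add_eq_mul, Circle.coe_mul]
    ring
  rw [h1, h2, Real.fourier_eq]
  simp only [Circle.smul_def]
  rw [← integral_smul]
  refine integral_congr_ae (Filter.Eventually.of_forall fun η => ?_)
  simp only [h3, hψe, smul_eq_mul, Circle.smul_def, inner_add_right, neg_add,
    AddChar.map_add_eq_mul, Circle.coe_mul, real_inner_comm η τ]
  ring

lemma SchwartzMap.lintegral_enorm_sq_fourier (g : 𝓢(E, ℂ)) :
    ∫⁻ ξ, ‖𝓕 (g : E → ℂ) ξ‖ₑ ^ 2 = ∫⁻ x, ‖g x‖ₑ ^ 2 := by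
  have key : ∀ f : 𝓢(E, ℂ), ∫⁻ ξ, ‖f ξ‖ₑ ^ 2 = ENNReal.ofReal (∫ ξ, ‖f ξ‖ ^ 2) := fun f => by
    rw [ofReal_integral_eq_lintegral_ofReal]
    · refine lintegral_congr fun ξ => ?_
      rw [ENNReal.ofReal_pow (norm_nonneg _), ofReal_norm]
    · exact (memLp_two_iff_integrable_sq_norm (f.memLp 2).aestronglyMeasurable).mp (f.memLp 2)
    · exact Filter.Eventually.of_forall fun ξ => by positivity
  rw [key, ← g.integral_norm_sq_fourier, ← key]
  rfl

lemma lintegral_stft_sq (θ φ : 𝓢(E, ℂ)) (ξ : E) :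
    ∫⁻ τ, ‖stft θ φ τ ξ‖ₑ ^ 2 = ∫⁻ η, ‖𝓕 (φ : E → ℂ) η‖ₑ ^ 2 * ‖𝓕 (θ : E → ℂ) (ξ - η)‖ₑ ^ 2 := by
  set g : 𝓢(E, ℂ) := SchwartzMap.smulLeftCLM ℂ (𝓕⁻ φ : 𝓢(E, ℂ))
    (SchwartzMap.compSubConstCLM ℂ (-ξ) (𝓕 θ)) with hg
  have hge : ∀ η, g η = 𝓕 φ (-η) * 𝓕 θ (η + ξ) := fun η => by
    rw [hg, SchwartzMap.smulLeftCLM_apply_apply (SchwartzMap.hasTemperateGrowth _),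
      SchwartzMap.compSubConstCLM_apply, sub_neg_eq_add, SchwartzMap.fourierInv_coe,
      Real.fourierInv_eq_fourier_neg, SchwartzMap.fourier_coe, smul_eq_mul]
    rfl
  have h1 : ∀ τ, ‖stft θ φ τ ξ‖ₑ ^ 2 = ‖𝓕 (g : E → ℂ) τ‖ₑ ^ 2 := fun τ => by
    rw [stft_eq_fourier, show (g : E → ℂ) = fun η => 𝓕 φ (-η) * 𝓕 θ (η + ξ) from funext hge]
    simp only [← ofReal_norm, Circle.norm_smul]
  simp_rw [h1]
  rw [SchwartzMap.lintegral_enorm_sq_fourier, ← lintegral_neg_eq_self]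
  refine lintegral_congr fun η => ?_
  rw [hge, neg_neg, enorm_mul, mul_pow, neg_add_eq_sub]
  rfl

/-- The squared phase space norm of the windowed Fourier transform. -/
def stftSq (M : E → ℝ) (θ φ : E → ℂ) : ℝ≥0∞ :=
  ∫⁻ ξ, ∫⁻ τ, ENNReal.ofReal (M ξ) ^ 2 * ‖stft θ φ τ ξ‖ₑ ^ 2

/-- Plancherel in `τ` and Tonelli: passing to the windowed transform only averages the weight `M²`
against `|θ̂|²`. -/
lemma stftSq_eq {M : E → ℝ} (hM : Continuous M) (θ φ : 𝓢(E, ℂ)) :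
    stftSq M θ φ = ∫⁻ η, ‖𝓕 (φ : E → ℂ) η‖ₑ ^ 2 *
      ∫⁻ ξ, ENNReal.ofReal (M ξ) ^ 2 * ‖𝓕 (θ : E → ℂ) (ξ - η)‖ₑ ^ 2 := by
  unfold stftSq
  have c1 : Continuous (𝓕 (φ : E → ℂ)) := (𝓕 φ : 𝓢(E, ℂ)).continuous
  have c2 : Continuous (𝓕 (θ : E → ℂ)) := (𝓕 θ : 𝓢(E, ℂ)).continuous
  have m1 : Measurable (fun p : E × E => ENNReal.ofReal (M p.1) ^ 2 *
      (‖𝓕 (φ : E → ℂ) p.2‖ₑ ^ 2 * ‖𝓕 (θ : E → ℂ) (p.1 - p.2)‖ₑ ^ 2)) := by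
    have a1 : Measurable (fun p : E × E => ENNReal.ofReal (M p.1)) :=
      (hM.comp continuous_fst).measurable.ennreal_ofReal
    have a2 : Measurable (fun p : E × E => ‖𝓕 (φ : E → ℂ) p.2‖ₑ) :=
      (c1.comp continuous_snd).measurable.enorm
    have a3 : Measurable (fun p : E × E => ‖𝓕 (θ : E → ℂ) (p.1 - p.2)‖ₑ) :=
      (c2.comp (continuous_fst.sub continuous_snd)).measurable.enorm
    exact (a1.pow_const 2).mul ((a2.pow_const 2).mul (a3.pow_const 2))
  calc _ = ∫⁻ ξ, ∫⁻ η, ENNReal.ofReal (M ξ) ^ 2 *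
      (‖𝓕 (φ : E → ℂ) η‖ₑ ^ 2 * ‖𝓕 (θ : E → ℂ) (ξ - η)‖ₑ ^ 2) := by
        refine lintegral_congr fun ξ => ?_
        rw [lintegral_const_mul' _ _ (by simp), lintegral_const_mul' _ _ (by simp),
          lintegral_stft_sq]
    _ = ∫⁻ η, ∫⁻ ξ, ENNReal.ofReal (M ξ) ^ 2 *
      (‖𝓕 (φ : E → ℂ) η‖ₑ ^ 2 * ‖𝓕 (θ : E → ℂ) (ξ - η)‖ₑ ^ 2) :=
        lintegral_lintegral_swap m1.aemeasurable
    _ = _ := by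
        refine lintegral_congr fun η => ?_
        rw [← lintegral_const_mul' _ _ (by simp)]
        refine lintegral_congr fun ξ => ?_
        ring

lemma SchwartzMap.lintegral_pow_mul_enorm_sq_lt_top (f : 𝓢(E, ℂ)) (N : ℕ) :
    ∫⁻ ζ, ENNReal.ofReal ((1 + ‖ζ‖) ^ N) ^ 2 * ‖f ζ‖ₑ ^ 2 < ⊤ := by
  have h := (show Moderate (fun ξ : E => (1 + ‖ξ‖) ^ N) from moderate_const_pow N).memLp_mul f
  have h2 := h.eLpNorm_lt_top
  rw [eLpNorm_lt_top_iff_lintegral_rpow_enorm_lt_top (by simp) (by simp)] at h2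
  refine lt_of_eq_of_lt (lintegral_congr fun ζ => ?_) h2
  simp only [ENNReal.toReal_ofNat, ENNReal.rpow_ofNat, enorm_mul, mul_pow]
  congr 2
  rw [← ofReal_norm, Complex.norm_real, Real.norm_of_nonneg (by positivity)]

/-- Moderateness replaces `M ξ` by `M η` at the price of a power of `1 + |ξ - η|`, which the
Schwartz function `θ̂` absorbs. -/
lemma stftSq_le {M : E → ℝ} (hM : Moderate M) (θ : 𝓢(E, ℂ)) :
    ∃ C : ℝ≥0∞, C ≠ ⊤ ∧ ∀ φ : 𝓢(E, ℂ), stftSq M θ φ ≤ C * wsq M φ := by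
  obtain ⟨C, N, hC, hb⟩ := hM.bound
  set I := ∫⁻ ζ, ENNReal.ofReal ((1 + ‖ζ‖) ^ N) ^ 2 * ‖(𝓕 θ : 𝓢(E, ℂ)) ζ‖ₑ ^ 2 with hIdef
  have hI : I ≠ ⊤ := ((𝓕 θ : 𝓢(E, ℂ)).lintegral_pow_mul_enorm_sq_lt_top N).ne
  refine ⟨ENNReal.ofReal C ^ 2 * I, by finiteness, fun φ => ?_⟩
  rw [stftSq_eq hM.cont, wsq, ← lintegral_const_mul' _ _ (by finiteness)]
  refine lintegral_mono fun η => ?_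
  have : ∫⁻ ξ, ENNReal.ofReal (M ξ) ^ 2 * ‖𝓕 (θ : E → ℂ) (ξ - η)‖ₑ ^ 2 ≤
      ENNReal.ofReal C ^ 2 * ENNReal.ofReal (M η) ^ 2 * I := by
    rw [hIdef, ← lintegral_sub_right_eq_self (fun ζ => ENNReal.ofReal ((1 + ‖ζ‖) ^ N) ^ 2 *
      ‖(𝓕 θ : 𝓢(E, ℂ)) ζ‖ₑ ^ 2) η, ← lintegral_const_mul' _ _ (by finiteness)]
    refine lintegral_mono fun ξ => ?_
    have h1 := hb ξ η
    calc _ ≤ ENNReal.ofReal (C * M η * (1 + ‖ξ - η‖) ^ N) ^ 2 * ‖𝓕 (θ : E → ℂ) (ξ - η)‖ₑ ^ 2 := by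
          gcongr
      _ = _ := by
          rw [ENNReal.ofReal_mul (mul_nonneg hC.le (hM.pos η).le), ENNReal.ofReal_mul hC.le]
          simp only [SchwartzMap.fourier_coe]
          ring
  calc _ ≤ ‖𝓕 (φ : E → ℂ) η‖ₑ ^ 2 * (ENNReal.ofReal C ^ 2 * ENNReal.ofReal (M η) ^ 2 * I) := by
        gcongr
    _ = _ := by ring

/-- The average of `M²` around `η` is bounded below by moderateness. The constant involves the
inverse of a weighted norm of `θ̂`, which is nonzero because `θ ≠ 0` and the Fourier transform is
injective. -/
lemma le_stftSq {M : E → ℝ} (hM : Moderate M) {θ : 𝓢(E, ℂ)} (hθ : θ ≠ 0) :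
    ∃ C : ℝ≥0∞, C ≠ ⊤ ∧ ∀ φ : 𝓢(E, ℂ), wsq M φ ≤ C * stftSq M θ φ := by
  obtain ⟨C, N, hC, hb⟩ := hM.bound
  set I := ∫⁻ ζ, ENNReal.ofReal (((1 + ‖ζ‖) ^ N)⁻¹) ^ 2 * ‖𝓕 (θ : E → ℂ) ζ‖ₑ ^ 2 with hIdef
  have c2 : Continuous (𝓕 (θ : E → ℂ)) := (𝓕 θ : 𝓢(E, ℂ)).continuous
  have cN : Continuous (fun ζ : E => ((1 + ‖ζ‖) ^ N)⁻¹) :=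
    Continuous.inv₀ (by fun_prop) fun ζ => by positivity
  have hI0 : I ≠ 0 := by
    intro h0
    have m := cN.measurable.ennreal_ofReal
    have m2 := c2.measurable.enorm
    rw [hIdef, lintegral_eq_zero_iff (by fun_prop)] at h0
    have h1 : 𝓕 (θ : E → ℂ) =ᵐ[volume] 0 := by
      filter_upwards [h0] with ζ hζ
      have : ENNReal.ofReal (((1 + ‖ζ‖) ^ N)⁻¹) ≠ 0 := by
        rw [Ne, ENNReal.ofReal_eq_zero, not_le]; positivity
      simpa [this] using hζ
    have h2 : 𝓕 (θ : E → ℂ) = 0 := (c2.ae_eq_iff_eq volume continuous_zero).mp h1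
    apply hθ
    have h3 : (𝓕 θ : 𝓢(E, ℂ)) = 0 := by ext ζ; exact congrFun h2 ζ
    have := FourierTransform.fourierInv_fourier_eq (F := 𝓢(E, ℂ)) θ
    rw [← this, h3]
    exact FourierTransform.fourierInv_zero
  refine ⟨ENNReal.ofReal C ^ 2 * I⁻¹, by finiteness, fun φ => ?_⟩
  rw [stftSq_eq hM.cont, wsq, ← lintegral_const_mul' _ _ (by finiteness)]
  refine lintegral_mono fun η => ?_
  have : ENNReal.ofReal (M η) ^ 2 * I ≤ ENNReal.ofReal C ^ 2 *
      ∫⁻ ξ, ENNReal.ofReal (M ξ) ^ 2 * ‖𝓕 (θ : E → ℂ) (ξ - η)‖ₑ ^ 2 := by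
    rw [hIdef, ← lintegral_sub_right_eq_self (fun ζ => ENNReal.ofReal (((1 + ‖ζ‖) ^ N)⁻¹) ^ 2 *
      ‖𝓕 (θ : E → ℂ) ζ‖ₑ ^ 2) η, ← lintegral_const_mul' _ _ (by finiteness),
      ← lintegral_const_mul' _ _ (by finiteness)]
    refine lintegral_mono fun ξ => ?_
    have h1 := hb η ξ
    rw [norm_sub_rev] at h1
    have h2 : M η * ((1 + ‖ξ - η‖) ^ N)⁻¹ ≤ C * M ξ := by
      rw [← div_eq_mul_inv, div_le_iff₀ (by positivity)]; exact h1
    simp only [← mul_assoc, ← mul_pow (ENNReal.ofReal _)]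
    rw [← ENNReal.ofReal_mul (hM.pos η).le, ← ENNReal.ofReal_mul hC.le]
    gcongr
  have h4 : ENNReal.ofReal (M η) ^ 2 ≤ ENNReal.ofReal C ^ 2 * I⁻¹ *
      ∫⁻ ξ, ENNReal.ofReal (M ξ) ^ 2 * ‖𝓕 (θ : E → ℂ) (ξ - η)‖ₑ ^ 2 := by
    have hItop : I ≠ ⊤ := by
      refine ((lintegral_mono fun ζ => ?_).trans_lt
        ((𝓕 θ : 𝓢(E, ℂ)).lintegral_pow_mul_enorm_sq_lt_top 0)).ne
      rw [SchwartzMap.fourier_coe]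
      gcongr
      rw [pow_zero]
      exact inv_le_one_of_one_le₀ (one_le_pow₀ (by linarith [norm_nonneg ζ]))
    calc ENNReal.ofReal (M η) ^ 2 = ENNReal.ofReal (M η) ^ 2 * I * I⁻¹ := by
          rw [mul_assoc, ENNReal.mul_inv_cancel hI0 hItop, mul_one]
      _ ≤ (ENNReal.ofReal C ^ 2 *
          ∫⁻ ξ, ENNReal.ofReal (M ξ) ^ 2 * ‖𝓕 (θ : E → ℂ) (ξ - η)‖ₑ ^ 2) * I⁻¹ := by gcongr
      _ = _ := by ring
  calc _ ≤ (ENNReal.ofReal C ^ 2 * I⁻¹ *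
      ∫⁻ ξ, ENNReal.ofReal (M ξ) ^ 2 * ‖𝓕 (θ : E → ℂ) (ξ - η)‖ₑ ^ 2) * ‖𝓕 (φ : E → ℂ) η‖ₑ ^ 2 := by
        gcongr
    _ = _ := by ring

lemma lintegral_one_add_norm_lt_top :
    ∫⁻ ζ : E, ENNReal.ofReal (((1 + ‖ζ‖) ^ (n + 1))⁻¹) < ⊤ := by
  have h := integrable_one_add_norm (μ := (volume : Measure E)) (r := (n + 1 : ℕ)) (by simp)
  have h2 := h.lintegral_lt_top
  refine lt_of_eq_of_lt (lintegral_congr fun ζ => ?_) h2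
  rw [Real.rpow_neg (by positivity), Real.rpow_natCast]

/-- Tonelli together with translation invariance in `τ` and in `ξ`: a convolution in phase space has
total mass the product of the masses. -/
lemma lintegral_phase_convolution {a m : E → ℝ≥0∞} {g : E × E → ℝ≥0∞} (ha : Measurable a)
    (hm : Measurable m) (hg : Measurable g) (ν : Measure E) [IsFiniteMeasure ν] :
    ∫⁻ ξ, ∫⁻ τ, ∫⁻ p : E × E, m p.2 * (a (ξ - p.2) * g (τ + p.1, p.2)) ∂(ν.prod volume) =
      ν Set.univ * (∫⁻ ζ, a ζ) * ∫⁻ η, ∫⁻ τ, m η * g (τ, η) := by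
  have mF : Measurable (fun q : E × E × E × E =>
      m q.2.2.2 * (a (q.1 - q.2.2.2) * g (q.2.1 + q.2.2.1, q.2.2.2))) := by fun_prop
  have h8 : Measurable (fun η => ∫⁻ τ, g (τ, η)) :=
    (hg.comp measurable_swap).lintegral_prod_right'
  calc _ = ∫⁻ ξ, ∫⁻ p : E × E, (∫⁻ τ, m p.2 * (a (ξ - p.2) * g (τ + p.1, p.2))) ∂(ν.prod volume) := by
        refine lintegral_congr fun ξ => ?_
        exact lintegral_lintegral_swap
          (mF.comp (measurable_const (a := ξ) |>.prodMk measurable_id)).aemeasurable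
    _ = ∫⁻ ξ, ∫⁻ p : E × E, a (ξ - p.2) * (m p.2 * (∫⁻ τ, g (τ, p.2))) ∂(ν.prod volume) := by
        refine lintegral_congr fun ξ => lintegral_congr fun p => ?_
        rw [lintegral_const_mul _ (by fun_prop), lintegral_const_mul _ (by fun_prop),
          lintegral_add_right_eq_self (fun τ => g (τ, p.2))]
        ring
    _ = ∫⁻ p : E × E, (∫⁻ ξ, a (ξ - p.2) * (m p.2 * (∫⁻ τ, g (τ, p.2)))) ∂(ν.prod volume) := by
        refine lintegral_lintegral_swap (Measurable.aemeasurable ?_)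
        have m0 : Measurable (fun q : E × E × E => q.2.2) := by fun_prop
        have := h8.comp m0
        simp only [Function.comp_def] at this
        simp only [Function.uncurry_def]
        fun_prop
    _ = ∫⁻ p : E × E, (∫⁻ ζ, a ζ) * (m p.2 * (∫⁻ τ, g (τ, p.2))) ∂(ν.prod volume) := by
        refine lintegral_congr fun p => ?_
        rw [lintegral_mul_const _ (by fun_prop), lintegral_sub_right_eq_self a]
    _ = _ := by
        have h9 : Measurable (fun η => (∫⁻ ζ, a ζ) * (m η * ∫⁻ τ, g (τ, η))) := by fun_prop
        rw [lintegral_prod _ (by fun_prop)]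
        simp only
        rw [lintegral_const, lintegral_const_mul _ (by fun_prop)]
        have : ∀ η, ∫⁻ τ, m η * g (τ, η) = m η * ∫⁻ τ, g (τ, η) := fun η =>
          lintegral_const_mul _ (by fun_prop)
        simp_rw [this]
        ring

/-- A Schur test in phase space: an operator whose windowed Fourier transform is controlled by a
kernel that decays off the diagonal is bounded between weighted spaces. -/
theorem wsq_le_of_stft_le {θ : 𝓢(E, ℂ)} (hθ : θ ≠ 0) (θ' : 𝓢(E, ℂ)) {M M₂ : E → ℝ}
    (hM : Moderate M) (hM₂ : Moderate M₂) (ν : Measure E) [IsFiniteMeasure ν] :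
    ∃ N : ℕ, ∀ K : ℝ≥0∞, K ≠ ⊤ → ∃ C : ℝ≥0∞, C ≠ ⊤ ∧ ∀ φ Ψ : 𝓢(E, ℂ),
      (∀ τ ξ, ‖stft θ Ψ τ ξ‖ₑ ≤ K * ENNReal.ofReal (M ξ) * ∫⁻ p : E × E,
        ENNReal.ofReal (((1 + ‖ξ - p.2‖) ^ N)⁻¹) * ‖stft θ' φ (τ + p.1) p.2‖ₑ ∂(ν.prod volume)) →
      wsq M₂ Ψ ≤ C * wsq (fun ξ => M₂ ξ * M ξ) φ := by
  have hM₁ := hM₂.mul hM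
  obtain ⟨C₁, N₁, hC₁, hb⟩ := hM₁.bound
  obtain ⟨C₂, hC₂, h₂⟩ := le_stftSq hM₂ hθ
  obtain ⟨C₃, hC₃, h₃⟩ := stftSq_le hM₁ θ'
  set a : E → ℝ≥0∞ := fun ζ => ENNReal.ofReal (((1 + ‖ζ‖) ^ (n + 1))⁻¹) with ha
  set b : E → ℝ≥0∞ := fun ζ => ENNReal.ofReal (((1 + ‖ζ‖) ^ (n + 1 + N₁))⁻¹) with hbdef
  have inv_meas : ∀ k : ℕ, Measurable (fun ζ : E => ENNReal.ofReal (((1 + ‖ζ‖) ^ k)⁻¹)) := fun k =>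
    (Continuous.measurable (Continuous.inv₀ (by fun_prop)
      fun ζ => by positivity)).ennreal_ofReal
  have am : Measurable a := inv_meas _
  have bm : Measurable b := inv_meas _
  have a1 : ∀ ζ, a ζ ≤ 1 := fun ζ => by
    rw [ha, ← ENNReal.ofReal_one]
    exact ENNReal.ofReal_le_ofReal
      (inv_le_one_of_one_le₀ (one_le_pow₀ (by linarith [norm_nonneg ζ])))
  set A := ∫⁻ ζ, a ζ with hA
  have hAt : A ≠ ⊤ := lintegral_one_add_norm_lt_top.ne
  have hA2 : ∫⁻ ζ, a ζ ^ 2 ≤ A := lintegral_mono fun ζ => by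
    calc a ζ ^ 2 = a ζ * a ζ := sq _
      _ ≤ a ζ * 1 := by gcongr; exact a1 ζ
      _ = a ζ := mul_one _
  -- The first `n + 1` powers are one factor in Cauchy–Schwarz. Of the others, `N₁` pay for moving
  -- the weight from `ξ` to `p.2`, and `n + 1` remain for the convolution.
  refine ⟨n + 1 + (n + 1 + N₁), fun K hK => ⟨C₂ * (K ^ 2 * (A * ν Set.univ) *
    (ENNReal.ofReal C₁ ^ 2 * A * ν Set.univ)) * C₃, by finiteness, fun φ Ψ h => ?_⟩⟩
  set G : E × E → ℝ≥0∞ := fun p => ‖stft θ' φ p.1 p.2‖ₑ with hG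
  have Gm : Measurable G := measurable_stft θ' φ
  have ab : ∀ ζ, ENNReal.ofReal (((1 + ‖ζ‖) ^ (n + 1 + (n + 1 + N₁)))⁻¹) = a ζ * b ζ := fun ζ => by
    simp only [ha, hbdef]
    rw [← ENNReal.ofReal_mul (by positivity), ← mul_inv, ← pow_add]
  have step1 : ∀ τ ξ, ENNReal.ofReal (M₂ ξ) ^ 2 * ‖stft θ Ψ τ ξ‖ₑ ^ 2 ≤
      K ^ 2 * (A * ν Set.univ) * ∫⁻ p : E × E, ENNReal.ofReal C₁ ^ 2 *
        (ENNReal.ofReal (M₂ p.2 * M p.2) ^ 2 * (a (ξ - p.2) ^ 2 * G (τ + p.1, p.2) ^ 2))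
          ∂(ν.prod volume) := by
    intro τ ξ
    have e1 : ∫⁻ p : E × E, a (ξ - p.2) ^ 2 ∂(ν.prod volume) ≤ A * ν Set.univ := by
      rw [lintegral_prod _ (by fun_prop)]
      simp only
      rw [lintegral_const]
      gcongr
      rw [lintegral_sub_left_eq_self (fun ζ => a ζ ^ 2) ξ]
      exact hA2
    have e2 : (∫⁻ p : E × E, a (ξ - p.2) * (b (ξ - p.2) * G (τ + p.1, p.2)) ∂(ν.prod volume)) ^ 2 ≤
        (A * ν Set.univ) *
          ∫⁻ p : E × E, (b (ξ - p.2) * G (τ + p.1, p.2)) ^ 2 ∂(ν.prod volume) := by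
      refine (lintegral_mul_sq_le (by fun_prop) (by fun_prop)).trans ?_
      gcongr
    calc _ ≤ ENNReal.ofReal (M₂ ξ) ^ 2 * (K * ENNReal.ofReal (M ξ) *
          ∫⁻ p : E × E, a (ξ - p.2) * (b (ξ - p.2) * G (τ + p.1, p.2)) ∂(ν.prod volume)) ^ 2 := by
          gcongr
          refine (h τ ξ).trans (le_of_eq ?_)
          congr 1
          refine lintegral_congr fun p => ?_
          rw [ab, mul_assoc]
      _ = K ^ 2 * (ENNReal.ofReal (M₂ ξ * M ξ) ^ 2 *
          (∫⁻ p : E × E, a (ξ - p.2) * (b (ξ - p.2) * G (τ + p.1, p.2)) ∂(ν.prod volume)) ^ 2) := by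
          rw [ENNReal.ofReal_mul (hM₂.pos ξ).le]; ring
      _ ≤ K ^ 2 * (ENNReal.ofReal (M₂ ξ * M ξ) ^ 2 * ((A * ν Set.univ) *
          ∫⁻ p : E × E, (b (ξ - p.2) * G (τ + p.1, p.2)) ^ 2 ∂(ν.prod volume))) := by gcongr
      _ = K ^ 2 * (A * ν Set.univ) * ∫⁻ p : E × E, ENNReal.ofReal (M₂ ξ * M ξ) ^ 2 *
            (b (ξ - p.2) * G (τ + p.1, p.2)) ^ 2 ∂(ν.prod volume) := by
          rw [lintegral_const_mul' _ _ (by finiteness)]; ring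
      _ ≤ _ := by
          refine mul_le_mul' le_rfl (lintegral_mono fun p => ?_)
          have h5 := hb ξ p.2
          have h6 : ENNReal.ofReal (M₂ ξ * M ξ) * b (ξ - p.2) ≤
              ENNReal.ofReal C₁ * (ENNReal.ofReal (M₂ p.2 * M p.2) * a (ξ - p.2)) := by
            simp only [ha, hbdef]
            rw [← ENNReal.ofReal_mul (hM₁.pos ξ).le, ← ENNReal.ofReal_mul (hM₁.pos p.2).le,
              ← ENNReal.ofReal_mul hC₁.le]
            apply ENNReal.ofReal_le_ofReal
            rw [pow_add, mul_inv, ← mul_assoc, ← div_eq_mul_inv, div_le_iff₀ (by positivity)]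
            have : (0:ℝ) ≤ ((1 + ‖ξ - p.2‖) ^ (n + 1))⁻¹ := by positivity
            calc _ ≤ (C₁ * (M₂ p.2 * M p.2) * (1 + ‖ξ - p.2‖) ^ N₁) *
                  ((1 + ‖ξ - p.2‖) ^ (n + 1))⁻¹ := by gcongr
              _ = _ := by ring
          calc _ = (ENNReal.ofReal (M₂ ξ * M ξ) * b (ξ - p.2)) ^ 2 * G (τ + p.1, p.2) ^ 2 := by ring
            _ ≤ (ENNReal.ofReal C₁ * (ENNReal.ofReal (M₂ p.2 * M p.2) * a (ξ - p.2))) ^ 2 *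
                  G (τ + p.1, p.2) ^ 2 := by gcongr
            _ = _ := by ring
  have cM : Measurable (fun η => ENNReal.ofReal (M₂ η * M η)) :=
    hM₁.cont.measurable.ennreal_ofReal
  have step2 : stftSq M₂ θ Ψ ≤ K ^ 2 * (A * ν Set.univ) *
      (ENNReal.ofReal C₁ ^ 2 * A * ν Set.univ * stftSq (fun ξ => M₂ ξ * M ξ) θ' φ) := by
    have e5 := lintegral_phase_convolution (am.pow_const 2) (cM.pow_const 2) (Gm.pow_const 2) ν
    have hfin : K ^ 2 * (A * ν Set.univ) * ENNReal.ofReal C₁ ^ 2 ≠ ⊤ := by finiteness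
    calc stftSq M₂ θ Ψ ≤ ∫⁻ ξ, ∫⁻ τ, K ^ 2 * (A * ν Set.univ) * ENNReal.ofReal C₁ ^ 2 *
          ∫⁻ p : E × E, ENNReal.ofReal (M₂ p.2 * M p.2) ^ 2 *
            (a (ξ - p.2) ^ 2 * G (τ + p.1, p.2) ^ 2) ∂(ν.prod volume) := by
          refine lintegral_mono fun ξ => lintegral_mono fun τ => (step1 τ ξ).trans (le_of_eq ?_)
          rw [lintegral_const_mul' _ _ (by finiteness)]
          ring
      _ = K ^ 2 * (A * ν Set.univ) * ENNReal.ofReal C₁ ^ 2 * (ν Set.univ * (∫⁻ ζ, a ζ ^ 2) *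
          ∫⁻ η, ∫⁻ τ, ENNReal.ofReal (M₂ η * M η) ^ 2 * G (τ, η) ^ 2) := by
          rw [← e5, ← lintegral_const_mul' _ _ hfin]
          refine lintegral_congr fun ξ => ?_
          rw [← lintegral_const_mul' _ _ hfin]
      _ ≤ K ^ 2 * (A * ν Set.univ) * ENNReal.ofReal C₁ ^ 2 * (ν Set.univ * A *
          ∫⁻ η, ∫⁻ τ, ENNReal.ofReal (M₂ η * M η) ^ 2 * G (τ, η) ^ 2) := by gcongr
      _ = _ := by
          simp only [stftSq, hG]
          ring
  calc wsq M₂ Ψ ≤ C₂ * stftSq M₂ θ Ψ := h₂ Ψ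
    _ ≤ C₂ * (K ^ 2 * (A * ν Set.univ) * (ENNReal.ofReal C₁ ^ 2 * A * ν Set.univ *
        (C₃ * wsq (fun ξ => M₂ ξ * M ξ) φ))) := by
        gcongr
        refine step2.trans ?_
        gcongr
        exact h₃ φ
    _ = _ := by ring

end STFT

noncomputable section

open scoped ENNReal NNReal


/-! ### Families of smooth functions with bounded derivatives -/

section SymCls

variable {α β : Type*} {V V' F G H : Type*}
  [NormedAddCommGroup V] [NormedSpace ℝ V] [NormedAddCommGroup V'] [NormedSpace ℝ V']
  [NormedAddCommGroup F] [NormedSpace ℝ F] [NormedAddCommGroup G] [NormedSpace ℝ G]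
  [NormedAddCommGroup H] [NormedSpace ℝ H]

lemma ContDiffAt.exists_contDiffOn {f : V → F} {x : V} (hf : ContDiffAt ℝ ∞ f x) (k : ℕ) :
    ∃ u, IsOpen u ∧ x ∈ u ∧ ContDiffOn ℝ k f u := by
  have h : ContDiffWithinAt ℝ k f Set.univ x := (hf.of_le (by exact_mod_cast le_top))
  obtain ⟨u, hu, hx, h'⟩ := h.contDiffOn' le_rfl (by simp)
  exact ⟨u, hu, hx, by simpa using h'⟩

lemma norm_iteratedFDeriv_bilin_le (B : F →L[ℝ] G →L[ℝ] H) {f : V → F} {g : V → G} {x : V}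
    (hf : ContDiffAt ℝ ∞ f x) (hg : ContDiffAt ℝ ∞ g x) (k : ℕ) :
    ‖iteratedFDeriv ℝ k (fun y => B (f y) (g y)) x‖ ≤
      ‖B‖ * ∑ i ∈ Finset.range (k + 1), (k.choose i : ℝ) * ‖iteratedFDeriv ℝ i f x‖ *
        ‖iteratedFDeriv ℝ (k - i) g x‖ := by
  obtain ⟨u, hu, hxu, h1⟩ := hf.exists_contDiffOn k
  obtain ⟨u', hu', hxu', h2⟩ := hg.exists_contDiffOn k
  have ho := hu.inter hu'
  have hx : x ∈ u ∩ u' := ⟨hxu, hxu'⟩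
  have := B.norm_iteratedFDerivWithin_le_of_bilinear (h1.mono Set.inter_subset_left)
    (h2.mono Set.inter_subset_right) ho.uniqueDiffOn hx (n := k) le_rfl
  simpa only [iteratedFDerivWithin_of_isOpen _ ho hx] using this

lemma norm_iteratedFDeriv_comp_le_at {g : F → G} {f : V → F} {x : V} {k : ℕ}
    (hg : ContDiffAt ℝ ∞ g (f x)) (hf : ContDiffAt ℝ ∞ f x) {C D : ℝ}
    (hC : ∀ i, i ≤ k → ‖iteratedFDeriv ℝ i g (f x)‖ ≤ C)
    (hD : ∀ i, 1 ≤ i → i ≤ k → ‖iteratedFDeriv ℝ i f x‖ ≤ D ^ i) :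
    ‖iteratedFDeriv ℝ k (g ∘ f) x‖ ≤ k.factorial * C * D ^ k := by
  obtain ⟨u, hu, hxu, h1⟩ := hf.exists_contDiffOn k
  obtain ⟨u', hu', hxu', h2⟩ := hg.exists_contDiffOn k
  have ho : IsOpen (u ∩ f ⁻¹' u') := h1.continuousOn.isOpen_inter_preimage hu hu'
  have hx : x ∈ u ∩ f ⁻¹' u' := ⟨hxu, hxu'⟩
  have := norm_iteratedFDerivWithin_comp_le (n := k) (N := k) h2 (h1.mono Set.inter_subset_left)
    le_rfl hu'.uniqueDiffOn ho.uniqueDiffOn (fun y hy => hy.2) hx (C := C) (D := D)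
    (fun i hi => by simpa only [iteratedFDerivWithin_of_isOpen _ hu' hxu'] using hC i hi)
    (fun i hi hi' => by simpa only [iteratedFDerivWithin_of_isOpen _ ho hx] using hD i hi hi')
  simpa only [iteratedFDerivWithin_of_isOpen _ ho hx] using this

/-- The functions `f a`, `a ∈ S`, are smooth at `p a`, with derivatives of all orders
`O(W a)` there. -/
structure SymCls (S : Set α) (p : α → V) (W : α → ℝ) (f : α → V → G) : Prop where
  smooth : ∀ a ∈ S, ContDiffAt ℝ ∞ (f a) (p a)
  bound : ∀ k, ∃ C, 0 < C ∧ ∀ a ∈ S, ‖iteratedFDeriv ℝ k (f a) (p a)‖ ≤ C * W a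

namespace SymCls

variable {S : Set α} {p : α → V} {W W₁ W₂ : α → ℝ} {f f₁ f₂ : α → V → G}

lemma weight_nonneg (h : SymCls S p W f) {a : α} (ha : a ∈ S) : 0 ≤ W a := by
  obtain ⟨C, hC, h'⟩ := h.bound 0
  exact nonneg_of_mul_nonneg_right ((norm_nonneg _).trans (h' a ha)) hC

lemma bound_le (h : SymCls S p W f) (m : ℕ) :
    ∃ C, 0 < C ∧ ∀ k ≤ m, ∀ a ∈ S, ‖iteratedFDeriv ℝ k (f a) (p a)‖ ≤ C * W a := by
  choose C hC h' using h.bound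
  refine ⟨∑ k ∈ Finset.range (m + 1), C k, Finset.sum_pos (fun k _ => hC k) (by simp),
    fun k hk a ha => (h' k a ha).trans ?_⟩
  exact mul_le_mul_of_nonneg_right (Finset.single_le_sum (f := C) (fun i _ => (hC i).le)
    (Finset.mem_range.2 (by omega))) (h.weight_nonneg ha)

lemma of_le (hs : ∀ a ∈ S, ContDiffAt ℝ ∞ (f a) (p a)) (hW : ∀ a ∈ S, 0 ≤ W a)
    (hb : ∀ k, ∃ C, ∀ a ∈ S, ‖iteratedFDeriv ℝ k (f a) (p a)‖ ≤ C * W a) : SymCls S p W f :=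
  ⟨hs, fun k => by
    obtain ⟨C, hC⟩ := hb k
    exact ⟨max C 1, by positivity, fun a ha => (hC a ha).trans
      (mul_le_mul_of_nonneg_right (le_max_left _ _) (hW a ha))⟩⟩

lemma mono (h : SymCls S p W₁ f) {c : ℝ} (hW : ∀ a ∈ S, W₁ a ≤ c * W₂ a) (hc : 0 < c) :
    SymCls S p W₂ f :=
  ⟨h.smooth, fun k => by
    obtain ⟨C, hC, h'⟩ := h.bound k
    refine ⟨C * c, by positivity, fun a ha => (h' a ha).trans ?_⟩
    rw [mul_assoc]
    exact mul_le_mul_of_nonneg_left (hW a ha) hC.le⟩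

lemma mono_set {S' : Set α} (h : SymCls S p W f) (hS : S' ⊆ S) : SymCls S' p W f :=
  ⟨fun a ha => h.smooth a (hS ha), fun k => by
    obtain ⟨C, hC, h'⟩ := h.bound k
    exact ⟨C, hC, fun a ha => h' a (hS ha)⟩⟩

lemma congr (h : SymCls S p W f₁) (he : ∀ a ∈ S, f₁ a =ᶠ[𝓝 (p a)] f₂ a) : SymCls S p W f₂ :=
  ⟨fun a ha => (h.smooth a ha).congr_of_eventuallyEq (he a ha).symm, fun k => by
    obtain ⟨C, hC, h'⟩ := h.bound k
    refine ⟨C, hC, fun a ha => ?_⟩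
    rw [← ((he a ha).iteratedFDeriv ℝ k).eq_of_nhds]
    exact h' a ha⟩

lemma reindex (h : SymCls S p W f) (σ : β → α) :
    SymCls (σ ⁻¹' S) (fun b => p (σ b)) (fun b => W (σ b)) (fun b => f (σ b)) :=
  ⟨fun b hb => h.smooth _ hb, fun k => by
    obtain ⟨C, hC, h'⟩ := h.bound k
    exact ⟨C, hC, fun b hb => h' _ hb⟩⟩

lemma union {S' : Set α} (h : SymCls S p W f) (h' : SymCls S' p W f) : SymCls (S ∪ S') p W f :=
  ⟨fun a ha => ha.elim (h.smooth a) (h'.smooth a), fun k => by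
    obtain ⟨C, hC, h1⟩ := h.bound k
    obtain ⟨C', hC', h1'⟩ := h'.bound k
    refine ⟨C + C', by positivity, fun a ha => ?_⟩
    rcases ha with ha | ha
    · have := h.weight_nonneg ha
      exact (h1 a ha).trans (by gcongr; linarith)
    · have := h'.weight_nonneg ha
      exact (h1' a ha).trans (by gcongr; linarith)⟩

lemma zero (hW : ∀ a ∈ S, 0 ≤ W a) (hf : ∀ a ∈ S, f a =ᶠ[𝓝 (p a)] fun _ => 0) :
    SymCls S p W f := by
  have : SymCls S p W (fun _ (_ : V) => (0 : G)) :=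
    ⟨fun a _ => contDiffAt_const, fun k => ⟨1, one_pos, fun a ha => by
      have h0 : iteratedFDeriv ℝ k (fun _ : V => (0 : G)) = 0 := iteratedFDeriv_fun_zero
      rw [h0]; simpa using hW a ha⟩⟩
  exact this.congr fun a ha => (hf a ha).symm

lemma const (c : α → G) (hc : ∀ a ∈ S, ‖c a‖ ≤ W a) : SymCls S p W (fun a (_ : V) => c a) :=
  ⟨fun a _ => contDiffAt_const, fun k => ⟨1, one_pos, fun a ha => by
    rcases Nat.eq_zero_or_pos k with rfl | hk
    · simpa using hc a ha
    · rw [iteratedFDeriv_const_of_ne hk.ne']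
      simpa using (norm_nonneg _).trans (hc a ha)⟩⟩

lemma add (h₁ : SymCls S p W f₁) (h₂ : SymCls S p W f₂) :
    SymCls S p W (fun a y => f₁ a y + f₂ a y) :=
  ⟨fun a ha => (h₁.smooth a ha).add (h₂.smooth a ha), fun k => by
    obtain ⟨C, hC, h⟩ := h₁.bound k
    obtain ⟨C', hC', h'⟩ := h₂.bound k
    refine ⟨C + C', by positivity, fun a ha => ?_⟩
    rw [fun_iteratedFDeriv_add_apply ((h₁.smooth a ha).of_le (by exact_mod_cast le_top))
      ((h₂.smooth a ha).of_le (by exact_mod_cast le_top)), add_mul]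
    exact (norm_add_le _ _).trans (add_le_add (h a ha) (h' a ha))⟩

lemma bilin {W₁ W₂ : α → ℝ} {f : α → V → F} {g : α → V → G} (B : F →L[ℝ] G →L[ℝ] H)
    (hf : SymCls S p W₁ f) (hg : SymCls S p W₂ g) :
    SymCls S p (fun a => W₁ a * W₂ a) (fun a y => B (f a y) (g a y)) := by
  refine of_le (fun a ha => (B.isBoundedBilinearMap.contDiff.contDiffAt).comp (p a)
      ((hf.smooth a ha).prodMk (hg.smooth a ha)))
    (fun a ha => mul_nonneg (hf.weight_nonneg ha) (hg.weight_nonneg ha)) fun k => ?_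
  choose C hC h using hf.bound
  choose C' hC' h' using hg.bound
  refine ⟨‖B‖ * ∑ i ∈ Finset.range (k + 1), (k.choose i : ℝ) * C i * C' (k - i), fun a ha => ?_⟩
  refine (norm_iteratedFDeriv_bilin_le B (hf.smooth a ha) (hg.smooth a ha) k).trans ?_
  rw [mul_assoc, Finset.sum_mul]
  refine mul_le_mul_of_nonneg_left (Finset.sum_le_sum fun i _ => ?_) (by positivity)
  have h1 := h i a ha
  have h2 := h' (k - i) a ha
  calc _ ≤ (k.choose i : ℝ) * (C i * W₁ a) * (C' (k - i) * W₂ a) := by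
        have := (norm_nonneg _).trans h1
        gcongr
    _ = _ := by ring

lemma mul {A : Type*} [NormedRing A] [NormedAlgebra ℝ A] {f g : α → V → A}
    (hf : SymCls S p W₁ f) (hg : SymCls S p W₂ g) :
    SymCls S p (fun a => W₁ a * W₂ a) (fun a y => f a y * g a y) :=
  hf.bilin (ContinuousLinearMap.mul ℝ A) hg

lemma clm (L : G →L[ℝ] H) (hf : SymCls S p W f) : SymCls S p W (fun a y => L (f a y)) :=
  ⟨fun a ha => L.contDiff.contDiffAt.comp _ (hf.smooth a ha), fun k => by
    obtain ⟨C, hC, h⟩ := hf.bound k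
    refine ⟨(‖L‖ + 1) * C, by positivity, fun a ha => ?_⟩
    refine (L.norm_iteratedFDeriv_comp_left (f := f a) (hf.smooth a ha)
      (by exact_mod_cast le_top)).trans ?_
    have := (norm_nonneg _).trans (h a ha)
    calc _ ≤ (‖L‖ + 1) * (C * W a) := by gcongr; linarith; exact h a ha
      _ = _ := by ring⟩

lemma ofReal {f : α → V → ℝ} (hf : SymCls S p W f) : SymCls S p W (fun a y => (f a y : ℂ)) :=
  hf.clm Complex.ofRealCLM

lemma neg (hf : SymCls S p W f) : SymCls S p W (fun a y => -f a y) :=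
  hf.clm (-(ContinuousLinearMap.id ℝ G))

lemma sub (h₁ : SymCls S p W f₁) (h₂ : SymCls S p W f₂) :
    SymCls S p W (fun a y => f₁ a y - f₂ a y) := by
  simpa only [sub_eq_add_neg] using h₁.add h₂.neg

lemma const_mul {A : Type*} [NormedRing A] [NormedAlgebra ℝ A] [NormOneClass A]
    {f : α → V → A} (c : α → A)
    (hf : SymCls S p W f) : SymCls S p (fun a => ‖c a‖ * W a) (fun a y => c a * f a y) :=
  (const c (fun a _ => le_rfl)).mul hf

lemma const_mul' {A : Type*} [NormedRing A] [NormedAlgebra ℝ A] [NormOneClass A]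
    {f : α → V → A} (c : A)
    (hf : SymCls S p W f) : SymCls S p W (fun a y => c * f a y) :=
  ((const (fun _ => c) (fun a _ => le_rfl)).mul hf).mono (c := ‖c‖ + 1) (fun a ha => by
    have := hf.weight_nonneg ha
    gcongr; linarith) (by positivity)

/-- Chain rule; the inner derivatives of order at least two vanish, so `‖L‖ + 1` dominates all of
them in the required geometric form. -/
lemma comp_clm (L : V' →L[ℝ] V) {q : α → V'} (h : SymCls S p W f) (hq : ∀ a ∈ S, L (q a) = p a) :
    SymCls S q W (fun a y => f a (L y)) := by
  refine of_le (fun a ha => ?_) (fun a ha => h.weight_nonneg ha) fun k => ?_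
  · have := h.smooth a ha
    rw [← hq a ha] at this
    exact this.comp (q a) L.contDiff.contDiffAt
  · obtain ⟨C, hC, h'⟩ := h.bound_le k
    refine ⟨k.factorial * C * (‖L‖ + 1) ^ k, fun a ha => ?_⟩
    have hs := h.smooth a ha
    rw [← hq a ha] at hs
    have := norm_iteratedFDeriv_comp_le_at (k := k) hs (L.contDiff.contDiffAt (x := q a))
      (C := C * W a) (D := ‖L‖ + 1) (fun i hi => by rw [hq a ha]; exact h' i hi a ha)
      (fun i hi _ => ?_)
    · refine this.trans (le_of_eq ?_)
      ring
    · rcases Nat.lt_or_ge 1 i with h2 | h2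
      · have h3 : iteratedFDeriv ℝ i (fun y : V' => L y) (q a) = 0 := by
          have := L.iteratedFDeriv_comp_left (f := fun y : V' => y) (x := q a) (n := ∞)
            contDiffAt_id (i := i) (by exact_mod_cast le_top)
          rw [show (fun y : V' => L y) = L ∘ (fun y => y) from rfl, this]
          obtain ⟨j, rfl⟩ : ∃ j, i = j + 1 + 1 := ⟨i - 2, by omega⟩
          have h0 : iteratedFDeriv ℝ (j + 1 + 1) (fun y : V' => y) (q a) = 0 := by
            rw [← norm_eq_zero, ← norm_iteratedFDeriv_fderiv]
            have hd : _root_.fderiv ℝ (fun y : V' => y) =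
                fun _ => ContinuousLinearMap.id ℝ V' := funext fun y => fderiv_fun_id
            rw [hd, iteratedFDeriv_const_of_ne (by omega)]
            simp
          rw [h0]
          ext; simp
        rw [show (⇑L : V' → V) = fun y => L y from rfl, h3]
        simp only [norm_zero]
        positivity
      · obtain rfl : i = 1 := by omega
        have : ‖iteratedFDeriv ℝ 1 (⇑L) (q a)‖ = ‖fderiv ℝ (⇑L) (q a)‖ := by
          rw [← norm_iteratedFDeriv_fderiv, norm_iteratedFDeriv_zero]
        rw [this, ContinuousLinearMap.fderiv]
        simp

/-- Faà di Bruno: every term has exactly one derivative of `g`, which carries the weight, and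
derivatives of `f`, which are bounded. -/
lemma comp {q : α → F} {g : α → F → G} {f : α → V → F}
    (hg : SymCls S q W g) (hf : SymCls S p (fun _ => 1) f) (hq : ∀ a ∈ S, f a (p a) = q a) :
    SymCls S p W (fun a y => g a (f a y)) := by
  refine of_le (fun a ha => ?_) (fun a ha => hg.weight_nonneg ha) fun k => ?_
  · have := hg.smooth a ha
    rw [← hq a ha] at this
    exact this.comp (p a) (hf.smooth a ha)
  · obtain ⟨C, hC, h'⟩ := hg.bound_le k
    obtain ⟨D, hD, h''⟩ := hf.bound_le k
    refine ⟨k.factorial * C * (D + 1) ^ k, fun a ha => ?_⟩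
    have hs := hg.smooth a ha
    rw [← hq a ha] at hs
    have := norm_iteratedFDeriv_comp_le_at (k := k) hs (hf.smooth a ha)
      (C := C * W a) (D := D + 1) (fun i hi => by rw [hq a ha]; exact h' i hi a ha)
      (fun i hi hi' => ?_)
    · refine this.trans (le_of_eq ?_)
      ring
    · refine (h'' i hi' a ha).trans ?_
      calc D * 1 ≤ D + 1 := by linarith
        _ ≤ (D + 1) ^ i := le_self_pow₀ (by linarith) (by omega)

/-- Variant of `SymCls.comp`: only the derivatives of the inner function have to be bounded. -/
lemma comp_of_fderiv {q : α → F} {g : α → F → G} {f : α → V → F}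
    (hg : SymCls S q W g) (hfs : ∀ a ∈ S, ContDiffAt ℝ ∞ (f a) (p a))
    (hf : ∀ k, 1 ≤ k → ∃ C, ∀ a ∈ S, ‖iteratedFDeriv ℝ k (f a) (p a)‖ ≤ C)
    (hq : ∀ a ∈ S, f a (p a) = q a) :
    SymCls S p W (fun a y => g a (f a y)) := by
  have h : SymCls S p (fun _ => 1) (fun a y => f a y - f a (p a)) := by
    refine of_le (fun a ha => (hfs a ha).sub contDiffAt_const) (fun _ _ => zero_le_one) fun k => ?_
    rcases Nat.eq_zero_or_pos k with rfl | hk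
    · exact ⟨0, fun a ha => by simp⟩
    · obtain ⟨C, hC⟩ := hf k hk
      refine ⟨C, fun a ha => ?_⟩
      have h1 : iteratedFDeriv ℝ k (fun y => f a y - f a (p a)) (p a) =
          iteratedFDeriv ℝ k (f a) (p a) := by
        have h2 := fun_iteratedFDeriv_add_apply (𝕜 := ℝ) (i := k) (x := p a)
          ((hfs a ha).of_le (by exact_mod_cast le_top))
          (contDiffAt_const (c := -f a (p a)))
        rw [iteratedFDeriv_const_of_ne hk.ne'] at h2
        simpa [sub_eq_add_neg] using h2
      rw [h1]
      simpa using hC a ha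
  have hg' : SymCls S (fun _ => (0 : F)) W (fun a z => g a (z + q a)) := by
    refine ⟨fun a ha => ?_, fun k => ?_⟩
    · have := hg.smooth a ha
      refine ContDiffAt.comp (0 : F) (g := g a) (f := fun z => z + q a) (by simpa using this) ?_
      fun_prop
    · obtain ⟨C, hC, h'⟩ := hg.bound k
      refine ⟨C, hC, fun a ha => ?_⟩
      have := iteratedFDeriv_comp_add_right (𝕜 := ℝ) (f := g a) k (q a) 0
      rw [this, zero_add]
      exact h' a ha
  refine (hg'.comp h (fun a ha => by simp)).congr fun a ha => ?_
  filter_upwards with y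
  rw [← hq a ha]; simp

lemma comp_contDiffOn {f : α → V → F} (hf : SymCls S p (fun _ => 1) f) {g : F → G} {O K : Set F}
    (hO : IsOpen O) (hK : IsCompact K) (hKO : K ⊆ O) (hg : ContDiffOn ℝ ∞ g O)
    (hfK : ∀ a ∈ S, f a (p a) ∈ K) : SymCls S p (fun _ => 1) (fun a y => g (f a y)) := by
  refine comp (q := fun a => f a (p a)) (g := fun _ => g) ?_ hf (fun _ _ => rfl)
  refine of_le (fun a ha => (hg.contDiffAt (hO.mem_nhds (hKO (hfK a ha)))))
    (fun _ _ => zero_le_one) fun k => ?_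
  have hc : ContinuousOn (iteratedFDeriv ℝ k g) O := by
    refine ContinuousOn.congr (hg.continuousOn_iteratedFDerivWithin (m := k)
      (by exact_mod_cast le_top) hO.uniqueDiffOn) fun y hy => ?_
    rw [iteratedFDerivWithin_of_isOpen _ hO hy]
  obtain ⟨C, hC⟩ := hK.exists_bound_of_continuousOn (hc.mono hKO)
  exact ⟨C, fun a ha => by simpa using hC _ (hfK a ha)⟩

/-- After division by `W` the value at the base point stays in a compact interval of `(0, ∞)`, where
`y ↦ y ^ s` is smooth with bounded derivatives; multiplying by `W ^ s` undoes the normalization. -/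
lemma rpow {f : α → V → ℝ} (hf : SymCls S p W f) {c : ℝ} (hc : 0 < c)
    (hW : ∀ a ∈ S, 0 < W a) (hfW : ∀ a ∈ S, c * W a ≤ f a (p a)) (s : ℝ) :
    SymCls S p (fun a => W a ^ s) (fun a y => f a y ^ s) := by
  obtain ⟨C, hC, hb⟩ := hf.bound 0
  have h1 : SymCls S p (fun _ => 1) (fun a y => (W a)⁻¹ * f a y) :=
    (hf.const_mul fun a => (W a)⁻¹).mono (c := 1) (fun a ha => by
      have := hW a ha
      simp [abs_of_pos this, this.ne']) one_pos
  have h2 := h1.comp_contDiffOn (g := fun y : ℝ => y ^ s) (O := Set.Ioi 0) (K := Set.Icc c C)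
    isOpen_Ioi isCompact_Icc (fun y hy => hc.trans_le hy.1)
    (fun y hy => (contDiffAt_id.rpow_const_of_ne (ne_of_gt hy)).contDiffWithinAt)
    (fun a ha => by
      have hWa := hW a ha
      have := hb a ha
      rw [norm_iteratedFDeriv_zero] at this
      constructor
      · rw [inv_mul_eq_div, le_div_iff₀ hWa]; exact hfW a ha
      · rw [inv_mul_eq_div, div_le_iff₀ hWa]; exact (Real.le_norm_self _).trans this)
  refine ((h2.const_mul (fun a => W a ^ s)).mono (W₂ := fun a => W a ^ s) (c := 1)
    (fun a ha => ?_) one_pos).congr fun a ha => ?_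
  · have := Real.rpow_pos_of_pos (hW a ha) s
    simp [abs_of_pos this]
  · have hWa := hW a ha
    have hpos : 0 < f a (p a) := (mul_pos hc hWa).trans_le (hfW a ha)
    filter_upwards [(hf.smooth a ha).continuousAt.eventually (lt_mem_nhds hpos)] with y hy
    rw [← Real.mul_rpow hWa.le (by positivity), mul_inv_cancel_left₀ hWa.ne']

lemma inv {f : α → V → ℝ} (hf : SymCls S p W f) {c : ℝ} (hc : 0 < c)
    (hW : ∀ a ∈ S, 0 < W a) (hfW : ∀ a ∈ S, c * W a ≤ f a (p a)) :
    SymCls S p (fun a => (W a)⁻¹) (fun a y => (f a y)⁻¹) := by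
  simpa only [Real.rpow_neg_one] using hf.rpow hc hW hfW (-1)

/-- The derivatives of positive order of a logarithm. -/
lemma log_sub {f : α → V → ℝ} (hf : SymCls S p W f) {c : ℝ} (hc : 0 < c)
    (hW : ∀ a ∈ S, 0 < W a) (hfW : ∀ a ∈ S, c * W a ≤ f a (p a)) :
    SymCls S p (fun _ => 1) (fun a y => Real.log (f a y) - Real.log (W a)) := by
  obtain ⟨C, hC, hb⟩ := hf.bound 0
  have h1 : SymCls S p (fun _ => 1) (fun a y => (W a)⁻¹ * f a y) :=
    (hf.const_mul fun a => (W a)⁻¹).mono (c := 1) (fun a ha => by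
      have := hW a ha
      simp [abs_of_pos this, this.ne']) one_pos
  have h2 := h1.comp_contDiffOn (g := Real.log) (O := Set.Ioi 0) (K := Set.Icc c C)
    isOpen_Ioi isCompact_Icc (fun y hy => hc.trans_le hy.1)
    (fun y hy => (Real.contDiffAt_log.2 (ne_of_gt hy)).contDiffWithinAt)
    (fun a ha => by
      have hWa := hW a ha
      have := hb a ha
      rw [norm_iteratedFDeriv_zero] at this
      constructor
      · rw [inv_mul_eq_div, le_div_iff₀ hWa]; exact hfW a ha
      · rw [inv_mul_eq_div, div_le_iff₀ hWa]; exact (Real.le_norm_self _).trans this)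
  refine h2.congr fun a ha => ?_
  have hWa := hW a ha
  have hpos : 0 < f a (p a) := (mul_pos hc hWa).trans_le (hfW a ha)
  filter_upwards [(hf.smooth a ha).continuousAt.eventually (lt_mem_nhds hpos)] with y hy
  rw [Real.log_mul (inv_ne_zero hWa.ne') hy.ne', Real.log_inv]
  ring

lemma fderiv {f : α → V → G} (hf : SymCls S p W f) :
    SymCls S p W (fun a => _root_.fderiv ℝ (f a)) :=
  ⟨fun a ha => (hf.smooth a ha).fderiv_right (by simp), fun k => by
    obtain ⟨C, hC, h⟩ := hf.bound (k + 1)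
    exact ⟨C, hC, fun a ha => by rw [norm_iteratedFDeriv_fderiv]; exact h a ha⟩⟩

end SymCls

end SymCls

end

noncomputable section


/-! ### Decay of Fourier integrals -/

section Decay

open MeasureTheory

/-- Integration by parts `m` times. The constant does not depend on the centre because the measure
of a ball does not; this uniformity is what allows the windows to move over all of phase space. -/
lemma norm_fourierIntegral_le_of_ball {V G : Type*} [NormedAddCommGroup V] [NormedSpace ℝ V]
    [FiniteDimensional ℝ V] [MeasurableSpace V] [BorelSpace V] (μ : Measure V)
    [μ.IsAddHaarMeasure] [NormedAddCommGroup G] [NormedSpace ℂ G] (L : V →L[ℝ] V →L[ℝ] ℝ)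
    (hL : ∀ v, ‖v‖ ^ 2 ≤ L v v) (R : ℝ) (m : ℕ) :
    ∃ C, 0 < C ∧ ∀ (c : V) (f : V → G) (B : ℝ), ContDiff ℝ ∞ f →
      (∀ v, f v ≠ 0 → ‖v - c‖ ≤ R) → (∀ k ≤ m, ∀ v, ‖iteratedFDeriv ℝ k f v‖ ≤ B) →
      ∀ w, ‖∫ v, Real.fourierChar (-(L v w)) • f v ∂μ‖ ≤ C * B * ((1 + ‖w‖) ^ m)⁻¹ := by
  set vol : ℝ := (μ (Metric.closedBall 0 R)).toReal with hvol
  have hvol0 : 0 ≤ vol := ENNReal.toReal_nonneg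
  -- The outer `2 ^ m` comes from `(1 + ‖w‖) ^ m ≤ 2 ^ m max(1, ‖w‖) ^ m`; the summand `1` keeps the
  -- constant positive when the ball is null.
  refine ⟨2 ^ m * (2 ^ m * (m + 1) * vol + 1), by positivity, fun c f B hf hsupp hB w => ?_⟩
  have hB0 : 0 ≤ B := (norm_nonneg _).trans (hB 0 (Nat.zero_le _) c)
  have hts : tsupport f ⊆ Metric.closedBall c R := by
    refine closure_minimal (fun v hv => ?_) Metric.isClosed_closedBall
    rw [mem_closedBall_iff_norm]
    exact hsupp v hv
  have hfc : HasCompactSupport f :=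
    (isCompact_closedBall c R).of_isClosed_subset (isClosed_tsupport f) hts
  have hint : ∀ k, Integrable (fun v => ‖iteratedFDeriv ℝ k f v‖) μ := fun k => by
    refine Continuous.integrable_of_hasCompactSupport ?_ ?_
    · exact (hf.continuous_iteratedFDeriv (m := k) (by exact_mod_cast le_top)).norm
    · exact (hfc.iteratedFDeriv k).norm
  have hI : ∀ k ≤ m, ∫ v, ‖iteratedFDeriv ℝ k f v‖ ∂μ ≤ B * vol := fun k hk => by
    have h1 : ∀ v, v ∉ Metric.closedBall c R → ‖iteratedFDeriv ℝ k f v‖ = 0 := fun v hv => by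
      by_contra h
      exact hv (hts (support_iteratedFDeriv_subset k (by simpa using h)))
    rw [← setIntegral_eq_integral_of_forall_compl_eq_zero h1]
    have h2 := norm_setIntegral_le_of_norm_le_const (μ := μ) (s := Metric.closedBall c R)
      (f := fun v => ‖iteratedFDeriv ℝ k f v‖) (C := B) measure_closedBall_lt_top
      (fun v _ => by simpa using hB k hk v)
    refine (Real.le_norm_self _).trans (h2.trans (le_of_eq ?_))
    rw [hvol, Measure.real, Measure.addHaar_closedBall_center μ c R]
  set I := ‖∫ v, Real.fourierChar (-(L v w)) • f v ∂μ‖ with hIdef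
  have h0 : I ≤ B * vol := by
    refine (norm_integral_le_integral_norm _).trans ((le_of_eq ?_).trans (hI 0 (Nat.zero_le _)))
    refine integral_congr_ae (Filter.Eventually.of_forall fun v => ?_)
    simp [Circle.norm_smul]
  have hm : ‖w‖ ^ m * I ≤ 2 ^ m * (m + 1) * (B * vol) := by
    rcases eq_or_ne w 0 with rfl | hw
    · rcases Nat.eq_zero_or_pos m with rfl | hm
      · simpa using h0
      · rw [norm_zero, zero_pow hm.ne', zero_mul]; positivity
    have h := VectorFourier.pow_mul_norm_iteratedFDeriv_fourierIntegral_le L (μ := μ)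
      (f := f) (K := ⊤) (N := ⊤) (k := 0) (n := m) hf
      (fun k n _ _ => by
        refine Continuous.integrable_of_hasCompactSupport ?_ ?_
        · exact (continuous_norm.pow k).mul
            (hf.continuous_iteratedFDeriv (m := n) (by exact_mod_cast le_top)).norm
        · exact ((hfc.iteratedFDeriv n).norm).mul_left) le_top le_top w w
    simp only [norm_iteratedFDeriv_zero, pow_zero, mul_one, mul_zero, zero_add,
      CharP.cast_eq_zero] at h
    have hs : ∑ p ∈ Finset.range 1 ×ˢ Finset.range (m + 1),
        ∫ v, ‖v‖ ^ p.1 * ‖iteratedFDeriv ℝ p.2 f v‖ ∂μ ≤ (m + 1) * (B * vol) := by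
      rw [Finset.sum_product]
      simp only [Finset.range_one, Finset.sum_singleton, pow_zero, one_mul]
      refine (Finset.sum_le_card_nsmul _ _ (B * vol) fun k hk => hI k ?_).trans ?_
      · exact Nat.lt_succ_iff.1 (Finset.mem_range.1 hk)
      · simp
    have hwp : 0 < ‖w‖ ^ m := pow_pos (norm_pos_iff.2 hw) m
    -- Differentiating in the direction `w` produces `|L w w| ^ m`, at least `‖w‖ ^ (2m)` by
    -- coercivity, against one factor `‖w‖ ^ m` on the right, which is then cancelled.
    have h3 : ‖w‖ ^ m * (‖w‖ ^ m * I) ≤ ‖w‖ ^ m * (2 ^ m * (m + 1) * (B * vol)) := by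
      calc ‖w‖ ^ m * (‖w‖ ^ m * I) = (‖w‖ ^ 2) ^ m * I := by ring
        _ ≤ |L w w| ^ m * I := by gcongr; exact (hL w).trans (le_abs_self _)
        _ ≤ _ := h
        _ ≤ ‖w‖ ^ m * 2 ^ m * ((m + 1) * (B * vol)) := by gcongr
        _ = _ := by ring
    exact le_of_mul_le_mul_left h3 hwp
  have hI0 : 0 ≤ I := norm_nonneg _
  rw [← div_eq_mul_inv, le_div_iff₀ (by positivity)]
  have hBv : 0 ≤ B * vol := by positivity
  have hm1 : (0 : ℝ) ≤ m := Nat.cast_nonneg m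
  have h2m : (1 : ℝ) ≤ 2 ^ m := one_le_pow₀ (by norm_num)
  rcases le_total ‖w‖ 1 with hw | hw
  · calc I * (1 + ‖w‖) ^ m ≤ I * 2 ^ m := by gcongr; linarith
      _ ≤ (B * vol) * 2 ^ m := by gcongr
      _ = 2 ^ m * (1 * 1 * vol + 0) * B := by ring
      _ ≤ _ := by gcongr <;> linarith
  · calc I * (1 + ‖w‖) ^ m ≤ I * (2 * ‖w‖) ^ m := by gcongr; linarith
      _ = 2 ^ m * (‖w‖ ^ m * I) := by ring
      _ ≤ 2 ^ m * (2 ^ m * (m + 1) * (B * vol)) := by gcongr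
      _ = 2 ^ m * (2 ^ m * (m + 1) * vol + 0) * B := by ring
      _ ≤ _ := by gcongr; norm_num

end Decay

/-! ### Test functions in logarithmic coordinates and oscillatory integrals -/

section Osc

open MeasureTheory

variable {n : ℕ} [NeZero n]

local notation "E" => EuclideanSpace ℝ (Fin n)

/-- The points with bounded `y` and `t` bounded below. -/
def logBox (n : ℕ) [NeZero n] (R : ℝ) : Set (EuclideanSpace ℝ (Fin n)) :=
  {w | -R ≤ w 0 ∧ ∀ i, i ≠ 0 → |w i| ≤ R}

lemma logBox_mono {R R' : ℝ} (h : R ≤ R') : logBox n R ⊆ logBox n R' := fun _ hw =>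
  ⟨(neg_le_neg h).trans hw.1, fun i hi => (hw.2 i hi).trans h⟩

lemma isClosed_logBox (R : ℝ) : IsClosed (logBox n R) := by
  have : logBox n R = {w | -R ≤ w 0} ∩ ⋂ i, ⋂ (_ : i ≠ 0), {w | |w i| ≤ R} := by
    ext w; simp [logBox]
  rw [this]
  refine (isClosed_le continuous_const (by fun_prop)).inter
    (isClosed_iInter fun i => isClosed_iInter fun _ => isClosed_le (by fun_prop) continuous_const)

lemma logBox_sub {R S : ℝ} {w v : E} (hw : w + v ∈ logBox n R) (hv : ‖v‖ ≤ S) :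
    w ∈ logBox n (R + S) := by
  have h : ∀ i, |v i| ≤ S := fun i => (EuclideanSpace.norm_eq v ▸ Real.abs_le_sqrt (by
    rw [← sq_abs, ← Real.norm_eq_abs]
    exact Finset.single_le_sum (f := fun i => ‖v i‖ ^ 2) (fun _ _ => by positivity)
      (Finset.mem_univ i))).trans hv
  refine ⟨?_, fun i hi => ?_⟩
  · have h1 := hw.1
    have h2 := abs_le.1 (h 0)
    simp only [PiLp.add_apply] at h1
    linarith
  · have h1 := hw.2 i hi
    have h2 := h i
    simp only [PiLp.add_apply] at h1
    calc |w i| = |(w i + v i) - v i| := by ring_nf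
      _ ≤ _ := (abs_sub _ _).trans (add_le_add h1 h2)

/-- Smooth functions supported in some `logBox` that decay superexponentially as `t → ∞`, with
all derivatives. -/
structure IsBT {G : Type*} [NormedAddCommGroup G] [NormedSpace ℝ G]
    (g : EuclideanSpace ℝ (Fin n) → G) : Prop where
  smooth : ContDiff ℝ ∞ g
  supp : ∃ R, ∀ w, g w ≠ 0 → w ∈ logBox n R
  bound : ∀ k N : ℕ, ∃ C, ∀ w, ‖iteratedFDeriv ℝ k g w‖ ≤ C * Real.exp (-(N * w 0))

/-- Oscillatory integrands `F w v ζ`. -/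
structure IsOsc {G : Type*} [NormedAddCommGroup G] [NormedSpace ℝ G]
    (F : EuclideanSpace ℝ (Fin n) → EuclideanSpace ℝ (Fin n) → EuclideanSpace ℝ (Fin n) → G) :
    Prop where
  smooth : ContDiff ℝ ∞ (fun q : EuclideanSpace ℝ (Fin n) × EuclideanSpace ℝ (Fin n) ×
    EuclideanSpace ℝ (Fin n) => F q.1 q.2.1 q.2.2)
  supp : ∃ R, ∀ w v ζ, F w v ζ ≠ 0 → ‖v‖ ≤ R ∧ w ∈ logBox n R
  bound : ∃ D : ℕ, ∀ k N : ℕ, ∃ C, ∀ w v ζ,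
    ‖iteratedFDeriv ℝ k (fun q : EuclideanSpace ℝ (Fin n) × EuclideanSpace ℝ (Fin n) =>
      F q.1 q.2 ζ) (w, v)‖ ≤ C * (1 + ‖ζ‖) ^ D * Real.exp (-(N * w 0))

variable {G : Type*} [NormedAddCommGroup G] [NormedSpace ℂ G]

/-- The oscillatory integral `∫∫ e^{-2πi v·ζ} F w v ζ dv dζ`. -/
def osc (F : E → E → E → G) (w : E) : G :=
  ∫ ζ : E, ∫ v : E, Real.fourierChar (-(inner ℝ v ζ)) • F w v ζ

namespace IsOsc

lemma smooth_slice {F : E → E → E → G} (h : IsOsc F) (ζ : E) : ContDiff ℝ ∞ (fun q : E × E => F q.1 q.2 ζ) :=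
  h.smooth.comp (contDiff_fst.prodMk (contDiff_snd.prodMk contDiff_const))

lemma fderiv_apply {F : E → E → E → G} (h : IsOsc F) (w v ζ : E) :
    HasFDerivAt (fun w => F w v ζ) (((fderiv ℝ (fun q : E × E => F q.1 q.2 ζ) (w, v))).comp
      (ContinuousLinearMap.inl ℝ E E)) w := by
  have h1 := ((h.smooth_slice ζ).differentiable (by simp) (w, v)).hasFDerivAt
  exact HasFDerivAt.comp (f := fun w => (w, v)) w h1 (hasFDerivAt_prodMk_left w v)

/-- The derivative of the integrand in `w`. -/
lemma fderiv_left {F : E → E → E → G} (h : IsOsc F) : IsOsc (fun w v ζ => fderiv ℝ (fun w => F w v ζ) w) := by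
  obtain ⟨R, hR⟩ := h.supp
  obtain ⟨D, hD⟩ := h.bound
  refine ⟨?_, ⟨R, ?_⟩, ⟨D, fun k N => ?_⟩⟩
  · exact ContDiff.fderiv (f := fun (q : E × E × E) w => F w q.2.1 q.2.2) (n := ∞) (m := ∞)
      (h.smooth.comp (contDiff_snd.prodMk ((contDiff_fst.comp (contDiff_snd.comp
        contDiff_fst)).prodMk (contDiff_snd.comp (contDiff_snd.comp contDiff_fst)))))
      contDiff_fst (by simp)
  · intro w v ζ hne
    by_contra hc
    apply hne
    have hcl : IsClosed {w : E | ‖v‖ ≤ R ∧ w ∈ logBox n R} := by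
      by_cases hv : ‖v‖ ≤ R
      · simpa [hv] using! isClosed_logBox R
      · simp [hv]
    have : (fun w => F w v ζ) =ᶠ[𝓝 w] fun _ => 0 := by
      filter_upwards [hcl.isOpen_compl.mem_nhds hc] with w' hw'
      by_contra h0
      exact hw' (hR w' v ζ h0)
    rw [this.fderiv_eq]; simp
  · obtain ⟨C, hC⟩ := hD (k + 1) N
    set L : (E × E →L[ℝ] G) →L[ℝ] (E →L[ℝ] G) :=
      (ContinuousLinearMap.compL ℝ E (E × E) G).flip (ContinuousLinearMap.inl ℝ E E)
    refine ⟨‖L‖ * C, fun w v ζ => ?_⟩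
    have e : (fun q : E × E => fderiv ℝ (fun w => F w q.2 ζ) q.1) =
        fun q => L (fderiv ℝ (fun q : E × E => F q.1 q.2 ζ) q) := by
      funext q
      rw [(h.fderiv_apply q.1 q.2 ζ).fderiv]; rfl
    rw [e]
    refine (L.norm_iteratedFDeriv_comp_left (N := ∞) (f := fderiv ℝ (fun q : E × E =>
      F q.1 q.2 ζ)) ((h.smooth_slice ζ).fderiv_right (m := ∞) (by simp)).contDiffAt
      (by exact_mod_cast le_top)).trans ?_
    rw [norm_iteratedFDeriv_fderiv, mul_assoc, mul_assoc]
    refine mul_le_mul_of_nonneg_left ((hC w v ζ).trans (le_of_eq (by ring))) (norm_nonneg _)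

/-- Integrating by parts `m + D` times in `v` beats the growth `(1 + ‖ζ‖) ^ D` of the integrand, so
that the `ζ` integral becomes absolutely convergent. -/
lemma inner_bound {F : E → E → E → G} (h : IsOsc F) (m N : ℕ) : ∃ C, 0 ≤ C ∧ ∀ w ζ,
    ‖∫ v : E, Real.fourierChar (-(inner ℝ v ζ)) • F w v ζ‖ ≤
      C * ((1 + ‖ζ‖) ^ m)⁻¹ * Real.exp (-(N * w 0)) := by
  obtain ⟨R, hR⟩ := h.supp
  obtain ⟨D, hD⟩ := h.bound
  obtain ⟨C₁, hC₁, hdec⟩ := norm_fourierIntegral_le_of_ball (G := G) (volume : Measure E)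
    (innerSL ℝ) (fun v => (real_inner_self_eq_norm_sq v).ge) R (m + D)
  choose C hC using fun k => hD k N
  set C₂ := ∑ k ∈ Finset.range (m + D + 1), |C k|
  have hC₂ : 0 ≤ C₂ := Finset.sum_nonneg fun _ _ => abs_nonneg _
  refine ⟨C₁ * C₂, by positivity, fun w ζ => ?_⟩
  have := hdec 0 (fun v => F w v ζ) (C₂ * (1 + ‖ζ‖) ^ D * Real.exp (-(N * w 0)))
    ((h.smooth_slice ζ).comp (contDiff_const.prodMk contDiff_id))
    (fun v hv => by simpa using (hR w v ζ hv).1) (fun k hk v => ?_) ζ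
  · refine this.trans (le_of_eq ?_)
    rw [pow_add, mul_inv]
    have : (1 + ‖ζ‖) ^ D ≠ 0 := by positivity
    field_simp
  · have e : (fun v => F w v ζ) = fun v => (fun q : E × E => F q.1 q.2 ζ)
        ((w, 0) + ContinuousLinearMap.inr ℝ E E v) := by funext v; simp
    have e2 := (ContinuousLinearMap.inr ℝ E E).iteratedFDeriv_comp_right
      (f := fun q : E × E => F ((w, (0 : E)) + q).1 ((w, (0 : E)) + q).2 ζ) (n := ∞)
      (((h.smooth_slice ζ).comp (contDiff_const.add contDiff_id))) v (i := k)
      (by exact_mod_cast le_top)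
    rw [e]
    refine (le_of_eq (congrArg norm e2)).trans ?_
    refine (ContinuousMultilinearMap.norm_compContinuousLinearMap_le _ _).trans ?_
    have e3 := iteratedFDeriv_comp_add_left (𝕜 := ℝ) (f := fun q : E × E => F q.1 q.2 ζ) k
      (w, (0 : E)) (ContinuousLinearMap.inr ℝ E E v)
    rw [e3]
    have h4 : ∏ i : Fin k, ‖ContinuousLinearMap.inr ℝ E E‖ ≤ 1 :=
      Finset.prod_le_one (fun _ _ => norm_nonneg _) fun _ _ =>
        ContinuousLinearMap.norm_inr_le_one ℝ E E
    refine (mul_le_of_le_one_right (norm_nonneg _) h4).trans ?_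
    have h5 : (w, (0 : E)) + ContinuousLinearMap.inr ℝ E E v = (w, v) := by simp
    rw [h5]
    refine (hC k w v ζ).trans ?_
    gcongr
    exact (le_abs_self _).trans (Finset.single_le_sum (f := fun k => |C k|)
      (fun _ _ => abs_nonneg _) (Finset.mem_range.2 (by omega)))

end IsOsc

lemma support_osc {F : E → E → E → G} (h : IsOsc F) : ∃ R, ∀ w, osc F w ≠ 0 → w ∈ logBox n R := by
  obtain ⟨R, hR⟩ := h.supp
  refine ⟨R, fun w hw => ?_⟩
  by_contra hc
  apply hw
  have : ∀ v ζ, F w v ζ = 0 := fun v ζ => by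
    by_contra h0
    exact hc (hR w v ζ h0).2
  simp [osc, this]

lemma integrable_inv_pow : Integrable (fun ζ : E => ((1 + ‖ζ‖) ^ (n + 1))⁻¹) := by
  have := integrable_one_add_norm (μ := (volume : Measure (EuclideanSpace ℝ (Fin n)))) (r := n + 1)
    (by simp)
  refine this.congr (Filter.Eventually.of_forall fun ζ => ?_)
  change (1 + ‖ζ‖) ^ (-((n : ℝ) + 1)) = ((1 + ‖ζ‖) ^ (n + 1))⁻¹
  rw [Real.rpow_neg (by positivity)]
  norm_cast

lemma aestronglyMeasurable_inner {F : E → E → E → G} (h : IsOsc F) (w : E) :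
    AEStronglyMeasurable
      (fun ζ => ∫ v : E, Real.fourierChar (-(inner ℝ v ζ)) • F w v ζ) volume := by
  have hc : Continuous (fun q : E × E => Real.fourierChar (-(inner ℝ q.2 q.1)) • F w q.2 q.1) := by
    have h1 : Continuous (fun q : E × E => F w q.2 q.1) :=
      h.smooth.continuous.comp (continuous_const.prodMk (continuous_snd.prodMk continuous_fst))
    have := Real.continuous_fourierChar
    exact Continuous.smul (by fun_prop) h1
  exact (hc.stronglyMeasurable.integral_prod_right' (ν := (volume : Measure E))).aestronglyMeasurable

lemma norm_osc_le {F : E → E → E → G} (h : IsOsc F) (N : ℕ) :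
    ∃ C, ∀ w, ‖osc F w‖ ≤ C * Real.exp (-(N * w 0)) := by
  obtain ⟨C, hC, hb⟩ := h.inner_bound (n + 1) N
  refine ⟨C * ∫ ζ : E, ((1 + ‖ζ‖) ^ (n + 1))⁻¹, fun w => ?_⟩
  refine (norm_integral_le_of_norm_le
    (g := fun ζ => C * ((1 + ‖ζ‖) ^ (n + 1))⁻¹ * Real.exp (-(N * w 0)))
    (((integrable_inv_pow (n := n)).const_mul C).mul_const _) (Filter.Eventually.of_forall fun ζ => hb w ζ)).trans ?_
  rw [integral_mul_const, integral_const_mul]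

lemma hasFDerivAt_inner [CompleteSpace G] {F : E → E → E → G} (h : IsOsc F) (w ζ : E) :
    HasFDerivAt (fun w => ∫ v : E, Real.fourierChar (-(inner ℝ v ζ)) • F w v ζ)
      (∫ v : E, Real.fourierChar (-(inner ℝ v ζ)) • fderiv ℝ (fun w => F w v ζ) w) w := by
  obtain ⟨R, hR⟩ := h.supp
  obtain ⟨R', hR'⟩ := h.fderiv_left.supp
  obtain ⟨D, hD⟩ := h.fderiv_left.bound
  obtain ⟨C, hC⟩ := hD 0 0
  have hcF : ∀ w, Continuous (fun v : E => Real.fourierChar (-(inner ℝ v ζ)) • F w v ζ) := fun w => by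
    have h1 : Continuous (fun v : E => F w v ζ) :=
      h.smooth.continuous.comp (continuous_const.prodMk (continuous_id.prodMk continuous_const))
    have := Real.continuous_fourierChar
    fun_prop
  have hcF' : Continuous (fun v : E => Real.fourierChar (-(inner ℝ v ζ)) •
      fderiv ℝ (fun w => F w v ζ) w) := by
    have h1 : Continuous (fun v : E => fderiv ℝ (fun w => F w v ζ) w) :=
      h.fderiv_left.smooth.continuous.comp
        (continuous_const.prodMk (continuous_id.prodMk continuous_const))
    have := Real.continuous_fourierChar
    fun_prop
  refine hasFDerivAt_integral_of_dominated_of_fderiv_le (𝕜 := ℝ) (s := Set.univ)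
    (F' := fun w v => Real.fourierChar (-(inner ℝ v ζ)) • fderiv ℝ (fun w => F w v ζ) w)
    (bound := (Metric.closedBall (0 : E) R').indicator fun _ => C * (1 + ‖ζ‖) ^ D)
    Filter.univ_mem (Filter.Eventually.of_forall fun w => (hcF w).aestronglyMeasurable) ?_
    hcF'.aestronglyMeasurable (Filter.Eventually.of_forall fun v w _ => ?_) ?_
    (Filter.Eventually.of_forall fun v w _ => ?_)
  · refine (hcF w).integrable_of_hasCompactSupport ?_
    refine HasCompactSupport.intro (isCompact_closedBall (0 : E) R) fun v hv => ?_
    have : F w v ζ = 0 := by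
      by_contra h0
      exact hv (by simpa using (hR w v ζ h0).1)
    simp [this]
  · rw [Circle.smul_def, norm_smul, Circle.norm_coe, one_mul]
    by_cases hv : v ∈ Metric.closedBall (0 : E) R'
    · rw [Set.indicator_of_mem hv]
      simpa using hC w v ζ
    · have : fderiv ℝ (fun w => F w v ζ) w = 0 := by
        by_contra h0
        exact hv (by simpa using (hR' w v ζ h0).1)
      rw [this, Set.indicator_of_notMem hv, norm_zero]
  · rw [integrable_indicator_iff measurableSet_closedBall]
    exact integrableOn_const measure_closedBall_lt_top.ne
  · have h2 : HasFDerivAt (fun w => F w v ζ) (fderiv ℝ (fun w => F w v ζ) w) w := by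
      rw [(h.fderiv_apply w v ζ).fderiv]; exact h.fderiv_apply w v ζ
    simp only [Circle.smul_def]
    exact h2.const_smul (Real.fourierChar (-(inner ℝ v ζ)) : ℂ)

lemma hasFDerivAt_osc [CompleteSpace G] {F : E → E → E → G} (h : IsOsc F) (w : E) :
    HasFDerivAt (osc F) (osc (fun w v ζ => fderiv ℝ (fun w => F w v ζ) w) w) w := by
  obtain ⟨C, hC, hb⟩ := h.fderiv_left.inner_bound (n + 1) 0
  obtain ⟨C', hC', hb'⟩ := h.inner_bound (n + 1) 0
  refine hasFDerivAt_integral_of_dominated_of_fderiv_le (𝕜 := ℝ) (s := Set.univ)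
    (F' := fun w ζ => ∫ v : E, Real.fourierChar (-(inner ℝ v ζ)) • fderiv ℝ (fun w => F w v ζ) w)
    (bound := fun ζ => C * ((1 + ‖ζ‖) ^ (n + 1))⁻¹)
    Filter.univ_mem (Filter.Eventually.of_forall fun w => aestronglyMeasurable_inner h w) ?_
    (aestronglyMeasurable_inner h.fderiv_left w) (Filter.Eventually.of_forall fun v w _ => ?_)
    ((integrable_inv_pow (n := n)).const_mul C)
    (Filter.Eventually.of_forall fun v w _ => hasFDerivAt_inner h w v)
  · exact ((integrable_inv_pow (n := n)).const_mul C').mono' (aestronglyMeasurable_inner h w)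
      (Filter.Eventually.of_forall fun ζ => by simpa using hb' w ζ)
  · simpa using hb w v

/-- Induction on the order: the derivative in `w` of an oscillatory integral is the oscillatory
integral of the differentiated integrand, which belongs to the same class with values in a space of
linear maps. Hence the quantification over all targets `G`. -/
lemma contDiff_osc (k : ℕ) : ∀ {G : Type} [NormedAddCommGroup G] [NormedSpace ℂ G]
    [CompleteSpace G] {F : E → E → E → G}, IsOsc F → ContDiff ℝ k (osc F) ∧
      ∀ N : ℕ, ∃ C, ∀ w, ‖iteratedFDeriv ℝ k (osc F) w‖ ≤ C * Real.exp (-(N * w 0)) := by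
  induction k with
  | zero =>
    intro G _ _ _ F h
    refine ⟨contDiff_zero.2 (continuous_iff_continuousAt.2 fun w =>
      (hasFDerivAt_osc h w).continuousAt), fun N => ?_⟩
    simpa using norm_osc_le h N
  | succ k ih =>
    intro G _ _ _ F h
    have hd : fderiv ℝ (osc F) = osc (fun w v ζ => fderiv ℝ (fun w => F w v ζ) w) :=
      funext fun w => (hasFDerivAt_osc h w).fderiv
    obtain ⟨h1, h2⟩ := ih h.fderiv_left
    refine ⟨?_, fun N => ?_⟩
    · rw [Nat.cast_succ, contDiff_succ_iff_fderiv]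
      refine ⟨fun w => (hasFDerivAt_osc h w).differentiableAt, by simp, ?_⟩
      rw [hd]; exact h1
    · obtain ⟨C, hC⟩ := h2 N
      refine ⟨C, fun w => ?_⟩
      rw [← norm_iteratedFDeriv_fderiv, hd]
      exact hC w

lemma isBT_osc {F : E → E → E → ℂ} (h : IsOsc F) : IsBT (osc F) :=
  ⟨contDiff_infty.2 fun k => (contDiff_osc k h).1, support_osc h, fun k N => (contDiff_osc k h).2 N⟩

end Osc

end

noncomputable section


/-! ### Operators given by amplitudes -/

section Amplitude

open MeasureTheory

variable {n : ℕ} [NeZero n]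

local notation "E" => EuclideanSpace ℝ (Fin n)

/-- The pseudodifferential operator with amplitude `p w' w ζ`. -/
def ampOp (p : E → E → E → ℂ) (f : E → ℂ) (w' : E) : ℂ :=
  ∫ ζ : E, ∫ w : E, Real.fourierChar (-(inner ℝ (w - w') ζ)) • (p w' w ζ * f w)

/-- Amplitudes of polynomial growth supported near the diagonal. -/
structure IsAmp (p : EuclideanSpace ℝ (Fin n) → EuclideanSpace ℝ (Fin n) →
    EuclideanSpace ℝ (Fin n) → ℂ) : Prop where
  smooth : ContDiff ℝ ∞ (fun q : EuclideanSpace ℝ (Fin n) × EuclideanSpace ℝ (Fin n) ×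
    EuclideanSpace ℝ (Fin n) => p q.1 q.2.1 q.2.2)
  supp : ∃ R, ∀ w' w ζ, p w' w ζ ≠ 0 → ‖w - w'‖ ≤ R
  bound : ∃ D : ℕ, SymCls Set.univ (fun a : EuclideanSpace ℝ (Fin n) × EuclideanSpace ℝ (Fin n) ×
    EuclideanSpace ℝ (Fin n) => (a.1, a.2.1)) (fun a => (1 + ‖a.2.2‖) ^ D)
    (fun a q => p q.1 q.2 a.2.2)

lemma abs_apply_le_norm (v : E) (i : Fin n) : |v i| ≤ ‖v‖ :=
  EuclideanSpace.norm_eq v ▸ Real.abs_le_sqrt (by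
    rw [← sq_abs, ← Real.norm_eq_abs]
    exact Finset.single_le_sum (f := fun i => ‖v i‖ ^ 2) (fun _ _ => by positivity)
      (Finset.mem_univ i))

lemma IsBT.symCls {G : Type*} [NormedAddCommGroup G] [NormedSpace ℝ G] {f : E → G} (hf : IsBT f)
    (N : ℕ) : SymCls Set.univ (fun w : E => w) (fun w => Real.exp (-(N * w 0))) (fun _ => f) :=
  SymCls.of_le (fun _ _ => hf.smooth.contDiffAt) (fun _ _ => (Real.exp_pos _).le) fun k => by
    obtain ⟨C, hC⟩ := hf.bound k N
    exact ⟨C, fun w _ => hC w⟩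

lemma IsBT.of_symCls {G : Type*} [NormedAddCommGroup G] [NormedSpace ℝ G] {f : E → G}
    (hs : ContDiff ℝ ∞ f) (hsupp : ∃ R, ∀ w, f w ≠ 0 → w ∈ logBox n R)
    (h : ∀ N : ℕ, SymCls Set.univ (fun w : E => w) (fun w => Real.exp (-(N * w 0))) (fun _ => f)) :
    IsBT f :=
  ⟨hs, hsupp, fun k N => by
    obtain ⟨C, -, hC⟩ := (h N).bound k
    exact ⟨C, fun w => hC w trivial⟩⟩

/-- On the support of `p` the points `w` and `w + v` are within distance `R`, so the decay of `f` at
`w + v` is decay at `w`. -/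
lemma IsAmp.isOsc {p : E → E → E → ℂ} (hp : IsAmp p) {f : E → ℂ} (hf : IsBT f) :
    IsOsc (fun w v ζ => p w (w + v) ζ * f (w + v)) := by
  obtain ⟨R, hR⟩ := hp.supp
  obtain ⟨R₁, hR₁⟩ := hf.supp
  obtain ⟨D, hD⟩ := hp.bound
  have hs : ContDiff ℝ ∞ (fun q : E × E × E => p q.1 (q.1 + q.2.1) q.2.2 * f (q.1 + q.2.1)) := by
    have h1 : ContDiff ℝ ∞ (fun q : E × E × E => q.1 + q.2.1) := by fun_prop
    refine ContDiff.mul (hp.smooth.comp (contDiff_fst.prodMk (h1.prodMk ?_))) (hf.smooth.comp h1)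
    fun_prop
  refine ⟨hs, ⟨max R (R₁ + R), fun w v ζ h => ?_⟩, ⟨D, fun k N => ?_⟩⟩
  · have h1 := hR w (w + v) ζ (left_ne_zero_of_mul h)
    have h2 := hR₁ (w + v) (right_ne_zero_of_mul h)
    rw [add_sub_cancel_left] at h1
    exact ⟨h1.trans (le_max_left _ _), logBox_mono (le_max_right _ _) (logBox_sub h2 h1)⟩
  -- The margin `1` makes the integrand vanish in a whole neighbourhood of every point outside `S`.
  · set S : Set (E × E × E) := {a | ‖a.2.1‖ < R + 1} with hS
    have c1 : SymCls Set.univ (fun a : E × E × E => (a.1, a.2.1)) (fun a => (1 + ‖a.2.2‖) ^ D)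
        (fun a q => p q.1 (q.1 + q.2) a.2.2) :=
      (hD.reindex (fun a : E × E × E => (a.1, a.1 + a.2.1, a.2.2))).comp_clm
        ((ContinuousLinearMap.fst ℝ E E).prod
          (ContinuousLinearMap.fst ℝ E E + ContinuousLinearMap.snd ℝ E E))
        (q := fun a : E × E × E => (a.1, a.2.1)) (fun a _ => rfl)
    have c2 : SymCls S (fun a : E × E × E => (a.1, a.2.1)) (fun a => Real.exp (-(N * a.1 0)))
        (fun a q => f (q.1 + q.2)) := by
      refine (((hf.symCls N).reindex (fun a : E × E × E => a.1 + a.2.1)).comp_clm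
        (ContinuousLinearMap.fst ℝ E E + ContinuousLinearMap.snd ℝ E E)
        (q := fun a : E × E × E => (a.1, a.2.1)) (fun a _ => rfl)).mono_set
        (Set.subset_univ S) |>.mono (c := Real.exp (N * (R + 1))) (fun a ha => ?_)
          (Real.exp_pos _)
      rw [← Real.exp_add, Real.exp_le_exp, PiLp.add_apply]
      have h1 := (abs_le.1 (abs_apply_le_norm a.2.1 0)).1
      have h2 : ‖a.2.1‖ < R + 1 := ha
      have : (N : ℝ) * -(a.2.1 0) ≤ N * (R + 1) := by gcongr; linarith
      linarith
    have c3 := (c1.mono_set (Set.subset_univ S)).mul c2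
    have c4 : SymCls (Set.univ \ S) (fun a : E × E × E => (a.1, a.2.1))
        (fun a => (1 + ‖a.2.2‖) ^ D * Real.exp (-(N * a.1 0)))
        (fun a q => p q.1 (q.1 + q.2) a.2.2 * f (q.1 + q.2)) := by
      refine SymCls.zero (fun _ _ => by positivity) fun a ha => ?_
      have h1 : R + 1 ≤ ‖a.2.1‖ := not_lt.1 ha.2
      have h2 : ∀ᶠ q : E × E in 𝓝 (a.1, a.2.1), R < ‖q.2‖ :=
        (continuous_snd.norm.continuousAt (x := (a.1, a.2.1))).eventually
          (lt_mem_nhds (by change R < ‖a.2.1‖; linarith))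
      filter_upwards [h2] with q hq
      by_contra h0
      have := hR q.1 (q.1 + q.2) a.2.2 (left_ne_zero_of_mul h0)
      rw [add_sub_cancel_left] at this
      linarith
    have c5 := c3.union c4
    obtain ⟨C, -, hC⟩ := c5.bound k
    refine ⟨C, fun w v ζ => ?_⟩
    rw [mul_assoc]
    exact hC (w, v, ζ) (by by_cases h : (w, v, ζ) ∈ S <;> simp [h])

lemma ampOp_eq_osc (p : E → E → E → ℂ) (f : E → ℂ) :
    ampOp p f = osc (fun w v ζ => p w (w + v) ζ * f (w + v)) := by
  funext w
  unfold ampOp osc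
  congr 1
  funext ζ
  rw [← integral_add_left_eq_self _ w]
  simp

lemma IsAmp.isBT_ampOp {p : E → E → E → ℂ} (hp : IsAmp p) {f : E → ℂ} (hf : IsBT f) :
    IsBT (ampOp p f) := by
  rw [ampOp_eq_osc]
  exact isBT_osc (hp.isOsc hf)

lemma IsAmp.inner_bound {p : E → E → E → ℂ} (hp : IsAmp p) {f : E → ℂ} (hf : IsBT f) (m : ℕ) :
    ∃ C, 0 ≤ C ∧ ∀ w' ζ,
      ‖∫ w : E, Real.fourierChar (-(inner ℝ (w - w') ζ)) • (p w' w ζ * f w)‖ ≤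
        C * ((1 + ‖ζ‖) ^ m)⁻¹ := by
  obtain ⟨C, hC, h⟩ := (hp.isOsc hf).inner_bound m 0
  refine ⟨C, hC, fun w' ζ => ?_⟩
  rw [← integral_add_left_eq_self _ w']
  simpa using h w' ζ

/-- Interchange of the order of integration in oscillatory integrals. -/
lemma integral_swap_osc {X : Type*} [NormedAddCommGroup X] [MeasureSpace X]
    [BorelSpace X] [SecondCountableTopology X] [ProperSpace X] [SFinite (volume : Measure X)]
    [IsFiniteMeasureOnCompacts (volume : Measure X)]
    {F : X → E → E → ℂ} (hF : Continuous (fun q : (X × E) × E => F q.1.1 q.1.2 q.2))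
    {C R : ℝ} (hb : ∀ x ζ, ‖∫ v, F x ζ v‖ ≤ C * ((1 + ‖ζ‖) ^ (n + 1))⁻¹) {c : X}
    (hsupp : ∀ x ζ, R < ‖x - c‖ → ∫ v, F x ζ v = 0) :
    Integrable (fun ζ => ∫ x, ∫ v, F x ζ v) ∧
      ∫ x, ∫ ζ, ∫ v, F x ζ v = ∫ ζ, ∫ x, ∫ v, F x ζ v := by
  have hm : StronglyMeasurable (fun q : X × E => ∫ v, F q.1 q.2 v) :=
    hF.stronglyMeasurable.integral_prod_right' (ν := (volume : Measure E))
  have hC : 0 ≤ C := by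
    have := (norm_nonneg _).trans (hb c 0)
    simpa using this
  have hi : Integrable (fun q : X × E => ∫ v, F q.1 q.2 v)
      ((volume : Measure X).prod (volume : Measure E)) := by
    have h1 : Integrable ((Metric.closedBall c R).indicator fun _ : X => C) := by
      rw [integrable_indicator_iff measurableSet_closedBall]
      exact integrableOn_const (isCompact_closedBall c R).measure_lt_top.ne
    refine (h1.mul_prod (integrable_inv_pow (n := n))).mono' hm.aestronglyMeasurable
      (Filter.Eventually.of_forall fun q => ?_)
    by_cases hq : q.1 ∈ Metric.closedBall c R
    · simp only [Set.indicator_of_mem hq]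
      exact hb q.1 q.2
    · rw [hsupp q.1 q.2 (by simpa [dist_eq_norm] using hq), Set.indicator_of_notMem hq]
      simp
  exact ⟨hi.integral_prod_right, integral_integral_swap hi⟩

end Amplitude

end

noncomputable section


/-! ### Windowed transforms of operators and of their compositions as iterated integrals -/

section Engine

open MeasureTheory

variable {n : ℕ} [NeZero n]

local notation "E" => EuclideanSpace ℝ (Fin n)

/-- The integrand of the windowed Fourier transform of `ampOp p (ampOp q φ)`, where
`e = p q`. -/
def tripleKernel (θ φ : E → ℂ) (τ ξ ζ η : E) (e : (E × E) × E → ℂ) (z : (E × E) × E) : ℂ :=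
  Real.fourierChar (-(inner ℝ z.1.1 (ξ - ζ) + inner ℝ z.1.2 (ζ - η) + inner ℝ z.2 η)) •
    (θ (z.1.1 - τ) * e z * φ z.2)

lemma exists_bound_of_compactSupport {X : Type*} [NormedAddCommGroup X] [ProperSpace X]
    {d : X → ℂ} (hd : Continuous d) {c : X} {R : ℝ} (hs : ∀ x, R < ‖x - c‖ → d x = 0) :
    ∃ C, 0 ≤ C ∧ ∀ x, ‖d x‖ ≤ C := by
  have : HasCompactSupport d := HasCompactSupport.intro (isCompact_closedBall c R) fun x hx =>
    hs x (by simpa [dist_eq_norm] using hx)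
  obtain ⟨C, hC⟩ := this.exists_bound_of_continuous hd
  exact ⟨C, (norm_nonneg _).trans (hC c), hC⟩

lemma integral_prod_of_compactSupport {X : Type*} [NormedAddCommGroup X] [MeasureSpace X]
    [BorelSpace X] [SecondCountableTopology X] [ProperSpace X] [SFinite (volume : Measure X)]
    [IsFiniteMeasureOnCompacts (volume : Measure X)]
    {F : X → E → ℂ} (hF : Continuous (fun q : X × E => F q.1 q.2)) {c : X} {c' : E} {R : ℝ}
    (hs : ∀ x v, F x v ≠ 0 → ‖x - c‖ ≤ R ∧ ‖v - c'‖ ≤ R) :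
    ∫ x, ∫ v, F x v = ∫ q : X × E, F q.1 q.2 := by
  have hc : HasCompactSupport (fun q : X × E => F q.1 q.2) :=
    HasCompactSupport.intro ((isCompact_closedBall c R).prod (isCompact_closedBall c' R))
      fun q hq => by
        by_contra h
        have := hs _ _ h
        exact hq ⟨by simpa [dist_eq_norm] using this.1, by simpa [dist_eq_norm] using this.2⟩
  exact (integral_prod (fun q : X × E => F q.1 q.2) (hF.integrable_of_hasCompactSupport hc)).symm

/-- The integral over `(w, ζ)` need not converge absolutely; only the inner integral over `w` decays
in `ζ`. The window makes the outer position compactly supported, so the `ζ` integral may be moved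
outside by `integral_swap_osc`. -/
lemma stft_ampOp {p : E → E → E → ℂ} (hp : IsAmp p) {f : E → ℂ} (hf : IsBT f)
    {θ : E → ℂ} (hθ : Continuous θ) {r : ℝ} (hθr : ∀ w, θ w ≠ 0 → ‖w‖ ≤ r) (τ ξ : E) :
    Integrable (fun ζ : E => ∫ x : E × E, (Real.fourierChar (-(inner ℝ x.1 ξ)) : ℂ) *
      θ (x.1 - τ) * (Real.fourierChar (-(inner ℝ (x.2 - x.1) ζ)) • (p x.1 x.2 ζ * f x.2))) ∧
    stft θ (ampOp p f) τ ξ = ∫ ζ : E, ∫ x : E × E, (Real.fourierChar (-(inner ℝ x.1 ξ)) : ℂ) *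
      θ (x.1 - τ) * (Real.fourierChar (-(inner ℝ (x.2 - x.1) ζ)) • (p x.1 x.2 ζ * f x.2)) := by
  obtain ⟨R, hR⟩ := hp.supp
  obtain ⟨C, hC, hb⟩ := hp.inner_bound hf (n + 1)
  set c : E → ℂ := fun w' => (Real.fourierChar (-(inner ℝ w' ξ)) : ℂ) * θ (w' - τ) with hc
  have hcc : Continuous c := by
    have := Real.continuous_fourierChar
    rw [hc]; fun_prop
  have hcs : ∀ w', r < ‖w' - τ‖ → c w' = 0 := fun w' hw => by
    have : θ (w' - τ) = 0 := by
      by_contra h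
      exact absurd (hθr _ h) (not_le.2 hw)
    simp [hc, this]
  obtain ⟨C', hC', hcb⟩ := exists_bound_of_compactSupport hcc hcs
  have hpc : Continuous (fun q : (E × E) × E => p q.1.1 q.2 q.1.2) :=
    hp.smooth.continuous.comp (f := fun q : (E × E) × E => (q.1.1, q.2, q.1.2)) (by fun_prop)
  have hFc : Continuous (fun q : (E × E) × E => c q.1.1 *
      (Real.fourierChar (-(inner ℝ (q.2 - q.1.1) q.1.2)) • (p q.1.1 q.2 q.1.2 * f q.2))) := by
    have := Real.continuous_fourierChar
    have := hf.smooth.continuous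
    refine (by fun_prop : Continuous fun q : (E × E) × E => c q.1.1).mul
      (Continuous.smul (by fun_prop) (hpc.mul (by fun_prop)))
  have key := integral_swap_osc (X := E) (F := fun w' ζ w => c w' *
      (Real.fourierChar (-(inner ℝ (w - w') ζ)) • (p w' w ζ * f w))) hFc (C := C' * C) (R := r)
      (c := τ) (fun w' ζ => by
        rw [integral_const_mul, norm_mul, mul_assoc]
        exact mul_le_mul (hcb _) (hb _ _) (norm_nonneg _) hC') (fun w' ζ hw => by
        simp [hcs w' hw])
  have e1 : ∀ ζ, ∫ w', ∫ w, c w' *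
      (Real.fourierChar (-(inner ℝ (w - w') ζ)) • (p w' w ζ * f w)) =
      ∫ x : E × E, c x.1 * (Real.fourierChar (-(inner ℝ (x.2 - x.1) ζ)) • (p x.1 x.2 ζ * f x.2)) :=
    fun ζ => by
      refine integral_prod_of_compactSupport (c := τ) (c' := τ) (R := max r (R + r))
        (F := fun w' w => c w' * (Real.fourierChar (-(inner ℝ (w - w') ζ)) • (p w' w ζ * f w)))
        ?_ fun w' w h => ?_
      · exact hFc.comp (f := fun q : E × E => ((q.1, ζ), q.2)) (by fun_prop)
      · have h1 : ‖w' - τ‖ ≤ r := by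
          by_contra h0
          exact left_ne_zero_of_mul h (hcs w' (not_le.1 h0))
        have h2 : ‖w - w'‖ ≤ R := hR w' w ζ (by
          intro h0
          apply h
          simp [h0])
        refine ⟨h1.trans (le_max_left _ _), le_trans ?_ (le_max_right _ _)⟩
        calc ‖w - τ‖ = ‖(w - w') + (w' - τ)‖ := by congr 1; abel
          _ ≤ _ := (norm_add_le _ _).trans (add_le_add h2 h1)
  simp only [e1] at key
  refine ⟨key.1, ?_⟩
  rw [← key.2, stft, Real.fourier_eq]
  refine integral_congr_ae (Filter.Eventually.of_forall fun w' => ?_)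
  simp only [integral_const_mul]
  simp only [hc, ampOp, Circle.smul_def, smul_eq_mul]
  ring

/-- Two interchanges put both frequency integrals outside and all three positions inside. In this
order integration by parts in the positions yields decay in the frequency differences. Integrability
at each level is recorded so that two such formulas may be subtracted. -/
lemma stft_ampOp_ampOp {p q : E → E → E → ℂ} (hp : IsAmp p) (hq : IsAmp q) {φ : E → ℂ}
    (hφ : IsBT φ) {θ : E → ℂ} (hθ : Continuous θ) {r : ℝ} (hθr : ∀ w, θ w ≠ 0 → ‖w‖ ≤ r)
    (τ ξ : E) :
    (∀ ζ, Integrable (fun η : E => ∫ z, tripleKernel θ φ τ ξ ζ η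
      (fun z => p z.1.1 z.1.2 ζ * q z.1.2 z.2 η) z)) ∧
    Integrable (fun ζ : E => ∫ η : E, ∫ z, tripleKernel θ φ τ ξ ζ η
      (fun z => p z.1.1 z.1.2 ζ * q z.1.2 z.2 η) z) ∧
    stft θ (ampOp p (ampOp q φ)) τ ξ = ∫ ζ : E, ∫ η : E, ∫ z, tripleKernel θ φ τ ξ ζ η
      (fun z => p z.1.1 z.1.2 ζ * q z.1.2 z.2 η) z := by
  obtain ⟨R, hR⟩ := hp.supp
  obtain ⟨R₁, hR₁⟩ := hq.supp
  obtain ⟨C, hC, hb⟩ := hq.inner_bound hφ (n + 1)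
  have hchar := Real.continuous_fourierChar
  have main : ∀ ζ, Integrable (fun η : E => ∫ z, tripleKernel θ φ τ ξ ζ η
      (fun z => p z.1.1 z.1.2 ζ * q z.1.2 z.2 η) z) ∧
      ∫ x : E × E, (Real.fourierChar (-(inner ℝ x.1 ξ)) : ℂ) *
      θ (x.1 - τ) * (Real.fourierChar (-(inner ℝ (x.2 - x.1) ζ)) • (p x.1 x.2 ζ * ampOp q φ x.2)) =
      ∫ η : E, ∫ z, tripleKernel θ φ τ ξ ζ η (fun z => p z.1.1 z.1.2 ζ * q z.1.2 z.2 η) z := by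
    intro ζ
    set d : E × E → ℂ := fun x => (Real.fourierChar (-(inner ℝ x.1 ξ)) : ℂ) * θ (x.1 - τ) *
      ((Real.fourierChar (-(inner ℝ (x.2 - x.1) ζ)) : ℂ) * p x.1 x.2 ζ) with hd
    have hdc : Continuous d := by
      have h1 : Continuous (fun x : E × E => p x.1 x.2 ζ) :=
        hp.smooth.continuous.comp (f := fun x : E × E => (x.1, x.2, ζ)) (by fun_prop)
      refine Continuous.mul (by fun_prop) (Continuous.mul (by fun_prop) h1)
    have hds' : ∀ x, d x ≠ 0 → ‖x.1 - τ‖ ≤ r ∧ ‖x.2 - τ‖ ≤ R + r := fun x h => by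
      have h1 : ‖x.1 - τ‖ ≤ r := hθr _ (by intro h0; apply h; simp [hd, h0])
      have h2 : ‖x.2 - x.1‖ ≤ R := hR x.1 x.2 ζ (by intro h0; apply h; simp [hd, h0])
      refine ⟨h1, ?_⟩
      calc ‖x.2 - τ‖ = ‖(x.2 - x.1) + (x.1 - τ)‖ := by congr 1; abel
        _ ≤ _ := (norm_add_le _ _).trans (add_le_add h2 h1)
    have hds : ∀ x, max r (R + r) < ‖x - (τ, τ)‖ → d x = 0 := fun x hx => by
      by_contra h
      have := hds' x h
      rw [Prod.norm_def, lt_max_iff] at hx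
      simp only [Prod.fst_sub, Prod.snd_sub, max_lt_iff] at hx
      rcases hx with hx | hx <;> linarith [hx.1, hx.2]
    obtain ⟨C', hC', hdb⟩ := exists_bound_of_compactSupport hdc hds
    have hqc : Continuous (fun u : ((E × E) × E) × E => q u.1.1.2 u.2 u.1.2) :=
      hq.smooth.continuous.comp (f := fun u : ((E × E) × E) × E => (u.1.1.2, u.2, u.1.2))
        (by fun_prop)
    have hFc : Continuous (fun u : ((E × E) × E) × E => d u.1.1 *
        (Real.fourierChar (-(inner ℝ (u.2 - u.1.1.2) u.1.2)) • (q u.1.1.2 u.2 u.1.2 * φ u.2))) := by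
      have := hφ.smooth.continuous
      refine (by fun_prop : Continuous fun u : ((E × E) × E) × E => d u.1.1).mul
        (Continuous.smul (by fun_prop) (hqc.mul (by fun_prop)))
    have key := integral_swap_osc (X := E × E) (F := fun x η w => d x *
        (Real.fourierChar (-(inner ℝ (w - x.2) η)) • (q x.2 w η * φ w))) hFc (C := C' * C)
        (R := max r (R + r)) (c := (τ, τ)) (fun w' ζ => by
          rw [integral_const_mul, norm_mul, mul_assoc]
          exact mul_le_mul (hdb _) (hb _ _) (norm_nonneg _) hC') (fun w' ζ hw => by
          simp [hds w' hw])
    have e1 : ∀ η, ∫ x, ∫ w, d x *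
        (Real.fourierChar (-(inner ℝ (w - x.2) η)) • (q x.2 w η * φ w)) =
        ∫ z, tripleKernel θ φ τ ξ ζ η (fun z => p z.1.1 z.1.2 ζ * q z.1.2 z.2 η) z := fun η => by
      rw [integral_prod_of_compactSupport (c := (τ, τ)) (c' := τ)
        (R := max (max r (R + r)) (R₁ + (R + r)))
        (F := fun x w => d x * (Real.fourierChar (-(inner ℝ (w - x.2) η)) • (q x.2 w η * φ w)))
        (hFc.comp (f := fun u : (E × E) × E => ((u.1, η), u.2)) (by fun_prop)) fun x w h => ?_]
      · refine integral_congr_ae (Filter.Eventually.of_forall fun z => ?_)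
        have h1 : (Real.fourierChar
            (-(inner ℝ z.1.1 (ξ - ζ) + inner ℝ z.1.2 (ζ - η) + inner ℝ z.2 η)) : ℂ) =
            (Real.fourierChar (-(inner ℝ z.1.1 ξ)) : ℂ) *
            (Real.fourierChar (-(inner ℝ (z.1.2 - z.1.1) ζ)) : ℂ) *
            (Real.fourierChar (-(inner ℝ (z.2 - z.1.2) η)) : ℂ) := by
          rw [← Circle.coe_mul, ← Circle.coe_mul, ← AddChar.map_add_eq_mul,
            ← AddChar.map_add_eq_mul]
          congr 2
          simp only [inner_sub_left, inner_sub_right]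
          ring
        simp only [tripleKernel, hd, Circle.smul_def, smul_eq_mul, h1]
        ring
      · have h1 := hds' x (left_ne_zero_of_mul h)
        have h2 : ‖w - x.2‖ ≤ R₁ := hR₁ x.2 w η (by intro h0; apply h; simp [h0])
        refine ⟨?_, le_trans ?_ (le_max_right _ _)⟩
        · by_contra h0
          exact left_ne_zero_of_mul h (hds x ((le_max_left _ _).trans_lt (not_le.1 h0)))
        · calc ‖w - τ‖ = ‖(w - x.2) + (x.2 - τ)‖ := by congr 1; abel
            _ ≤ _ := (norm_add_le _ _).trans (add_le_add h2 h1.2)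
    simp only [e1] at key
    refine ⟨key.1, ?_⟩
    rw [← key.2]
    refine integral_congr_ae (Filter.Eventually.of_forall fun x => ?_)
    simp only [integral_const_mul]
    simp only [hd, ampOp, Circle.smul_def, smul_eq_mul]
    ring
  obtain ⟨h1, h2⟩ := stft_ampOp hp (hq.isBT_ampOp hφ) hθ hθr τ ξ
  simp only [fun ζ => (main ζ).2] at h1 h2
  exact ⟨fun ζ => (main ζ).1, h1, h2⟩

end Engine

end

noncomputable section


/-! ### Off-diagonal decay for a composition of two operators -/

section EngineBound

open MeasureTheory

variable {n : ℕ}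

local notation "E" => EuclideanSpace ℝ (Fin n)

lemma exists_schwartz_stft (θ φ : 𝓢(E, ℂ)) (τ : E) :
    ∃ h : 𝓢(E, ℂ), (∀ w, h w = θ (w - τ) * φ w) ∧ stft θ φ τ = (𝓕 h : 𝓢(E, ℂ)) := by
  refine ⟨SchwartzMap.smulLeftCLM ℂ (SchwartzMap.compSubConstCLM ℂ τ θ) φ, fun w => ?_, ?_⟩
  · rw [SchwartzMap.smulLeftCLM_apply_apply (SchwartzMap.hasTemperateGrowth _),
      SchwartzMap.compSubConstCLM_apply, smul_eq_mul]
  · have h : (fun w => θ (w - τ) * φ w) =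
        SchwartzMap.smulLeftCLM ℂ (SchwartzMap.compSubConstCLM ℂ τ θ) φ := funext fun w => by
      rw [SchwartzMap.smulLeftCLM_apply_apply (SchwartzMap.hasTemperateGrowth _),
        SchwartzMap.compSubConstCLM_apply, smul_eq_mul]
    funext ξ
    rw [SchwartzMap.fourier_coe, stft, h]

lemma integrable_stft (θ φ : 𝓢(E, ℂ)) (τ : E) : Integrable (stft θ φ τ) := by
  obtain ⟨h, -, h2⟩ := exists_schwartz_stft θ φ τ
  rw [h2]; exact (𝓕 h : 𝓢(E, ℂ)).integrable

/-- Fourier inversion: near `τ`, the function `φ` is a superposition of plane waves with amplitudes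
its windowed transform. -/
lemma mul_eq_integral_stft (θ φ : 𝓢(E, ℂ)) (τ w : E) :
    θ (w - τ) * φ w = ∫ μ : E, Real.fourierChar (inner ℝ μ w) • stft θ φ τ μ := by
  obtain ⟨h, h1, h2⟩ := exists_schwartz_stft θ φ τ
  have : h = 𝓕⁻ (𝓕 h) := (FourierTransform.fourierInv_fourier_eq h).symm
  rw [← h1, h2, this, SchwartzMap.fourierInv_coe, Real.fourierInv_eq, ← this]

/-- The pairing on `(E × E) × E`. -/
def triplePairing : ((E × E) × E) →L[ℝ] ((E × E) × E) →L[ℝ] ℝ :=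
  let A := ContinuousLinearMap.fst ℝ E E ∘L ContinuousLinearMap.fst ℝ (E × E) E
  let B := ContinuousLinearMap.snd ℝ E E ∘L ContinuousLinearMap.fst ℝ (E × E) E
  let D := ContinuousLinearMap.snd ℝ (E × E) E
  let I : E →L[ℝ] E →L[ℝ] ℝ := innerSL ℝ
  (((ContinuousLinearMap.compL ℝ ((E × E) × E) E ℝ).flip A).comp (I.comp A)) +
    (((ContinuousLinearMap.compL ℝ ((E × E) × E) E ℝ).flip B).comp (I.comp B)) +
    (((ContinuousLinearMap.compL ℝ ((E × E) × E) E ℝ).flip D).comp (I.comp D))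

lemma triplePairing_apply (v w : (E × E) × E) : triplePairing (n := n) v w =
    inner ℝ v.1.1 w.1.1 + inner ℝ v.1.2 w.1.2 + inner ℝ v.2 w.2 := rfl

lemma sq_norm_le_triplePairing (v : (E × E) × E) : ‖v‖ ^ 2 ≤ triplePairing (n := n) v v := by
  rw [triplePairing_apply, real_inner_self_eq_norm_sq, real_inner_self_eq_norm_sq,
    real_inner_self_eq_norm_sq, Prod.norm_def, Prod.norm_def]
  rcases max_choice (max ‖v.1.1‖ ‖v.1.2‖) ‖v.2‖ with h | h <;> rw [h]
  · rcases max_choice ‖v.1.1‖ ‖v.1.2‖ with h | h <;> rw [h] <;> nlinarith [sq_nonneg ‖v.1.1‖, sq_nonneg ‖v.1.2‖, sq_nonneg ‖v.2‖]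
  · nlinarith [sq_nonneg ‖v.1.1‖, sq_nonneg ‖v.1.2‖, sq_nonneg ‖v.2‖]

lemma SymCls.translate {α V G : Type*} [NormedAddCommGroup V] [NormedSpace ℝ V]
    [NormedAddCommGroup G] [NormedSpace ℝ G] {S : Set α} {p : α → V} {W : α → ℝ} {f : α → V → G}
    (h : SymCls S p W f) (c : α → V) :
    SymCls S (fun a => p a + c a) W (fun a y => f a (y - c a)) := by
  refine ⟨fun a ha => ?_, fun k => ?_⟩
  · have := h.smooth a ha
    refine ContDiffAt.comp (p a + c a) (g := f a) (f := fun y => y - c a) (by simpa using this) ?_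
    fun_prop
  · obtain ⟨C, hC, h'⟩ := h.bound k
    refine ⟨C, hC, fun a ha => ?_⟩
    rw [iteratedFDeriv_comp_sub, add_sub_cancel_right]
    exact h' a ha

lemma SchwartzMap.symCls {V G : Type*} [NormedAddCommGroup V] [NormedSpace ℝ V]
    [NormedAddCommGroup G] [NormedSpace ℝ G] (θ : 𝓢(V, G)) :
    SymCls Set.univ (fun v : V => v) (fun _ => 1) (fun _ => θ) :=
  SymCls.of_le (fun _ _ => θ.smooth'.contDiffAt) (fun _ _ => zero_le_one) fun k => by
    obtain ⟨C, hC⟩ := θ.decay' 0 k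
    exact ⟨C, fun v _ => by have := hC v; rwa [pow_zero, one_mul, ← mul_one C] at this⟩

/-- The joint decay in the three differences is distributed: `N₁ + k` powers move `M` from `ζ` to
`ξ` and leave `k` for `ξ - ζ`; `N₀ + k` cancel the growth in `ζ - η` and leave `k`; the remaining `3
N` give `N` powers for `ξ - μ`, because `1 + |ξ - μ|` is at most a product of three factors. -/
lemma weight_triple_le {M : E → ℝ} (hM : Moderate M) : ∃ C, 0 < C ∧ ∃ N₁ : ℕ, ∀ (k N₀ N : ℕ)
    (ξ ζ η μ : E), M ζ * (1 + ‖ζ - η‖) ^ N₀ *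
      ((1 + ‖(((ξ - ζ, ζ - η), η - μ) : (E × E) × E)‖) ^ (N₁ + k + (N₀ + k) + 3 * N))⁻¹ ≤
      C * M ξ * ((1 + ‖ξ - ζ‖) ^ k)⁻¹ * ((1 + ‖ζ - η‖) ^ k)⁻¹ * ((1 + ‖ξ - μ‖) ^ N)⁻¹ := by
  obtain ⟨C, N₁, hC, h⟩ := hM.bound
  refine ⟨C, hC, N₁, fun k N₀ N ξ ζ η μ => ?_⟩
  set T := ‖(((ξ - ζ, ζ - η), η - μ) : (E × E) × E)‖ with hT
  have ha : ‖ξ - ζ‖ ≤ T := (le_max_left _ _).trans (le_max_left _ _)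
  have hb : ‖ζ - η‖ ≤ T := (le_max_right _ _).trans (le_max_left _ _)
  have hc : ‖η - μ‖ ≤ T := le_max_right _ _
  have hm : M ζ ≤ C * M ξ * (1 + ‖ξ - ζ‖) ^ N₁ := by
    rw [← norm_neg (ξ - ζ), neg_sub]; exact h ζ ξ
  have hd : 1 + ‖ξ - μ‖ ≤ (1 + ‖ξ - ζ‖) * (1 + ‖ζ - η‖) * (1 + ‖η - μ‖) := by
    have h1 : ‖ξ - μ‖ ≤ ‖ξ - ζ‖ + ‖ζ - η‖ + ‖η - μ‖ := by
      calc ‖ξ - μ‖ = ‖(ξ - ζ) + (ζ - η) + (η - μ)‖ := by congr 1; abel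
        _ ≤ _ := norm_add₃_le
    have := norm_nonneg (ξ - ζ); have := norm_nonneg (ζ - η); have := norm_nonneg (η - μ)
    have : 0 ≤ ‖ξ - ζ‖ * ‖ζ - η‖ := by positivity
    have : 0 ≤ ‖ξ - ζ‖ * ‖η - μ‖ := by positivity
    have : 0 ≤ ‖ζ - η‖ * ‖η - μ‖ := by positivity
    have : 0 ≤ ‖ξ - ζ‖ * ‖ζ - η‖ * ‖η - μ‖ := by positivity
    nlinarith
  have hpow : (1 + ‖ξ - ζ‖) ^ (N₁ + k) * (1 + ‖ζ - η‖) ^ (N₀ + k) * (1 + ‖ξ - μ‖) ^ N ≤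
      (1 + T) ^ (N₁ + k + (N₀ + k) + 3 * N) := by
    calc _ ≤ (1 + T) ^ (N₁ + k) * (1 + T) ^ (N₀ + k) * ((1 + T) * (1 + T) * (1 + T)) ^ N := by
          gcongr
          exact hd.trans (by gcongr)
      _ = (1 + T) ^ (N₁ + k) * (1 + T) ^ (N₀ + k) * (1 + T) ^ (3 * N) := by
          rw [pow_mul (1 + T) 3 N]; congr 2; ring
      _ = _ := by rw [← pow_add, ← pow_add]
  have hMξ := hM.pos ξ
  calc _ ≤ (C * M ξ * (1 + ‖ξ - ζ‖) ^ N₁) * (1 + ‖ζ - η‖) ^ N₀ *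
        ((1 + ‖ξ - ζ‖) ^ (N₁ + k) * (1 + ‖ζ - η‖) ^ (N₀ + k) * (1 + ‖ξ - μ‖) ^ N)⁻¹ := by
        gcongr
    _ = _ := by
        have h1 : (1 + ‖ξ - ζ‖) ≠ 0 := by positivity
        have h2 : (1 + ‖ζ - η‖) ≠ 0 := by positivity
        rw [pow_add, pow_add, mul_inv, mul_inv, mul_inv, mul_inv]
        field_simp

variable [NeZero n]

/-- The window `θ'` equals `1` wherever the last position can lie, so it may be inserted and `θ' φ`
expanded into plane waves of frequency `μ`. What remains is the Fourier transform, at `(ξ - ζ, ζ -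
η, η - μ)`, of a smooth function supported in a ball of fixed radius with derivatives bounded by the
weight of `e`. -/
lemma norm_integral_tripleKernel_le {R : ℝ} {e : E → E → (E × E) × E → ℂ}
    (hsupp : ∀ ζ η z, e ζ η z ≠ 0 → ‖z.1.2 - z.1.1‖ ≤ R ∧ ‖z.2 - z.1.2‖ ≤ R)
    {M : E → ℝ} (hM : Moderate M) {N₀ : ℕ}
    (he : SymCls Set.univ (fun a : ((E × E) × E) × E × E => a.1)
      (fun a => M a.2.1 * (1 + ‖a.2.1 - a.2.2‖) ^ N₀) (fun a => e a.2.1 a.2.2))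
    (hes : ∀ ζ η, ContDiff ℝ ∞ (e ζ η))
    {θ θ' : 𝓢(E, ℂ)} {r : ℝ} (hr : 0 ≤ r) (hR : 0 ≤ R) (hθ : ∀ w, θ w ≠ 0 → ‖w‖ ≤ r)
    (hθ' : ∀ w, ‖w‖ ≤ r + 2 * R → θ' w = 1) (N : ℕ) :
    ∃ C : ℝ, 0 < C ∧ ∀ (φ : 𝓢(E, ℂ)) (τ ξ ζ η : E),
      ‖∫ z, tripleKernel θ φ τ ξ ζ η (e ζ η) z‖ ≤
        C * M ξ * ((1 + ‖ξ - ζ‖) ^ (n + 1))⁻¹ * ((1 + ‖ζ - η‖) ^ (n + 1))⁻¹ *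
          ∫ μ, ((1 + ‖ξ - μ‖) ^ N)⁻¹ * ‖stft θ' φ τ μ‖ := by
  obtain ⟨C₁, hC₁, N₁, hw⟩ := weight_triple_le hM
  set m := N₁ + (n + 1) + (N₀ + (n + 1)) + 3 * N with hm
  haveI : (volume : Measure ((E × E) × E)).IsAddHaarMeasure := by
    haveI : (volume : Measure (E × E)).IsAddHaarMeasure :=
      Measure.prod.instIsAddHaarMeasure (volume : Measure E) (volume : Measure E)
    exact Measure.prod.instIsAddHaarMeasure (volume : Measure (E × E)) (volume : Measure E)
  obtain ⟨C₂, hC₂, hdec⟩ := norm_fourierIntegral_le_of_ball (G := ℂ)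
    (volume : Measure ((E × E) × E)) (triplePairing (n := n)) sq_norm_le_triplePairing (r + 2 * R) m
  have hprod : SymCls Set.univ (fun a : (((E × E) × E) × E × E) × E => a.1.1)
      (fun a => 1 * (M a.1.2.1 * (1 + ‖a.1.2.1 - a.1.2.2‖) ^ N₀))
      (fun a z => θ (z.1.1 - a.2) * e a.1.2.1 a.1.2.2 z) := by
    refine SymCls.mul ?_ (he.reindex (fun a : (((E × E) × E) × E × E) × E => a.1))
    have h1 := (θ.symCls.reindex (fun a : (((E × E) × E) × E × E) × E => a.1.1.1.1 - a.2)).translate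
      (fun a => a.2)
    exact h1.comp_clm (ContinuousLinearMap.fst ℝ E E ∘L ContinuousLinearMap.fst ℝ (E × E) E)
      (fun a _ => by simp)
  obtain ⟨C₃, hC₃, hB⟩ := hprod.bound_le m
  refine ⟨C₂ * C₃ * C₁, by positivity, fun φ τ ξ ζ η => ?_⟩
  set A : (E × E) × E → ℂ := fun z => θ (z.1.1 - τ) * e ζ η z with hA
  have hAs : ContDiff ℝ ∞ A := by
    refine ContDiff.mul ?_ (hes ζ η)
    exact θ.smooth'.comp (by fun_prop : ContDiff ℝ ∞ fun z : (E × E) × E => z.1.1 - τ)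
  have hAsupp : ∀ z, A z ≠ 0 → ‖z.1.1 - τ‖ ≤ r ∧ ‖z.1.2 - τ‖ ≤ R + r ∧ ‖z.2 - τ‖ ≤ R + (R + r) :=
    fun z hz => by
      have h1 := hθ _ (left_ne_zero_of_mul hz)
      have h2 := hsupp _ _ _ (right_ne_zero_of_mul hz)
      have h3 : ‖z.1.2 - τ‖ ≤ R + r := by
        calc ‖z.1.2 - τ‖ = ‖(z.1.2 - z.1.1) + (z.1.1 - τ)‖ := by congr 1; abel
          _ ≤ _ := (norm_add_le _ _).trans (add_le_add h2.1 h1)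
      refine ⟨h1, h3, ?_⟩
      calc ‖z.2 - τ‖ = ‖(z.2 - z.1.2) + (z.1.2 - τ)‖ := by congr 1; abel
        _ ≤ _ := (norm_add_le _ _).trans (add_le_add h2.2 h3)
  have hAball : ∀ z, A z ≠ 0 → ‖z - ((τ, τ), τ)‖ ≤ r + 2 * R := fun z hz => by
    obtain ⟨h1, h2, h3⟩ := hAsupp z hz
    rw [Prod.norm_def, Prod.norm_def]
    exact max_le (max_le (by simpa using h1.trans (by linarith))
      (by simpa using h2.trans (by linarith))) (by simpa using h3.trans (by linarith))
  have hAc : HasCompactSupport A :=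
    HasCompactSupport.intro (isCompact_closedBall (((τ, τ), τ) : (E × E) × E) (r + 2 * R))
      fun z hz => by
        by_contra h
        exact hz (by simpa [dist_eq_norm] using hAball z h)
  have hAi : Integrable A := hAs.continuous.integrable_of_hasCompactSupport hAc
  have hSi := integrable_stft θ' φ τ
  have hchar := Real.continuous_fourierChar
  set P : (E × E) × E → ℝ := fun z =>
    inner ℝ z.1.1 (ξ - ζ) + inner ℝ z.1.2 (ζ - η) + inner ℝ z.2 η with hP
  have hPc : Continuous P := by rw [hP]; fun_prop
  have e1 : ∀ z, tripleKernel θ φ τ ξ ζ η (e ζ η) z =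
      ∫ μ : E, (Real.fourierChar (-(P z)) : ℂ) * A z *
        ((Real.fourierChar (inner ℝ μ z.2) : ℂ) * stft θ' φ τ μ) := fun z => by
    rw [integral_const_mul]
    have := mul_eq_integral_stft θ' φ τ z.2
    simp only [Circle.smul_def, smul_eq_mul] at this
    rw [← this, tripleKernel, Circle.smul_def, smul_eq_mul]
    by_cases hz : A z = 0
    · rw [show θ (z.1.1 - τ) * e ζ η z = 0 from hz, hz]; simp
    · rw [hθ' (z.2 - τ) ((hAsupp z hz).2.2.trans (by linarith))]
      simp only [hA]; ring
  have hint : Integrable (Function.uncurry fun (z : (E × E) × E) (μ : E) =>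
      (Real.fourierChar (-(P z)) : ℂ) * A z *
        ((Real.fourierChar (inner ℝ μ z.2) : ℂ) * stft θ' φ τ μ))
      ((volume : Measure ((E × E) × E)).prod (volume : Measure E)) := by
    obtain ⟨h, -, h2⟩ := exists_schwartz_stft θ' φ τ
    have hc : Continuous (stft θ' φ τ) := by rw [h2]; exact (𝓕 h : 𝓢(E, ℂ)).continuous
    have hAcont := hAs.continuous
    refine (hAi.norm.mul_prod hSi.norm).mono' ?_ (Filter.Eventually.of_forall fun q => ?_)
    · refine Continuous.aestronglyMeasurable ?_
      unfold Function.uncurry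
      fun_prop
    · simp only [Function.uncurry, norm_mul, Circle.norm_coe, one_mul, le_refl]
  have e2 : ∫ z, tripleKernel θ φ τ ξ ζ η (e ζ η) z = ∫ μ : E, stft θ' φ τ μ *
      ∫ z, Real.fourierChar (-(triplePairing (n := n) z ((ξ - ζ, ζ - η), η - μ))) • A z := by
    simp only [e1]
    rw [integral_integral_swap hint]
    refine integral_congr_ae (Filter.Eventually.of_forall fun μ => ?_)
    simp only
    rw [← integral_const_mul]
    refine integral_congr_ae (Filter.Eventually.of_forall fun z => ?_)
    have h1 : (Real.fourierChar (-(triplePairing (n := n) z ((ξ - ζ, ζ - η), η - μ))) : ℂ) =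
        (Real.fourierChar (-(P z)) : ℂ) * (Real.fourierChar (inner ℝ μ z.2) : ℂ) := by
      rw [← Circle.coe_mul, ← AddChar.map_add_eq_mul]
      congr 2
      simp only [triplePairing_apply, hP, inner_sub_right, real_inner_comm μ z.2]
      ring
    simp only [Circle.smul_def, smul_eq_mul, h1]
    ring
  have hMζ := hM.pos ζ
  have hMξ := hM.pos ξ
  have e3 : ∀ μ, ‖∫ z, Real.fourierChar (-(triplePairing (n := n) z ((ξ - ζ, ζ - η), η - μ))) • A z‖ ≤
      C₂ * C₃ * C₁ * M ξ * ((1 + ‖ξ - ζ‖) ^ (n + 1))⁻¹ * ((1 + ‖ζ - η‖) ^ (n + 1))⁻¹ *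
        ((1 + ‖ξ - μ‖) ^ N)⁻¹ := fun μ => by
    refine (hdec ((τ, τ), τ) A (C₃ * (1 * (M ζ * (1 + ‖ζ - η‖) ^ N₀))) hAs hAball
      (fun k hk z => hB k hk ((z, ζ, η), τ) trivial) ((ξ - ζ, ζ - η), η - μ)).trans ?_
    have := hw (n + 1) N₀ N ξ ζ η μ
    refine (le_of_eq (by ring)).trans ((mul_le_mul_of_nonneg_left this
      (by positivity : 0 ≤ C₂ * C₃)).trans (le_of_eq (by ring)))
  rw [e2, ← integral_const_mul]
  refine norm_integral_le_of_norm_le (Integrable.const_mul ?_ _)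
    (Filter.Eventually.of_forall fun μ => ?_)
  · refine hSi.norm.mono' ?_ (Filter.Eventually.of_forall fun μ => ?_)
    · obtain ⟨h, -, h2⟩ := exists_schwartz_stft θ' φ τ
      have hc : Continuous (stft θ' φ τ) := by rw [h2]; exact (𝓕 h : 𝓢(E, ℂ)).continuous
      refine Continuous.aestronglyMeasurable ?_
      exact (Continuous.inv₀ (by fun_prop) (fun μ => by positivity)).mul hc.norm
    · rw [norm_mul, norm_norm]
      refine mul_le_of_le_one_left (norm_nonneg _) ?_
      rw [Real.norm_of_nonneg (by positivity)]
      exact inv_le_one_of_one_le₀ (one_le_pow₀ (by linarith [norm_nonneg (ξ - μ)]))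
  · rw [norm_mul]
    exact (mul_le_mul_of_nonneg_left (e3 μ) (norm_nonneg _)).trans (le_of_eq (by ring))

end EngineBound

end

noncomputable section


/-! ### Weighted bounds for operators given by amplitudes -/

section EngineFinal

open MeasureTheory

open scoped ENNReal

variable {n : ℕ}

local notation "E" => EuclideanSpace ℝ (Fin n)

lemma exists_window (r : ℝ) (hr : 0 < r) : ∃ θ : 𝓢(E, ℂ), (∀ w, ‖w‖ ≤ r → θ w = 1) ∧
    ∀ w, θ w ≠ 0 → ‖w‖ ≤ 2 * r := by
  obtain ⟨b, hb1, hb2⟩ : ∃ b : ContDiffBump (0 : E), b.rIn = r ∧ b.rOut = 2 * r :=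
    ⟨⟨r, 2 * r, hr, by linarith⟩, rfl, rfl⟩
  have h1 : HasCompactSupport (fun w => ((b w : ℝ) : ℂ)) :=
    HasCompactSupport.comp_left (g := Complex.ofReal) b.hasCompactSupport Complex.ofReal_zero
  have h2 : ContDiff ℝ ∞ (fun w => ((b w : ℝ) : ℂ)) :=
    Complex.ofRealCLM.contDiff.comp (b.contDiff (n := ⊤))
  refine ⟨h1.toSchwartzMap h2, fun w hw => ?_, fun w hw => ?_⟩
  · have h3 : b w = 1 := b.one_of_mem_closedBall (by simpa [hb1] using hw)
    change ((b w : ℝ) : ℂ) = 1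
    rw [h3, Complex.ofReal_one]
  · by_contra h
    apply hw
    have h3 : b w = 0 := b.zero_of_le_dist (by simpa [hb2] using (not_le.1 h).le)
    change ((b w : ℝ) : ℂ) = 0
    rw [h3, Complex.ofReal_zero]

lemma lintegral_dirac_zero_prod {F : E × E → ℝ≥0∞} (hF : Measurable F) :
    ∫⁻ p, F p ∂((Measure.dirac (0 : E)).prod volume) = ∫⁻ μ, F (0, μ) := by
  rw [Measure.dirac_prod, lintegral_map hF (by fun_prop)]

variable [NeZero n]

lemma IsAmp.exists_radius {p : E → E → E → ℂ} (hp : IsAmp p) :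
    ∃ R, 0 ≤ R ∧ ∀ w' w ζ, p w' w ζ ≠ 0 → ‖w - w'‖ ≤ R := by
  obtain ⟨R, hR⟩ := hp.supp
  exact ⟨max R 0, le_max_right _ _, fun w' w ζ h => (hR w' w ζ h).trans (le_max_left _ _)⟩

lemma IsAmp.smooth_left {p : E → E → E → ℂ} (hp : IsAmp p) (ζ : E) :
    ContDiff ℝ ∞ (fun z : (E × E) × E => p z.1.1 z.1.2 ζ) :=
  hp.smooth.comp (f := fun z : (E × E) × E => (z.1.1, z.1.2, ζ)) (by fun_prop)

lemma IsAmp.smooth_right {p : E → E → E → ℂ} (hp : IsAmp p) (ζ : E) :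
    ContDiff ℝ ∞ (fun z : (E × E) × E => p z.1.2 z.2 ζ) :=
  hp.smooth.comp (f := fun z : (E × E) × E => (z.1.2, z.2, ζ)) (by fun_prop)

lemma tripleKernel_integrable {p q : E → E → E → ℂ} (hp : IsAmp p) (hq : IsAmp q)
    (θ φ : 𝓢(E, ℂ)) {r : ℝ} (hθr : ∀ w, θ w ≠ 0 → ‖w‖ ≤ r) (τ ξ ζ η : E) :
    Integrable (tripleKernel θ φ τ ξ ζ η (fun z => p z.1.1 z.1.2 ζ * q z.1.2 z.2 η)) := by
  obtain ⟨R, hR0, hR⟩ := hp.exists_radius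
  obtain ⟨R₁, hR₁0, hR₁⟩ := hq.exists_radius
  have h1 := (hp.smooth_left ζ).continuous
  have h2 := (hq.smooth_right η).continuous
  have := θ.continuous
  have := φ.continuous
  have := Real.continuous_fourierChar
  refine Continuous.integrable_of_hasCompactSupport ?_ ?_
  · unfold tripleKernel
    refine Continuous.smul (by fun_prop) (((by fun_prop : Continuous fun z : (E × E) × E =>
      θ (z.1.1 - τ)).mul (h1.mul h2)).mul (by fun_prop))
  · refine HasCompactSupport.intro (((isCompact_closedBall τ r).prod
      (isCompact_closedBall τ (R + r))).prod (isCompact_closedBall τ (R₁ + (R + r)))) fun z hz => ?_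
    by_contra h
    apply hz
    have a0 : θ (z.1.1 - τ) ≠ 0 := by intro h0; apply h; simp [tripleKernel, h0]
    have a1 : p z.1.1 z.1.2 ζ ≠ 0 := by intro h0; apply h; simp [tripleKernel, h0]
    have a2 : q z.1.2 z.2 η ≠ 0 := by intro h0; apply h; simp [tripleKernel, h0]
    have b0 := hθr _ a0
    have b1 : ‖z.1.2 - τ‖ ≤ R + r := by
      calc ‖z.1.2 - τ‖ = ‖(z.1.2 - z.1.1) + (z.1.1 - τ)‖ := by congr 1; abel
        _ ≤ _ := (norm_add_le _ _).trans (add_le_add (hR _ _ _ a1) b0)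
    have b2 : ‖z.2 - τ‖ ≤ R₁ + (R + r) := by
      calc ‖z.2 - τ‖ = ‖(z.2 - z.1.2) + (z.1.2 - τ)‖ := by congr 1; abel
        _ ≤ _ := (norm_add_le _ _).trans (add_le_add (hR₁ _ _ _ a2) b1)
    exact ⟨⟨by simpa [dist_eq_norm] using b0, by simpa [dist_eq_norm] using b1⟩,
      by simpa [dist_eq_norm] using b2⟩

lemma continuous_inv_one_add_pow (N : ℕ) : Continuous (fun μ : E => ((1 + ‖μ‖) ^ N)⁻¹) :=
  Continuous.inv₀ (by fun_prop) (fun μ => by positivity)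

lemma measurable_translate_left {g : E → E → ℝ≥0∞} (hg : Measurable (fun p : E × E => g p.1 p.2))
    (τ : E) : Measurable (fun p : E × E => g (τ + p.1) p.2) :=
  hg.comp ((measurable_const.add measurable_fst).prodMk measurable_snd)

lemma measurable_inv_pow_mul_stft (θ φ : 𝓢(E, ℂ)) (τ ξ : E) (N : ℕ) :
    Measurable (fun p : E × E => ENNReal.ofReal (((1 + ‖ξ - p.2‖) ^ N)⁻¹) *
      ‖stft θ φ (τ + p.1) p.2‖ₑ) := by
  have h0 : Continuous (fun p : E × E => ((1 + ‖ξ - p.2‖) ^ N)⁻¹) :=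
    Continuous.inv₀ (by fun_prop) (fun μ => by positivity)
  exact h0.measurable.ennreal_ofReal.mul
    (measurable_translate_left (g := fun x y => ‖stft θ φ x y‖ₑ) (measurable_stft θ φ) τ)

lemma integrable_inv_pow_mul_stft (θ φ : 𝓢(E, ℂ)) (τ ξ : E) (N : ℕ) :
    Integrable (fun μ : E => ((1 + ‖ξ - μ‖) ^ N)⁻¹ * ‖stft θ φ τ μ‖) := by
  have hs := integrable_stft θ φ τ
  have hi : Continuous (fun μ : E => ((1 + ‖ξ - μ‖) ^ N)⁻¹) :=
    (continuous_inv_one_add_pow N).comp (continuous_const.sub continuous_id)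
  refine hs.norm.mono' (hi.aestronglyMeasurable.mul hs.norm.aestronglyMeasurable)
    (Filter.Eventually.of_forall fun μ => ?_)
  rw [norm_mul, norm_norm]
  refine mul_le_of_le_one_left (norm_nonneg _) ?_
  rw [Real.norm_of_nonneg (by positivity)]
  exact inv_le_one_of_one_le₀ (one_le_pow₀ (by linarith [norm_nonneg (ξ - μ)]))

lemma ofReal_integral_inv_pow_mul_stft (θ φ : 𝓢(E, ℂ)) (τ ξ : E) (N : ℕ) :
    ENNReal.ofReal (∫ μ, ((1 + ‖ξ - μ‖) ^ N)⁻¹ * ‖stft θ φ τ μ‖) =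
      ∫⁻ p : E × E, ENNReal.ofReal (((1 + ‖ξ - p.2‖) ^ N)⁻¹) * ‖stft θ φ (τ + p.1) p.2‖ₑ
        ∂((Measure.dirac (0 : E)).prod volume) := by
  refine Eq.trans ?_ (lintegral_dirac_zero_prod (measurable_inv_pow_mul_stft θ φ τ ξ N)).symm
  rw [ofReal_integral_eq_lintegral_ofReal (integrable_inv_pow_mul_stft θ φ τ ξ N)
    (Filter.Eventually.of_forall fun μ => mul_nonneg (by positivity) (norm_nonneg _))]
  refine lintegral_congr fun μ => ?_
  rw [add_zero, ENNReal.ofReal_mul (by positivity), ofReal_norm]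

/-- Weighted `L²` bounds for a difference of compositions of operators given by amplitudes. -/
theorem wsq_ampOp_sub_le {p₁ q₁ p₂ q₂ : E → E → E → ℂ} (hp₁ : IsAmp p₁) (hq₁ : IsAmp q₁)
    (hp₂ : IsAmp p₂) (hq₂ : IsAmp q₂) {M M₂ : E → ℝ} (hM : Moderate M) (hM₂ : Moderate M₂) {N₀ : ℕ}
    (he : SymCls Set.univ (fun a : ((E × E) × E) × E × E => a.1)
      (fun a => M a.2.1 * (1 + ‖a.2.1 - a.2.2‖) ^ N₀)
      (fun a z => p₁ z.1.1 z.1.2 a.2.1 * q₁ z.1.2 z.2 a.2.2 -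
        p₂ z.1.1 z.1.2 a.2.1 * q₂ z.1.2 z.2 a.2.2)) :
    ∃ C : ℝ≥0∞, C ≠ ⊤ ∧ ∀ φ Ψ : 𝓢(E, ℂ), IsBT (φ : E → ℂ) →
      (∀ w, Ψ w = ampOp p₁ (ampOp q₁ φ) w - ampOp p₂ (ampOp q₂ φ) w) →
      wsq M₂ Ψ ≤ C * wsq (fun ξ => M₂ ξ * M ξ) φ := by
  obtain ⟨R₁, hR₁0, hR₁⟩ := hp₁.exists_radius
  obtain ⟨R₂, hR₂0, hR₂⟩ := hq₁.exists_radius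
  obtain ⟨R₃, hR₃0, hR₃⟩ := hp₂.exists_radius
  obtain ⟨R₄, hR₄0, hR₄⟩ := hq₂.exists_radius
  set R := R₁ + R₂ + R₃ + R₄ with hRdef
  have hR0 : 0 ≤ R := by positivity
  obtain ⟨θ, hθ1, hθ⟩ := exists_window (n := n) 1 one_pos
  -- The window `θ` is supported in the ball of radius `2`, and each of the two operators moves
  -- points by at most `R`.
  obtain ⟨θ', hθ', -⟩ := exists_window (n := n) (2 * 1 + 2 * R) (by positivity)
  have hθ0 : θ ≠ 0 := by
    intro h
    have := hθ1 0 (by simp)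
    simp [h] at this
  set e : E → E → (E × E) × E → ℂ := fun ζ η z => p₁ z.1.1 z.1.2 ζ * q₁ z.1.2 z.2 η -
    p₂ z.1.1 z.1.2 ζ * q₂ z.1.2 z.2 η with hedef
  have hesupp : ∀ ζ η z, e ζ η z ≠ 0 → ‖z.1.2 - z.1.1‖ ≤ R ∧ ‖z.2 - z.1.2‖ ≤ R := by
    intro ζ η z hz
    by_cases h1 : p₁ z.1.1 z.1.2 ζ * q₁ z.1.2 z.2 η = 0
    · have h2 : p₂ z.1.1 z.1.2 ζ * q₂ z.1.2 z.2 η ≠ 0 := by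
        intro h2; apply hz; simp [hedef, h1, h2]
      have a := hR₃ _ _ _ (left_ne_zero_of_mul h2)
      have b := hR₄ _ _ _ (right_ne_zero_of_mul h2)
      constructor <;> linarith
    · have a := hR₁ _ _ _ (left_ne_zero_of_mul h1)
      have b := hR₂ _ _ _ (right_ne_zero_of_mul h1)
      constructor <;> linarith
  have hes : ∀ ζ η, ContDiff ℝ ∞ (e ζ η) := fun ζ η =>
    ((hp₁.smooth_left ζ).mul (hq₁.smooth_right η)).sub
      ((hp₂.smooth_left ζ).mul (hq₂.smooth_right η))
  -- A Dirac mass suffices: near the diagonal no displacement between the windows is needed.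
  obtain ⟨N, hN⟩ := wsq_le_of_stft_le hθ0 θ' hM hM₂ (Measure.dirac (0 : E))
  obtain ⟨C, hC, hb⟩ := norm_integral_tripleKernel_le hesupp hM he hes (θ := θ) (θ' := θ')
    (r := 2 * 1) (by norm_num) hR0 hθ hθ' N
  set A : ℝ≥0∞ := ∫⁻ ζ : E, ENNReal.ofReal (((1 + ‖ζ‖) ^ (n + 1))⁻¹) with hA
  have hAt : A ≠ ⊤ := lintegral_one_add_norm_lt_top.ne
  obtain ⟨C', hC', hfin⟩ := hN (ENNReal.ofReal C * A * A)
    (ENNReal.mul_ne_top (ENNReal.mul_ne_top ENNReal.ofReal_ne_top hAt) hAt)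
  refine ⟨C', hC', fun φ Ψ hφ hΨ => hfin φ Ψ fun τ ξ => ?_⟩
  obtain ⟨a1, a2, a3⟩ := stft_ampOp_ampOp hp₁ hq₁ hφ θ.continuous hθ τ ξ
  obtain ⟨b1, b2, b3⟩ := stft_ampOp_ampOp hp₂ hq₂ hφ θ.continuous hθ τ ξ
  have i1 := (hp₁.isBT_ampOp (hq₁.isBT_ampOp hφ)).smooth.continuous
  have i2 := (hp₂.isBT_ampOp (hq₂.isBT_ampOp hφ)).smooth.continuous
  have hθc : HasCompactSupport θ := HasCompactSupport.intro (isCompact_closedBall (0 : E) 2)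
    fun w hw => by
      by_contra h
      exact hw (by simpa using hθ w h)
  have hci : ∀ f : E → ℂ, Continuous f → Integrable (fun w =>
      Real.fourierChar (-(inner ℝ w ξ)) • (θ (w - τ) * f w)) := fun f hf => by
    have := θ.continuous
    have := Real.continuous_fourierChar
    refine Continuous.integrable_of_hasCompactSupport (by fun_prop) ?_
    refine HasCompactSupport.intro (isCompact_closedBall τ 2) fun w hw => ?_
    have : θ (w - τ) = 0 := by
      by_contra h
      exact hw (by simpa [dist_eq_norm] using hθ _ h)
    simp [this]
  have e1 : stft θ Ψ τ ξ = stft θ (ampOp p₁ (ampOp q₁ φ)) τ ξ -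
      stft θ (ampOp p₂ (ampOp q₂ φ)) τ ξ := by
    simp only [stft, Real.fourier_eq]
    rw [← integral_sub (hci _ i1) (hci _ i2)]
    refine integral_congr_ae (Filter.Eventually.of_forall fun w => ?_)
    simp only [hΨ, Circle.smul_def, smul_eq_mul]
    ring
  have e2 : stft θ Ψ τ ξ = ∫ ζ, ∫ η, ∫ z, tripleKernel θ φ τ ξ ζ η (e ζ η) z := by
    rw [e1, a3, b3, ← integral_sub a2 b2]
    refine integral_congr_ae (Filter.Eventually.of_forall fun ζ => ?_)
    simp only
    rw [← integral_sub (a1 ζ) (b1 ζ)]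
    refine integral_congr_ae (Filter.Eventually.of_forall fun η => ?_)
    simp only
    rw [← integral_sub (tripleKernel_integrable hp₁ hq₁ θ φ hθ τ ξ ζ η)
      (tripleKernel_integrable hp₂ hq₂ θ φ hθ τ ξ ζ η)]
    refine integral_congr_ae (Filter.Eventually.of_forall fun z => ?_)
    simp only [tripleKernel, hedef, Circle.smul_def, smul_eq_mul]
    ring
  rw [e2, ← ofReal_integral_inv_pow_mul_stft]
  set D := ∫ μ, ((1 + ‖ξ - μ‖) ^ N)⁻¹ * ‖stft θ' φ τ μ‖ with hD
  have hD0 : 0 ≤ D := integral_nonneg fun μ => by positivity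
  have hMξ := hM.pos ξ
  have hJ : ∀ ζ η, ‖∫ z, tripleKernel θ φ τ ξ ζ η (e ζ η) z‖ₑ ≤
      (ENNReal.ofReal C * ENNReal.ofReal (M ξ) * ENNReal.ofReal D) *
      (ENNReal.ofReal (((1 + ‖ξ - ζ‖) ^ (n + 1))⁻¹) *
      ENNReal.ofReal (((1 + ‖ζ - η‖) ^ (n + 1))⁻¹)) := fun ζ η => by
    rw [← ofReal_norm, ← ENNReal.ofReal_mul (by positivity), ← ENNReal.ofReal_mul (by positivity),
      ← ENNReal.ofReal_mul (by positivity), ← ENNReal.ofReal_mul (by positivity)]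
    exact ENNReal.ofReal_le_ofReal ((hb φ τ ξ ζ η).trans (le_of_eq (by ring)))
  have hm : Measurable (fun ζ : E => ENNReal.ofReal (((1 + ‖ζ‖) ^ (n + 1))⁻¹)) :=
    (Continuous.measurable (Continuous.inv₀ (by fun_prop)
      fun ζ => by positivity)).ennreal_ofReal
  have t1 : ∀ ζ : E, ∫⁻ η : E, ENNReal.ofReal (((1 + ‖ζ - η‖) ^ (n + 1))⁻¹) = A := fun ζ =>
    lintegral_sub_left_eq_self (fun x : E => ENNReal.ofReal (((1 + ‖x‖) ^ (n + 1))⁻¹)) ζ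
  calc _ ≤ ∫⁻ ζ, ∫⁻ η, ‖∫ z, tripleKernel θ φ τ ξ ζ η (e ζ η) z‖ₑ :=
        (enorm_integral_le_lintegral_enorm _).trans
          (lintegral_mono fun ζ => enorm_integral_le_lintegral_enorm _)
    _ ≤ ∫⁻ ζ, ∫⁻ η, (ENNReal.ofReal C * ENNReal.ofReal (M ξ) * ENNReal.ofReal D) *
      (ENNReal.ofReal (((1 + ‖ξ - ζ‖) ^ (n + 1))⁻¹) *
      ENNReal.ofReal (((1 + ‖ζ - η‖) ^ (n + 1))⁻¹)) :=
        lintegral_mono fun ζ => lintegral_mono fun η => hJ ζ η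
    _ = (ENNReal.ofReal C * ENNReal.ofReal (M ξ) * ENNReal.ofReal D) * (A * A) := by
        have s1 : ∀ ζ : E, ∫⁻ η : E, (ENNReal.ofReal C * ENNReal.ofReal (M ξ) *
            ENNReal.ofReal D) * (ENNReal.ofReal (((1 + ‖ξ - ζ‖) ^ (n + 1))⁻¹) *
            ENNReal.ofReal (((1 + ‖ζ - η‖) ^ (n + 1))⁻¹)) = (ENNReal.ofReal C *
            ENNReal.ofReal (M ξ) * ENNReal.ofReal D) *
            (ENNReal.ofReal (((1 + ‖ξ - ζ‖) ^ (n + 1))⁻¹) * A) := fun ζ => by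
          have hm2 : Measurable (fun η : E => ENNReal.ofReal (((1 + ‖ζ - η‖) ^ (n + 1))⁻¹)) :=
            hm.comp (measurable_const.sub measurable_id)
          rw [lintegral_const_mul _ (hm2.const_mul _), lintegral_const_mul _ hm2, t1]
        simp only [s1]
        have hm3 : Measurable (fun ζ : E => ENNReal.ofReal (((1 + ‖ξ - ζ‖) ^ (n + 1))⁻¹)) :=
          hm.comp (measurable_const.sub measurable_id)
        rw [lintegral_const_mul _ (hm3.mul_const _), lintegral_mul_const _ hm3, t1]
    _ = _ := by ring

end EngineFinal

end

noncomputable section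


/-! ### Integral operators with smooth, superexponentially decaying kernels -/

section Residual

open MeasureTheory

variable {n : ℕ} [NeZero n]

local notation "E" => EuclideanSpace ℝ (Fin n)

lemma norm_le_of_abs_le {R : ℝ} {w : E} (hw : ∀ i, i ≠ 0 → |w i| ≤ R) :
    ‖w‖ ≤ n * (|w 0| + |R|) := by
  have h : ∀ i, ‖w i‖ ≤ |w 0| + |R| := fun i => by
    rw [Real.norm_eq_abs]
    by_cases hi : i = 0
    · rw [hi]; linarith [abs_nonneg R]
    · linarith [hw i hi, le_abs_self R, abs_nonneg (w 0)]
  have h0 : 0 ≤ |w 0| + |R| := by positivity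
  have h1 : ‖w‖ ≤ ∑ i : Fin n, ‖w i‖ := by
    rw [EuclideanSpace.norm_eq]
    refine Real.sqrt_le_iff.2 ⟨Finset.sum_nonneg fun _ _ => norm_nonneg _, ?_⟩
    exact Finset.sum_sq_le_sq_sum_of_nonneg fun i _ => norm_nonneg _
  refine h1.trans ((Finset.sum_le_card_nsmul _ _ _ fun i _ => h i).trans ?_)
  simp [mul_add]

/-- In a `logBox` only `t → ∞` is an unbounded direction, so powers of the norm are controlled by
`e^t`. Exponential decay in `t` is therefore Schwartz decay. -/
lemma exists_pow_le_exp_of_mem_logBox (R : ℝ) (k : ℕ) :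
    ∃ C, 0 < C ∧ ∀ w ∈ logBox n R, (1 + ‖w‖) ^ k ≤ C * Real.exp (w 0) := by
  set B : ℝ := 1 + n * (2 * |R| + |R|) with hB
  have hn : (0 : ℝ) ≤ n := Nat.cast_nonneg n
  have hB0 : 0 < B := by positivity
  refine ⟨(B + n) ^ k * (k.factorial * Real.exp |R| * Real.exp 1), by positivity, fun w hw => ?_⟩
  set s := w 0 + |R| with hs
  have hs0 : 0 ≤ s := by linarith [hw.1, le_abs_self R]
  have h1 : 1 + ‖w‖ ≤ (B + n) * (1 + s) := by
    have h2 := norm_le_of_abs_le hw.2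
    have h3 : |w 0| ≤ s + |R| := by
      rw [abs_le]; constructor <;> linarith [abs_nonneg R]
    have h4 : ‖w‖ ≤ n * (s + 2 * |R|) := h2.trans (mul_le_mul_of_nonneg_left (by linarith) hn)
    have h5 : 0 ≤ n * |R| := by positivity
    have h6 : 0 ≤ B * s := by positivity
    have h7 : 0 ≤ n * s := by positivity
    nlinarith
  have h2 : (1 + s) ^ k ≤ k.factorial * Real.exp (1 + s) := by
    have := Real.pow_div_factorial_le_exp (1 + s) (by linarith) k
    rw [div_le_iff₀ (by positivity)] at this
    linarith
  calc (1 + ‖w‖) ^ k ≤ ((B + n) * (1 + s)) ^ k := by gcongr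
    _ = (B + n) ^ k * (1 + s) ^ k := mul_pow _ _ _
    _ ≤ (B + n) ^ k * (k.factorial * Real.exp (1 + s)) := by gcongr
    _ = _ := by rw [hs, Real.exp_add, Real.exp_add]; ring

lemma IsBT.iteratedFDeriv_eq_zero {G : Type*} [NormedAddCommGroup G] [NormedSpace ℝ G] {g : E → G}
    {R : ℝ} (hR : ∀ w, g w ≠ 0 → w ∈ logBox n R) (k : ℕ) {w : E} (hw : w ∉ logBox n R) :
    iteratedFDeriv ℝ k g w = 0 := by
  by_contra h
  exact hw (closure_minimal (fun v hv => hR v hv) (isClosed_logBox R)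
    (support_iteratedFDeriv_subset k h))

/-- A test function as a Schwartz function. -/
lemma IsBT.exists_schwartz {g : E → ℂ} (hg : IsBT g) : ∃ Φ : 𝓢(E, ℂ), ∀ w, Φ w = g w := by
  obtain ⟨R, hR⟩ := hg.supp
  refine ⟨⟨g, hg.smooth, fun k m => ?_⟩, fun w => rfl⟩
  obtain ⟨C, hC⟩ := hg.bound m 1
  obtain ⟨C', hC', h⟩ := exists_pow_le_exp_of_mem_logBox (n := n) R k
  refine ⟨C' * C, fun w => ?_⟩
  have hC0 : 0 ≤ C := nonneg_of_mul_nonneg_left ((norm_nonneg _).trans (hC 0)) (Real.exp_pos _)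
  by_cases hw : w ∈ logBox n R
  · calc ‖w‖ ^ k * ‖iteratedFDeriv ℝ m g w‖
        ≤ (C' * Real.exp (w 0)) * (C * Real.exp (-((1 : ℕ) * w 0))) := by
          gcongr
          · exact (pow_le_pow_left₀ (norm_nonneg _) (by linarith) k).trans (h w hw)
          · exact hC w
      _ = C' * C * (Real.exp (w 0) * Real.exp (-(w 0))) := by
          rw [Nat.cast_one, one_mul]; ring
      _ = _ := by rw [← Real.exp_add]; simp
  · rw [IsBT.iteratedFDeriv_eq_zero hR m hw]
    simp only [norm_zero, mul_zero]; positivity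

/-- Integrands `F w' w` of absolutely convergent integrals. -/
structure IsRes {G : Type*} [NormedAddCommGroup G] [NormedSpace ℝ G]
    (F : EuclideanSpace ℝ (Fin n) → EuclideanSpace ℝ (Fin n) → G) : Prop where
  smooth : ContDiff ℝ ∞ (fun q : EuclideanSpace ℝ (Fin n) × EuclideanSpace ℝ (Fin n) => F q.1 q.2)
  supp : ∃ R, ∀ w' w, F w' w ≠ 0 → w' ∈ logBox n R
  bound : ∀ k N : ℕ, ∃ C, ∀ w' w,
    ‖iteratedFDeriv ℝ k (fun q : EuclideanSpace ℝ (Fin n) × EuclideanSpace ℝ (Fin n) => F q.1 q.2)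
      (w', w)‖ ≤ C * Real.exp (-(N * w' 0)) * ((1 + ‖w‖) ^ (n + 1))⁻¹

namespace IsRes

variable {G : Type*} [NormedAddCommGroup G] [NormedSpace ℝ G]

lemma hasFDerivAt_left {F : E → E → G} (h : IsRes F) (w' w : E) :
    HasFDerivAt (fun w' => F w' w) (((fderiv ℝ (fun q : E × E => F q.1 q.2) (w', w))).comp
      (ContinuousLinearMap.inl ℝ E E)) w' := by
  have h1 := (h.smooth.differentiable (by simp) (w', w)).hasFDerivAt
  exact HasFDerivAt.comp (f := fun w' => (w', w)) w' h1 (hasFDerivAt_prodMk_left w' w)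

lemma fderiv_left {F : E → E → G} (h : IsRes F) :
    IsRes (fun w' w => fderiv ℝ (fun w' => F w' w) w') := by
  obtain ⟨R, hR⟩ := h.supp
  set L : (E × E →L[ℝ] G) →L[ℝ] (E →L[ℝ] G) :=
    (ContinuousLinearMap.compL ℝ E (E × E) G).flip (ContinuousLinearMap.inl ℝ E E)
  have e : (fun q : E × E => fderiv ℝ (fun w => F w q.2) q.1) =
      fun q => L (fderiv ℝ (fun q : E × E => F q.1 q.2) q) := by
    funext q
    rw [(h.hasFDerivAt_left q.1 q.2).fderiv]; rfl
  refine ⟨?_, ⟨R, ?_⟩, fun k N => ?_⟩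
  · rw [e]
    exact L.contDiff.comp (h.smooth.fderiv_right (m := ∞) (by simp))
  · intro w v hne
    by_contra hc
    apply hne
    have : (fun w => F w v) =ᶠ[𝓝 w] fun _ => 0 := by
      filter_upwards [(isClosed_logBox R).isOpen_compl.mem_nhds hc] with w' hw'
      by_contra h0
      exact hw' (hR w' v h0)
    rw [this.fderiv_eq]; simp
  · obtain ⟨C, hC⟩ := h.bound (k + 1) N
    refine ⟨‖L‖ * C, fun w v => ?_⟩
    rw [e]
    refine (L.norm_iteratedFDeriv_comp_left (N := ∞) (f := fderiv ℝ (fun q : E × E =>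
      F q.1 q.2)) (h.smooth.fderiv_right (m := ∞) (by simp)).contDiffAt
      (by exact_mod_cast le_top)).trans ?_
    rw [norm_iteratedFDeriv_fderiv, mul_assoc, mul_assoc]
    exact mul_le_mul_of_nonneg_left ((hC w v).trans (le_of_eq (by ring))) (norm_nonneg _)

lemma norm_le {F : E → E → G} (h : IsRes F) (N : ℕ) : ∃ C, ∀ w' w,
    ‖F w' w‖ ≤ C * Real.exp (-(N * w' 0)) * ((1 + ‖w‖) ^ (n + 1))⁻¹ := by
  obtain ⟨C, hC⟩ := h.bound 0 N
  exact ⟨C, fun w' w => by simpa using hC w' w⟩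

lemma continuous_right {F : E → E → G} (h : IsRes F) (w' : E) : Continuous (F w') :=
  h.smooth.continuous.comp (continuous_const.prodMk continuous_id)

lemma norm_integral_le {F : E → E → G} (h : IsRes F) (N : ℕ) :
    ∃ C, ∀ w, ‖∫ v, F w v‖ ≤ C * Real.exp (-(N * w 0)) := by
  obtain ⟨C, hb⟩ := h.norm_le N
  refine ⟨C * ∫ ζ : E, ((1 + ‖ζ‖) ^ (n + 1))⁻¹, fun w => ?_⟩
  refine (norm_integral_le_of_norm_le
    (g := fun ζ => C * Real.exp (-(N * w 0)) * ((1 + ‖ζ‖) ^ (n + 1))⁻¹)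
    ((integrable_inv_pow (n := n)).const_mul _)
    (Filter.Eventually.of_forall fun ζ => hb w ζ)).trans ?_
  rw [integral_const_mul]
  exact le_of_eq (by ring)

lemma hasFDerivAt_integral [CompleteSpace G] {F : E → E → G} (h : IsRes F) (w : E) :
    HasFDerivAt (fun w => ∫ v : E, F w v) (∫ v : E, fderiv ℝ (fun w => F w v) w) w := by
  obtain ⟨C, hC⟩ := h.fderiv_left.norm_le 0
  obtain ⟨C', hC'⟩ := h.norm_le 0
  refine hasFDerivAt_integral_of_dominated_of_fderiv_le (𝕜 := ℝ) (s := Set.univ)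
    (F' := fun w v => fderiv ℝ (fun w => F w v) w)
    (bound := fun v => C * ((1 + ‖v‖) ^ (n + 1))⁻¹)
    Filter.univ_mem
    (Filter.Eventually.of_forall fun w => (h.continuous_right w).aestronglyMeasurable) ?_
    (h.fderiv_left.continuous_right w).aestronglyMeasurable
    (Filter.Eventually.of_forall fun v w _ => by simpa using hC w v)
    ((integrable_inv_pow (n := n)).const_mul C) (Filter.Eventually.of_forall fun v w _ => ?_)
  · exact ((integrable_inv_pow (n := n)).const_mul C').mono'
      (h.continuous_right w).aestronglyMeasurable
      (Filter.Eventually.of_forall fun ζ => by simpa using hC' w ζ)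
  · rw [(h.hasFDerivAt_left w v).fderiv]; exact h.hasFDerivAt_left w v

end IsRes

lemma contDiff_integral_of_isRes (k : ℕ) : ∀ {G : Type} [NormedAddCommGroup G] [NormedSpace ℝ G]
    [CompleteSpace G] {F : E → E → G}, IsRes F → ContDiff ℝ k (fun w => ∫ v, F w v) ∧
      ∀ N : ℕ, ∃ C, ∀ w, ‖iteratedFDeriv ℝ k (fun w => ∫ v, F w v) w‖ ≤
        C * Real.exp (-(N * w 0)) := by
  induction k with
  | zero =>
    intro G _ _ _ F h
    refine ⟨contDiff_zero.2 (continuous_iff_continuousAt.2 fun w =>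
      (h.hasFDerivAt_integral w).continuousAt), fun N => ?_⟩
    simpa using h.norm_integral_le N
  | succ k ih =>
    intro G _ _ _ F h
    have hd : fderiv ℝ (fun w => ∫ v, F w v) = fun w => ∫ v, fderiv ℝ (fun w => F w v) w :=
      funext fun w => (h.hasFDerivAt_integral w).fderiv
    obtain ⟨h1, h2⟩ := ih h.fderiv_left
    refine ⟨?_, fun N => ?_⟩
    · rw [Nat.cast_succ, contDiff_succ_iff_fderiv]
      refine ⟨fun w => (h.hasFDerivAt_integral w).differentiableAt, by simp, ?_⟩
      rw [hd]; exact h1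
    · obtain ⟨C, hC⟩ := h2 N
      refine ⟨C, fun w => ?_⟩
      rw [← norm_iteratedFDeriv_fderiv, hd]
      exact hC w

lemma IsRes.isBT {F : E → E → ℂ} (h : IsRes F) : IsBT (fun w => ∫ v, F w v) := by
  refine ⟨contDiff_infty.2 fun k => (contDiff_integral_of_isRes k h).1, ?_,
    fun k N => (contDiff_integral_of_isRes k h).2 N⟩
  obtain ⟨R, hR⟩ := h.supp
  refine ⟨R, fun w hw => ?_⟩
  by_contra hc
  apply hw
  have : ∀ v, F w v = 0 := fun v => by
    by_contra h0
    exact hc (hR w v h0)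
  simp [this]

/-- Smooth kernels `G w w'` decaying superexponentially in `t - t'`. -/
structure IsResKer (G : EuclideanSpace ℝ (Fin n) → EuclideanSpace ℝ (Fin n) → ℂ) : Prop where
  smooth : ContDiff ℝ ∞ (fun q : EuclideanSpace ℝ (Fin n) × EuclideanSpace ℝ (Fin n) => G q.1 q.2)
  supp : ∃ R, ∀ w w', G w w' ≠ 0 → w ∈ logBox n R ∧ w' ∈ logBox n R
  bound : ∀ N : ℕ, SymCls Set.univ (fun q : EuclideanSpace ℝ (Fin n) ×
    EuclideanSpace ℝ (Fin n) => q) (fun q => Real.exp (-(N * |q.1 0 - q.2 0|)))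
    (fun _ q => G q.1 q.2)

/-- Decay of the kernel in `|t - t'|` transfers the decay of `φ` in `t` to decay in `t'`. -/
lemma IsResKer.isRes {G : E → E → ℂ} (hG : IsResKer G) {φ : E → ℂ} (hφ : IsBT φ) :
    IsRes (fun w' w => G w w' * φ w) := by
  obtain ⟨R, hR⟩ := hG.supp
  obtain ⟨R₁, hR₁⟩ := hφ.supp
  have hs : ContDiff ℝ ∞ (fun q : E × E => G q.2 q.1 * φ q.2) :=
    (hG.smooth.comp (contDiff_snd.prodMk contDiff_fst)).mul (hφ.smooth.comp contDiff_snd)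
  refine ⟨hs, ⟨R, fun w' w h => (hR w w' (left_ne_zero_of_mul h)).2⟩, fun k N => ?_⟩
  set S : Set (E × E) := {q | q.2 ∈ logBox n R₁} with hS
  obtain ⟨C', hC', hexp⟩ := exists_pow_le_exp_of_mem_logBox (n := n) R₁ (n + 1)
  have c1 : SymCls S (fun q : E × E => q) (fun q => Real.exp (-(N * |q.2 0 - q.1 0|)))
      (fun _ q => G q.2 q.1) :=
    (((hG.bound N).reindex (fun q : E × E => (q.2, q.1))).comp_clm
      ((ContinuousLinearMap.snd ℝ E E).prod (ContinuousLinearMap.fst ℝ E E))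
      (q := fun q : E × E => q) (fun a _ => rfl)).mono_set (Set.subset_univ S)
  -- One exponential more than asked for: the spare factor `e^{-t}` makes the integral over `w`
  -- converge.
  have c2 : SymCls S (fun q : E × E => q) (fun q => Real.exp (-((N + 1 : ℕ) * q.2 0)))
      (fun _ q => φ q.2) :=
    (((hφ.symCls (N + 1)).reindex (fun q : E × E => q.2)).comp_clm (ContinuousLinearMap.snd ℝ E E)
      (q := fun q : E × E => q) (fun a _ => rfl)).mono_set (Set.subset_univ S)
  have c3 : SymCls S (fun q : E × E => q)
      (fun q => Real.exp (-(N * q.1 0)) * ((1 + ‖q.2‖) ^ (n + 1))⁻¹)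
      (fun _ q => G q.2 q.1 * φ q.2) := by
    refine (c1.mul c2).mono (c := C') (fun q hq => ?_) hC'
    have h1 : Real.exp (-(q.2 0)) ≤ C' * ((1 + ‖q.2‖) ^ (n + 1))⁻¹ := by
      rw [← div_eq_mul_inv, le_div_iff₀ (by positivity), Real.exp_neg, inv_mul_le_iff₀
        (Real.exp_pos _), mul_comm]
      exact hexp _ hq
    have h2 : -(N * |q.2 0 - q.1 0|) + -((N + 1 : ℕ) * q.2 0) ≤ -(N * q.1 0) + -(q.2 0) := by
      have h3 : q.1 0 - q.2 0 ≤ |q.2 0 - q.1 0| := by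
        rw [abs_sub_comm]; exact le_abs_self _
      have h4 : (N : ℝ) * (q.1 0 - q.2 0) ≤ N * |q.2 0 - q.1 0| := by gcongr
      push_cast
      linarith
    calc _ = Real.exp (-(N * |q.2 0 - q.1 0|) + -((N + 1 : ℕ) * q.2 0)) := (Real.exp_add _ _).symm
      _ ≤ Real.exp (-(N * q.1 0) + -(q.2 0)) := Real.exp_le_exp.2 h2
      _ = Real.exp (-(N * q.1 0)) * Real.exp (-(q.2 0)) := Real.exp_add _ _
      _ ≤ Real.exp (-(N * q.1 0)) * (C' * ((1 + ‖q.2‖) ^ (n + 1))⁻¹) := by gcongr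
      _ = _ := by ring
  have c4 : SymCls (Set.univ \ S) (fun q : E × E => q)
      (fun q => Real.exp (-(N * q.1 0)) * ((1 + ‖q.2‖) ^ (n + 1))⁻¹)
      (fun _ q => G q.2 q.1 * φ q.2) := by
    refine SymCls.zero (fun _ _ => by positivity) fun a ha => ?_
    have h2 : ∀ᶠ q : E × E in 𝓝 a, q.2 ∉ logBox n R₁ :=
      (continuous_snd.continuousAt (x := a)).eventually
        ((isClosed_logBox R₁).isOpen_compl.mem_nhds ha.2)
    filter_upwards [h2] with q hq
    by_contra h0
    exact hq (hR₁ _ (right_ne_zero_of_mul h0))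
  obtain ⟨C, -, hC⟩ := (c3.union c4).bound k
  refine ⟨C, fun w' w => ?_⟩
  rw [mul_assoc]
  exact hC (w', w) (by by_cases h : (w', w) ∈ S <;> simp [h])

lemma IsResKer.isBT {G : E → E → ℂ} (hG : IsResKer G) {φ : E → ℂ} (hφ : IsBT φ) :
    IsBT (fun w' => ∫ w, G w w' * φ w) :=
  (hG.isRes hφ).isBT

end Residual

end

noncomputable section


/-! ### Localization of residual kernels in pairs of windows -/

section ResidualBound

open MeasureTheory

open scoped ENNReal

variable {n : ℕ} [NeZero n]

local notation "E" => EuclideanSpace ℝ (Fin n)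

/-- The pairing on `E × E`. -/
def pairPairing : (E × E) →L[ℝ] (E × E) →L[ℝ] ℝ :=
  let A := ContinuousLinearMap.fst ℝ E E
  let B := ContinuousLinearMap.snd ℝ E E
  let I : E →L[ℝ] E →L[ℝ] ℝ := innerSL ℝ
  (((ContinuousLinearMap.compL ℝ (E × E) E ℝ).flip A).comp (I.comp A)) +
    (((ContinuousLinearMap.compL ℝ (E × E) E ℝ).flip B).comp (I.comp B))

lemma pairPairing_apply (v w : E × E) : pairPairing (n := n) v w =
    inner ℝ v.1 w.1 + inner ℝ v.2 w.2 := rfl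

lemma sq_norm_le_pairPairing (v : E × E) : ‖v‖ ^ 2 ≤ pairPairing (n := n) v v := by
  rw [pairPairing_apply, real_inner_self_eq_norm_sq, real_inner_self_eq_norm_sq, Prod.norm_def]
  rcases max_choice ‖v.1‖ ‖v.2‖ with h | h <;> rw [h] <;>
    nlinarith [sq_nonneg ‖v.1‖, sq_nonneg ‖v.2‖]

/-- The localized residual kernel. -/
def locKer (θ : E → ℂ) (G : E → E → ℂ) (τ κ : E) (q : E × E) : ℂ :=
  θ (q.1 - τ) * (starRingEnd ℂ (θ (q.2 - (τ + κ))) * G q.2 q.1)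

/-- Since `y` is bounded on the support, the displacement `κ` of the two windows is controlled by
the difference of the `t` coordinates. Exponential decay in that difference thus beats all powers of
`κ`. -/
lemma exists_pow_le_exp_sub (R : ℝ) (k : ℕ) : ∃ C, 0 < C ∧ ∀ q : E × E, ∀ κ τ : E,
    q.1 ∈ logBox n R → q.2 ∈ logBox n R → ‖q.1 - τ‖ ≤ 3 → ‖q.2 - (τ + κ)‖ ≤ 3 →
      (1 + ‖κ‖) ^ k ≤ C * Real.exp |q.2 0 - q.1 0| := by
  set B : ℝ := 7 + n * |2 * R| + n with hB
  have hB0 : 0 < B := by positivity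
  refine ⟨B ^ k * (k.factorial * Real.exp 1), by positivity, fun q κ τ h1 h2 h3 h4 => ?_⟩
  set s := |q.2 0 - q.1 0| with hs
  have hs0 : 0 ≤ s := abs_nonneg _
  have hd : ‖q.2 - q.1‖ ≤ n * (s + |2 * R|) := by
    refine norm_le_of_abs_le (w := q.2 - q.1) fun i hi => ?_
    rw [PiLp.sub_apply]
    exact (abs_sub _ _).trans (by linarith [h1.2 i hi, h2.2 i hi])
  have hκ : ‖κ‖ ≤ 6 + n * (s + |2 * R|) := by
    calc ‖κ‖ = ‖(q.2 - q.1) + (q.1 - τ) - (q.2 - (τ + κ))‖ := by congr 1; abel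
      _ ≤ ‖q.2 - q.1‖ + ‖q.1 - τ‖ + ‖q.2 - (τ + κ)‖ :=
        (norm_sub_le _ _).trans (by gcongr; exact norm_add_le _ _)
      _ ≤ _ := by linarith
  have hn : (0 : ℝ) ≤ n := Nat.cast_nonneg n
  have h5 : 1 + ‖κ‖ ≤ B * (1 + s) := by
    have : 0 ≤ n * |2 * R| * s := by positivity
    rw [hB]; nlinarith
  have h6 : (1 + s) ^ k ≤ k.factorial * Real.exp (1 + s) := by
    have := Real.pow_div_factorial_le_exp (1 + s) (by linarith) k
    rw [div_le_iff₀ (by positivity)] at this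
    linarith
  calc (1 + ‖κ‖) ^ k ≤ (B * (1 + s)) ^ k := by gcongr
    _ = B ^ k * (1 + s) ^ k := mul_pow _ _ _
    _ ≤ B ^ k * (k.factorial * Real.exp (1 + s)) := by gcongr
    _ = _ := by rw [Real.exp_add]; ring

lemma symCls_locKer {θ : 𝓢(E, ℂ)} (hθ : ∀ w, θ w ≠ 0 → ‖w‖ ≤ 2) {G : E → E → ℂ}
    (hG : IsResKer G) (k : ℕ) :
    SymCls Set.univ (fun a : (E × E) × E × E => a.1) (fun a => ((1 + ‖a.2.2‖) ^ k)⁻¹)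
      (fun a q => locKer θ G a.2.1 a.2.2 q) := by
  obtain ⟨R, hR⟩ := hG.supp
  obtain ⟨C, hC, hexp⟩ := exists_pow_le_exp_sub (n := n) R k
  -- The windows have radius `2`; the radius `3` leaves room for the localized kernel to vanish near
  -- every point outside `S`.
  set S : Set ((E × E) × E × E) := {a | a.1.1 ∈ logBox n R ∧ a.1.2 ∈ logBox n R ∧
    ‖a.1.1 - a.2.1‖ < 3 ∧ ‖a.1.2 - (a.2.1 + a.2.2)‖ < 3} with hS
  have c1 : SymCls Set.univ (fun a : (E × E) × E × E => a.1) (fun _ => 1)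
      (fun a q => θ (q.1 - a.2.1)) :=
    ((θ.symCls.reindex (fun a : (E × E) × E × E => a.1.1 - a.2.1)).translate
      (fun a => a.2.1)).comp_clm (ContinuousLinearMap.fst ℝ E E) (fun a _ => by simp)
  have c2 : SymCls Set.univ (fun a : (E × E) × E × E => a.1) (fun _ => 1)
      (fun a q => starRingEnd ℂ (θ (q.2 - (a.2.1 + a.2.2)))) :=
    (((θ.symCls.reindex (fun a : (E × E) × E × E => a.1.2 - (a.2.1 + a.2.2))).translate
      (fun a => a.2.1 + a.2.2)).comp_clm (ContinuousLinearMap.snd ℝ E E)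
        (q := fun a : (E × E) × E × E => a.1) (fun a _ => by simp)).clm
        (Complex.conjCLE : ℂ →L[ℝ] ℂ)
  -- A single exponential is enough for any power of `κ`.
  have c3 : SymCls Set.univ (fun a : (E × E) × E × E => a.1)
      (fun a => Real.exp (-((1 : ℕ) * |a.1.2 0 - a.1.1 0|))) (fun _ q => G q.2 q.1) :=
    ((hG.bound 1).reindex (fun a : (E × E) × E × E => (a.1.2, a.1.1))).comp_clm
      ((ContinuousLinearMap.snd ℝ E E).prod (ContinuousLinearMap.fst ℝ E E))
      (q := fun a : (E × E) × E × E => a.1) (fun a _ => rfl)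
  have c4 : SymCls S (fun a : (E × E) × E × E => a.1) (fun a => ((1 + ‖a.2.2‖) ^ k)⁻¹)
      (fun a q => locKer θ G a.2.1 a.2.2 q) := by
    refine ((c1.mul (c2.mul c3)).mono_set (Set.subset_univ S)).mono (c := C) (fun a ha => ?_) hC
    rw [one_mul, one_mul, Nat.cast_one, one_mul, ← div_eq_mul_inv, le_div_iff₀ (by positivity),
      Real.exp_neg, inv_mul_le_iff₀ (Real.exp_pos _), mul_comm]
    exact hexp a.1 a.2.2 a.2.1 ha.1 ha.2.1 ha.2.2.1.le ha.2.2.2.le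
  have c5 : SymCls (Set.univ \ S) (fun a : (E × E) × E × E => a.1)
      (fun a => ((1 + ‖a.2.2‖) ^ k)⁻¹) (fun a q => locKer θ G a.2.1 a.2.2 q) := by
    refine SymCls.zero (fun _ _ => by positivity) fun a ha => ?_
    have hcl : IsClosed {q : E × E | q.1 ∈ logBox n R ∧ q.2 ∈ logBox n R ∧
        ‖q.1 - a.2.1‖ ≤ 2 ∧ ‖q.2 - (a.2.1 + a.2.2)‖ ≤ 2} :=
      ((isClosed_logBox R).preimage continuous_fst).inter
        (((isClosed_logBox R).preimage continuous_snd).inter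
        ((isClosed_le (f := fun q : E × E => ‖q.1 - a.2.1‖) (by fun_prop) continuous_const).inter
          (isClosed_le (f := fun q : E × E => ‖q.2 - (a.2.1 + a.2.2)‖) (by fun_prop)
            continuous_const)))
    have hn : a.1 ∉ {q : E × E | q.1 ∈ logBox n R ∧ q.2 ∈ logBox n R ∧
        ‖q.1 - a.2.1‖ ≤ 2 ∧ ‖q.2 - (a.2.1 + a.2.2)‖ ≤ 2} := fun h =>
      ha.2 ⟨h.1, h.2.1, h.2.2.1.trans_lt (by norm_num), h.2.2.2.trans_lt (by norm_num)⟩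
    filter_upwards [hcl.isOpen_compl.mem_nhds hn] with q hq
    by_contra h0
    have a1 : θ (q.1 - a.2.1) ≠ 0 := left_ne_zero_of_mul h0
    have a2 := right_ne_zero_of_mul h0
    have a3 : θ (q.2 - (a.2.1 + a.2.2)) ≠ 0 := fun h => left_ne_zero_of_mul a2 (by rw [h]; simp)
    have a4 := hR _ _ (right_ne_zero_of_mul a2)
    exact hq ⟨a4.2, a4.1, hθ _ a1, hθ _ a3⟩
  exact (c4.union c5).mono_set fun a _ => by by_cases h : a ∈ S <;> simp [h]

/-- A moderate weight is bounded below by an inverse power, so `N₁` powers of the joint decay in `ξ`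
and `η` produce the factor `M ξ`; the other `2 N` give decay in `ξ - η`. This is how a smoothing
kernel accommodates every weight. -/
lemma weight_pair_le {M : E → ℝ} (hM : Moderate M) : ∃ C, 0 < C ∧ ∃ N₁ : ℕ, ∀ (N : ℕ) (ξ η : E),
    ((1 + ‖((ξ, -η) : E × E)‖) ^ (N₁ + 2 * N))⁻¹ ≤ C * M ξ * ((1 + ‖ξ - η‖) ^ N)⁻¹ := by
  obtain ⟨C, N₁, hC, h⟩ := hM.bound
  have h0 := hM.pos 0
  refine ⟨C / M 0, by positivity, N₁, fun N ξ η => ?_⟩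
  have h1 := h 0 ξ
  rw [zero_sub, norm_neg] at h1
  set T := ‖((ξ, -η) : E × E)‖ with hT
  have hξ : ‖ξ‖ ≤ T := le_max_left _ _
  have hη : ‖η‖ ≤ T := by
    have : ‖-η‖ ≤ T := le_max_right _ _
    rwa [norm_neg] at this
  have hMξ := hM.pos ξ
  have h2 : 1 + ‖ξ - η‖ ≤ (1 + T) * (1 + T) := by
    have := norm_sub_le ξ η
    nlinarith [norm_nonneg ξ]
  rw [← div_eq_mul_inv, le_div_iff₀ (by positivity), inv_mul_le_iff₀ (by positivity)]
  calc (1 + ‖ξ - η‖) ^ N ≤ ((1 + T) * (1 + T)) ^ N * 1 := by rw [mul_one]; gcongr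
    _ ≤ ((1 + T) * (1 + T)) ^ N * (C / M 0 * M ξ * (1 + T) ^ N₁) := by
        gcongr
        rw [div_mul_eq_mul_div, div_mul_eq_mul_div, le_div_iff₀ h0, one_mul]
        exact h1.trans (by gcongr)
    _ = _ := by rw [pow_add, pow_mul, ← sq]; ring

/-- Expanding the localized `φ` into plane waves leaves the Fourier transform of the localized
kernel at `(ξ, -η)`. It decays in both frequencies, not merely in their difference, because the
kernel is smooth. -/
lemma norm_integral_locKer_le {θ : 𝓢(E, ℂ)} (hθ : ∀ w, θ w ≠ 0 → ‖w‖ ≤ 2) {G : E → E → ℂ}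
    (hG : IsResKer G) {M : E → ℝ} (hM : Moderate M) (N : ℕ) : ∃ C, 0 < C ∧
    ∀ (φ : 𝓢(E, ℂ)) (τ κ ξ : E), ‖∫ q : E × E, (Real.fourierChar (-(inner ℝ q.1 ξ)) : ℂ) *
      locKer θ G τ κ q * (θ (q.2 - (τ + κ)) * φ q.2)‖ ≤
      C * M ξ * ((1 + ‖κ‖) ^ (n + 1))⁻¹ *
        ∫ η, ((1 + ‖ξ - η‖) ^ N)⁻¹ * ‖stft θ φ (τ + κ) η‖ := by
  obtain ⟨C₁, hC₁, N₁, hw⟩ := weight_pair_le hM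
  set m := N₁ + 2 * N with hm
  haveI : (volume : Measure (E × E)).IsAddHaarMeasure :=
    Measure.prod.instIsAddHaarMeasure (volume : Measure E) (volume : Measure E)
  obtain ⟨C₂, hC₂, hdec⟩ := norm_fourierIntegral_le_of_ball (G := ℂ)
    (volume : Measure (E × E)) (pairPairing (n := n)) sq_norm_le_pairPairing 2 m
  have hsym := symCls_locKer hθ hG (n + 1)
  obtain ⟨C₃, hC₃, hB⟩ := hsym.bound_le m
  refine ⟨C₂ * C₃ * C₁, by positivity, fun φ τ κ ξ => ?_⟩
  set A : E × E → ℂ := locKer θ G τ κ with hA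
  have hAs : ContDiff ℝ ∞ A := contDiff_iff_contDiffAt.2 fun q =>
    hsym.smooth (q, τ, κ) trivial
  have hAball : ∀ z, A z ≠ 0 → ‖z - (τ, τ + κ)‖ ≤ 2 := fun z hz => by
    have a1 : θ (z.1 - τ) ≠ 0 := left_ne_zero_of_mul hz
    have a3 : θ (z.2 - (τ + κ)) ≠ 0 := fun h =>
      left_ne_zero_of_mul (right_ne_zero_of_mul hz) (by rw [h]; simp)
    exact max_le (hθ _ a1) (hθ _ a3)
  have hAc : HasCompactSupport A :=
    HasCompactSupport.intro (isCompact_closedBall ((τ, τ + κ) : E × E) 2)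
      fun z hz => by
        by_contra h
        exact hz (by simpa [dist_eq_norm] using hAball z h)
  have hAi : Integrable A := hAs.continuous.integrable_of_hasCompactSupport hAc
  have hSi := integrable_stft θ φ (τ + κ)
  have hchar := Real.continuous_fourierChar
  have e1 : ∀ q : E × E, (Real.fourierChar (-(inner ℝ q.1 ξ)) : ℂ) *
      A q * (θ (q.2 - (τ + κ)) * φ q.2) = ∫ η : E, (Real.fourierChar (-(inner ℝ q.1 ξ)) : ℂ) *
      A q * ((Real.fourierChar (inner ℝ η q.2) : ℂ) * stft θ φ (τ + κ) η) := fun q => by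
    rw [integral_const_mul]
    have := mul_eq_integral_stft θ φ (τ + κ) q.2
    simp only [Circle.smul_def, smul_eq_mul] at this
    rw [← this]
  have hint : Integrable (Function.uncurry fun (q : E × E) (η : E) =>
      (Real.fourierChar (-(inner ℝ q.1 ξ)) : ℂ) *
      A q * ((Real.fourierChar (inner ℝ η q.2) : ℂ) * stft θ φ (τ + κ) η))
      ((volume : Measure (E × E)).prod (volume : Measure E)) := by
    obtain ⟨h, -, h2⟩ := exists_schwartz_stft θ φ (τ + κ)
    have hc : Continuous (stft θ φ (τ + κ)) := by rw [h2]; exact (𝓕 h : 𝓢(E, ℂ)).continuous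
    have hAcont := hAs.continuous
    refine (hAi.norm.mul_prod hSi.norm).mono' ?_ (Filter.Eventually.of_forall fun q => ?_)
    · refine Continuous.aestronglyMeasurable ?_
      unfold Function.uncurry
      fun_prop
    · simp only [Function.uncurry, norm_mul, Circle.norm_coe, one_mul, le_refl]
  have e2 : ∫ q : E × E, (Real.fourierChar (-(inner ℝ q.1 ξ)) : ℂ) *
      A q * (θ (q.2 - (τ + κ)) * φ q.2) = ∫ η : E, stft θ φ (τ + κ) η *
      ∫ q, Real.fourierChar (-(pairPairing (n := n) q (ξ, -η))) • A q := by
    simp only [e1]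
    rw [integral_integral_swap hint]
    refine integral_congr_ae (Filter.Eventually.of_forall fun μ => ?_)
    simp only
    rw [← integral_const_mul]
    refine integral_congr_ae (Filter.Eventually.of_forall fun z => ?_)
    have h1 : (Real.fourierChar (-(pairPairing (n := n) z (ξ, -μ))) : ℂ) =
        (Real.fourierChar (-(inner ℝ z.1 ξ)) : ℂ) * (Real.fourierChar (inner ℝ μ z.2) : ℂ) := by
      rw [← Circle.coe_mul, ← AddChar.map_add_eq_mul]
      congr 2
      simp only [pairPairing_apply, inner_neg_right, real_inner_comm μ z.2]
      ring
    simp only [Circle.smul_def, smul_eq_mul, h1]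
    ring
  have hMξ := hM.pos ξ
  have e3 : ∀ η, ‖∫ q, Real.fourierChar (-(pairPairing (n := n) q (ξ, -η))) • A q‖ ≤
      C₂ * C₃ * C₁ * M ξ * ((1 + ‖κ‖) ^ (n + 1))⁻¹ * ((1 + ‖ξ - η‖) ^ N)⁻¹ := fun η => by
    refine (hdec (τ, τ + κ) A (C₃ * ((1 + ‖κ‖) ^ (n + 1))⁻¹) hAs hAball
      (fun k hk z => hB k hk (z, τ, κ) trivial) (ξ, -η)).trans ?_
    refine (le_of_eq (by ring)).trans ((mul_le_mul_of_nonneg_left (hw N ξ η)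
      (by positivity : 0 ≤ C₂ * C₃ * ((1 + ‖κ‖) ^ (n + 1))⁻¹)).trans (le_of_eq (by ring)))
  rw [e2, ← integral_const_mul]
  refine norm_integral_le_of_norm_le ((integrable_inv_pow_mul_stft θ φ (τ + κ) ξ N).const_mul _)
    (Filter.Eventually.of_forall fun μ => ?_)
  rw [norm_mul]
  exact (mul_le_mul_of_nonneg_left (e3 μ) (norm_nonneg _)).trans (le_of_eq (by ring))

end ResidualBound

end

noncomputable section


/-! ### Residual operators between arbitrary weights; multiplication operators -/

section ResidualFinal

open MeasureTheory

open scoped ENNReal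

variable {n : ℕ} [NeZero n]

local notation "E" => EuclideanSpace ℝ (Fin n)

lemma exists_bound_schwartz_pow (φ : 𝓢(E, ℂ)) (k : ℕ) :
    ∃ C, 0 ≤ C ∧ ∀ w, ‖φ w‖ ≤ C * ((1 + ‖w‖) ^ k)⁻¹ := by
  have h := φ.one_add_le_sup_seminorm_apply (𝕜 := ℂ) (m := (k, 0)) (k := k) (n := 0) le_rfl le_rfl
  refine ⟨_, (by positivity : 0 ≤ (2 : ℝ) ^ k *
    ((Finset.Iic (k, 0)).sup fun m => SchwartzMap.seminorm ℂ m.1 m.2) φ), fun w => ?_⟩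
  have := h w
  rw [norm_iteratedFDeriv_zero] at this
  rw [← div_eq_mul_inv, le_div_iff₀ (by positivity), mul_comm]
  exact this

lemma integral_normSq_window_ne_zero {θ : 𝓢(E, ℂ)} (hθ : θ 0 ≠ 0)
    (hθc : ∀ w, θ w ≠ 0 → ‖w‖ ≤ 2) :
    (∫ w, starRingEnd ℂ (θ w) * θ w) ≠ 0 := by
  have h1 : ∀ w, starRingEnd ℂ (θ w) * θ w = ((‖θ w‖ ^ 2 : ℝ) : ℂ) := fun w => by
    rw [Complex.conj_mul', Complex.ofReal_pow]
  simp only [h1]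
  rw [show ∫ w, ((‖θ w‖ ^ 2 : ℝ) : ℂ) = ((∫ w, ‖θ w‖ ^ 2 : ℝ) : ℂ) from integral_ofReal,
    Complex.ofReal_ne_zero]
  have hc : Continuous (fun w => ‖θ w‖ ^ 2) := by
    have := θ.continuous
    fun_prop
  refine (hc.integral_pos_of_hasCompactSupport_nonneg_nonzero ?_ (fun w => by positivity)
    (x := 0) (by simpa using hθ)).ne'
  refine HasCompactSupport.intro (isCompact_closedBall (0 : E) 2) fun w hw => ?_
  have : θ w = 0 := by
    by_contra h
    exact hw (by simpa using hθc w h)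
  simp [this]

lemma one_add_norm_le_of_sub {w τ κ : E} (h : ‖w - (τ + κ)‖ ≤ 2) :
    1 + ‖κ‖ ≤ (3 + ‖τ‖) * (1 + ‖w‖) := by
  have : ‖κ‖ ≤ ‖w - τ‖ + 2 := by
    calc ‖κ‖ = ‖(w - τ) - (w - (τ + κ))‖ := by congr 1; abel
      _ ≤ _ := (norm_sub_le _ _).trans (by gcongr)
  have h2 := norm_sub_le w τ
  nlinarith [norm_nonneg w, norm_nonneg τ, mul_nonneg (norm_nonneg τ) (norm_nonneg w)]

/-- The integrand of the windowed Fourier transform of a residual operator, with the second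
variable localized. -/
def locInt (θ : E → ℂ) (G : E → E → ℂ) (φ : E → ℂ) (τ ξ : E) (q : E × E) (κ : E) : ℂ :=
  (Real.fourierChar (-(inner ℝ q.1 ξ)) : ℂ) * locKer θ G τ κ q * (θ (q.2 - (τ + κ)) * φ q.2)

lemma integrable_locInt {θ : 𝓢(E, ℂ)} (hθ : ∀ w, θ w ≠ 0 → ‖w‖ ≤ 2) {G : E → E → ℂ}
    (hG : IsResKer G) (φ : 𝓢(E, ℂ)) (τ ξ : E) :
    Integrable (Function.uncurry (locInt θ G φ τ ξ))
      ((volume : Measure (E × E)).prod (volume : Measure E)) := by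
  -- Half of this decay is for the integral over `w`. The other half becomes decay in `κ`, because
  -- `w` lies within distance `2` of `τ + κ`.
  obtain ⟨C₁, hC₁, h₁⟩ := exists_bound_schwartz_pow φ (n + 1 + (n + 1))
  obtain ⟨C₂, hC₂, h₂⟩ := exists_bound_schwartz_pow θ 0
  obtain ⟨C₃, hC₃, h₃⟩ := (hG.bound 0).bound 0
  have hθi : Integrable (fun w' : E => ‖θ (w' - τ)‖) := (θ.integrable.comp_sub_right τ).norm
  set D : ℝ := C₂ * (C₃ * (C₂ * (C₁ * (3 + ‖τ‖) ^ (n + 1)))) with hD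
  have hi := (hθi.mul_prod (integrable_inv_pow (n := n))).mul_prod (integrable_inv_pow (n := n))
  refine (hi.const_mul D).mono' ?_ (Filter.Eventually.of_forall fun z => ?_)
  · refine Continuous.aestronglyMeasurable ?_
    have a1 := θ.continuous
    have a2 := φ.continuous
    have a3 := Real.continuous_fourierChar
    have a4 : Continuous (fun z : (E × E) × E => G z.1.2 z.1.1) :=
      hG.smooth.continuous.comp (f := fun z : (E × E) × E => (z.1.2, z.1.1)) (by fun_prop)
    have a5 : Continuous (fun z : (E × E) × E => starRingEnd ℂ (θ (z.1.2 - (τ + z.2)))) :=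
      Complex.continuous_conj.comp (by fun_prop)
    unfold Function.uncurry locInt locKer
    exact ((by fun_prop : Continuous fun z : (E × E) × E =>
      (Real.fourierChar (-(inner ℝ z.1.1 ξ)) : ℂ)).mul ((by fun_prop : Continuous
      fun z : (E × E) × E => θ (z.1.1 - τ)).mul (a5.mul a4))).mul (by fun_prop)
  · obtain ⟨⟨w', w⟩, κ⟩ := z
    have b1 : ∀ w, ‖θ w‖ ≤ C₂ := fun w => by simpa using h₂ w
    have b2 : ‖G w w'‖ ≤ C₃ := by simpa using h₃ (w, w') trivial
    simp only [Function.uncurry, locInt, locKer, norm_mul, Circle.norm_coe, one_mul,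
      RCLike.norm_conj]
    by_cases h0 : θ (w - (τ + κ)) = 0
    · simp only [h0, norm_zero, mul_zero, zero_mul]
      positivity
    have b3 : ‖φ w‖ ≤ C₁ * (3 + ‖τ‖) ^ (n + 1) *
        (((1 + ‖w‖) ^ (n + 1))⁻¹ * ((1 + ‖κ‖) ^ (n + 1))⁻¹) := by
      refine (h₁ w).trans ?_
      have h4 := one_add_norm_le_of_sub (hθ _ h0)
      have h5 : ((1 + ‖w‖) ^ (n + 1))⁻¹ ≤ (3 + ‖τ‖) ^ (n + 1) * ((1 + ‖κ‖) ^ (n + 1))⁻¹ := by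
        rw [← div_eq_mul_inv, le_div_iff₀ (by positivity), inv_mul_le_iff₀ (by positivity),
          ← mul_pow, mul_comm (1 + ‖w‖)]
        gcongr
      rw [pow_add, mul_inv]
      calc C₁ * (((1 + ‖w‖) ^ (n + 1))⁻¹ * ((1 + ‖w‖) ^ (n + 1))⁻¹)
          ≤ C₁ * (((1 + ‖w‖) ^ (n + 1))⁻¹ * ((3 + ‖τ‖) ^ (n + 1) * ((1 + ‖κ‖) ^ (n + 1))⁻¹)) := by
            gcongr
        _ = _ := by ring
    calc ‖θ (w' - τ)‖ * (‖θ (w - (τ + κ))‖ * ‖G w w'‖) * (‖θ (w - (τ + κ))‖ * ‖φ w‖)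
        ≤ ‖θ (w' - τ)‖ * (C₂ * C₃) * (C₂ * (C₁ * (3 + ‖τ‖) ^ (n + 1) *
        (((1 + ‖w‖) ^ (n + 1))⁻¹ * ((1 + ‖κ‖) ^ (n + 1))⁻¹))) := by
          gcongr
          · exact b1 _
          · exact b1 _
      _ = _ := by rw [hD]; ring

/-- The squares `|θ(w - τ - κ)|²` integrate in `κ` to a nonzero constant for every `w`; inserting
this continuous partition of unity localizes the input variable near `τ + κ`. -/
lemma stft_resOp {θ : 𝓢(E, ℂ)} (hθ : ∀ w, θ w ≠ 0 → ‖w‖ ≤ 2) (hθ0 : θ 0 ≠ 0) {G : E → E → ℂ}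
    (hG : IsResKer G) (φ Ψ : 𝓢(E, ℂ)) (hΨ : ∀ w', Ψ w' = ∫ w, G w w' * φ w) (τ ξ : E) :
    stft θ Ψ τ ξ = (∫ w, starRingEnd ℂ (θ w) * θ w)⁻¹ *
      ∫ κ, ∫ q, locInt θ G φ τ ξ q κ := by
  have hi := integrable_locInt hθ hG φ τ ξ
  have hc0 := integral_normSq_window_ne_zero hθ0 hθ
  set c : ℂ := ∫ w, starRingEnd ℂ (θ w) * θ w with hc
  have e1 : ∀ q : E × E, ∫ κ, locInt θ G φ τ ξ q κ =
      c * ((Real.fourierChar (-(inner ℝ q.1 ξ)) : ℂ) * (θ (q.1 - τ) * (G q.2 q.1 * φ q.2))) :=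
    fun q => by
      have h2 : ∀ κ, locInt θ G φ τ ξ q κ =
          ((Real.fourierChar (-(inner ℝ q.1 ξ)) : ℂ) * (θ (q.1 - τ) * (G q.2 q.1 * φ q.2))) *
          (starRingEnd ℂ (θ ((q.2 - τ) - κ)) * θ ((q.2 - τ) - κ)) := fun κ => by
        rw [sub_sub, locInt, locKer]; ring
      simp only [h2]
      rw [integral_const_mul,
        integral_sub_left_eq_self (fun x => starRingEnd ℂ (θ x) * θ x) volume (q.2 - τ)]
      ring
  rw [← integral_integral_swap hi]
  have hi2 : Integrable (fun q : E × E => ∫ κ, locInt θ G φ τ ξ q κ)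
      ((volume : Measure E).prod (volume : Measure E)) := hi.integral_prod_left
  have e2 : ∫ q : E × E, ∫ κ, locInt θ G φ τ ξ q κ =
      ∫ w', ∫ w, ∫ κ, locInt θ G φ τ ξ (w', w) κ :=
    integral_prod (fun q : E × E => ∫ κ, locInt θ G φ τ ξ q κ) hi2
  rw [e2]
  simp only [e1]
  simp only [integral_const_mul]
  rw [inv_mul_cancel_left₀ hc0, stft, Real.fourier_eq]
  refine integral_congr_ae (Filter.Eventually.of_forall fun w' => ?_)
  simp only [hΨ, Circle.smul_def, smul_eq_mul]

lemma lintegral_withDensity_prod {a : E → ℝ≥0∞} (ha : Measurable a)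
    [SFinite ((volume : Measure E).withDensity a)] {F : E × E → ℝ≥0∞}
    (hF : Measurable F) :
    ∫⁻ p, F p ∂(((volume : Measure E).withDensity a).prod volume) =
      ∫⁻ κ, a κ * ∫⁻ η, F (κ, η) := by
  rw [lintegral_prod _ hF.aemeasurable,
    lintegral_withDensity_eq_lintegral_mul _ ha hF.lintegral_prod_right']
  rfl

/-- Residual operators are bounded between all weighted spaces. -/
theorem wsq_resOp_le {G : E → E → ℂ} (hG : IsResKer G) {M₁ M₂ : E → ℝ} (hM₁ : Moderate M₁)
    (hM₂ : Moderate M₂) : ∃ C : ℝ≥0∞, C ≠ ⊤ ∧ ∀ φ Ψ : 𝓢(E, ℂ),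
      (∀ w', Ψ w' = ∫ w, G w w' * φ w) → wsq M₂ Ψ ≤ C * wsq M₁ φ := by
  obtain ⟨θ, hθ1, hθ⟩ := exists_window (n := n) 1 one_pos
  rw [mul_one] at hθ
  have hθ01 : θ 0 = 1 := hθ1 0 (by simp)
  have hθ0 : θ 0 ≠ 0 := by rw [hθ01]; exact one_ne_zero
  have hθne : θ ≠ 0 := fun h => hθ0 (by simp [h])
  -- Chosen so that the product of `M₂` with it is `M₁`.
  have hM : Moderate (fun ξ => M₁ ξ * M₂ ξ ^ (-1 : ℝ)) := hM₁.mul (hM₂.rpow (-1))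
  set a : E → ℝ≥0∞ := fun κ => ENNReal.ofReal (((1 + ‖κ‖) ^ (n + 1))⁻¹) with ha
  have ham : Measurable a := (continuous_inv_one_add_pow (n + 1)).measurable.ennreal_ofReal
  have hafin : ∫⁻ κ, a κ ≠ ⊤ := lintegral_one_add_norm_lt_top.ne
  haveI : IsFiniteMeasure ((volume : Measure E).withDensity a) :=
    isFiniteMeasure_withDensity hafin
  -- Here the window does move, by `κ`; the density of the measure is the decay of the kernel in
  -- `κ`.
  obtain ⟨N, hN⟩ := wsq_le_of_stft_le hθne θ hM hM₂ ((volume : Measure E).withDensity a)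
  obtain ⟨C, hC, hb⟩ := norm_integral_locKer_le hθ hG hM N
  set c : ℂ := ∫ w, starRingEnd ℂ (θ w) * θ w with hc
  obtain ⟨C', hC', hfin⟩ := hN (‖c⁻¹‖ₑ * ENNReal.ofReal C)
    (ENNReal.mul_ne_top enorm_ne_top ENNReal.ofReal_ne_top)
  refine ⟨C', hC', fun φ Ψ hΨ => ?_⟩
  have hw : (fun ξ => M₂ ξ * (M₁ ξ * M₂ ξ ^ (-1 : ℝ))) = M₁ := funext fun ξ => by
    have := hM₂.pos ξ
    rw [Real.rpow_neg_one]
    field_simp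
  rw [← hw]
  refine hfin φ Ψ fun τ ξ => ?_
  rw [stft_resOp hθ hθ0 hG φ Ψ hΨ τ ξ, enorm_mul]
  have hMξ := hM.pos ξ
  set Mξ := M₁ ξ * M₂ ξ ^ (-1 : ℝ) with hMξdef
  have hI : ∀ κ, ‖∫ q, locInt θ G φ τ ξ q κ‖ₑ ≤ ENNReal.ofReal C * ENNReal.ofReal Mξ *
      (a κ * ∫⁻ η, ENNReal.ofReal (((1 + ‖ξ - η‖) ^ N)⁻¹) * ‖stft θ φ (τ + κ) η‖ₑ) := fun κ => by
    have h1 : ∫⁻ η, ENNReal.ofReal (((1 + ‖ξ - η‖) ^ N)⁻¹) * ‖stft θ φ (τ + κ) η‖ₑ =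
        ENNReal.ofReal (∫ η, ((1 + ‖ξ - η‖) ^ N)⁻¹ * ‖stft θ φ (τ + κ) η‖) := by
      rw [ofReal_integral_eq_lintegral_ofReal (integrable_inv_pow_mul_stft θ φ (τ + κ) ξ N)
        (Filter.Eventually.of_forall fun μ => mul_nonneg (by positivity) (norm_nonneg _))]
      refine lintegral_congr fun μ => ?_
      rw [ENNReal.ofReal_mul (by positivity), ofReal_norm]
    rw [h1, ← ofReal_norm, ha, ← ENNReal.ofReal_mul hC.le,
      ← ENNReal.ofReal_mul (by positivity), ← ENNReal.ofReal_mul (by positivity)]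
    refine ENNReal.ofReal_le_ofReal ?_
    have := hb φ τ κ ξ
    unfold locInt
    linarith
  rw [lintegral_withDensity_prod ham (measurable_inv_pow_mul_stft θ φ τ ξ N)]
  have hmeas : Measurable fun κ => a κ * ∫⁻ η, ENNReal.ofReal (((1 + ‖ξ - η‖) ^ N)⁻¹) *
      ‖stft θ φ (τ + κ) η‖ₑ :=
    ham.mul (measurable_inv_pow_mul_stft θ φ τ ξ N).lintegral_prod_right'
  calc _ ≤ ‖c⁻¹‖ₑ * ∫⁻ κ, ‖∫ q, locInt θ G φ τ ξ q κ‖ₑ := by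
        gcongr
        exact enorm_integral_le_lintegral_enorm _
    _ ≤ ‖c⁻¹‖ₑ * ∫⁻ κ, ENNReal.ofReal C * ENNReal.ofReal Mξ *
      (a κ * ∫⁻ η, ENNReal.ofReal (((1 + ‖ξ - η‖) ^ N)⁻¹) * ‖stft θ φ (τ + κ) η‖ₑ) := by
        gcongr with κ
        exact hI κ
    _ = _ := by rw [lintegral_const_mul _ hmeas]; ring

/-- An amplitude that does not depend on the fibre variable gives a multiplication operator. -/
lemma ampOp_eq_mul {h : E → E → ℂ} (hh : ContDiff ℝ ∞ (fun q : E × E => h q.1 q.2)) {R : ℝ}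
    (hR : ∀ w' w, h w' w ≠ 0 → ‖w - w'‖ ≤ R) {f : E → ℂ} (hf : ContDiff ℝ ∞ f) (w' : E) :
    ampOp (fun w' w _ => h w' w) f w' = h w' w' * f w' := by
  have hs : ContDiff ℝ ∞ (fun w => h w' w * f w) :=
    (hh.comp (contDiff_const.prodMk contDiff_id)).mul hf
  have hc : HasCompactSupport (fun w => h w' w * f w) :=
    HasCompactSupport.intro (isCompact_closedBall w' R) fun w hw => by
      by_contra h0
      exact hw (by simpa [dist_eq_norm] using hR w' w (left_ne_zero_of_mul h0))
  obtain ⟨g, hg⟩ : ∃ g : 𝓢(E, ℂ), ∀ w, g w = h w' w * f w := ⟨hc.toSchwartzMap hs, fun w => rfl⟩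
  -- The inner integral is the Fourier transform of `g` times a phase, so the outer integral is the
  -- inversion formula at `w'`.
  have h1 : g = 𝓕⁻ (𝓕 g) := (FourierTransform.fourierInv_fourier_eq g).symm
  have h2 : g w' = 𝓕⁻ ((𝓕 g : 𝓢(E, ℂ)) : E → ℂ) w' := by
    conv_lhs => rw [h1]
    rw [SchwartzMap.fourierInv_coe]
  rw [← hg, h2, Real.fourierInv_eq, ampOp]
  refine integral_congr_ae (Filter.Eventually.of_forall fun ζ => ?_)
  simp only
  rw [SchwartzMap.fourier_coe, Real.fourier_eq]
  simp only [Circle.smul_def, smul_eq_mul]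
  rw [← integral_const_mul]
  refine integral_congr_ae (Filter.Eventually.of_forall fun w => ?_)
  have h3 : (Real.fourierChar (-(inner ℝ (w - w') ζ)) : ℂ) =
      (Real.fourierChar (inner ℝ ζ w') : ℂ) * (Real.fourierChar (-(inner ℝ w ζ)) : ℂ) := by
    rw [← Circle.coe_mul, ← AddChar.map_add_eq_mul, real_inner_comm w' ζ, inner_sub_left]
    congr 2
    ring
  simp only [h3, hg]
  ring

end ResidualFinal

end

noncomputable section


/-! ### Test functions flat at the boundary and functions decaying superexponentially in `t` -/

section BTest

variable {n : ℕ} [NeZero n]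

local notation "E" => EuclideanSpace ℝ (Fin n)

/-- The unit vector in the direction of the first coordinate. -/
def unitZero (n : ℕ) [NeZero n] : EuclideanSpace ℝ (Fin n) := EuclideanSpace.single 0 1

/-- The first coordinate. -/
def prZero (n : ℕ) [NeZero n] : EuclideanSpace ℝ (Fin n) →L[ℝ] ℝ := EuclideanSpace.proj 0

@[simp] lemma prZero_apply (v : E) : prZero n v = v 0 := rfl

lemma unitZero_apply (i : Fin n) : unitZero n i = if i = 0 then 1 else 0 := by
  simp [unitZero]

@[simp] lemma unitZero_zero : unitZero n 0 = 1 := by simp [unitZero_apply]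

/-- The linear map `v ↦ v + c v₀ e₀`. -/
def shearZero (c : ℝ) : E →L[ℝ] E := ContinuousLinearMap.id ℝ E + c • (prZero n).smulRight (unitZero n)

lemma shearZero_apply (c : ℝ) (v : E) : shearZero c v = v + (c * v 0) • unitZero n := by
  simp [shearZero, mul_smul]

lemma logPt_eq (z : E) : logPt z = z + (-Real.log (z 0) - z 0) • unitZero n := by
  ext i
  by_cases hi : i = 0
  · subst hi; simp [logPt]
  · simp [logPt, hi, unitZero_apply]

lemma expPt_eq (w : E) : expPt w = w + (Real.exp (-(w 0)) - w 0) • unitZero n := by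
  ext i
  by_cases hi : i = 0
  · subst hi; simp [expPt]
  · simp [expPt, hi, unitZero_apply]

@[simp] lemma expPt_zero (w : E) : expPt w 0 = Real.exp (-(w 0)) := by simp [expPt]

lemma expPt_of_ne (w : E) {i : Fin n} (hi : i ≠ 0) : expPt w i = w i := by simp [expPt, hi]

@[simp] lemma logPt_zero (z : E) : logPt z 0 = -Real.log (z 0) := by simp [logPt]

lemma logPt_of_ne (w : E) {i : Fin n} (hi : i ≠ 0) : logPt w i = w i := by simp [logPt, hi]

@[simp] lemma logPt_expPt (w : E) : logPt (expPt w) = w := by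
  ext i
  by_cases hi : i = 0
  · subst hi; simp
  · simp [logPt_of_ne _ hi, expPt_of_ne _ hi]

lemma expPt_logPt {z : E} (hz : 0 < z 0) : expPt (logPt z) = z := by
  ext i
  by_cases hi : i = 0
  · subst hi; simp [Real.exp_log hz]
  · simp [logPt_of_ne _ hi, expPt_of_ne _ hi]

lemma hasFDerivAt_expPt (w : E) :
    HasFDerivAt (expPt : E → E) (shearZero (-(expPt w 0) - 1)) w := by
  have h0 : HasFDerivAt (fun w : E => w 0) (prZero n) w := (prZero n).hasFDerivAt
  have h1 : HasFDerivAt (fun w : E => Real.exp (-(w 0)) - w 0)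
      ((-(expPt w 0) - 1) • prZero n) w := by
    refine (h0.neg.exp.sub h0).congr_fderiv ?_
    ext v; simp; ring
  have h2 : (expPt : E → E) = fun w => w + (Real.exp (-(w 0)) - w 0) • unitZero n :=
    funext expPt_eq
  rw [h2]
  refine ((hasFDerivAt_id w).add (h1.smul_const (unitZero n))).congr_fderiv ?_
  ext1 v
  simp [shearZero_apply]

/-- The slope `-1/z₀` is written as `-e^t`, so that after the chain rule the derivative of a pulled
back function is again pulled back from logarithmic coordinates. -/
lemma hasFDerivAt_logPt {z : E} (hz : 0 < z 0) :
    HasFDerivAt (logPt : E → E) (shearZero (-Real.exp (logPt z 0) - 1)) z := by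
  have h0 : HasFDerivAt (fun w : E => w 0) (prZero n) z := (prZero n).hasFDerivAt
  have h1 : HasFDerivAt (fun w : E => -Real.log (w 0) - w 0)
      ((-Real.exp (logPt z 0) - 1) • prZero n) z := by
    refine ((h0.log hz.ne').neg.sub h0).congr_fderiv ?_
    ext v; simp [Real.exp_neg, Real.exp_log hz]; ring
  have h2 : (logPt : E → E) = fun w => w + (-Real.log (w 0) - w 0) • unitZero n :=
    funext logPt_eq
  rw [h2]
  refine ((hasFDerivAt_id z).add (h1.smul_const (unitZero n))).congr_fderiv ?_
  ext1 v
  simp [shearZero_apply]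

lemma contDiff_expPt : ContDiff ℝ ∞ (expPt : E → E) := by
  have h2 : (expPt : E → E) = fun w => w + (Real.exp (-(w 0)) - w 0) • unitZero n :=
    funext expPt_eq
  rw [h2]
  have h0 : ContDiff ℝ ∞ (fun w : E => w 0) := (prZero n).contDiff
  exact contDiff_id.add (((Real.contDiff_exp.comp h0.neg).sub h0).smul contDiff_const)

lemma continuous_expPt : Continuous (expPt : E → E) := contDiff_expPt.continuous

/-! #### From logarithmic coordinates to the half space -/

section Pull

variable {G : Type*} [NormedAddCommGroup G] [NormedSpace ℝ G]

/-- The vector valued version of `pullLog`. -/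
def pullLogG (g : E → G) : E → G := fun z => if 0 < z 0 then g (logPt z) else 0

lemma symCls_exp_zero : SymCls Set.univ (fun w : E => w) (fun w => Real.exp (w 0))
    (fun _ w => Real.exp (w 0)) := by
  have h : SymCls Set.univ (fun t : ℝ => t) Real.exp (fun _ => Real.exp) :=
    SymCls.of_le (fun _ _ => Real.contDiff_exp.contDiffAt) (fun _ _ => (Real.exp_pos _).le)
      fun k => ⟨1, fun t _ => by
        rw [norm_iteratedFDeriv_eq_norm_iteratedDeriv, iteratedDeriv_eq_iterate,
          Real.iter_deriv_exp]
        simp⟩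
  exact (h.reindex (fun w : E => w 0)).comp_clm (prZero n) (fun _ _ => rfl)

/-- The shear grows like `e^t`, which costs one of the arbitrarily many exponentials at hand. The
class is therefore stable under differentiation in the half space coordinates. -/
lemma IsBT.fderiv_comp_shear {g : E → G} (hg : IsBT g) :
    IsBT (fun w => (fderiv ℝ g w).comp (shearZero (-Real.exp (w 0) - 1))) := by
  obtain ⟨R, hR⟩ := hg.supp
  set B : (E →L[ℝ] G) →L[ℝ] (E →L[ℝ] E) →L[ℝ] (E →L[ℝ] G) := ContinuousLinearMap.compL ℝ E E G
  have h0 : ContDiff ℝ ∞ (fun w : E => w 0) := (prZero n).contDiff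
  have hsh : ContDiff ℝ ∞ (fun w : E => (shearZero (-Real.exp (w 0) - 1) : E →L[ℝ] E)) :=
    contDiff_const.add (((Real.contDiff_exp.comp h0).neg.sub contDiff_const).smul contDiff_const)
  refine IsBT.of_symCls ?_ ⟨R, fun w hw => ?_⟩ fun N => ?_
  · exact (hg.smooth.fderiv_right (m := ∞) (by simp)).clm_comp hsh
  · by_contra hc
    apply hw
    have : g =ᶠ[𝓝 w] fun _ => 0 := by
      filter_upwards [(isClosed_logBox R).isOpen_compl.mem_nhds hc] with w' hw'
      by_contra h0
      exact hw' (hR w' h0)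
    rw [this.fderiv_eq]; simp
  · have c0 := (hg.symCls (N + 1)).fderiv
    have c1 : SymCls (logBox n R) (fun w : E => w) (fun w => Real.exp (w 0))
        (fun _ w => (shearZero (-Real.exp (w 0) - 1) : E →L[ℝ] E)) := by
      set L : ℝ →L[ℝ] (E →L[ℝ] E) :=
        (ContinuousLinearMap.id ℝ ℝ).smulRight ((prZero n).smulRight (unitZero n))
      have d1 : SymCls (logBox n R) (fun w : E => w) (fun w => Real.exp (w 0))
          (fun _ _ => (shearZero (-1) : E →L[ℝ] E)) := by
        refine (SymCls.const (W := fun _ => ‖(shearZero (-1) : E →L[ℝ] E)‖) (fun _ => _)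
          (fun _ _ => le_rfl)).mono (c := (‖(shearZero (-1) : E →L[ℝ] E)‖ + 1) * Real.exp R)
          (fun w hw => ?_) (by positivity)
        rw [mul_assoc, ← Real.exp_add]
        have h1 : 1 ≤ Real.exp (R + w 0) := Real.one_le_exp (by linarith [hw.1])
        nlinarith [norm_nonneg (shearZero (-1) : E →L[ℝ] E)]
      have d2 := ((symCls_exp_zero (n := n)).mono_set (Set.subset_univ (logBox n R))).neg.clm L
      refine (d1.add d2).congr fun a _ => Filter.Eventually.of_forall fun w => ?_
      ext1 v
      simp [L, shearZero, add_smul, sub_smul]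
      abel
    have c2 := (c0.mono_set (Set.subset_univ (logBox n R))).bilin B c1
    have c3 : SymCls (logBox n R) (fun w : E => w) (fun w => Real.exp (-(N * w 0)))
        (fun _ w => (fderiv ℝ g w).comp (shearZero (-Real.exp (w 0) - 1))) :=
      c2.mono (c := 1) (fun w _ => by
        rw [← Real.exp_add, one_mul, Real.exp_le_exp]; push_cast; linarith) one_pos
    have c4 : SymCls (Set.univ \ logBox n R) (fun w : E => w) (fun w => Real.exp (-(N * w 0)))
        (fun _ w => (fderiv ℝ g w).comp (shearZero (-Real.exp (w 0) - 1))) := by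
      refine SymCls.zero (fun _ _ => (Real.exp_pos _).le) fun a ha => ?_
      filter_upwards [(isClosed_logBox R).isOpen_compl.mem_nhds ha.2] with w hw
      have : g =ᶠ[𝓝 w] fun _ => 0 := by
        filter_upwards [(isClosed_logBox R).isOpen_compl.mem_nhds hw] with w' hw'
        by_contra h0
        exact hw' (hR w' h0)
      rw [this.fderiv_eq]; simp
    exact (c3.union c4).mono_set fun a _ => by by_cases h : a ∈ logBox n R <;> simp [h]

lemma IsBT.norm_pullLogG_le {g : E → G} (hg : IsBT g) (N : ℕ) :
    ∃ C, 0 ≤ C ∧ ∀ z, ‖pullLogG g z‖ ≤ C * |z 0| ^ N := by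
  obtain ⟨C, hC⟩ := hg.bound 0 N
  have hC0 : 0 ≤ C := nonneg_of_mul_nonneg_left ((norm_nonneg _).trans (hC 0)) (Real.exp_pos _)
  refine ⟨C, hC0, fun z => ?_⟩
  unfold pullLogG
  split_ifs with hz
  · have := hC (logPt z)
    rw [norm_iteratedFDeriv_zero] at this
    refine this.trans (le_of_eq ?_)
    rw [logPt_zero, abs_of_pos hz, mul_neg, neg_neg, mul_comm (N : ℝ), Real.exp_mul,
      Real.exp_log hz, Real.rpow_natCast]
  · simp; positivity

/-- Away from the boundary this is the chain rule or the derivative of zero. At the boundary the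
function is `O(z₀²)`, so the derivative exists and vanishes, in accordance with the formula. -/
lemma IsBT.hasFDerivAt_pullLogG {g : E → G} (hg : IsBT g) (z : E) :
    HasFDerivAt (pullLogG g) (pullLogG
      (fun w => (fderiv ℝ g w).comp (shearZero (-Real.exp (w 0) - 1))) z) z := by
  have hc0 : Continuous (fun z : E => z 0) := (prZero n).continuous
  rcases lt_trichotomy (z 0) 0 with hz | hz | hz
  · have h1 : pullLogG g =ᶠ[𝓝 z] fun _ => 0 := by
      filter_upwards [hc0.continuousAt.eventually (gt_mem_nhds hz)] with y hy
      simp [pullLogG, not_lt.2 (le_of_lt hy)]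
    have h2 : pullLogG (fun w => (fderiv ℝ g w).comp (shearZero (-Real.exp (w 0) - 1))) z = 0 := by
      simp [pullLogG, not_lt.2 hz.le]
    rw [h2]
    exact (hasFDerivAt_const (0 : G) z).congr_of_eventuallyEq h1
  · have h2 : pullLogG (fun w => (fderiv ℝ g w).comp (shearZero (-Real.exp (w 0) - 1))) z = 0 := by
      simp [pullLogG, hz]
    obtain ⟨C, hC, hb⟩ := hg.norm_pullLogG_le 2
    have h3 : pullLogG g z = 0 := by simp [pullLogG, hz]
    rw [h2, hasFDerivAt_iff_isLittleO_nhds_zero]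
    have h4 : (fun h => pullLogG g (z + h) - pullLogG g z - (0 : E →L[ℝ] G) h) =O[𝓝 0]
        fun h : E => ‖h‖ ^ 2 := by
      refine Asymptotics.IsBigO.of_bound C (Filter.Eventually.of_forall fun h => ?_)
      have h5 := hb (z + h)
      rw [PiLp.add_apply, hz, zero_add] at h5
      simp only [h3, sub_zero, ContinuousLinearMap.zero_apply, norm_pow, norm_norm]
      exact h5.trans (by gcongr; exact abs_apply_le_norm h 0)
    refine h4.trans_isLittleO ?_
    have := Asymptotics.isLittleO_norm_pow_id (E' := E) (n := 2) (by norm_num)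
    exact this
  · have h1 : pullLogG g =ᶠ[𝓝 z] fun z => g (logPt z) := by
      filter_upwards [hc0.continuousAt.eventually (lt_mem_nhds hz)] with y hy
      simp [pullLogG, hy]
    have h2 : pullLogG (fun w => (fderiv ℝ g w).comp (shearZero (-Real.exp (w 0) - 1))) z =
        (fderiv ℝ g (logPt z)).comp (shearZero (-Real.exp (logPt z 0) - 1)) := by
      simp only [pullLogG, if_pos hz]
    rw [h2]
    have h3 := (hg.smooth.differentiable (by simp) (logPt z)).hasFDerivAt
    exact (h3.comp z (hasFDerivAt_logPt hz)).congr_of_eventuallyEq h1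

end Pull

lemma contDiff_pullLogG (k : ℕ) : ∀ {G : Type} [NormedAddCommGroup G] [NormedSpace ℝ G]
    {g : E → G}, IsBT g → ContDiff ℝ k (pullLogG g) := by
  induction k with
  | zero =>
    intro G _ _ g hg
    exact contDiff_zero.2 (continuous_iff_continuousAt.2 fun z =>
      (hg.hasFDerivAt_pullLogG z).continuousAt)
  | succ k ih =>
    intro G _ _ g hg
    rw [Nat.cast_succ, contDiff_succ_iff_fderiv]
    refine ⟨fun z => (hg.hasFDerivAt_pullLogG z).differentiableAt, by simp, ?_⟩
    rw [show fderiv ℝ (pullLogG g) = _ from funext fun z => (hg.hasFDerivAt_pullLogG z).fderiv]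
    exact ih hg.fderiv_comp_shear

lemma IsBT.contDiff_pullLog {g : E → ℂ} (hg : IsBT g) : ContDiff ℝ ∞ (pullLog g) :=
  contDiff_infty.2 fun k => contDiff_pullLogG k hg

lemma IsBT.isBTest_of_compact {g : E → ℂ} (hg : IsBT g) {K V : Set E} (hK : IsCompact K)
    (hKV : K ⊆ V) (hgK : ∀ w, g w ≠ 0 → expPt w ∈ K) : IsBTest V g := by
  have h : tsupport (pullLog g) ⊆ K := by
    refine closure_minimal (fun z hz => ?_) hK.isClosed
    have hz' : pullLog g z ≠ 0 := hz
    unfold pullLog at hz'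
    split_ifs at hz' with h0
    · have := hgK _ hz'
      rwa [expPt_logPt h0] at this
    · exact absurd rfl hz'
  exact ⟨hg.contDiff_pullLog, hK.of_isClosed_subset (isClosed_tsupport _) h, h.trans hKV⟩

lemma exists_isCompact_expPt (R : ℝ) : ∃ K : Set E, IsCompact K ∧ ∀ w ∈ logBox n R, expPt w ∈ K := by
  refine ⟨Metric.closedBall 0 (n * (Real.exp R + |R|)), isCompact_closedBall _ _, fun w hw => ?_⟩
  rw [mem_closedBall_zero_iff]
  refine (norm_le_of_abs_le (R := R) fun i hi => ?_).trans ?_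
  · rw [expPt_of_ne w hi]; exact hw.2 i hi
  · rw [expPt_zero, abs_of_pos (Real.exp_pos _)]
    gcongr
    linarith [hw.1]

lemma IsBT.isBTest {g : E → ℂ} (hg : IsBT g) : IsBTest Set.univ g := by
  obtain ⟨R, hR⟩ := hg.supp
  obtain ⟨K, hK, h⟩ := exists_isCompact_expPt (n := n) R
  exact hg.isBTest_of_compact hK (Set.subset_univ _) fun w hw => h w (hR w hw)

/-! #### From the half space to logarithmic coordinates -/

/-- Smooth functions of compact support that vanish for `z₀ ≤ 0`. -/
structure IsFlat {G : Type*} [NormedAddCommGroup G] [NormedSpace ℝ G]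
    (F : EuclideanSpace ℝ (Fin n) → G) : Prop where
  smooth : ContDiff ℝ ∞ F
  compact : HasCompactSupport F
  zero : ∀ z, z 0 ≤ 0 → F z = 0

lemma zero_of_continuous_of_neg {X : Type*} [TopologicalSpace X] [T2Space X] [Zero X]
    {F : E → X} (hF : Continuous F) (h : ∀ z, z 0 < 0 → F z = 0) (z : E) (hz : z 0 ≤ 0) :
    F z = 0 := by
  have hcl : IsClosed {z : E | F z = 0} := isClosed_eq hF continuous_const
  have hmem : z ∈ closure {z : E | z 0 < 0} := by
    have ht : Filter.Tendsto (fun s : ℝ => z - s • unitZero n) (𝓝[>] 0) (𝓝 z) := by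
      have : Filter.Tendsto (fun s : ℝ => z - s • unitZero n) (𝓝 0) (𝓝 (z - (0 : ℝ) • unitZero n)) :=
        (by fun_prop : Continuous fun s : ℝ => z - s • unitZero n).tendsto 0
      rw [zero_smul, sub_zero] at this
      exact this.mono_left nhdsWithin_le_nhds
    refine mem_closure_of_tendsto ht ?_
    filter_upwards [self_mem_nhdsWithin] with s hs
    have : (0 : ℝ) < s := hs
    simp
    linarith
  exact closure_minimal (fun z hz => h z hz) hcl hmem

section Flat

variable {G : Type*} [NormedAddCommGroup G] [NormedSpace ℝ G]

lemma IsFlat.fderiv {F : E → G} (hF : IsFlat F) : IsFlat (fderiv ℝ F) := by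
  have hs : ContDiff ℝ ∞ (_root_.fderiv ℝ F) := hF.smooth.fderiv_right (m := ∞) (by simp)
  refine ⟨hs, hF.compact.fderiv (𝕜 := ℝ), zero_of_continuous_of_neg hs.continuous fun z hz => ?_⟩
  have h1 : F =ᶠ[𝓝 z] fun _ => 0 := by
    filter_upwards [(prZero n).continuous.continuousAt.eventually (gt_mem_nhds hz)] with y hy
    exact hF.zero y (le_of_lt hy)
  rw [h1.fderiv_eq]; simp

lemma IsFlat.fderiv_comp_shear {F : E → G} (hF : IsFlat F) :
    IsFlat (fun z => (_root_.fderiv ℝ F z).comp (shearZero (-(z 0) - 1))) := by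
  have h0 : ContDiff ℝ ∞ (fun w : E => w 0) := (prZero n).contDiff
  have hsh : ContDiff ℝ ∞ (fun w : E => (shearZero (-(w 0) - 1) : E →L[ℝ] E)) :=
    contDiff_const.add ((h0.neg.sub contDiff_const).smul contDiff_const)
  refine ⟨hF.fderiv.smooth.clm_comp hsh, ?_, fun z hz => ?_⟩
  · refine hF.fderiv.compact.mono fun z hz h => hz ?_
    change (_root_.fderiv ℝ F z).comp _ = 0
    rw [h]; simp
  · rw [hF.fderiv.zero z hz]; simp

end Flat

/-- Induction on the order of vanishing: the derivative is flat as well, and the mean value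
inequality along the normal segment from the boundary gains one power of `z₀`. -/
lemma IsFlat.norm_le (N : ℕ) : ∀ {G : Type} [NormedAddCommGroup G] [NormedSpace ℝ G]
    {F : E → G}, IsFlat F → ∃ C, 0 ≤ C ∧ ∀ z, 0 ≤ z 0 → ‖F z‖ ≤ C * z 0 ^ N := by
  induction N with
  | zero =>
    intro G _ _ F hF
    obtain ⟨C, hC⟩ := hF.compact.exists_bound_of_continuous hF.smooth.continuous
    exact ⟨C, (norm_nonneg _).trans (hC 0), fun z _ => by simpa using hC z⟩
  | succ N ih =>
    intro G _ _ F hF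
    obtain ⟨C, hC, h⟩ := ih hF.fderiv
    refine ⟨C * ‖unitZero n‖, by positivity, fun z hz => ?_⟩
    set z' : E := z - (z 0) • unitZero n with hz'
    have h0 : F z' = 0 := hF.zero _ (by simp [hz'])
    have hseg : ∀ y ∈ segment ℝ z' z, ‖_root_.fderiv ℝ F y‖ ≤ C * z 0 ^ N := fun y hy => by
      rw [segment_eq_image'] at hy
      obtain ⟨s, hs, rfl⟩ := hy
      have e : (z' + s • (z - z')) 0 = s * z 0 := by simp [hz']
      have := h (z' + s • (z - z')) (by rw [e]; exact mul_nonneg hs.1 hz)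
      rw [e] at this
      refine this.trans ?_
      gcongr
      · exact mul_nonneg hs.1 hz
      · exact mul_le_of_le_one_left hz hs.2
    have := (convex_segment z' z).norm_image_sub_le_of_norm_fderiv_le
      (fun y _ => hF.smooth.differentiable (by simp) y) hseg (left_mem_segment ℝ z' z)
      (right_mem_segment ℝ z' z)
    rw [h0, sub_zero] at this
    refine this.trans (le_of_eq ?_)
    rw [hz', sub_sub_cancel, norm_smul, Real.norm_of_nonneg hz]
    ring

/-- In logarithmic coordinates a derivative becomes a derivative composed with a shear that is
affine in `z₀`; this preserves flatness. Since `z₀ = e^{-t}`, powers of `z₀` become exponentials. -/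
lemma IsFlat.norm_iteratedFDeriv_comp_le (k : ℕ) : ∀ {G : Type} [NormedAddCommGroup G]
    [NormedSpace ℝ G] {F : E → G}, IsFlat F → ∀ N : ℕ, ∃ C, ∀ w,
      ‖iteratedFDeriv ℝ k (fun w => F (expPt w)) w‖ ≤ C * Real.exp (-(N * w 0)) := by
  induction k with
  | zero =>
    intro G _ _ F hF N
    obtain ⟨C, -, h⟩ := IsFlat.norm_le N hF
    refine ⟨C, fun w => ?_⟩
    have := h (expPt w) (by rw [expPt_zero]; positivity)
    rw [expPt_zero, ← Real.exp_nat_mul] at this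
    simpa using this
  | succ k ih =>
    intro G _ _ F hF N
    obtain ⟨C, h⟩ := ih hF.fderiv_comp_shear N
    refine ⟨C, fun w => ?_⟩
    rw [← norm_iteratedFDeriv_fderiv]
    have e : _root_.fderiv ℝ (fun w => F (expPt w)) = fun w => (_root_.fderiv ℝ F (expPt w)).comp
        (shearZero (-(expPt w 0) - 1)) := funext fun w =>
      ((hF.smooth.differentiable (by simp) _).hasFDerivAt.comp w (hasFDerivAt_expPt w)).fderiv
    rw [e]
    exact h w

/-- Together with `IsBT.isBTest` this identifies, for `V = Set.univ`, the two descriptions of test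
functions. The estimates are carried out in the one written in logarithmic coordinates. -/
lemma IsBTest.isBT {V : Set E} {g : E → ℂ} (hg : IsBTest V g) : IsBT g := by
  have hF : IsFlat (pullLog g) := ⟨hg.1, hg.2.1, fun z hz => by simp [pullLog, not_lt.2 hz]⟩
  have e : g = fun w => pullLog g (expPt w) := by
    funext w
    simp [pullLog, Real.exp_pos]
  obtain ⟨R, hR⟩ := hg.2.1.isCompact.isBounded.subset_closedBall 0
  refine ⟨?_, ?_, fun k N => ?_⟩
  · rw [e]; exact hg.1.comp contDiff_expPt
  · have hR1 : ∀ w, g w ≠ 0 → ‖expPt w‖ ≤ |R| + 1 := fun w hw => by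
      have h1 : expPt w ∈ tsupport (pullLog g) := subset_tsupport _ (by
        rw [e] at hw; exact hw)
      have := hR h1
      rw [mem_closedBall_zero_iff] at this
      linarith [le_abs_self R]
    refine ⟨|R| + 1, fun w hw => ⟨?_, fun i hi => ?_⟩⟩
    · have h1 := (abs_apply_le_norm (expPt w) 0).trans (hR1 w hw)
      rw [expPt_zero, abs_of_pos (Real.exp_pos _)] at h1
      have := Real.add_one_le_exp (-(w 0))
      linarith
    · rw [← expPt_of_ne w hi]
      exact (abs_apply_le_norm _ i).trans (hR1 w hw)
  · obtain ⟨C, hC⟩ := IsFlat.norm_iteratedFDeriv_comp_le k hF N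
    exact ⟨C, fun w => by rw [e]; exact hC w⟩

end BTest

end

noncomputable section


/-! ### Functions smooth up to the boundary of a half space, in logarithmic coordinates -/

section HalfOpen

open Filter

variable {n : ℕ} [NeZero n]

local notation "E" => EuclideanSpace ℝ (Fin n)

/-- Relatively open subsets of the half space `{z₀ ≥ 0}`. -/
def IsHalfOpen (T : Set E) : Prop := ∃ U : Set E, IsOpen U ∧ T = U ∩ {z | 0 ≤ z 0}

lemma norm_unitZero : ‖unitZero n‖ = 1 := by simp [unitZero]

lemma continuous_apply_zero : Continuous fun z : E => z 0 := (prZero n).continuous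

lemma convex_halfSpace_zero : Convex ℝ {z : E | 0 ≤ z 0} :=
  convex_halfSpace_ge ⟨fun _ _ => rfl, fun _ _ => rfl⟩ 0

/-- Derivatives within `T` are continuous up to the boundary and hence bounded on `K`; at the points
actually visited, where `T` is a neighbourhood, they are the ordinary derivatives. -/
lemma SymCls.comp_contDiffOn_within {α V F G : Type*} [NormedAddCommGroup V] [NormedSpace ℝ V]
    [NormedAddCommGroup F] [NormedSpace ℝ F] [NormedAddCommGroup G] [NormedSpace ℝ G]
    {S : Set α} {p : α → V} {f : α → V → F} {g : F → G} {T K : Set F}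
    (hfs : ∀ a ∈ S, ContDiffAt ℝ ∞ (f a) (p a))
    (hf : ∀ k, 1 ≤ k → ∃ C, ∀ a ∈ S, ‖iteratedFDeriv ℝ k (f a) (p a)‖ ≤ C)
    (hT : UniqueDiffOn ℝ T) (hK : IsCompact K) (hKT : K ⊆ T) (hg : ContDiffOn ℝ ∞ g T)
    (hfK : ∀ a ∈ S, f a (p a) ∈ K) (hfT : ∀ a ∈ S, T ∈ 𝓝 (f a (p a))) :
    SymCls S p (fun _ => 1) (fun a y => g (f a y)) := by
  refine SymCls.comp_of_fderiv (q := fun a => f a (p a)) (g := fun _ => g) ?_ hfs hf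
    (fun _ _ => rfl)
  have hs : ∀ a ∈ S, ContDiffAt ℝ ∞ g (f a (p a)) := fun a ha => hg.contDiffAt (hfT a ha)
  refine SymCls.of_le hs (fun _ _ => zero_le_one) fun k => ?_
  obtain ⟨C, hC⟩ := hK.exists_bound_of_continuousOn
    ((hg.continuousOn_iteratedFDerivWithin (m := k) (by exact_mod_cast le_top) hT).mono hKT)
  refine ⟨C, fun a ha => ?_⟩
  rw [mul_one, ← iteratedFDerivWithin_eq_iteratedFDeriv hT
    ((hs a ha).of_le (by exact_mod_cast le_top)) (hKT (hfK a ha))]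
  exact hC _ (hfK a ha)

namespace IsHalfOpen

variable {T : Set (EuclideanSpace ℝ (Fin n))} {G : Type*} [NormedAddCommGroup G] [NormedSpace ℝ G]
  {F : EuclideanSpace ℝ (Fin n) → G}

lemma uniqueDiffOn (hT : IsHalfOpen T) : UniqueDiffOn ℝ T := by
  obtain ⟨U, hU, rfl⟩ := hT
  rw [Set.inter_comm]
  refine UniqueDiffOn.inter (uniqueDiffOn_convex convex_halfSpace_zero ⟨unitZero n, ?_⟩) hU
  refine mem_interior.2 ⟨{z | 0 < z 0}, fun z (hz : 0 < z 0) => hz.le,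
    isOpen_lt continuous_const continuous_apply_zero, by simp⟩

lemma mem_nhds (hT : IsHalfOpen T) {z : E} (hz : z ∈ T) (h0 : 0 < z 0) : T ∈ 𝓝 z := by
  obtain ⟨U, hU, rfl⟩ := hT
  refine Filter.inter_mem (hU.mem_nhds hz.1) ?_
  filter_upwards [(isOpen_lt continuous_const continuous_apply_zero).mem_nhds h0] with y hy
    using le_of_lt hy

lemma nonneg (hT : IsHalfOpen T) {z : E} (hz : z ∈ T) : 0 ≤ z 0 := by
  obtain ⟨U, hU, rfl⟩ := hT
  exact hz.2

lemma eventually_mem (hT : IsHalfOpen T) {z : E} (hz : z ∈ T) {c : ℝ → E} (hc : Tendsto c (𝓝 0) (𝓝 z))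
    {p : ℝ → Prop} (h : ∀ s, p s → 0 ≤ c s 0) : ∀ᶠ s in 𝓝 0, p s → c s ∈ T := by
  obtain ⟨U, hU, rfl⟩ := hT
  filter_upwards [hc (hU.mem_nhds hz.1)] with s hs hp using ⟨hs, h s hp⟩

/-- Functions vanishing on the boundary have vanishing tangential derivatives there. -/
lemma fderivWithin_tangential (hT : IsHalfOpen T) (hF : ContDiffOn ℝ ∞ F T)
    (h0 : ∀ z ∈ T, z 0 = 0 → F z = 0) {z : E} (hz : z ∈ T) (hz0 : z 0 = 0) {v : E} (hv : v 0 = 0) :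
    fderivWithin ℝ F T z v = 0 := by
  have hc0 : Continuous fun s : ℝ => z + s • v := by fun_prop
  have hc : Tendsto (fun s : ℝ => z + s • v) (𝓝 0) (𝓝 z) := by
    simpa using hc0.tendsto 0
  have hmem : ∀ᶠ s : ℝ in 𝓝 0, z + s • v ∈ T := by
    have := hT.eventually_mem hz hc (p := fun _ => True) (fun s _ => by simp [hv, hz0])
    simpa using this
  have hl : HasDerivAt (fun s : ℝ => z + s • v) v 0 := by
    simpa using ((hasDerivAt_id (0 : ℝ)).smul_const v).const_add z
  have hd : HasFDerivWithinAt F (fderivWithin ℝ F T z) T (z + (0 : ℝ) • v) := by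
    simpa using (hF.differentiableOn (by simp) z hz).hasFDerivWithinAt
  have h1 := hd.comp_hasDerivAt (0 : ℝ) hl hmem
  have h2 : HasDerivAt (F ∘ fun s : ℝ => z + s • v) 0 0 := by
    refine (hasDerivAt_const (0 : ℝ) (0 : G)).congr_of_eventuallyEq ?_
    filter_upwards [hmem] with s hs using h0 _ hs (by simp [hv, hz0])
  exact h1.unique h2

/-- Mean value inequality along the normal direction, from the foot of `y` on the boundary, where
the function vanishes. -/
lemma eventually_norm_le (hT : IsHalfOpen T) (hF : ContDiffOn ℝ ∞ F T)
    (h0 : ∀ z ∈ T, z 0 = 0 → F z = 0) {z : E} (hz : z ∈ T) (hz0 : z 0 = 0) {c : ℝ}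
    (hc : ‖fderivWithin ℝ F T z‖ < c) : ∀ᶠ y in 𝓝[T] z, ‖F y‖ ≤ c * y 0 := by
  have hcont := (hF.continuousOn_fderivWithin hT.uniqueDiffOn (by simp)).norm z hz
  have h1 : ∀ᶠ y in 𝓝[T] z, ‖fderivWithin ℝ F T y‖ < c := hcont.eventually (gt_mem_nhds hc)
  have hT' := hT
  obtain ⟨U, hU, rfl⟩ := hT
  rw [eventually_nhdsWithin_iff] at h1
  obtain ⟨δ, hδ, hB⟩ := Metric.mem_nhds_iff.1 (Filter.inter_mem h1 (hU.mem_nhds hz.1))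
  rw [eventually_nhdsWithin_iff]
  filter_upwards [Metric.ball_mem_nhds z (half_pos hδ)] with y hy hyT
  set s : Set E := Metric.ball z δ ∩ {z | 0 ≤ z 0}
  have hsT : s ⊆ U ∩ {z | 0 ≤ z 0} := fun w hw => ⟨(hB hw.1).2, hw.2⟩
  have hconv : Convex ℝ s := (convex_ball z δ).inter convex_halfSpace_zero
  have hy0 : |y 0| ≤ ‖y - z‖ := by
    have := abs_apply_le_norm (y - z) 0
    simpa [hz0] using this
  rw [mem_ball_iff_norm] at hy
  have hys : y ∈ s := ⟨by rw [mem_ball_iff_norm]; linarith, hyT.2⟩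
  have hy's : y - (y 0) • unitZero n ∈ s := by
    refine ⟨?_, by simp⟩
    rw [mem_ball_iff_norm]
    calc ‖y - (y 0) • unitZero n - z‖ = ‖(y - z) - (y 0) • unitZero n‖ := by congr 1; abel
      _ ≤ ‖y - z‖ + |y 0| := by
        refine (norm_sub_le _ _).trans ?_
        rw [norm_smul, norm_unitZero, mul_one, Real.norm_eq_abs]
      _ < δ := by linarith
  have := hconv.norm_image_sub_le_of_norm_hasFDerivWithin_le
    (f' := fderivWithin ℝ F (U ∩ {z | 0 ≤ z 0})) (C := c) (f := F)
    (fun w hw => ((hF.differentiableOn (by simp) w (hsT hw)).hasFDerivWithinAt).mono hsT)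
    (fun w hw => ((hB hw.1).1 (hsT hw)).le) hy's hys
  rw [h0 _ (hsT hy's) (by simp), sub_zero, sub_sub_cancel, norm_smul, norm_unitZero, mul_one,
    Real.norm_of_nonneg hyT.2] at this
  exact this

lemma exists_norm_le (hT : IsHalfOpen T) (hF : ContDiffOn ℝ ∞ F T)
    (h0 : ∀ z ∈ T, z 0 = 0 → F z = 0) {K : Set E} (hK : IsCompact K) (hKT : K ⊆ T) :
    ∃ C, 0 < C ∧ ∀ z ∈ K, ‖F z‖ ≤ C * z 0 := by
  refine hK.induction_on (p := fun K' => ∃ C, 0 < C ∧ ∀ z ∈ K' ∩ T, ‖F z‖ ≤ C * z 0)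
    ⟨1, one_pos, by simp⟩ ?_ ?_ ?_ |>.imp fun C h => ⟨h.1, fun z hz => h.2 z ⟨hz, hKT hz⟩⟩
  · rintro s t hst ⟨C, hC, h⟩
    exact ⟨C, hC, fun z hz => h z ⟨hst hz.1, hz.2⟩⟩
  · rintro s t ⟨C, hC, h⟩ ⟨C', hC', h'⟩
    refine ⟨max C C', by positivity, fun z hz => ?_⟩
    have := hT.nonneg hz.2
    rcases hz with ⟨hz | hz, hzT⟩
    · exact (h z ⟨hz, hzT⟩).trans (by gcongr; exact le_max_left _ _)
    · exact (h' z ⟨hz, hzT⟩).trans (by gcongr; exact le_max_right _ _)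
  · intro z hz
    have hzT := hKT hz
    rcases (hT.nonneg hzT).eq_or_lt with hz0 | hz0
    · have := hT.eventually_norm_le hF h0 hzT hz0.symm (lt_add_one _)
      refine ⟨_, (nhdsWithin_mono _ hKT) this, _, by positivity, fun y hy => hy.1⟩
    · have h1 : ∀ᶠ y in 𝓝 z, ‖F y‖ < ‖F z‖ + 1 :=
        (hF.contDiffAt (hT.mem_nhds hzT hz0)).continuousAt.norm.eventually
          (gt_mem_nhds (lt_add_one _))
      have h2 : ∀ᶠ y : E in 𝓝 z, z 0 / 2 < y 0 :=
        (continuous_apply_zero.continuousAt).eventually (lt_mem_nhds (by linarith))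
      refine ⟨_, mem_nhdsWithin_of_mem_nhds (h1.and h2), (‖F z‖ + 1) / (z 0 / 2), by positivity,
        fun y hy => hy.1.1.le.trans ?_⟩
      rw [div_mul_eq_mul_div, le_div_iff₀ (by positivity)]
      exact mul_le_mul_of_nonneg_left hy.1.2.le (by positivity)

/-- On the boundary tangential derivatives vanish, so the differential is `d · dz₀` with `d ≠ 0`.
Subtracting this linear part leaves a function with zero derivative at the point, hence at most
`(|d|/2) z₀` nearby. Compactness makes the local lower bounds uniform. -/
lemma exists_le_of_fderivWithin_ne_zero {F : E → ℝ} (hT : IsHalfOpen T) (hF : ContDiffOn ℝ ∞ F T)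
    (h0 : ∀ z ∈ T, z 0 = 0 → F z = 0) (hpos : ∀ z ∈ T, 0 < z 0 → 0 < F z)
    (hd : ∀ z ∈ T, z 0 = 0 → fderivWithin ℝ F T z ≠ 0) {K : Set E} (hK : IsCompact K)
    (hKT : K ⊆ T) : ∃ c, 0 < c ∧ ∀ z ∈ K, c * z 0 ≤ F z := by
  refine hK.induction_on (p := fun K' => ∃ c, 0 < c ∧ ∀ z ∈ K' ∩ T, c * z 0 ≤ F z)
    ⟨1, one_pos, by simp⟩ ?_ ?_ ?_ |>.imp fun C h => ⟨h.1, fun z hz => h.2 z ⟨hz, hKT hz⟩⟩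
  · rintro s t hst ⟨C, hC, h⟩
    exact ⟨C, hC, fun z hz => h z ⟨hst hz.1, hz.2⟩⟩
  · rintro s t ⟨C, hC, h⟩ ⟨C', hC', h'⟩
    refine ⟨min C C', by positivity, fun z hz => ?_⟩
    have := hT.nonneg hz.2
    rcases hz with ⟨hz | hz, hzT⟩
    · exact le_trans (by gcongr; exact min_le_left _ _) (h z ⟨hz, hzT⟩)
    · exact le_trans (by gcongr; exact min_le_right _ _) (h' z ⟨hz, hzT⟩)
  · intro z hz
    have hzT := hKT hz
    rcases (hT.nonneg hzT).eq_or_lt with hz0 | hz0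
    · set d := fderivWithin ℝ F T z (unitZero n) with hd'
      have hdv : fderivWithin ℝ F T z = d • prZero n := by
        ext v
        have := hT.fderivWithin_tangential hF h0 hzT hz0.symm (v := v - v 0 • unitZero n) (by simp)
        rw [map_sub, map_smul, sub_eq_zero] at this
        rw [this]
        simp [prZero, mul_comm, hd']
      have hd0 : d ≠ 0 := fun h => hd z hzT hz0.symm (by rw [hdv, h, zero_smul])
      have hH : ContDiffOn ℝ ∞ (fun z => F z - (d • prZero n) z) T :=
        hF.sub (d • prZero n).contDiff.contDiffOn
      have hfd : fderivWithin ℝ (fun z => F z - (d • prZero n) z) T z = 0 := by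
        rw [fderivWithin_fun_sub (hT.uniqueDiffOn z hzT) (hF.differentiableOn (by simp) z hzT)
          (d • prZero n).differentiableWithinAt, hdv,
          ContinuousLinearMap.fderivWithin _ (hT.uniqueDiffOn z hzT), sub_self]
      have hev := hT.eventually_norm_le hH (fun y hy hy0 => by simp [h0 y hy hy0, prZero, hy0]) hzT
        hz0.symm (c := |d| / 2) (by rw [hfd, norm_zero]; positivity)
      -- A negative slope would make the function negative at small interior points of the normal
      -- ray.
      have hdpos : 0 < d := by
        by_contra hneg
        have hneg' : d < 0 := lt_of_le_of_ne (not_lt.1 hneg) hd0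
        have hc0 : Continuous fun s : ℝ => z + s • unitZero n := by fun_prop
        have hc : Tendsto (fun s : ℝ => z + s • unitZero n) (𝓝 0) (𝓝 z) := by
          simpa using hc0.tendsto 0
        have hm := hT.eventually_mem hzT hc (p := fun s => 0 < s)
          (fun s hs => by simp [← hz0, hs.le])
        rw [eventually_nhdsWithin_iff] at hev
        have hall : ∀ᶠ s : ℝ in 𝓝[>] 0, False := by
          filter_upwards [mem_nhdsWithin_of_mem_nhds hm, mem_nhdsWithin_of_mem_nhds (hc hev),
            self_mem_nhdsWithin] with s h1 h2 h3
          have h3' : 0 < s := h3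
          have h4 := hpos _ (h1 h3') (by simp [← hz0, h3'])
          have h5 := h2 (h1 h3')
          have e : (d • prZero n) (z + s • unitZero n) = d * s := by simp [prZero, ← hz0]
          rw [e, Real.norm_eq_abs, abs_of_neg hneg'] at h5
          have e' : (z + s • unitZero n) 0 = s := by simp [← hz0]
          rw [e'] at h5
          have := (abs_le.1 h5).2
          nlinarith
        exact hall.exists.elim fun _ h => h
      refine ⟨_, (nhdsWithin_mono _ hKT) hev, d / 2, by positivity, fun y hy => ?_⟩
      have h5 : ‖F y - (d • prZero n) y‖ ≤ |d| / 2 * y 0 := hy.1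
      have e : (d • prZero n) y = d * y 0 := by simp [prZero]
      rw [e, Real.norm_eq_abs, abs_of_pos hdpos] at h5
      have := (abs_le.1 h5).1
      linarith
    · have hFz := hpos z hzT hz0
      have h1 : ∀ᶠ y in 𝓝 z, F z / 2 < F y :=
        (hF.contDiffAt (hT.mem_nhds hzT hz0)).continuousAt.eventually
          (lt_mem_nhds (by linarith))
      have h2 : ∀ᶠ y : E in 𝓝 z, y 0 < z 0 + 1 :=
        (continuous_apply_zero.continuousAt).eventually (gt_mem_nhds (by linarith))
      refine ⟨_, mem_nhdsWithin_of_mem_nhds (h1.and h2), (F z / 2) / (z 0 + 1), by positivity,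
        fun y hy => le_trans ?_ hy.1.1.le⟩
      rw [div_mul_eq_mul_div, div_le_iff₀ (by positivity)]
      exact mul_le_mul_of_nonneg_left hy.1.2.le (by positivity)

end IsHalfOpen

lemma symCls_exp_neg_zero : SymCls Set.univ (fun w : E => w) (fun w => Real.exp (-(w 0)))
    (fun _ w => Real.exp (-(w 0))) := by
  have := (symCls_exp_zero (n := n)).reindex (fun w : E => -w)
  exact this.comp_clm (-ContinuousLinearMap.id ℝ E) (fun _ _ => rfl)

/-- The first derivative is a constant plus a multiple of `e^{-t}`, and `e^{-t}`, with all its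
derivatives, is bounded over a compact set. -/
lemma norm_iteratedFDeriv_expPt_le {K : Set E} (hK : IsCompact K) (k : ℕ) (hk : 1 ≤ k) :
    ∃ C, ∀ w, expPt w ∈ K → ‖iteratedFDeriv ℝ k (expPt : E → E) w‖ ≤ C := by
  obtain ⟨R, hR⟩ := hK.isBounded.exists_norm_le
  obtain ⟨k, rfl⟩ := Nat.exists_eq_add_of_le' hk
  set T₀ : E →L[ℝ] E := (prZero n).smulRight (unitZero n) with hT₀
  have e : fderiv ℝ (expPt : E → E) = fun w =>
      (ContinuousLinearMap.id ℝ E - T₀) - (ContinuousLinearMap.toSpanSingleton ℝ T₀)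
        (Real.exp (-(w 0))) := by
    funext w
    rw [(hasFDerivAt_expPt w).fderiv, expPt_zero]
    ext1 v
    simp [shearZero, hT₀, sub_smul]
    module
  have h1 := ((symCls_exp_neg_zero (n := n)).mono_set (Set.subset_univ (expPt ⁻¹' K))).clm
    (ContinuousLinearMap.toSpanSingleton ℝ T₀)
  have h2 := h1.mono (W₂ := fun _ => 1) (c := |R| + 1) (fun w hw => by
    have h3 := (abs_apply_le_norm (expPt w) 0).trans (hR _ hw)
    rw [expPt_zero, abs_of_pos (Real.exp_pos _)] at h3
    rw [mul_one]
    linarith [le_abs_self R]) (by positivity)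
  have h4 : SymCls (expPt ⁻¹' K) (fun w : E => w) (fun _ => ‖ContinuousLinearMap.id ℝ E - T₀‖ + 1)
      (fun _ _ => ContinuousLinearMap.id ℝ E - T₀) := SymCls.const _ fun _ _ => by linarith
  have h5 := h4.sub (h2.mono (W₂ := fun _ => ‖ContinuousLinearMap.id ℝ E - T₀‖ + 1) (c := 1)
    (fun _ _ => by linarith [norm_nonneg (ContinuousLinearMap.id ℝ E - T₀)]) one_pos)
  obtain ⟨C, -, hC⟩ := h5.bound k
  refine ⟨C * (‖ContinuousLinearMap.id ℝ E - T₀‖ + 1), fun w hw => ?_⟩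
  rw [← norm_iteratedFDeriv_fderiv, e]
  exact hC w hw

namespace IsHalfOpen

variable {T : Set (EuclideanSpace ℝ (Fin n))} {G : Type*} [NormedAddCommGroup G] [NormedSpace ℝ G]
  {F : EuclideanSpace ℝ (Fin n) → G}

lemma mem_nhds_expPt (hT : IsHalfOpen T) {w : E} (hw : expPt w ∈ T) : T ∈ 𝓝 (expPt w) :=
  hT.mem_nhds hw (by rw [expPt_zero]; positivity)

lemma isOpen_preimage (hT : IsHalfOpen T) : IsOpen (expPt ⁻¹' T) :=
  isOpen_iff_mem_nhds.2 fun _ hw =>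
    continuous_expPt.continuousAt.preimage_mem_nhds (hT.mem_nhds_expPt hw)

lemma contDiffOn_comp_expPt (hT : IsHalfOpen T) (hF : ContDiffOn ℝ ∞ F T) :
    ContDiffOn ℝ ∞ (fun w => F (expPt w)) (expPt ⁻¹' T) :=
  hF.comp contDiff_expPt.contDiffOn fun _ hw => hw

lemma symCls_comp_expPt (hT : IsHalfOpen T) (hF : ContDiffOn ℝ ∞ F T) {K : Set E}
    (hK : IsCompact K) (hKT : K ⊆ T) :
    SymCls (expPt ⁻¹' K) (fun w : E => w) (fun _ => 1) (fun _ w => F (expPt w)) :=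
  SymCls.comp_contDiffOn_within (f := fun _ : E => expPt) (fun _ _ => contDiff_expPt.contDiffAt)
    (fun k hk => norm_iteratedFDeriv_expPt_le hK k hk) hT.uniqueDiffOn hK hKT hF (fun _ h => h)
    (fun _ h => hT.mem_nhds_expPt (hKT h))

/-- Functions vanishing on the boundary are stable under b-derivatives, so induction reduces every
order to the bound of the function itself by `C z₀ = C e^{-t}`. -/
lemma norm_iteratedFDeriv_comp_expPt_le (hT : IsHalfOpen T) {K : Set E}
    (hK : IsCompact K) (hKT : K ⊆ T) (k : ℕ) : ∀ {G : Type} [NormedAddCommGroup G]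
    [NormedSpace ℝ G] {F : E → G}, ContDiffOn ℝ ∞ F T → (∀ z ∈ T, z 0 = 0 → F z = 0) →
    ∃ C, ∀ w, expPt w ∈ K →
      ‖iteratedFDeriv ℝ k (fun w => F (expPt w)) w‖ ≤ C * Real.exp (-(w 0)) := by
  induction k with
  | zero =>
    intro G _ _ F hF h0
    obtain ⟨C, -, hC⟩ := hT.exists_norm_le hF h0 hK hKT
    refine ⟨C, fun w hw => ?_⟩
    simpa using hC _ hw
  | succ k ih =>
    intro G _ _ F hF h0
    have hs : ContDiffOn ℝ ∞ (fun z : E => shearZero (n := n) (-(z 0) - 1)) T := by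
      have : ContDiff ℝ ∞ fun z : E => (-(z 0) - 1) := by fun_prop
      unfold shearZero
      exact (contDiff_const.add (this.smul contDiff_const)).contDiffOn
    obtain ⟨C, hC⟩ := ih (F := fun z => (fderivWithin ℝ F T z).comp (shearZero (-(z 0) - 1)))
      ((hF.fderivWithin hT.uniqueDiffOn (by simp)).clm_comp hs) (fun z hz hz0 => by
        -- Where `z₀ = 0` the shear projects onto the tangential directions, in which the derivative
        -- vanishes.
        ext v
        refine hT.fderivWithin_tangential hF h0 hz hz0 ?_
        simp [shearZero_apply, hz0])
    refine ⟨C, fun w hw => ?_⟩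
    rw [← norm_iteratedFDeriv_fderiv]
    have e : fderiv ℝ (fun w => F (expPt w)) =ᶠ[𝓝 w] fun w =>
        (fderivWithin ℝ F T (expPt w)).comp (shearZero (-(expPt w 0) - 1)) := by
      filter_upwards [hT.isOpen_preimage.mem_nhds (hKT hw)] with y hy
      have hy' := hT.mem_nhds_expPt hy
      rw [fderivWithin_of_mem_nhds hy']
      exact (((hF.contDiffAt hy').differentiableAt (by simp)).hasFDerivAt.comp y
        (hasFDerivAt_expPt y)).fderiv
    rw [(e.iteratedFDeriv ℝ k).eq_of_nhds]
    exact hC w hw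

lemma symCls_comp_expPt_of_zero {G : Type} [NormedAddCommGroup G] [NormedSpace ℝ G] {F : E → G}
    (hT : IsHalfOpen T) (hF : ContDiffOn ℝ ∞ F T)
    (h0 : ∀ z ∈ T, z 0 = 0 → F z = 0) {K : Set E} (hK : IsCompact K) (hKT : K ⊆ T) :
    SymCls (expPt ⁻¹' K) (fun w : E => w) (fun w => Real.exp (-(w 0))) (fun _ w => F (expPt w)) :=
  SymCls.of_le (fun _ hw => (hT.contDiffOn_comp_expPt hF).contDiffAt
    (hT.isOpen_preimage.mem_nhds (hKT hw))) (fun _ _ => (Real.exp_pos _).le)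
    fun k => (hT.norm_iteratedFDeriv_comp_expPt_le hK hKT k hF h0).imp fun _ h w hw => h w hw

end IsHalfOpen
end HalfOpen
end

noncomputable section


/-! ### Charts and boundary defining functions in logarithmic coordinates -/

section ChartGeometry

open Filter

variable {n : ℕ} [NeZero n] {M : Type*} [TopologicalSpace M]
  {κ : OpenPartialHomeomorph M (EuclideanHalfSpace n)}

local notation "E" => EuclideanSpace ℝ (Fin n)

lemma isHalfOpen_target (κ : OpenPartialHomeomorph M (EuclideanHalfSpace n)) :
    IsHalfOpen (κ.extend (𝓡∂ n)).target := by
  refine ⟨(𝓡∂ n).symm ⁻¹' κ.target, κ.open_target.preimage (𝓡∂ n).continuous_symm, ?_⟩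
  rw [κ.extend_target, range_modelWithCornersEuclideanHalfSpace]

lemma isOpen_logDomain (κ : OpenPartialHomeomorph M (EuclideanHalfSpace n)) :
    IsOpen (logDomain κ) := (isHalfOpen_target κ).isOpen_preimage

/-- The points of `logDomain κ` over a subset of `M`. -/
def logOver (κ : OpenPartialHomeomorph M (EuclideanHalfSpace n)) (S : Set M) : Set E :=
  {w | w ∈ logDomain κ ∧ logInv κ w ∈ S}

lemma logOver_eq {S : Set M} (hS : S ⊆ κ.source) :
    logOver κ S = expPt ⁻¹' (κ.extend (𝓡∂ n) '' S) := by
  ext w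
  constructor
  · rintro ⟨h1, h2⟩
    exact ⟨_, h2, (κ.extend (𝓡∂ n)).right_inv h1⟩
  · rintro ⟨p, hp, h⟩
    have hp' : p ∈ (κ.extend (𝓡∂ n)).source := by rw [κ.extend_source]; exact hS hp
    have hw : expPt w ∈ (κ.extend (𝓡∂ n)).target := by rw [← h]; exact (κ.extend _).map_source hp'
    refine ⟨hw, ?_⟩
    unfold logInv
    rwa [← h, (κ.extend (𝓡∂ n)).left_inv hp']

lemma isCompact_extend_image {S : Set M} (hS : IsCompact S) (h : S ⊆ κ.source) :
    IsCompact (κ.extend (𝓡∂ n) '' S) :=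
  hS.image_of_continuousOn ((κ.continuousOn_extend).mono (by rwa [κ.extend_source]))

lemma extend_image_subset {S : Set M} (h : S ⊆ κ.source) :
    κ.extend (𝓡∂ n) '' S ⊆ (κ.extend (𝓡∂ n)).target := by
  rintro _ ⟨p, hp, rfl⟩
  exact (κ.extend _).map_source (by rw [κ.extend_source]; exact h hp)

lemma isClosed_logOver {S : Set M} (hS : IsCompact S) (h : S ⊆ κ.source) :
    IsClosed (logOver κ S) := by
  rw [logOver_eq h]
  exact (isCompact_extend_image hS h).isClosed.preimage continuous_expPt

lemma exists_logBox_of_logOver {S : Set M} (hS : IsCompact S) (h : S ⊆ κ.source) :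
    ∃ R, 0 ≤ R ∧ logOver κ S ⊆ logBox n R := by
  obtain ⟨R, hR⟩ := (isCompact_extend_image hS h).isBounded.exists_norm_le
  rw [logOver_eq h]
  refine ⟨|R| + 1, by positivity, fun w hw => ?_⟩
  have h1 := fun i => (abs_apply_le_norm (expPt w) i).trans ((hR _ hw).trans (le_abs_self R))
  refine ⟨?_, fun i hi => ?_⟩
  · have := h1 0
    rw [expPt_zero, abs_of_pos (Real.exp_pos _)] at this
    have h2 := Real.add_one_le_exp (-(w 0))
    linarith
  · have := h1 i
    rw [expPt_of_ne w hi] at this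
    linarith

open scoped Classical in
/-- A function on `M` in logarithmic coordinates, extended by zero. -/
def logLift (κ : OpenPartialHomeomorph M (EuclideanHalfSpace n)) (θ : M → ℝ) (w : E) : ℝ :=
  if w ∈ logDomain κ then θ (logInv κ w) else 0

lemma logLift_of_mem (θ : M → ℝ) {w : E} (hw : w ∈ logDomain κ) :
    logLift κ θ w = θ (logInv κ w) := if_pos hw

lemma chartMul_eq (θ : M → ℝ) (f : E → ℂ) :
    chartMul κ θ f = fun w => (logLift κ θ w : ℂ) * f w := by
  funext w
  unfold chartMul logLift
  split_ifs <;> simp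

lemma logLift_eq_zero {θ : M → ℝ} {S : Set M} (h : ∀ p, p ∉ S → θ p = 0) {w : E}
    (hw : w ∉ logOver κ S) : logLift κ θ w = 0 := by
  unfold logLift
  split_ifs with h1
  · exact h _ fun h2 => hw ⟨h1, h2⟩
  · rfl

/-- Extension by zero of symbols defined over a compact subset of the chart domain. -/
lemma SymCls.of_logOver {ι G : Type*} [NormedAddCommGroup G] [NormedSpace ℝ G] {S : Set M}
    (hS : IsCompact S) (h : S ⊆ κ.source) {W : E × ι → ℝ} {f : ι → E → G}
    (hf : SymCls (logOver κ S ×ˢ Set.univ) (fun a : E × ι => a.1) W (fun a => f a.2))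
    (hW : ∀ a, 0 ≤ W a) (h0 : ∀ i w, w ∉ logOver κ S → f i w = 0) :
    SymCls Set.univ (fun a : E × ι => a.1) W (fun a => f a.2) := by
  have h1 : SymCls ((logOver κ S)ᶜ ×ˢ Set.univ) (fun a : E × ι => a.1) W (fun a => f a.2) :=
    SymCls.zero (fun a _ => hW a) fun a ha => by
      filter_upwards [(isClosed_logOver hS h).isOpen_compl.mem_nhds ha.1] with w hw
        using h0 _ _ hw
  refine (hf.union h1).mono_set fun a _ => ?_
  by_cases ha : a.1 ∈ logOver κ S
  · exact Or.inl ⟨ha, trivial⟩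
  · exact Or.inr ⟨ha, trivial⟩

lemma SymCls.of_logOver' {G : Type*} [NormedAddCommGroup G] [NormedSpace ℝ G] {S : Set M}
    (hS : IsCompact S) (h : S ⊆ κ.source) {W : E → ℝ} {f : E → G}
    (hf : SymCls (logOver κ S) (fun a : E => a) W (fun _ => f))
    (hW : ∀ a, 0 ≤ W a) (h0 : ∀ w, w ∉ logOver κ S → f w = 0) :
    SymCls Set.univ (fun a : E => a) W (fun _ => f) := by
  have h1 : SymCls ((logOver κ S)ᶜ) (fun a : E => a) W (fun _ => f) :=
    SymCls.zero (fun a _ => hW a) fun a ha => by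
      filter_upwards [(isClosed_logOver hS h).isOpen_compl.mem_nhds ha] with w hw
        using h0 _ hw
  exact (hf.union h1).mono_set fun a _ => em _

variable [ChartedSpace (EuclideanHalfSpace n) M]

section Smooth

lemma contDiffOn_comp_extend_symm (hκ : κ ∈ IsManifold.maximalAtlas (𝓡∂ n) ∞ M) {θ : M → ℝ}
    (hθ : ContMDiff (𝓡∂ n) 𝓘(ℝ, ℝ) ∞ θ) :
    ContDiffOn ℝ ∞ (fun z => θ ((κ.extend (𝓡∂ n)).symm z)) (κ.extend (𝓡∂ n)).target := by
  have h1 := contMDiffOn_extend_symm hκ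
  rw [← contMDiffOn_iff_contDiffOn]
  have e : (κ.extend (𝓡∂ n)).target = (𝓡∂ n) '' κ.target := by
    rw [κ.extend_target, (𝓡∂ n).image_eq]
  rw [e]
  exact hθ.comp_contMDiffOn h1

lemma contDiffOn_comp_logInv (hκ : κ ∈ IsManifold.maximalAtlas (𝓡∂ n) ∞ M) {θ : M → ℝ}
    (hθ : ContMDiff (𝓡∂ n) 𝓘(ℝ, ℝ) ∞ θ) :
    ContDiffOn ℝ ∞ (fun w => θ (logInv κ w)) (logDomain κ) :=
  (isHalfOpen_target κ).contDiffOn_comp_expPt (contDiffOn_comp_extend_symm hκ hθ)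

lemma symCls_comp_logInv (hκ : κ ∈ IsManifold.maximalAtlas (𝓡∂ n) ∞ M) {θ : M → ℝ}
    (hθ : ContMDiff (𝓡∂ n) 𝓘(ℝ, ℝ) ∞ θ) {S : Set M} (hS : IsCompact S) (h : S ⊆ κ.source) :
    SymCls (logOver κ S) (fun w : E => w) (fun _ => 1) (fun _ w => θ (logInv κ w)) := by
  rw [logOver_eq h]
  exact (isHalfOpen_target κ).symCls_comp_expPt (contDiffOn_comp_extend_symm hκ hθ)
    (isCompact_extend_image hS h) (extend_image_subset h)

lemma SymCls.logLift_congr {S : Set M} {W : E → ℝ} {θ : M → ℝ}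
    (h : SymCls (logOver κ S) (fun w : E => w) W (fun _ w => θ (logInv κ w))) :
    SymCls (logOver κ S) (fun w : E => w) W (fun _ => logLift κ θ) :=
  h.congr fun w hw => by
    filter_upwards [(isOpen_logDomain κ).mem_nhds hw.1] with y hy using (logLift_of_mem θ hy).symm

lemma IsCutoff.symCls_mul_logLift (hκ : κ ∈ IsManifold.maximalAtlas (𝓡∂ n) ∞ M) {χ : M → ℝ}
    (hχ : IsCutoff κ χ) {W : E → ℝ} {θ : M → ℝ} (hW : ∀ w, 0 ≤ W w)
    (h : SymCls (logOver κ (tsupport χ)) (fun w : E => w) W (fun _ w => θ (logInv κ w))) :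
    SymCls Set.univ (fun w : E => w) W (fun _ => logLift κ (fun p => χ p * θ p)) := by
  refine SymCls.of_logOver' hχ.compact hχ.subset ?_ hW fun w hw =>
    logLift_eq_zero (fun p hp => by rw [image_eq_zero_of_notMem_tsupport hp, zero_mul]) hw
  refine SymCls.logLift_congr ?_
  exact ((symCls_comp_logInv hκ hχ.smooth hχ.compact hχ.subset).mul h).mono (c := 1)
    (fun _ _ => le_rfl) one_pos

lemma IsCutoff.symCls_logLift (hκ : κ ∈ IsManifold.maximalAtlas (𝓡∂ n) ∞ M) {χ : M → ℝ}
    (hχ : IsCutoff κ χ) :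
    SymCls Set.univ (fun w : E => w) (fun _ => 1) (fun _ => logLift κ χ) :=
  SymCls.of_logOver' hχ.compact hχ.subset
    (SymCls.logLift_congr (symCls_comp_logInv hκ hχ.smooth hχ.compact hχ.subset))
    (fun _ => zero_le_one) fun w hw =>
    logLift_eq_zero (fun p hp => image_eq_zero_of_notMem_tsupport hp) hw

end Smooth

section BoundaryDefining

variable [IsManifold (𝓡∂ n) ∞ M] {x : M → ℝ}

/-- A chart of the maximal atlas is a local diffeomorphism and preserves interior points, so the
question is transferred to the model half space. -/
lemma isInteriorPoint_extend_symm (hκ : κ ∈ IsManifold.maximalAtlas (𝓡∂ n) ∞ M) {z : E}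
    (hz : z ∈ (κ.extend (𝓡∂ n)).target) :
    (𝓡∂ n).IsInteriorPoint ((κ.extend (𝓡∂ n)).symm z) ↔ 0 < z 0 := by
  have hp : (κ.extend (𝓡∂ n)).symm z ∈ κ.source := by
    rw [← κ.extend_source (I := 𝓡∂ n)]; exact (κ.extend _).map_target hz
  have hl : IsLocalDiffeomorphAt (𝓡∂ n) (𝓡∂ n) ∞ κ ((κ.extend (𝓡∂ n)).symm z) :=
    ⟨{ κ.toPartialEquiv with
        open_source := κ.open_source
        open_target := κ.open_target
        contMDiffOn_toFun := contMDiffOn_of_mem_maximalAtlas hκ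
        contMDiffOn_invFun := contMDiffOn_symm_of_mem_maximalAtlas hκ }, hp, fun _ _ => rfl⟩
  rw [hl.isInteriorPoint_iff (by simp), ModelWithCorners.isInteriorPoint_iff]
  have e : extChartAt (𝓡∂ n) (κ ((κ.extend (𝓡∂ n)).symm z)) (κ ((κ.extend (𝓡∂ n)).symm z)) = z :=
    (κ.extend (𝓡∂ n)).right_inv hz
  rw [e]
  have e2 : (extChartAt (𝓡∂ n) (κ ((κ.extend (𝓡∂ n)).symm z))).target = Set.range (𝓡∂ n) := by
    rw [extChartAt_target, chartAt_self_eq]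
    simp
  rw [e2, interior_range_modelWithCornersEuclideanHalfSpace]
  rfl

lemma IsBoundaryDefining.pos_iff (hx : IsBoundaryDefining n x)
    (hκ : κ ∈ IsManifold.maximalAtlas (𝓡∂ n) ∞ M) {z : E} (hz : z ∈ (κ.extend (𝓡∂ n)).target) :
    0 < x ((κ.extend (𝓡∂ n)).symm z) ↔ 0 < z 0 := by
  rw [← isInteriorPoint_extend_symm hκ hz, (hx.nonneg _).lt_iff_ne', ne_eq, hx.zero_iff,
    ← ModelWithCorners.compl_interior]
  simp [ModelWithCorners.interior]

lemma IsBoundaryDefining.eq_zero (hx : IsBoundaryDefining n x)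
    (hκ : κ ∈ IsManifold.maximalAtlas (𝓡∂ n) ∞ M) {z : E} (hz : z ∈ (κ.extend (𝓡∂ n)).target)
    (h0 : z 0 = 0) : x ((κ.extend (𝓡∂ n)).symm z) = 0 :=
  le_antisymm (not_lt.1 fun h => by
    have := (hx.pos_iff hκ hz).1 h
    rw [h0] at this
    exact lt_irrefl _ this) (hx.nonneg _)

/-- If the derivative in the chart vanished, composing with the chart would make the manifold
derivative of `x` vanish at a boundary point. -/
lemma IsBoundaryDefining.fderivWithin_ne_zero (hx : IsBoundaryDefining n x)
    (hκ : κ ∈ IsManifold.maximalAtlas (𝓡∂ n) ∞ M) {z : E} (hz : z ∈ (κ.extend (𝓡∂ n)).target)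
    (h0 : z 0 = 0) :
    fderivWithin ℝ (fun z => x ((κ.extend (𝓡∂ n)).symm z)) (κ.extend (𝓡∂ n)).target z ≠ 0 := by
  set p := (κ.extend (𝓡∂ n)).symm z with hp
  have hps : p ∈ κ.source := by
    rw [← κ.extend_source (I := 𝓡∂ n)]; exact (κ.extend _).map_target hz
  have hzp : κ.extend (𝓡∂ n) p = z := (κ.extend (𝓡∂ n)).right_inv hz
  intro hf
  refine hx.deriv_ne_zero p ((hx.zero_iff p).1 (hx.eq_zero hκ hz h0)) ?_
  have hF := contDiffOn_comp_extend_symm hκ hx.smooth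
  have h1 : HasFDerivWithinAt (fun z => x ((κ.extend (𝓡∂ n)).symm z)) (0 : E →L[ℝ] ℝ)
      (κ.extend (𝓡∂ n)).target (κ.extend (𝓡∂ n) p) := by
    rw [hzp, ← hf]; exact (hF.differentiableOn (by simp) z hz).hasFDerivWithinAt
  have h2 : MDifferentiableAt (𝓡∂ n) 𝓘(ℝ, E) (κ.extend (𝓡∂ n)) p :=
    (κ.contMDiffAt_extend hκ hps).mdifferentiableAt (by simp)
  have h3 := (h1.hasMFDerivWithinAt).comp p h2.hasMFDerivAt.hasMFDerivWithinAt
    (s := κ.source) (fun q hq => (κ.extend (𝓡∂ n)).map_source (by rwa [κ.extend_source]))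
  have h4 := h3.hasMFDerivAt (κ.open_source.mem_nhds hps)
  have h5 : HasMFDerivAt (𝓡∂ n) 𝓘(ℝ, ℝ) x p
      ((0 : E →L[ℝ] ℝ).comp (mfderiv (𝓡∂ n) 𝓘(ℝ, E) (κ.extend (𝓡∂ n)) p)) := by
    refine h4.congr_of_eventuallyEq ?_
    filter_upwards [κ.open_source.mem_nhds hps] with q hq
    simp only [Function.comp_apply]
    rw [(κ.extend (𝓡∂ n)).left_inv (by rwa [κ.extend_source])]
  rw [h5.mfderiv]
  exact ContinuousLinearMap.zero_comp _

variable (hx : IsBoundaryDefining n x) (hκ : κ ∈ IsManifold.maximalAtlas (𝓡∂ n) ∞ M)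
include hx hκ

lemma IsBoundaryDefining.pos {w : E} (hw : w ∈ logDomain κ) : 0 < x (logInv κ w) :=
  (hx.pos_iff hκ hw).2 (by rw [expPt_zero]; positivity)

lemma IsBoundaryDefining.log_inv_pos {w : E} (hw : w ∈ logDomain κ) :
    Real.log 2 ≤ Real.log ((x (logInv κ w))⁻¹) := by
  have h1 := hx.pos hκ hw
  refine Real.log_le_log two_pos ?_
  rw [le_inv_comm₀ two_pos h1]
  exact (hx.le_half _).trans (by norm_num)

variable {S : Set M} (hS : IsCompact S) (h : S ⊆ κ.source)
include hS h

lemma IsBoundaryDefining.symCls : SymCls (logOver κ S) (fun w : E => w)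
    (fun w => Real.exp (-(w 0))) (fun _ w => x (logInv κ w)) := by
  rw [logOver_eq h]
  exact (isHalfOpen_target κ).symCls_comp_expPt_of_zero (contDiffOn_comp_extend_symm hκ hx.smooth)
    (fun z hz h0 => hx.eq_zero hκ hz h0) (isCompact_extend_image hS h) (extend_image_subset h)

lemma IsBoundaryDefining.exists_le : ∃ c, 0 < c ∧ ∀ w ∈ logOver κ S,
    c * Real.exp (-(w 0)) ≤ x (logInv κ w) := by
  obtain ⟨c, hc, hc'⟩ := (isHalfOpen_target κ).exists_le_of_fderivWithin_ne_zero
    (contDiffOn_comp_extend_symm hκ hx.smooth) (fun z hz h0 => hx.eq_zero hκ hz h0)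
    (fun z hz h0 => (hx.pos_iff hκ hz).2 h0) (fun z hz h0 => hx.fderivWithin_ne_zero hκ hz h0)
    (isCompact_extend_image hS h) (extend_image_subset h)
  refine ⟨c, hc, fun w hw => ?_⟩
  rw [logOver_eq h] at hw
  have := hc' _ hw
  rwa [expPt_zero] at this

lemma IsBoundaryDefining.symCls_rpow (r : ℝ) : SymCls (logOver κ S) (fun w : E => w)
    (fun w => Real.exp (-(w 0)) ^ r) (fun _ w => x (logInv κ w) ^ r) := by
  obtain ⟨c, hc, hc'⟩ := hx.exists_le hκ hS h
  exact (hx.symCls hκ hS h).rpow hc (fun _ _ => Real.exp_pos _) hc' r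

/-- `log x⁻¹` is `t` minus the logarithm of the ratio of `x` to `e^{-t}`. The latter is bounded with
all its derivatives, because `x` and `e^{-t}` are comparable with symbol bounds. -/
lemma IsBoundaryDefining.symCls_log : SymCls (logOver κ S) (fun w : E => w)
    (fun w => japanese (w 0)) (fun _ w => Real.log ((x (logInv κ w))⁻¹)) := by
  obtain ⟨c, hc, hc'⟩ := hx.exists_le hκ hS h
  have h1 := ((hx.symCls hκ hS h).log_sub hc (fun _ _ => Real.exp_pos _) hc').mono
    (W₂ := fun w => japanese (w 0)) (c := 1) (fun w _ => by linarith [one_le_japanese (w 0)])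
    one_pos
  have h2 : SymCls (logOver κ S) (fun w : E => w) (fun w => japanese (w 0)) (fun a _ => a 0) :=
    SymCls.const _ fun w _ => abs_le_japanese (w 0)
  refine (h2.sub h1).congr fun w hw => Eventually.of_forall fun y => ?_
  simp only [Real.log_exp, Real.log_inv]
  ring

/-- The bound `x ≤ C e^{-t}` gives `log x⁻¹ ≥ t - log C`, and `x ≤ 1/2` gives `log x⁻¹ ≥ log 2`. A
multiple of the second inequality absorbs the additive constants of the first. -/
lemma IsBoundaryDefining.exists_le_log : ∃ c, 0 < c ∧ ∀ w ∈ logOver κ S,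
    c * japanese (w 0) ≤ Real.log ((x (logInv κ w))⁻¹) := by
  obtain ⟨C, hC, hC'⟩ := (hx.symCls hκ hS h).bound 0
  obtain ⟨R, hR, hbox⟩ := exists_logBox_of_logOver hS h
  have hlog2 : 0 < Real.log 2 := Real.log_pos (by norm_num)
  set D := 1 + 2 * R + |Real.log C| with hD
  have hD0 : 0 < D := by positivity
  refine ⟨(1 + D / Real.log 2)⁻¹, by positivity, fun w hw => ?_⟩
  have hxp := hx.pos hκ hw.1
  have h1 := hC' w hw
  rw [norm_iteratedFDeriv_zero, Real.norm_of_nonneg hxp.le] at h1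
  have h2 := Real.log_le_log hxp h1
  rw [Real.log_mul hC.ne' (Real.exp_pos _).ne', Real.log_exp] at h2
  have h3 := hx.log_inv_pos hκ hw.1
  have h4 : |w 0| ≤ w 0 + 2 * R := by
    have := (hbox hw).1
    rw [abs_le]; constructor <;> linarith
  have h5 := japanese_le_one_add (w 0)
  rw [Real.log_inv] at h3 ⊢
  rw [inv_mul_le_iff₀ (by positivity)]
  have h6 : D ≤ D / Real.log 2 * -Real.log (x (logInv κ w)) := by
    rw [div_mul_eq_mul_div, le_div_iff₀ hlog2]
    exact mul_le_mul_of_nonneg_left h3 hD0.le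
  have := le_abs_self (Real.log C)
  linarith

lemma IsBoundaryDefining.symCls_weight (r j : ℝ) : SymCls (logOver κ S) (fun w : E => w)
    (fun w => Real.exp (-(w 0)) ^ r * japanese (w 0) ^ j)
    (fun _ w => x (logInv κ w) ^ r * Real.log ((x (logInv κ w))⁻¹) ^ j) := by
  obtain ⟨c, hc, hc'⟩ := hx.exists_le_log hκ hS h
  exact (hx.symCls_rpow hκ hS h r).mul
    ((hx.symCls_log hκ hS h).rpow hc (fun _ _ => japanese_pos _) hc' j)

end BoundaryDefining

end ChartGeometry
end

noncomputable section


/-! ### Dual norms and functions logarithmically homogeneous in the fibres -/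

section DualNorm

variable {n : ℕ} [NeZero n]

local notation "E" => EuclideanSpace ℝ (Fin n)

/-- The bracket `⟨log ⟨ζ⟩⟩`. -/
def logBracket {V : Type*} [NormedAddCommGroup V] (ζ : V) : ℝ := japanese (Real.log (japanese ‖ζ‖))

lemma one_le_logBracket {V : Type*} [NormedAddCommGroup V] (ζ : V) : 1 ≤ logBracket ζ :=
  one_le_japanese _

lemma logBracket_pos {V : Type*} [NormedAddCommGroup V] (ζ : V) : 0 < logBracket ζ :=
  japanese_pos _

lemma logBracket_rpow {V : Type*} [NormedAddCommGroup V] (ℓ : ℝ) (ζ : V) :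
    logBracket ζ ^ ℓ = logWeight 0 ℓ ζ := by
  simp [logBracket, logWeight]

lemma log_japanese_nonneg (t : ℝ) : 0 ≤ Real.log (japanese t) :=
  Real.log_nonneg (one_le_japanese t)

variable {B : EuclideanSpace ℝ (Fin n) →L[ℝ] EuclideanSpace ℝ (Fin n) →L[ℝ] ℝ}

lemma continuous_norm_bilin : Continuous fun B : E →L[ℝ] E →L[ℝ] ℝ => ‖B‖ :=
  @continuous_norm (E →L[ℝ] E →L[ℝ] ℝ) _

lemma dualNorm_smul {c : ℝ} (hc : 0 ≤ c) (ζ : E) : dualNorm B (c • ζ) = c * dualNorm B ζ := by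
  unfold dualNorm
  rw [← smul_eq_mul, ← Real.sSup_smul_of_nonneg hc]
  congr 1
  ext d
  simp only [Set.mem_setOf_eq, Set.mem_smul_set]
  constructor
  · rintro ⟨a, ha, rfl⟩
    exact ⟨_, ⟨a, ha, rfl⟩, by rw [inner_smul_left]; simp⟩
  · rintro ⟨_, ⟨a, ha, rfl⟩, rfl⟩
    exact ⟨a, ha, by rw [inner_smul_left]; simp⟩

/-- Test the supremum on the multiple of `ζ` of length `C⁻¹`, which lies in the unit ball of `B`. -/
lemma norm_le_mul_dualNorm (hpos : ∀ a, a ≠ 0 → 0 < B a a) {C : ℝ} (hC : 0 < C)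
    (hB : ‖B‖ ≤ C ^ 2) (ζ : E) : ‖ζ‖ ≤ C * dualNorm B ζ := by
  -- Positivity on the compact unit sphere bounds the set; for an unbounded set the real supremum
  -- would be the default value `0`.
  have hbdd : BddAbove {c : ℝ | ∃ a : E, B a a ≤ 1 ∧ c = inner ℝ ζ a} := by
    have hcont : Continuous fun a : E => B a a := by fun_prop
    obtain ⟨m, hm, hm'⟩ : ∃ m, 0 < m ∧ ∀ a : E, ‖a‖ = 1 → m ≤ B a a := by
      rcases (Metric.sphere (0 : E) 1).eq_empty_or_nonempty with he | hne
      · exact ⟨1, one_pos, fun a ha => by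
          have : a ∈ Metric.sphere (0 : E) 1 := by simpa using ha
          rw [he] at this; exact this.elim⟩
      · obtain ⟨a, ha, hmin⟩ := (isCompact_sphere (0 : E) 1).exists_isMinOn hne hcont.continuousOn
        refine ⟨B a a, hpos a ?_, fun b hb => hmin (by simpa using hb)⟩
        rintro rfl
        simp at ha
    refine ⟨‖ζ‖ * Real.sqrt m⁻¹, ?_⟩
    rintro _ ⟨a, ha, rfl⟩
    refine (real_inner_le_norm ζ a).trans (mul_le_mul_of_nonneg_left ?_ (norm_nonneg _))
    refine Real.le_sqrt_of_sq_le ?_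
    rcases eq_or_ne a 0 with rfl | ha0
    · simpa using hm.le
    have hn : ‖a‖ ≠ 0 := norm_ne_zero_iff.2 ha0
    have h1 := hm' (‖a‖⁻¹ • a) (by rw [norm_smul, norm_inv, norm_norm, inv_mul_cancel₀ hn])
    simp only [map_smul, ContinuousLinearMap.smul_apply, smul_eq_mul] at h1
    rw [← mul_assoc, ← mul_inv, ← sq, ← div_eq_inv_mul, le_div_iff₀ (by positivity)] at h1
    rw [← one_div, le_div_iff₀ hm, mul_comm]
    exact h1.trans ha
  rcases eq_or_ne ζ 0 with rfl | hζ
  · have := le_csSup hbdd ⟨0, by simp, rfl⟩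
    simp only [inner_zero_right] at this
    rw [norm_zero]
    exact mul_nonneg hC.le this
  have hn : 0 < ‖ζ‖ := norm_pos_iff.2 hζ
  have h1 : inner ℝ ζ ((C * ‖ζ‖)⁻¹ • ζ) ≤ dualNorm B ζ := by
    refine le_csSup hbdd ⟨_, ?_, rfl⟩
    have h2 := (le_abs_self _).trans ((B ((C * ‖ζ‖)⁻¹ • ζ)).le_opNorm ((C * ‖ζ‖)⁻¹ • ζ))
    refine h2.trans ?_
    have h3 : ‖(C * ‖ζ‖)⁻¹ • ζ‖ = C⁻¹ := by
      rw [norm_smul, norm_inv, Real.norm_of_nonneg (by positivity)]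
      field_simp
    have h4 := (B.le_opNorm ((C * ‖ζ‖)⁻¹ • ζ))
    rw [h3] at h4 ⊢
    calc ‖B ((C * ‖ζ‖)⁻¹ • ζ)‖ * C⁻¹ ≤ (C ^ 2 * C⁻¹) * C⁻¹ := by
          gcongr
          exact h4.trans (by gcongr)
      _ = 1 := by field_simp
  rw [inner_smul_right, real_inner_self_eq_norm_sq] at h1
  have e : (C * ‖ζ‖)⁻¹ * ‖ζ‖ ^ 2 = C⁻¹ * ‖ζ‖ := by field_simp
  rw [e, inv_mul_le_iff₀ hC] at h1
  exact h1

lemma log_norm_div_le {R : ℝ} (hR : 0 < R) : ∃ C, 0 < C ∧ ∀ ζ : E, R ≤ ‖ζ‖ →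
    |Real.log (‖ζ‖ / R)| ≤ C * logBracket ζ ∧ logBracket ζ ≤ Real.log (‖ζ‖ / R) + C := by
  refine ⟨2 + |Real.log R| + |Real.log (1 + R)|, by positivity, fun ζ hζ => ?_⟩
  have hζ0 : 0 < ‖ζ‖ := lt_of_lt_of_le hR hζ
  have h0 : 0 ≤ Real.log (‖ζ‖ / R) := Real.log_nonneg (by rwa [le_div_iff₀ hR, one_mul])
  have h1 : Real.log ‖ζ‖ ≤ logBracket ζ := by
    refine le_trans ?_ (abs_le_japanese _)
    refine le_trans ?_ (le_abs_self _)
    exact Real.log_le_log hζ0 ((le_abs_self _).trans (abs_le_japanese _))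
  have h2 := one_le_logBracket ζ
  have h3 := neg_abs_le (Real.log R)
  have h4 := le_abs_self (Real.log (1 + R))
  have h5 := abs_nonneg (Real.log (1 + R))
  have h6 := abs_nonneg (Real.log R)
  constructor
  · rw [abs_of_nonneg h0, Real.log_div hζ0.ne' hR.ne']
    nlinarith
  · have h7 : logBracket ζ ≤ 1 + Real.log (japanese ‖ζ‖) := by
      have := japanese_le_one_add (Real.log (japanese ‖ζ‖))
      rwa [abs_of_nonneg (log_japanese_nonneg _)] at this
    have h8 : Real.log (japanese ‖ζ‖) ≤ Real.log ((1 + R) * (‖ζ‖ / R)) := by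
      refine Real.log_le_log (japanese_pos _) ((japanese_le_one_add _).trans ?_)
      rw [abs_norm, mul_div_assoc', le_div_iff₀ hR]
      nlinarith
    rw [Real.log_mul (by positivity) (by positivity)] at h8
    linarith

/-- The point of the sphere of radius `R` on the ray through `ζ`. -/
def radialPt (R : ℝ) (ζ : E) : E := (R / ‖ζ‖) • ζ

lemma SymCls.comp_index {α β V G : Type*} [NormedAddCommGroup V] [NormedSpace ℝ V]
    [NormedAddCommGroup G] [NormedSpace ℝ G] {S : Set α} {S' : Set β} {p : α → V} {W : α → ℝ}
    {f : α → V → G} (h : SymCls S p W f) (σ : β → α) (hσ : ∀ b ∈ S', σ b ∈ S) :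
    SymCls S' (fun b => p (σ b)) (fun b => W (σ b)) (fun b => f (σ b)) :=
  (h.reindex σ).mono_set hσ

lemma norm_radialPt {R : ℝ} (hR : 0 < R) {ζ : E} (hζ : R ≤ ‖ζ‖) : ‖radialPt R ζ‖ = R := by
  have hζ0 : 0 < ‖ζ‖ := lt_of_lt_of_le hR hζ
  rw [radialPt, norm_smul, Real.norm_of_nonneg (by positivity), div_mul_cancel₀ _ hζ0.ne']

lemma SymCls.radial {Γ : E → E → ℝ} {A : Set E} {R : ℝ} (hR : 0 < R)
    (h1 : SymCls (A ×ˢ Metric.closedBall 0 R) (fun a : E × E => a.1) (fun _ => 1)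
      (fun a w => Γ w a.2)) :
    SymCls (A ×ˢ {ζ | R ≤ ‖ζ‖}) (fun a : E × E => a.1) (fun _ => 1)
      (fun a w => Γ w (radialPt R a.2)) :=
  h1.comp_index (fun a : E × E => (a.1, radialPt R a.2)) fun a ha =>
    ⟨ha.1, mem_closedBall_zero_iff.2 (norm_radialPt hR ha.2).le⟩

lemma SymCls.one_le_logBracket {S : Set (E × E)} {f : E × E → E → ℝ}
    (h : SymCls S (fun a : E × E => a.1) (fun _ => 1) f) :
    SymCls S (fun a : E × E => a.1) (fun a => logBracket a.2) f :=
  h.mono (c := 1) (fun a _ => by rw [one_mul]; exact _root_.one_le_logBracket _) one_pos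

/-- Beyond radius `R` the function is `log(‖ζ‖/R)`, which does not depend on `w`, plus its value on
a sphere. The derivatives in `w` are therefore controlled by those over a compact set of fibre
variables. -/
lemma SymCls.of_log_homogeneous {Γ : E → E → ℝ} {A : Set E} {R : ℝ} (hR : 0 < R)
    (h1 : SymCls (A ×ˢ Metric.closedBall 0 R) (fun a : E × E => a.1) (fun _ => 1)
      (fun a w => Γ w a.2))
    (hR' : ∀ w₀ ∈ A, ∀ᶠ w in 𝓝 w₀, ∀ ζ : E, R ≤ ‖ζ‖ →
      Γ w ζ = Real.log (‖ζ‖ / R) + Γ w (radialPt R ζ)) :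
    SymCls (A ×ˢ Set.univ) (fun a : E × E => a.1) (fun a => logBracket a.2)
      (fun a w => Γ w a.2) := by
  obtain ⟨C, hC, hC'⟩ := log_norm_div_le (n := n) hR
  have h4 : SymCls (A ×ˢ {ζ | R ≤ ‖ζ‖}) (fun a : E × E => a.1)
      (fun a => logBracket a.2) (fun a _ => Real.log (‖a.2‖ / R)) := by
    have h6 : ∀ a ∈ A ×ˢ {ζ : E | R ≤ ‖ζ‖}, ‖Real.log (‖a.2‖ / R)‖ ≤ C * logBracket a.2 :=
      fun a ha => (hC' a.2 ha.2).1
    exact (SymCls.const (p := fun a : E × E => a.1) (fun a : E × E => Real.log (‖a.2‖ / R))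
      h6).mono (c := C) (fun _ _ => le_rfl) hC
  have h5 := (h4.add (SymCls.radial hR h1).one_le_logBracket).congr (f₂ := fun a w => Γ w a.2)
    fun a ha => by filter_upwards [hR' a.1 ha.1] with w hw using (hw a.2 ha.2).symm
  refine (h1.one_le_logBracket.union h5).mono_set fun a ha => ?_
  rcases le_total ‖a.2‖ R with hle | hle
  · exact Or.inl ⟨ha.1, by simpa using hle⟩
  · exact Or.inr ⟨ha.1, hle⟩

end DualNorm

/-! ### The function `log ρ⁻¹` in logarithmic coordinates -/

section FiberNorm

open Filter

variable {n : ℕ} [NeZero n] {M : Type*} [TopologicalSpace M]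
  {κ : OpenPartialHomeomorph M (EuclideanHalfSpace n)} [ChartedSpace (EuclideanHalfSpace n) M]
  {g : BMetric n M} (ρ : BInvNorm g) (hκ : κ ∈ IsManifold.maximalAtlas (𝓡∂ n) ∞ M)
include hκ

local notation "E" => EuclideanSpace ℝ (Fin n)

lemma BInvNorm.log_two_le {w : E} (hw : w ∈ logDomain κ) (ζ : E) :
    Real.log 2 ≤ -Real.log (ρ.val κ (expPt w) ζ) := by
  rw [← Real.log_inv]
  have h1 := ρ.pos κ hκ _ hw ζ
  refine Real.log_le_log two_pos ?_
  rw [le_inv_comm₀ two_pos h1]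
  exact ((ρ.lt_half κ hκ _ hw ζ).le).trans (by norm_num)

lemma BInvNorm.contDiffOn_log :
    ContDiffOn ℝ ∞ (fun q : E × E => -Real.log (ρ.val κ (expPt q.1) q.2))
      (logDomain κ ×ˢ Set.univ) := by
  refine ContDiffOn.neg (ContDiffOn.log ?_ fun q hq => (ρ.pos κ hκ _ hq.1 _).ne')
  exact (ρ.smooth κ hκ).comp (f := fun q : E × E => (expPt q.1, q.2))
    ((contDiff_expPt.comp contDiff_fst).prodMk contDiff_snd).contDiffOn fun q hq => ⟨hq.1, trivial⟩

/-- Homogeneity of `log ρ⁻¹` in the fibers, outside a large ball. -/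
lemma BInvNorm.exists_log_eq {S : Set M} (hS : IsCompact S) (h : S ⊆ κ.source) :
    ∃ R, 0 < R ∧ ∀ w₀ ∈ logOver κ S, ∀ᶠ w in 𝓝 w₀, ∀ ζ : E, R ≤ ‖ζ‖ →
      -Real.log (ρ.val κ (expPt w) ζ) =
        Real.log (‖ζ‖ / R) + -Real.log (ρ.val κ (expPt w) (radialPt R ζ)) := by
  have hco : ContinuousOn (fun z => ‖g.coeff κ z‖) (κ.extend (𝓡∂ n) '' S) :=
    continuous_norm_bilin.comp_continuousOn
      ((g.smooth κ hκ).continuousOn.mono (extend_image_subset h))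
  obtain ⟨C, hC⟩ := (isCompact_extend_image hS h).bddAbove_image hco
  set D := |C| + 1 with hD
  have hD1 : 1 ≤ D := by simp [hD]
  -- `D²` exceeds the norm of the metric, so `‖ζ‖ ≥ 4 D` forces the dual norm to be at least `4`,
  -- where `ρ` is its inverse.
  refine ⟨D * 4, by positivity, fun w₀ hw₀ => ?_⟩
  have hcont : ContinuousAt (fun w => ‖g.coeff κ (expPt w)‖) w₀ :=
    continuous_norm_bilin.continuousAt.comp
      (((isHalfOpen_target κ).contDiffOn_comp_expPt (g.smooth κ hκ)).contDiffAt
        ((isOpen_logDomain κ).mem_nhds hw₀.1)).continuousAt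
  have hlt : ‖g.coeff κ (expPt w₀)‖ < D ^ 2 := by
    rw [logOver_eq h] at hw₀
    have := hC (Set.mem_image_of_mem _ hw₀)
    nlinarith [le_abs_self C]
  filter_upwards [hcont.eventually (gt_mem_nhds hlt), (isOpen_logDomain κ).mem_nhds hw₀.1]
    with w hw hwD ζ hζ
  have hn := norm_le_mul_dualNorm (g.pos κ hκ _ hwD) (by positivity) hw.le
  have hζ0 : 0 < ‖ζ‖ := lt_of_lt_of_le (by positivity) hζ
  have hc : 0 < D * 4 / ‖ζ‖ := by positivity
  have h1 : 4 ≤ dualNorm (g.coeff κ (expPt w)) ζ := by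
    have := hζ.trans (hn ζ)
    exact le_of_mul_le_mul_left this (by positivity)
  have h2 : 4 ≤ dualNorm (g.coeff κ (expPt w)) (radialPt (D * 4) ζ) := by
    have := hn (radialPt (D * 4) ζ)
    rw [radialPt, norm_smul, Real.norm_of_nonneg hc.le, div_mul_cancel₀ _ hζ0.ne'] at this
    exact le_of_mul_le_mul_left this (by positivity)
  rw [ρ.eq_inv κ hκ _ hwD _ h1, ρ.eq_inv κ hκ _ hwD _ h2, radialPt, dualNorm_smul hc.le, Real.log_inv,
    Real.log_inv, neg_neg, neg_neg, ← Real.log_mul (by positivity) (by positivity)]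
  congr 1
  field_simp

variable {S : Set M} (hS : IsCompact S) (h : S ⊆ κ.source)
include hS h

/-- The function is smooth up to the boundary in `(x₀, y)` and in `ζ`, and only a compact part of
both variables is involved. -/
lemma BInvNorm.symCls_log_of_norm_le (R : ℝ) :
    SymCls (logOver κ S ×ˢ Metric.closedBall 0 R) (fun a : E × E => a.1) (fun _ => 1)
      (fun a w => -Real.log (ρ.val κ (expPt w) a.2)) := by
  have hK := isCompact_extend_image hS h
  have hT := isHalfOpen_target κ
  have hs : ∀ ζ : E, ContDiff ℝ ∞ fun y : E => ((expPt y, ζ) : E × E) :=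
    fun ζ => contDiff_expPt.prodMk contDiff_const
  refine SymCls.comp_contDiffOn_within (F := E × E) (f := fun (a : E × E) (y : E) => (expPt y, a.2))
    (g := fun q : E × E => -Real.log (ρ.val κ q.1 q.2)) (T := (κ.extend (𝓡∂ n)).target ×ˢ Set.univ)
    (K := (κ.extend (𝓡∂ n) '' S) ×ˢ Metric.closedBall 0 R)
    (fun a _ => (hs a.2).contDiffAt) ?_
    (hT.uniqueDiffOn.prod uniqueDiffOn_univ) (hK.prod (isCompact_closedBall _ _))
    (Set.prod_mono (extend_image_subset h) (Set.subset_univ _))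
    (ContDiffOn.neg (ContDiffOn.log (ρ.smooth κ hκ) fun q hq => (ρ.pos κ hκ _ hq.1 _).ne')) ?_ ?_
  · intro k hk
    obtain ⟨C, hC⟩ := norm_iteratedFDeriv_expPt_le hK k hk
    refine ⟨C, fun a ha => ?_⟩
    have e : (fun y : E => ((expPt y, a.2) : E × E)) = fun y =>
        (ContinuousLinearMap.inl ℝ E E) (expPt y) + ((0 : E), a.2) := by
      funext y; simp
    obtain ⟨k, rfl⟩ := Nat.exists_eq_add_of_le' hk
    rw [e, ← norm_iteratedFDeriv_fderiv]
    have e2 : (fderiv ℝ fun y : E => (ContinuousLinearMap.inl ℝ E E) (expPt y) + ((0 : E), a.2)) =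
        fderiv ℝ fun y : E => (ContinuousLinearMap.inl ℝ E E) (expPt y) := by
      funext y; rw [fderiv_add_const]
    rw [e2, norm_iteratedFDeriv_fderiv]
    have h1 := (ContinuousLinearMap.inl ℝ E E).norm_iteratedFDeriv_comp_left
      (f := expPt) (x := a.1) contDiff_expPt.contDiffAt (n := k + 1) (N := ∞)
      (by exact_mod_cast le_top)
    refine h1.trans ?_
    have h2 := hC a.1 (by have := ha.1; rw [logOver_eq h] at this; exact this)
    exact (mul_le_of_le_one_left (norm_nonneg _) (ContinuousLinearMap.norm_inl_le_one ℝ E E)).trans h2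
  · intro a ha
    refine ⟨?_, ha.2⟩
    have := ha.1; rw [logOver_eq h] at this; exact this
  · intro a ha
    exact prod_mem_nhds (hT.mem_nhds_expPt ha.1.1) univ_mem

lemma BInvNorm.symCls_log :
    SymCls (logOver κ S ×ˢ Set.univ) (fun a : E × E => a.1) (fun a => logBracket a.2)
      (fun a w => -Real.log (ρ.val κ (expPt w) a.2)) := by
  obtain ⟨R, hR, hR'⟩ := ρ.exists_log_eq hκ hS h
  exact SymCls.of_log_homogeneous (Γ := fun w ζ => -Real.log (ρ.val κ (expPt w) ζ)) hR
    (ρ.symCls_log_of_norm_le hκ hS h R) hR'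

/-- Homogeneity gives the bound up to an additive constant, and `ρ < 1/2` keeps `log ρ⁻¹` above `log
2`, which absorbs that constant. -/
lemma BInvNorm.exists_le_log : ∃ c, 0 < c ∧ ∀ w ∈ logOver κ S, ∀ ζ : E,
    c * logBracket ζ ≤ -Real.log (ρ.val κ (expPt w) ζ) := by
  obtain ⟨R, hR, hR'⟩ := ρ.exists_log_eq hκ hS h
  obtain ⟨C, hC, hC'⟩ := log_norm_div_le (n := n) hR
  have hlog2 : 0 < Real.log 2 := Real.log_pos (by norm_num)
  obtain ⟨D, hD⟩ := (isCompact_closedBall (0 : E) R).exists_bound_of_continuousOn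
    (f := fun ζ : E => logBracket ζ) (moderate_logJapanese.cont.continuousOn)
  refine ⟨(1 + (C + |D|) / Real.log 2)⁻¹, by positivity, fun w hw ζ => ?_⟩
  have h2 := ρ.log_two_le hκ hw.1 ζ
  rw [inv_mul_le_iff₀ (by positivity)]
  have h3 : C + |D| ≤ (C + |D|) / Real.log 2 * -Real.log (ρ.val κ (expPt w) ζ) := by
    rw [div_mul_eq_mul_div, le_div_iff₀ hlog2]
    exact mul_le_mul_of_nonneg_left h2 (by positivity)
  rcases le_total ‖ζ‖ R with hle | hle
  · have h4 := (le_abs_self _).trans (hD ζ (by simpa using hle))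
    have := le_abs_self D
    linarith
  · have h4 := (hC' ζ hle).2
    have h5 := (hR' w hw).self_of_nhds ζ hle
    have h6 := ρ.log_two_le hκ hw.1 (radialPt R ζ)
    have := abs_nonneg D
    linarith

end FiberNorm
end

noncomputable section


/-! ### Nested cutoff functions -/

section Cutoffs

open Filter

variable {n : ℕ} [NeZero n] {M : Type*} [TopologicalSpace M] [T2Space M]
  [SecondCountableTopology M] [ChartedSpace (EuclideanHalfSpace n) M]
  {κ : OpenPartialHomeomorph M (EuclideanHalfSpace n)}

lemma exists_isCutoff [IsManifold (𝓡∂ n) ∞ M] {S O : Set M} (hS : IsCompact S) (hO : IsOpen O)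
    (hSO : S ⊆ O) (hOκ : O ⊆ κ.source) :
    ∃ χ : M → ℝ, IsCutoff κ χ ∧ (∀ᶠ p in 𝓝ˢ S, χ p = 1) ∧ tsupport χ ⊆ O := by
  have : LocallyCompactSpace M := Manifold.locallyCompact_of_finiteDimensional (𝓡∂ n)
  obtain ⟨L, hL, hSL, hLO⟩ := exists_compact_between hS hO hSO
  obtain ⟨f, hf1, hf0, -⟩ := exists_contMDiffMap_one_nhds_of_subset_interior (n := (⊤ : ℕ∞)) (𝓡∂ n)
    hS.isClosed hSL
  have hsub : tsupport f ⊆ L := closure_minimal (fun p hp => by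
    by_contra h
    exact hp (hf0 p h)) hL.isClosed
  exact ⟨f, ⟨f.contMDiff, hL.of_isClosed_subset (isClosed_tsupport _) hsub,
    hsub.trans (hLO.trans hOκ)⟩, hf1, hsub.trans hLO⟩

lemma IsCutoff.exists_between [IsManifold (𝓡∂ n) ∞ M] {χ Y : M → ℝ} (hχ : IsCutoff κ χ)
    (hY : ∀ᶠ p in 𝓝ˢ (tsupport χ), Y p = 1) :
    ∃ X : M → ℝ, IsCutoff κ X ∧ (∀ᶠ p in 𝓝ˢ (tsupport χ), X p = 1) ∧
      ∀ᶠ p in 𝓝ˢ (tsupport X), Y p = 1 := by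
  rw [eventually_nhdsSet_iff_exists] at hY
  obtain ⟨U, hU, hχU, hU1⟩ := hY
  obtain ⟨X, hX, h1, h2⟩ := exists_isCutoff hχ.compact (hU.inter κ.open_source)
    (Set.subset_inter hχU hχ.subset) Set.inter_subset_right
  exact ⟨X, hX, h1, eventually_nhdsSet_iff_exists.2 ⟨U, hU, h2.trans Set.inter_subset_left, hU1⟩⟩

lemma IsCutoff.exists_larger [IsManifold (𝓡∂ n) ∞ M] {χ : M → ℝ} (hχ : IsCutoff κ χ) :
    ∃ X : M → ℝ, IsCutoff κ X ∧ ∀ᶠ p in 𝓝ˢ (tsupport χ), X p = 1 := by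
  obtain ⟨X, h1, h2, -⟩ := exists_isCutoff hχ.compact κ.open_source hχ.subset subset_rfl
  exact ⟨X, h1, h2⟩

end Cutoffs

/-! ### The weights `e^{-rt} ⟨t⟩^j` -/

section TWeight

variable {n : ℕ} [NeZero n]

local notation "E" => EuclideanSpace ℝ (Fin n)

/-- The weight `e^{-r t} ⟨t⟩^j`. -/
def tWeight (r j : ℝ) (w : EuclideanSpace ℝ (Fin n)) : ℝ :=
  Real.exp (-(w 0)) ^ r * japanese (w 0) ^ j

lemma tWeight_pos (r j : ℝ) (w : E) : 0 < tWeight r j w :=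
  mul_pos (Real.rpow_pos_of_pos (Real.exp_pos _) _) (Real.rpow_pos_of_pos (japanese_pos _) _)

lemma tWeight_mul (r j r' j' : ℝ) (w : E) :
    tWeight r j w * tWeight r' j' w = tWeight (r + r') (j + j') w := by
  unfold tWeight
  rw [Real.rpow_add (Real.exp_pos _), Real.rpow_add (japanese_pos _)]
  ring

lemma tWeight_zero (w : E) : tWeight 0 0 w = 1 := by simp [tWeight]

lemma tWeight_le_mul (r j : ℝ) : ∃ C N, 0 < C ∧ 0 ≤ N ∧ ∀ w w' : E,
    tWeight r j w ≤ C * tWeight r j w' * Real.exp (N * |w 0 - w' 0|) := by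
  refine ⟨1, |r| + |j|, one_pos, by positivity, fun w w' => ?_⟩
  have hJ : ∀ a b : ℝ, japanese a ≤ japanese b * Real.exp |a - b| := fun a b => by
    refine (japanese_le_mul a b).trans (mul_le_mul_of_nonneg_left ?_ (japanese_pos _).le)
    linarith [Real.add_one_le_exp |a - b|]
  have hK : ∀ a b : ℝ, japanese a ^ j ≤ japanese b ^ j * Real.exp (|j| * |a - b|) := fun a b => by
    rcases le_total 0 j with hj | hj
    · have := Real.rpow_le_rpow (japanese_pos _).le (hJ a b) hj
      rw [Real.mul_rpow (japanese_pos _).le (Real.exp_pos _).le, ← Real.exp_mul, mul_comm |a - b|,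
        ← abs_of_nonneg hj] at this
      rwa [abs_of_nonneg hj] at this ⊢
    · have h1 := Real.rpow_le_rpow (japanese_pos _).le (hJ b a) (neg_nonneg.2 hj)
      rw [Real.mul_rpow (japanese_pos _).le (Real.exp_pos _).le, ← Real.exp_mul,
        Real.rpow_neg (japanese_pos _).le, Real.rpow_neg (japanese_pos _).le,
        abs_sub_comm] at h1
      rw [abs_of_nonpos hj, mul_comm (-j)]
      have ha := Real.rpow_pos_of_pos (japanese_pos a) j
      have hb := Real.rpow_pos_of_pos (japanese_pos b) j
      rwa [inv_mul_eq_div, inv_eq_one_div, div_le_div_iff₀ hb ha, one_mul, mul_comm] at h1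
  have h1 := hK (w 0) (w' 0)
  have h2 : Real.exp (-(w 0)) ^ r ≤ Real.exp (-(w' 0)) ^ r * Real.exp (|r| * |w 0 - w' 0|) := by
    rw [← Real.exp_mul, ← Real.exp_mul, ← Real.exp_add, Real.exp_le_exp]
    have := neg_abs_le (r * (w 0 - w' 0))
    rw [abs_mul] at this
    nlinarith
  unfold tWeight
  rw [add_mul, Real.exp_add, one_mul]
  calc _ ≤ (Real.exp (-(w' 0)) ^ r * Real.exp (|r| * |w 0 - w' 0|)) *
      (japanese (w' 0) ^ j * Real.exp (|j| * |w 0 - w' 0|)) :=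
        mul_le_mul h2 h1 (Real.rpow_nonneg (japanese_pos _).le _) (by positivity)
    _ = _ := by ring

lemma tWeight_le_of_norm_sub_le (r j R : ℝ) : ∃ C, 0 < C ∧ ∀ w w' : E, ‖w - w'‖ ≤ R →
    tWeight r j w ≤ C * tWeight r j w' := by
  obtain ⟨C, N, hC, hN, h⟩ := tWeight_le_mul (n := n) r j
  refine ⟨C * Real.exp (N * R), by positivity, fun w w' hw => (h w w').trans ?_⟩
  have h1 : |w 0 - w' 0| ≤ R := (abs_apply_le_norm (w - w') 0).trans hw
  have h2 := tWeight_pos r j w'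
  calc _ ≤ C * tWeight r j w' * Real.exp (N * R) := by gcongr
    _ = _ := by ring

lemma tWeight_le_exp (r j R : ℝ) : ∃ C, 0 < C ∧ ∃ N : ℕ, ∀ w ∈ logBox n R,
    tWeight r j w ≤ C * Real.exp (N * w 0) := by
  obtain ⟨C, N, hC, hN, h⟩ := tWeight_le_mul (n := n) r j
  refine ⟨C * tWeight r j (0 : E) * Real.exp (2 * ⌈N⌉₊ * |R|),
    by have := tWeight_pos r j (0 : E); positivity, ⌈N⌉₊, fun w hw => (h w 0).trans ?_⟩
  have h1 := hw.1
  have h0 : |w 0| ≤ w 0 + 2 * |R| := by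
    have := le_abs_self R
    rw [abs_le]; constructor <;> linarith [abs_nonneg R]
  have h2 := tWeight_pos r j (0 : E)
  rw [mul_assoc (C * _), ← Real.exp_add]
  refine mul_le_mul_of_nonneg_left (Real.exp_le_exp.2 ?_) (by positivity)
  have h3 := Nat.le_ceil N
  simp only [PiLp.zero_apply, sub_zero]
  calc N * |w 0| ≤ ⌈N⌉₊ * (w 0 + 2 * |R|) := by gcongr
    _ = _ := by ring

end TWeight

/-! ### Algebra of test functions -/

section BTAlgebra

variable {n : ℕ} [NeZero n]

local notation "E" => EuclideanSpace ℝ (Fin n)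

lemma IsBT.add {f g : E → ℂ} (hf : IsBT f) (hg : IsBT g) : IsBT (fun w => f w + g w) := by
  obtain ⟨R, hR⟩ := hf.supp
  obtain ⟨R', hR'⟩ := hg.supp
  refine IsBT.of_symCls (hf.smooth.add hg.smooth) ⟨max R R', fun w hw => ?_⟩
    fun N => (hf.symCls N).add (hg.symCls N)
  by_contra h
  have h1 : f w = 0 := by
    by_contra h1; exact h (logBox_mono (le_max_left _ _) (hR w h1))
  have h2 : g w = 0 := by
    by_contra h2; exact h (logBox_mono (le_max_right _ _) (hR' w h2))
  exact hw (by rw [h1, h2, add_zero])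

/-- On a `logBox` the weight grows at most exponentially in `t`, while test functions decay faster
than every exponential. -/
lemma IsBT.mul_symCls {f : E → ℂ} (hf : IsBT f) {r j : ℝ} {m : E → ℂ}
    (hm : SymCls Set.univ (fun w : E => w) (tWeight r j) (fun _ => m)) :
    IsBT (fun w => m w * f w) := by
  obtain ⟨R, hR⟩ := hf.supp
  obtain ⟨C, hC, N₀, hN⟩ := tWeight_le_exp (n := n) r j R
  have hms : ContDiff ℝ ∞ m := contDiff_iff_contDiffAt.2 fun w => hm.smooth w trivial
  refine IsBT.of_symCls (hms.mul hf.smooth) ⟨R, fun w hw => hR w (right_ne_zero_of_mul hw)⟩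
    fun N => ?_
  have h1 : SymCls (logBox n R) (fun w : E => w) (fun w => Real.exp (-(N * w 0)))
      (fun _ w => m w * f w) :=
    ((hm.mono_set (Set.subset_univ _)).mul ((hf.symCls (N + N₀)).mono_set (Set.subset_univ _))).mono
      (c := C) (fun w hw => by
        calc tWeight r j w * Real.exp (-((N + N₀ : ℕ) * w 0))
            ≤ C * Real.exp (N₀ * w 0) * Real.exp (-((N + N₀ : ℕ) * w 0)) :=
              mul_le_mul_of_nonneg_right (hN w hw) (Real.exp_pos _).le
          _ = C * Real.exp (-(N * w 0)) := by
              rw [mul_assoc, ← Real.exp_add]; congr 2; push_cast; ring) hC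
  have h2 : SymCls (logBox n R)ᶜ (fun w : E => w) (fun w => Real.exp (-(N * w 0)))
      (fun _ w => m w * f w) :=
    SymCls.zero (fun _ _ => (Real.exp_pos _).le) fun w hw => by
      filter_upwards [(isClosed_logBox R).isOpen_compl.mem_nhds hw] with y hy
      have : f y = 0 := by by_contra h; exact hy (hR y h)
      rw [this, mul_zero]
  exact (h1.union h2).mono_set fun w _ => em _

lemma IsBT.const_mul {f : E → ℂ} (hf : IsBT f) (c : ℂ) : IsBT (fun w => c * f w) := by
  refine hf.mul_symCls (r := 0) (j := 0) ?_
  have : SymCls Set.univ (fun w : E => w) (fun _ => ‖c‖ + 1) (fun _ _ => c) :=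
    SymCls.const _ fun _ _ => by linarith
  exact this.mono (c := ‖c‖ + 1) (fun w _ => by rw [tWeight_zero, mul_one]) (by positivity)

/-- The space of test functions, as a subspace of the Schwartz space. -/
def btSubmodule (n : ℕ) [NeZero n] : Submodule ℂ 𝓢(EuclideanSpace ℝ (Fin n), ℂ) where
  carrier := {φ | IsBT fun w => φ w}
  zero_mem' := by
    refine IsBT.of_symCls contDiff_const ⟨0, fun w hw => absurd rfl hw⟩ fun N => ?_
    exact SymCls.zero (fun _ _ => (Real.exp_pos _).le) fun _ _ => Filter.EventuallyEq.rfl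
  add_mem' := fun h₁ h₂ => h₁.add h₂
  smul_mem' := fun c _ h => h.const_mul c

end BTAlgebra

/-! ### Cut off weights, and membership in the spaces as a bound on test functions -/

section CutLift

variable {n : ℕ} [NeZero n] {M : Type*} [TopologicalSpace M]
  {κ : OpenPartialHomeomorph M (EuclideanHalfSpace n)} {x : M → ℝ}

local notation "E" => EuclideanSpace ℝ (Fin n)

/-- The function `χ x^r log^j(x⁻¹)` in logarithmic coordinates, extended by zero. -/
def cutLift (κ : OpenPartialHomeomorph M (EuclideanHalfSpace n)) (x χ : M → ℝ) (r j : ℝ) :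
    EuclideanSpace ℝ (Fin n) → ℝ :=
  logLift κ fun p => χ p * (x p ^ r * Real.log ((x p)⁻¹) ^ j)

lemma cutLift_of_notMem {χ : M → ℝ} (r j : ℝ) {w : E} (hw : w ∉ logOver κ (tsupport χ)) :
    cutLift κ x χ r j w = 0 :=
  logLift_eq_zero (fun p hp => by rw [image_eq_zero_of_notMem_tsupport hp, zero_mul]) hw

lemma mem_of_cutLift_ne_zero {χ : M → ℝ} {r j : ℝ} {w : E} (hw : cutLift κ x χ r j w ≠ 0) :
    w ∈ logOver κ (tsupport χ) := by
  by_contra h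
  exact hw (cutLift_of_notMem r j h)

lemma mul_eq_of_eventually_one {χ X : M → ℝ} (h : ∀ᶠ p in 𝓝ˢ (tsupport χ), X p = 1) (p : M) :
    χ p * X p = χ p := by
  by_cases hp : p ∈ tsupport χ
  · rw [h.self_of_nhdsSet p hp, mul_one]
  · rw [image_eq_zero_of_notMem_tsupport hp, zero_mul]

variable [ChartedSpace (EuclideanHalfSpace n) M] [IsManifold (𝓡∂ n) ∞ M]
  (hx : IsBoundaryDefining n x) (hκ : κ ∈ IsManifold.maximalAtlas (𝓡∂ n) ∞ M)
include hx hκ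

/-- Allows weights to be divided out on the support of `χ`, although neither factor is invertible.
-/
lemma cutLift_mul {χ X : M → ℝ} (h : ∀ᶠ p in 𝓝ˢ (tsupport χ), X p = 1) (r j r' j' : ℝ) (w : E) :
    cutLift κ x χ r j w * cutLift κ x X r' j' w = cutLift κ x χ (r + r') (j + j') w := by
  by_cases hw : w ∈ logDomain κ
  · unfold cutLift
    rw [logLift_of_mem _ hw, logLift_of_mem _ hw, logLift_of_mem _ hw]
    rw [Real.rpow_add (hx.pos hκ hw), Real.rpow_add (lt_of_lt_of_le (Real.log_pos (by norm_num))
      (hx.log_inv_pos hκ hw)), ← mul_eq_of_eventually_one h (logInv κ w)]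
    linear_combination (x (logInv κ w) ^ r * Real.log (x (logInv κ w))⁻¹ ^ j *
      (x (logInv κ w) ^ r' * Real.log (x (logInv κ w))⁻¹ ^ j') * X (logInv κ w)) *
      mul_eq_of_eventually_one h (logInv κ w)
  · unfold cutLift logLift
    simp [hw]

lemma cutLift_zero_zero (χ : M → ℝ) : cutLift κ x χ 0 0 = logLift κ χ := by
  funext w
  simp [cutLift]

lemma IsCutoff.symCls_cutLift {χ : M → ℝ} (hχ : IsCutoff κ χ) (r j : ℝ) :
    SymCls Set.univ (fun w : E => w) (tWeight r j) (fun _ => cutLift κ x χ r j) :=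
  hχ.symCls_mul_logLift hκ (fun w => (tWeight_pos r j w).le)
    (hx.symCls_weight hκ hχ.compact hχ.subset r j)

lemma IsCutoff.isBT_cutLift_mul {χ : M → ℝ} (hχ : IsCutoff κ χ) (r j : ℝ) {f : E → ℂ}
    (hf : IsBT f) : IsBT (fun w => (cutLift κ x χ r j w : ℂ) * f w) :=
  hf.mul_symCls (hχ.symCls_cutLift hx hκ r j).ofReal

lemma IsCutoff.isBTest_cutLift_mul {χ : M → ℝ} (hχ : IsCutoff κ χ) (r j : ℝ) {f : E → ℂ}
    (hf : IsBT f) :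
    IsBTest (κ.extend (𝓡∂ n)).target (fun w => (cutLift κ x χ r j w : ℂ) * f w) :=
  (hχ.isBT_cutLift_mul hx hκ r j hf).isBTest_of_compact
    (isCompact_extend_image hχ.compact hχ.subset) (extend_image_subset hχ.subset) fun w hw => by
      have h1 : cutLift κ x χ r j w ≠ 0 := fun h => hw (by simp [h])
      have h2 := mem_of_cutLift_ne_zero h1
      rwa [logOver_eq hχ.subset] at h2

variable {χ : M → ℝ} (hχ : IsCutoff κ χ) {u : BDistribution n M} {s ℓ r j : ℝ}

omit hκ hx [IsManifold (𝓡∂ n) ∞ M] in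
lemma MemHbAt.exists_tempered (h : MemHbAt x s ℓ r j u κ χ) :
    ∃ T : 𝓢'(E, ℂ), MemHLog s ℓ T ∧ ∀ φ : 𝓢(E, ℂ), IsBT (fun w => φ w) →
      u.pairing κ (fun w => (cutLift κ x χ (-r) j w : ℂ) * φ w) = T φ := by
  obtain ⟨T, hT, h⟩ := h
  refine ⟨T, hT, fun φ hφ => ?_⟩
  rw [← h φ hφ.isBTest, chartMul_eq]
  rfl

include hχ

/-- The duality statement applied to the subspace of test functions. They decay so fast that the
weight `x^{-r} log^j(x⁻¹)` keeps them in the class, so the pairing is defined and linear on it. -/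
lemma memHbAt_of_bound {C : ENNReal} (hC : C ≠ ⊤)
    (h : ∀ φ : 𝓢(E, ℂ), IsBT (fun w => φ w) →
      ‖u.pairing κ (fun w => (cutLift κ x χ (-r) j w : ℂ) * φ w)‖ₑ ^ 2 ≤
        C * wsq (logWeight (-s) (-ℓ)) φ) : MemHbAt x s ℓ r j u κ χ := by
  let L : btSubmodule n →ₗ[ℂ] ℂ :=
    { toFun := fun φ => u.pairing κ (fun w => (cutLift κ x χ (-r) j w : ℂ) * φ.1 w)
      map_add' := fun φ₁ φ₂ => by
        rw [← u.map_add κ hκ _ _ (hχ.isBTest_cutLift_mul hx hκ _ _ φ₁.2)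
          (hχ.isBTest_cutLift_mul hx hκ _ _ φ₂.2)]
        congr 1
        funext w
        simp [mul_add]
      map_smul' := fun c φ => by
        rw [RingHom.id_apply, smul_eq_mul,
          ← u.map_smul κ hκ _ _ (hχ.isBTest_cutLift_mul hx hκ _ _ φ.2)]
        congr 1
        funext w
        simp
        ring }
  obtain ⟨T, hT, hT'⟩ := exists_memHLog_of_bound (btSubmodule n) L hC fun φ => h φ.1 φ.2
  refine ⟨T, hT, fun φ hφ => ?_⟩
  rw [← hT' ⟨φ, hφ.isBT⟩, chartMul_eq]
  rfl

omit hx hκ hχ [IsManifold (𝓡∂ n) ∞ M] in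
lemma MemHbAt.bound (h : MemHbAt x s ℓ r j u κ χ) : ∃ C : ENNReal, C ≠ ⊤ ∧
    ∀ φ : 𝓢(E, ℂ), IsBT (fun w => φ w) →
      ‖u.pairing κ (fun w => (cutLift κ x χ (-r) j w : ℂ) * φ w)‖ₑ ^ 2 ≤
        C * wsq (logWeight (-s) (-ℓ)) φ := by
  obtain ⟨T, hT, h⟩ := h.exists_tempered
  obtain ⟨C, hC, hb⟩ := hT.bound
  exact ⟨C, hC, fun φ hφ => by rw [h φ hφ]; exact hb φ⟩

end CutLift
end

noncomputable section


/-! ### Pairings with residual operators -/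

section ResidualPairing

open MeasureTheory Filter

variable {n : ℕ} [NeZero n] {M : Type*} [TopologicalSpace M] [T2Space M]
  [SecondCountableTopology M] [ChartedSpace (EuclideanHalfSpace n) M] [IsManifold (𝓡∂ n) ∞ M]
  {κ κ' : OpenPartialHomeomorph M (EuclideanHalfSpace n)} {x : M → ℝ}

local notation "E" => EuclideanSpace ℝ (Fin n)

lemma SymCls.comp_fst {V G : Type*} [NormedAddCommGroup V] [NormedSpace ℝ V]
    [NormedAddCommGroup G] [NormedSpace ℝ G] {W : V → ℝ} {f : V → G}
    (h : SymCls Set.univ (fun v : V => v) W (fun _ => f)) :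
    SymCls Set.univ (fun q : V × V => q) (fun q => W q.1) (fun _ q => f q.1) :=
  (h.reindex (fun q : V × V => q.1)).comp_clm (ContinuousLinearMap.fst ℝ V V) (fun _ _ => rfl)

lemma SymCls.comp_snd {V G : Type*} [NormedAddCommGroup V] [NormedSpace ℝ V]
    [NormedAddCommGroup G] [NormedSpace ℝ G] {W : V → ℝ} {f : V → G}
    (h : SymCls Set.univ (fun v : V => v) W (fun _ => f)) :
    SymCls Set.univ (fun q : V × V => q) (fun q => W q.2) (fun _ q => f q.2) :=
  (h.reindex (fun q : V × V => q.2)).comp_clm (ContinuousLinearMap.snd ℝ V V) (fun _ _ => rfl)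

lemma SymCls.contDiff {V G : Type*} [NormedAddCommGroup V] [NormedSpace ℝ V]
    [NormedAddCommGroup G] [NormedSpace ℝ G] {W : V → ℝ} {f : V → G}
    (h : SymCls Set.univ (fun v : V => v) W (fun _ => f)) : ContDiff ℝ ∞ f :=
  contDiff_iff_contDiffAt.2 fun v => h.smooth v trivial

lemma cutLift_mem_logBox {χ : M → ℝ} (hχ : IsCutoff κ χ) :
    ∃ R, ∀ r j w, cutLift κ x χ r j w ≠ 0 → w ∈ logBox n R := by
  obtain ⟨R, -, hR⟩ := exists_logBox_of_logOver hχ.compact hχ.subset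
  exact ⟨R, fun r j w hw => hR (mem_of_cutLift_ne_zero hw)⟩

lemma IsResidualKernel.symCls {j : ℝ} {K : E → E → ℂ} (hK : IsResidualKernel j κ κ' K) (N : ℕ) :
    SymCls Set.univ (fun q : E × E => q)
      (fun q => tWeight 0 j q.1 * Real.exp (-(N * |q.1 0 - q.2 0|))) (fun _ q => K q.1 q.2) :=
  SymCls.of_le (fun _ _ => hK.1.contDiffAt)
    (fun q _ => mul_nonneg (tWeight_pos _ _ _).le (Real.exp_pos _).le) fun k => by
      obtain ⟨C, hC⟩ := hK.2.2 k N
      refine ⟨C, fun q _ => (hC q.1 q.2).trans (le_of_eq ?_)⟩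
      simp [tWeight, mul_assoc]

variable (hx : IsBoundaryDefining n x) (hκ : κ ∈ IsManifold.maximalAtlas (𝓡∂ n) ∞ M)
  (hκ' : κ' ∈ IsManifold.maximalAtlas (𝓡∂ n) ∞ M)
include hx hκ hκ'

/-- The weights at the two points cancel up to an exponential of `|t - t'|`, which the
superexponential decay of the kernel absorbs. -/
lemma IsResidualKernel.isResKer {j : ℝ} {K : E → E → ℂ} (hK : IsResidualKernel j κ κ' K)
    {χ χ' : M → ℝ} (hχ : IsCutoff κ χ) (hχ' : IsCutoff κ' χ') (r : ℝ) :
    IsResKer (fun w w' => K w w' * (cutLift κ x χ (-r) 0 w : ℂ) * (cutLift κ' x χ' r (-j) w' : ℂ)) := by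
  have h1 := ((hχ.symCls_cutLift hx hκ (-r) 0).ofReal).comp_fst
  have h2 := ((hχ'.symCls_cutLift hx hκ' r (-j)).ofReal).comp_snd
  obtain ⟨C, N₀, hC, hN₀, hw⟩ := tWeight_le_mul (n := n) (-r) j
  have h3 : ∀ N : ℕ, SymCls Set.univ (fun q : E × E => q) (fun q => Real.exp (-(N * |q.1 0 - q.2 0|)))
      (fun _ q => K q.1 q.2 * (cutLift κ x χ (-r) 0 q.1 : ℂ) * (cutLift κ' x χ' r (-j) q.2 : ℂ)) :=
    fun N => (((hK.symCls (N + ⌈N₀⌉₊)).mul h1).mul h2).mono (c := C) (fun q _ => by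
      have e : tWeight 0 j q.1 * Real.exp (-((N + ⌈N₀⌉₊ : ℕ) * |q.1 0 - q.2 0|)) *
          tWeight (-r) 0 q.1 * tWeight r (-j) q.2 =
          tWeight (-r) j q.1 * (tWeight r (-j) q.2 *
            Real.exp (-((N + ⌈N₀⌉₊ : ℕ) * |q.1 0 - q.2 0|))) := by
        have := tWeight_mul 0 j (-r) 0 q.1
        rw [zero_add, add_zero] at this
        rw [← this]; ring
      rw [e]
      have h4 := tWeight_pos r (-j) q.2
      refine (mul_le_mul_of_nonneg_right (hw q.1 q.2) (by positivity)).trans ?_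
      have e2 := tWeight_mul (-r) j r (-j) q.2
      rw [neg_add_cancel, add_neg_cancel, tWeight_zero] at e2
      have e3 : C * tWeight (-r) j q.2 * Real.exp (N₀ * |q.1 0 - q.2 0|) * (tWeight r (-j) q.2 *
          Real.exp (-((N + ⌈N₀⌉₊ : ℕ) * |q.1 0 - q.2 0|))) =
          C * (tWeight (-r) j q.2 * tWeight r (-j) q.2) * (Real.exp (N₀ * |q.1 0 - q.2 0|) *
          Real.exp (-((N + ⌈N₀⌉₊ : ℕ) * |q.1 0 - q.2 0|))) := by ring
      rw [e3, e2, mul_one, ← Real.exp_add]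
      refine mul_le_mul_of_nonneg_left (Real.exp_le_exp.2 ?_) hC.le
      have h5 := Nat.le_ceil N₀
      have h6 := abs_nonneg (q.1 0 - q.2 0)
      push_cast
      nlinarith) hC
  obtain ⟨R, hR⟩ := cutLift_mem_logBox (x := x) hχ
  obtain ⟨R', hR'⟩ := cutLift_mem_logBox (x := x) hχ'
  refine ⟨(h3 0).contDiff, ⟨max R R', fun w w' h => ⟨?_, ?_⟩⟩, h3⟩
  · exact logBox_mono (le_max_left _ _) (hR (-r) 0 w fun h0 => h (by simp [h0]))
  · exact logBox_mono (le_max_right _ _) (hR' r (-j) w' fun h0 => h (by simp [h0]))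

/-- The distribution has some finite order near the support of the kernel in the second variable,
and a residual operator reaches the corresponding dual weight from any weight `M₁`. Hence residual
terms never restrict the regularity. -/
lemma residual_pairing_bound {j : ℝ} {K : E → E → ℂ} (hK : IsResidualKernel j κ κ' K)
    {X : M → ℝ} (hX : IsCutoff κ X) {r : ℝ} {u : BDistribution n M}
    (hu : MemHbLocNegInf x r j u) {M₁ : E → ℝ} (hM₁ : Moderate M₁) :
    ∃ C : ENNReal, C ≠ ⊤ ∧ ∀ φ : 𝓢(E, ℂ), IsBT (fun w => φ w) →
      ‖u.pairing κ' (fun w' => ∫ w, K w w' * ((cutLift κ x X (-r) 0 w : ℂ) * φ w))‖ₑ ^ 2 ≤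
        C * wsq M₁ φ := by
  obtain ⟨S, S', -, -, hS', hSκ', hsupp⟩ := hK.2.1
  obtain ⟨χ', hχ', h1, -⟩ := exists_isCutoff hS' κ'.open_source hSκ' subset_rfl
  obtain ⟨X', hX', hχX⟩ := hχ'.exists_larger
  obtain ⟨m, hm⟩ := hu κ' hκ' X' hX'
  obtain ⟨C₁, hC₁, hb₁⟩ := hm.bound
  have hG := hK.isResKer hx hκ hκ' hX hχ' r
  obtain ⟨C₂, hC₂, hb₂⟩ := wsq_resOp_le hG hM₁ (moderate_logWeight (-m) (-0))
  refine ⟨C₁ * C₂, ENNReal.mul_ne_top hC₁ hC₂, fun φ hφ => ?_⟩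
  obtain ⟨Ψ, hΨ⟩ := (hG.isBT hφ).exists_schwartz
  have e : (fun w' => ∫ w, K w w' * ((cutLift κ x X (-r) 0 w : ℂ) * φ w)) =
      fun w' => (cutLift κ' x X' (-r) j w' : ℂ) * Ψ w' := by
    funext w'
    rw [hΨ, ← integral_const_mul]
    refine integral_congr_ae (Eventually.of_forall fun w => ?_)
    simp only
    by_cases hKw : K w w' = 0
    · simp [hKw]
    · have hw' := (hsupp w w' hKw).2
      -- On the support of the kernel the weight put into the kernel and the one remaining with `u`
      -- multiply to `1`.
      have e1 := cutLift_mul hx hκ' hχX r (-j) (-r) j w'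
      rw [add_neg_cancel, neg_add_cancel, cutLift_zero_zero hx hκ', logLift_of_mem _ hw'.1,
        h1.self_of_nhdsSet _ hw'.2] at e1
      have e2 : (cutLift κ' x χ' r (-j) w' : ℂ) * (cutLift κ' x X' (-r) j w' : ℂ) = 1 := by
        exact_mod_cast e1
      linear_combination (-(K w w' * (cutLift κ x X (-r) 0 w : ℂ) * φ w)) * e2
  have hΨB : IsBT fun w => Ψ w := by
    have : (fun w => Ψ w) = _ := funext hΨ
    rw [this]; exact hG.isBT hφ
  rw [e]
  calc _ ≤ C₁ * wsq (logWeight (-m) (-0)) Ψ := hb₁ Ψ hΨB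
    _ ≤ C₁ * (C₂ * wsq M₁ φ) := by gcongr; exact hb₂ φ Ψ hΨ
    _ = _ := by ring

end ResidualPairing

/-! ### Derivatives of integrals over `[0, 1]` with a parameter -/

section ParametricIntegral

open MeasureTheory

variable {n : ℕ} [NeZero n]

local notation "E" => EuclideanSpace ℝ (Fin n)

lemma hasFDerivAt_intervalIntegral_of_contDiff {G : Type*} [NormedAddCommGroup G] [NormedSpace ℝ G]
    {g : E × ℝ → G} (hg : ContDiff ℝ ∞ g) (w : E) :
    HasFDerivAt (fun w => ∫ s in (0:ℝ)..1, g (w, s))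
      (∫ s in (0:ℝ)..1, (fderiv ℝ g (w, s)).comp (ContinuousLinearMap.inl ℝ E ℝ)) w := by
  have hg1 : Continuous fun q => (fderiv ℝ g q).comp (ContinuousLinearMap.inl ℝ E ℝ) :=
    (hg.continuous_fderiv (by simp)).clm_comp continuous_const
  obtain ⟨C, hC⟩ := ((isCompact_closedBall w 1).prod (isCompact_Icc (a := (0:ℝ)) (b := 1))).exists_bound_of_continuousOn
    hg1.continuousOn
  refine (intervalIntegral.hasFDerivAt_integral_of_dominated_of_fderiv_le (μ := volume)
    (F := fun w s => g (w, s)) (bound := fun _ => C)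
    (F' := fun w s => (fderiv ℝ g (w, s)).comp (ContinuousLinearMap.inl ℝ E ℝ))
    (Metric.ball_mem_nhds w one_pos) ?_ ?_ ?_ ?_ ?_ ?_)
  · exact Filter.Eventually.of_forall fun y =>
      (hg.continuous.comp (by fun_prop : Continuous fun s : ℝ => (y, s))).aestronglyMeasurable
  · exact (hg.continuous.comp (by fun_prop : Continuous fun s : ℝ => (w, s))).intervalIntegrable _ _
  · exact (hg1.comp (by fun_prop : Continuous fun s : ℝ => (w, s))).aestronglyMeasurable
  · refine Filter.Eventually.of_forall fun s hs y hy => hC (y, s) ⟨?_, ?_⟩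
    · exact Metric.ball_subset_closedBall hy
    · rw [Set.uIoc_of_le zero_le_one] at hs
      exact ⟨hs.1.le, hs.2⟩
  · exact intervalIntegrable_const
  · refine Filter.Eventually.of_forall fun s _ y _ => ?_
    exact ((hg.differentiable (by simp) (y, s)).hasFDerivAt).comp y (hasFDerivAt_prodMk_left y s)

/-- Differentiation under the integral sign by induction on the order; each derivative is an
integral of the same kind, so the final bound is the trivial one on an interval of length `1`. -/
lemma norm_iteratedFDeriv_intervalIntegral_le (k : ℕ) : ∀ {G : Type} [NormedAddCommGroup G]
    [NormedSpace ℝ G] {g : E × ℝ → G}, ContDiff ℝ ∞ g → ∀ (w : E) (C : ℝ),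
    (∀ s ∈ Set.Icc (0:ℝ) 1, ‖iteratedFDeriv ℝ k (fun w => g (w, s)) w‖ ≤ C) →
    ‖iteratedFDeriv ℝ k (fun w => ∫ s in (0:ℝ)..1, g (w, s)) w‖ ≤ C := by
  induction k with
  | zero =>
    intro G _ _ g hg w C h
    simp only [norm_iteratedFDeriv_zero] at h ⊢
    have := intervalIntegral.norm_integral_le_of_norm_le_const (a := 0) (b := 1) (C := C)
      (f := fun s => g (w, s)) (fun s hs => h s (by
        rw [Set.uIoc_of_le zero_le_one] at hs
        exact ⟨hs.1.le, hs.2⟩))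
    simpa using this
  | succ k ih =>
    intro G _ _ g hg w C h
    rw [← norm_iteratedFDeriv_fderiv]
    have e : (fderiv ℝ fun w => ∫ s in (0:ℝ)..1, g (w, s)) = fun w => ∫ s in (0:ℝ)..1,
        (fun q => (fderiv ℝ g q).comp (ContinuousLinearMap.inl ℝ E ℝ)) (w, s) :=
      funext fun w => (hasFDerivAt_intervalIntegral_of_contDiff hg w).fderiv
    rw [e]
    refine ih (g := fun q => (fderiv ℝ g q).comp (ContinuousLinearMap.inl ℝ E ℝ))
      ((hg.fderiv_right (by simp)).clm_comp contDiff_const) w C fun s hs => ?_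
    have e2 : (fun w : E => (fderiv ℝ g (w, s)).comp (ContinuousLinearMap.inl ℝ E ℝ)) =
        fderiv ℝ fun w => g (w, s) := funext fun y =>
      (((hg.differentiable (by simp) (y, s)).hasFDerivAt).comp y
        (hasFDerivAt_prodMk_left y s)).fderiv.symm
    simp only
    rw [e2, norm_iteratedFDeriv_fderiv]
    exact h s hs

end ParametricIntegral
end

noncomputable section


/-! ### Symbols, their variation in the fibres and the normalization of frequencies -/

section LogSymbols

open MeasureTheory

variable {n : ℕ} [NeZero n]

local notation "E" => EuclideanSpace ℝ (Fin n)

lemma IsLogSymbol.nonneg_weight {m ℓ j : ℝ} (w ζ : E) :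
    0 ≤ tWeight 0 j w * logWeight m ℓ ζ :=
  mul_nonneg (tWeight_pos _ _ _).le (logWeight_pos _ _ _).le

lemma tWeight_zero_left (j : ℝ) (w : E) : tWeight 0 j w = japanese (w 0) ^ j := by
  simp [tWeight]

lemma IsLogSymbol.symCls {m ℓ j : ℝ} {b : E → E → ℂ} (hb : IsLogSymbol m ℓ j b) :
    SymCls Set.univ (fun a : E × E => a.1)
      (fun a => tWeight 0 j a.1 * logWeight m ℓ a.2) (fun a w => b w a.2) := by
  refine SymCls.of_le (fun a _ => ?_) (fun a _ => IsLogSymbol.nonneg_weight _ _) fun k => ?_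
  · exact (hb.1.comp (contDiff_id.prodMk contDiff_const)).contDiffAt
  · obtain ⟨C, hC⟩ := hb.2 k 0
    refine ⟨C, fun a _ => ?_⟩
    have h := hC a.1 a.2
    have e : (fun w' => iteratedFDeriv ℝ 0 (b w') a.2) =
        (continuousMultilinearCurryFin0 ℝ E ℂ).symm ∘ fun w' => b w' a.2 := by
      funext w'
      rw [iteratedFDeriv_zero_eq_comp]; rfl
    rw [e, LinearIsometryEquiv.norm_iteratedFDeriv_comp_left] at h
    rw [tWeight_zero_left]
    simpa [mul_assoc] using h

lemma fderiv_right_eq {b : E → E → ℂ} (hb : ContDiff ℝ ∞ fun q : E × E => b q.1 q.2) (w ζ : E) :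
    fderiv ℝ (b w) ζ =
      (fderiv ℝ (fun q : E × E => b q.1 q.2) (w, ζ)).comp (ContinuousLinearMap.inr ℝ E E) :=
  (((hb.differentiable (by simp) (w, ζ)).hasFDerivAt).comp ζ (hasFDerivAt_prodMk_right w ζ)).fderiv

lemma contDiff_fderiv_right {b : E → E → ℂ} (hb : ContDiff ℝ ∞ fun q : E × E => b q.1 q.2) :
    ContDiff ℝ ∞ fun q : E × E => fderiv ℝ (b q.1) q.2 := by
  have e : (fun q : E × E => fderiv ℝ (b q.1) q.2) = fun q =>
      (fderiv ℝ (fun q : E × E => b q.1 q.2) q).comp (ContinuousLinearMap.inr ℝ E E) :=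
    funext fun q => fderiv_right_eq hb q.1 q.2
  rw [e]
  exact (hb.fderiv_right (by simp)).clm_comp contDiff_const

lemma IsLogSymbol.symCls_fderiv {m ℓ j : ℝ} {b : E → E → ℂ} (hb : IsLogSymbol m ℓ j b) :
    SymCls Set.univ (fun a : E × E => a.1)
      (fun a => tWeight 0 j a.1 * logWeight (m - 1) ℓ a.2) (fun a w => fderiv ℝ (b w) a.2) := by
  refine SymCls.of_le (fun a _ => ?_) (fun a _ => IsLogSymbol.nonneg_weight _ _) fun k => ?_
  · exact ((contDiff_fderiv_right hb.1).comp (contDiff_id.prodMk contDiff_const)).contDiffAt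
  · obtain ⟨C, hC⟩ := hb.2 k 1
    refine ⟨C, fun a _ => ?_⟩
    have h := hC a.1 a.2
    have e : (fun w' => iteratedFDeriv ℝ 1 (b w') a.2) =
        (continuousMultilinearCurryRightEquiv' ℝ 0 E ℂ).symm ∘
          ((continuousMultilinearCurryFin0 ℝ E (E →L[ℝ] ℂ)).symm ∘
            fun w' => fderiv ℝ (b w') a.2) := by
      funext w'
      rw [iteratedFDeriv_succ_eq_comp_right, Function.comp_apply, iteratedFDeriv_zero_eq_comp]
      rfl
    have h1 := LinearIsometryEquiv.norm_iteratedFDeriv_comp_left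
      (continuousMultilinearCurryRightEquiv' ℝ 0 E ℂ).symm
      ((continuousMultilinearCurryFin0 ℝ E (E →L[ℝ] ℂ)).symm ∘ fun w' => fderiv ℝ (b w') a.2) a.1 k
    have h2 := LinearIsometryEquiv.norm_iteratedFDeriv_comp_left
      (continuousMultilinearCurryFin0 ℝ E (E →L[ℝ] ℂ)).symm (fun w' => fderiv ℝ (b w') a.2) a.1 k
    replace h := (congrArg (fun f => ‖iteratedFDeriv ℝ k f a.1‖) e).symm.trans_le h
    replace h := h2.symm.trans_le (h1.symm.trans_le h)
    rw [tWeight_zero_left]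
    simpa [mul_assoc] using h

lemma sub_eq_intervalIntegral {b : E → E → ℂ} (hb : ContDiff ℝ ∞ fun q : E × E => b q.1 q.2)
    (w ζ η : E) : b w ζ - b w η =
      ∫ s in (0:ℝ)..1, fderiv ℝ (b w) (η + s • (ζ - η)) (ζ - η) := by
  have hbw : ContDiff ℝ ∞ (b w) := hb.comp (contDiff_const.prodMk contDiff_id)
  have h1 : ∀ s : ℝ, HasDerivAt (fun s : ℝ => b w (η + s • (ζ - η)))
      (fderiv ℝ (b w) (η + s • (ζ - η)) (ζ - η)) s := fun s => by
    have hl : HasDerivAt (fun s : ℝ => η + s • (ζ - η)) (ζ - η) s := by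
      simpa using ((hasDerivAt_id s).smul_const (ζ - η)).const_add η
    exact (hbw.differentiable (by simp) _).hasFDerivAt.comp_hasDerivAt s hl
  have hc : Continuous fun s : ℝ => fderiv ℝ (b w) (η + s • (ζ - η)) (ζ - η) :=
    ((hbw.continuous_fderiv (by simp)).comp (by fun_prop)).clm_apply continuous_const
  have := intervalIntegral.integral_eq_sub_of_hasDerivAt (fun s _ => h1 s)
    (hc.intervalIntegrable 0 1)
  rw [this]
  simp

/-- Variation of a symbol in the fiber variables. -/
lemma IsLogSymbol.exists_symCls_sub {m ℓ j : ℝ} {b : E → E → ℂ} (hb : IsLogSymbol m ℓ j b) :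
    ∃ N : ℕ, SymCls Set.univ (fun a : E × E × E => a.1)
      (fun a => tWeight 0 j a.1 * (logWeight (m - 1) ℓ a.2.1 * (1 + ‖a.2.1 - a.2.2‖) ^ N))
      (fun a w => b w a.2.1 - b w a.2.2) := by
  have hmod : Moderate (logWeight (m - 1) ℓ : E → ℝ) := moderate_logWeight _ _
  obtain ⟨C₀, N, hC₀, hN⟩ := hmod.bound
  have hs : ∀ ζ : E, ContDiff ℝ ∞ fun w => b w ζ := fun ζ =>
    hb.1.comp (contDiff_id.prodMk contDiff_const)
  -- `N` powers move the weight from a point of the segment to `ζ`; one more comes from the factor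
  -- `ζ - η` in the mean value formula.
  refine ⟨N + 1, SymCls.of_le (fun a _ => ((hs _).sub (hs _)).contDiffAt) (fun a _ =>
    mul_nonneg (tWeight_pos _ _ _).le (mul_nonneg (logWeight_pos _ _ _).le (by positivity)))
    fun k => ?_⟩
  obtain ⟨C, hC, hCb⟩ := hb.symCls_fderiv.bound k
  refine ⟨C * C₀, ?_⟩
  rintro ⟨w, ζ, η⟩ -
  simp only
  have e : (fun w => b w ζ - b w η) = fun w => ∫ s in (0:ℝ)..1,
      (fun q : E × ℝ => fderiv ℝ (b q.1) (η + q.2 • (ζ - η)) (ζ - η)) (w, s) :=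
    funext fun w => sub_eq_intervalIntegral hb.1 w ζ η
  have hg : ContDiff ℝ ∞ fun q : E × ℝ => fderiv ℝ (b q.1) (η + q.2 • (ζ - η)) (ζ - η) := by
    refine ContDiff.clm_apply ((contDiff_fderiv_right hb.1).comp
      (g := fun q : E × E => fderiv ℝ (b q.1) q.2)
      (f := fun q : E × ℝ => (q.1, η + q.2 • (ζ - η))) ?_) contDiff_const
    fun_prop
  rw [e]
  refine norm_iteratedFDeriv_intervalIntegral_le k hg w _ fun s hs' => ?_
  simp only
  have h1 := hCb (w, η + s • (ζ - η)) trivial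
  simp only at h1
  have hsm : ContDiff ℝ ∞ fun w => fderiv ℝ (b w) (η + s • (ζ - η)) :=
    (contDiff_fderiv_right hb.1).comp (g := fun q : E × E => fderiv ℝ (b q.1) q.2)
      (f := fun w : E => (w, η + s • (ζ - η))) (contDiff_id.prodMk contDiff_const)
  have h2 := (ContinuousLinearMap.apply ℝ ℂ (ζ - η)).norm_iteratedFDeriv_comp_left
    (hsm.contDiffAt (x := w)) (n := k) (N := ∞) (by exact_mod_cast le_top)
  have h3 : ‖ContinuousLinearMap.apply ℝ ℂ (ζ - η)‖ ≤ ‖ζ - η‖ :=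
    ContinuousLinearMap.opNorm_le_bound _ (norm_nonneg _) fun L => by
      rw [ContinuousLinearMap.apply_apply, mul_comm]; exact L.le_opNorm _
  have h4 := hN (η + s • (ζ - η)) ζ
  have h5 : ‖η + s • (ζ - η) - ζ‖ ≤ ‖ζ - η‖ := by
    have : η + s • (ζ - η) - ζ = (s - 1) • (ζ - η) := by module
    rw [this, norm_smul]
    refine mul_le_of_le_one_left (norm_nonneg _) ?_
    rw [Real.norm_eq_abs, abs_le]
    constructor <;> linarith [hs'.1, hs'.2]
  have ht := tWeight_pos 0 j w
  have hl := logWeight_pos (m - 1) ℓ ζ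
  have hn := norm_nonneg (ζ - η)
  refine h2.trans ?_
  calc _ ≤ ‖ζ - η‖ * (C * (tWeight 0 j w * (C₀ * logWeight (m - 1) ℓ ζ * (1 + ‖ζ - η‖) ^ N))) := by
        refine mul_le_mul h3 (h1.trans ?_) (norm_nonneg _) (norm_nonneg _)
        gcongr
        exact h4.trans (by gcongr)
    _ ≤ (1 + ‖ζ - η‖) *
        (C * (tWeight 0 j w * (C₀ * logWeight (m - 1) ℓ ζ * (1 + ‖ζ - η‖) ^ N))) :=
        mul_le_mul_of_nonneg_right (by linarith) (by positivity)
    _ = _ := by ring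

/-- The scaling of fiber variables that relates the conventions for the Fourier transform. -/
def scaled (b : EuclideanSpace ℝ (Fin n) → EuclideanSpace ℝ (Fin n) → ℂ)
    (w ζ : EuclideanSpace ℝ (Fin n)) : ℂ := b w ((-(2 * Real.pi)) • ζ)

lemma contDiff_scaled {b : E → E → ℂ} (hb : ContDiff ℝ ∞ fun q : E × E => b q.1 q.2) :
    ContDiff ℝ ∞ fun q : E × E => scaled b q.1 q.2 :=
  hb.comp (contDiff_fst.prodMk (contDiff_snd.const_smul (-(2 * Real.pi))))

/-- Substitution `ζ ↦ -2πζ`; its Jacobian cancels the factor `(2π)⁻ⁿ`. -/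
lemma opTranspose_eq_ampOp (b : E → E → ℂ) (ψ : E → ℝ) (f : E → ℂ) (w' : E) :
    opTranspose b ψ f w' = ampOp (fun w' w ζ => (ψ (w - w') : ℂ) * scaled b w ζ) f w' := by
  unfold opTranspose ampOp
  set F : E → ℂ := fun ζ => ∫ w : E, Complex.exp (Complex.I * (inner ℝ (w - w') ζ : ℝ)) * b w ζ *
    (ψ (w - w') : ℂ) * f w with hF
  have h1 : ∀ ζ : E, (∫ w : E, Real.fourierChar (-(inner ℝ (w - w') ζ)) •
      ((ψ (w - w') : ℂ) * scaled b w ζ * f w)) = F ((-(2 * Real.pi)) • ζ) := fun ζ => by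
    rw [hF]
    refine integral_congr_ae (Filter.Eventually.of_forall fun w => ?_)
    simp only [scaled]
    rw [Circle.smul_def, Real.fourierChar_apply, smul_eq_mul, inner_smul_right]
    have e : (2 * Real.pi * -(inner ℝ (w - w') ζ) : ℝ) * Complex.I =
        Complex.I * ((-(2 * Real.pi) * inner ℝ (w - w') ζ : ℝ) : ℂ) := by push_cast; ring
    have e' : Complex.exp (((2 * Real.pi * -(inner ℝ (w - w') ζ) : ℝ) : ℂ) * Complex.I) =
        Complex.exp (Complex.I * ((-(2 * Real.pi) * inner ℝ (w - w') ζ : ℝ) : ℂ)) := by rw [e]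
    rw [e']
    ring
  rw [integral_congr_ae (Filter.Eventually.of_forall h1), Measure.integral_comp_smul]
  rw [finrank_euclideanSpace, Fintype.card_fin, neg_pow, abs_inv, abs_mul, abs_pow, abs_neg,
    abs_one, one_pow, one_mul, abs_of_nonneg (by positivity)]
  rw [Complex.real_smul]

end LogSymbols
end

noncomputable section


/-! ### Conjugation by weights and compositions of two quantizations -/

section Sandwich

open MeasureTheory

variable {n : ℕ} [NeZero n]

local notation "E" => EuclideanSpace ℝ (Fin n)

lemma symCls_of_hasCompactSupport {V G : Type*} [NormedAddCommGroup V] [NormedSpace ℝ V]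
    [NormedAddCommGroup G] [NormedSpace ℝ G] {f : V → G} (hf : ContDiff ℝ ∞ f)
    (hc : HasCompactSupport f) : SymCls Set.univ (fun v : V => v) (fun _ => 1) (fun _ => f) :=
  SymCls.of_le (fun _ _ => hf.contDiffAt) (fun _ _ => zero_le_one) fun k => by
    obtain ⟨C, hC⟩ := (hf.continuous_iteratedFDeriv (m := k)
      (by exact_mod_cast le_top)).bounded_above_of_compact_support (hc.iteratedFDeriv k)
    exact ⟨C, fun v _ => by simpa using hC v⟩

lemma HasCompactSupport.exists_norm_le {V : Type*} [NormedAddCommGroup V] {ψ : V → ℝ}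
    (hψ : HasCompactSupport ψ) : ∃ R, ∀ v, ψ v ≠ 0 → ‖v‖ ≤ R := by
  obtain ⟨R, hR⟩ := hψ.isCompact.isBounded.exists_norm_le
  exact ⟨R, fun v hv => hR v (subset_tsupport _ hv)⟩

variable {V : Type*} [NormedAddCommGroup V] [NormedSpace ℝ V]

/-- The product of functions of two nearby points whose weights cancel. -/
lemma SymCls.sandwich {α : Type*} {p : α → V} (L₁ L₂ : V →L[ℝ] EuclideanSpace ℝ (Fin n))
    {m : EuclideanSpace ℝ (Fin n) → ℂ} {r j r' j' : ℝ}
    (hm : SymCls Set.univ (fun w : EuclideanSpace ℝ (Fin n) => w) (tWeight r' j') (fun _ => m))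
    (hr : r' + r = 0) (hj : j' + j = 0)
    {ψ : EuclideanSpace ℝ (Fin n) → ℝ} (hψ : ContDiff ℝ ∞ ψ) (hψc : HasCompactSupport ψ)
    {W : α → ℝ} (hW : ∀ a, 0 ≤ W a) {F : α → EuclideanSpace ℝ (Fin n) → ℂ}
    (hF : SymCls Set.univ (fun a => L₂ (p a)) (fun a => tWeight r j (L₂ (p a)) * W a) F) :
    SymCls Set.univ p W (fun a y => m (L₁ y) * ψ (L₂ y - L₁ y) * F a (L₂ y)) := by
  obtain ⟨R, hR⟩ := hψc.exists_norm_le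
  obtain ⟨C, hC, hCt⟩ := tWeight_le_of_norm_sub_le (n := n) r j R
  have h1 : SymCls Set.univ p (fun a => tWeight r' j' (L₁ (p a))) (fun _ y => m (L₁ y)) :=
    (hm.reindex (fun a => L₁ (p a))).comp_clm L₁ (fun _ _ => rfl)
  have h2 : SymCls Set.univ p (fun _ => 1) (fun _ y => (ψ (L₂ y - L₁ y) : ℂ)) :=
    (((symCls_of_hasCompactSupport hψ hψc).ofReal).reindex
      (fun a => (L₂ - L₁) (p a))).comp_clm (L₂ - L₁) (fun _ _ => rfl)
  have h3 : SymCls Set.univ p (fun a => tWeight r j (L₂ (p a)) * W a) (fun a y => F a (L₂ y)) :=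
    hF.comp_clm L₂ (fun _ _ => rfl)
  have hcl : IsClosed {y : V | ‖L₂ y - L₁ y‖ ≤ R} :=
    isClosed_le (by fun_prop) continuous_const
  -- On the support of `ψ` the two points are at bounded distance, so their weights are comparable
  -- and the opposite exponents cancel.
  have h4 : SymCls {a | ‖L₂ (p a) - L₁ (p a)‖ ≤ R} p W
      (fun a y => m (L₁ y) * ψ (L₂ y - L₁ y) * F a (L₂ y)) :=
    (((h1.mul h2).mul h3).mono_set (Set.subset_univ _)).mono (c := C) (fun a ha => by
      have e := tWeight_mul r' j' r j (L₁ (p a))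
      rw [hr, hj, tWeight_zero] at e
      have := hCt _ _ ha
      have h5 := tWeight_pos r' j' (L₁ (p a))
      calc tWeight r' j' (L₁ (p a)) * 1 * (tWeight r j (L₂ (p a)) * W a)
          ≤ tWeight r' j' (L₁ (p a)) * 1 * (C * tWeight r j (L₁ (p a)) * W a) := by
            gcongr; exact hW a
        _ = C * (tWeight r' j' (L₁ (p a)) * tWeight r j (L₁ (p a))) * W a := by ring
        _ = C * W a := by rw [e, mul_one]) hC
  have h5 : SymCls {a | ‖L₂ (p a) - L₁ (p a)‖ ≤ R}ᶜ p W
      (fun a y => m (L₁ y) * ψ (L₂ y - L₁ y) * F a (L₂ y)) :=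
    SymCls.zero (fun a _ => hW a) fun a ha => by
      filter_upwards [hcl.isOpen_compl.mem_nhds ha] with y hy
      have : ψ (L₂ y - L₁ y) = 0 := by by_contra h; exact hy (hR _ h)
      simp [this]
  exact (h4.union h5).mono_set fun a _ => em _

/-- Local symbols: smooth functions of `w` and `ζ` with uniform bounds on the derivatives
in `w`. -/
structure IsLocSym (r j : ℝ) (W : EuclideanSpace ℝ (Fin n) → ℝ)
    (B : EuclideanSpace ℝ (Fin n) → EuclideanSpace ℝ (Fin n) → ℂ) : Prop where
  smooth : ContDiff ℝ ∞ fun q : EuclideanSpace ℝ (Fin n) × EuclideanSpace ℝ (Fin n) => B q.1 q.2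
  cls : SymCls Set.univ (fun a : EuclideanSpace ℝ (Fin n) × EuclideanSpace ℝ (Fin n) => a.1)
    (fun a => tWeight r j a.1 * W a.2) (fun a w => B w a.2)

lemma IsLocSym.mono {r j : ℝ} {W W' : EuclideanSpace ℝ (Fin n) → ℝ}
    {B : EuclideanSpace ℝ (Fin n) → EuclideanSpace ℝ (Fin n) → ℂ} (hB : IsLocSym r j W B) {c : ℝ}
    (hc : 0 < c) (h : ∀ ζ, W ζ ≤ c * W' ζ) : IsLocSym r j W' B :=
  ⟨hB.smooth, hB.cls.mono (c := c) (fun a _ => by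
    have := tWeight_pos r j a.1
    calc _ ≤ tWeight r j a.1 * (c * W' a.2) := by gcongr; exact h _
      _ = _ := by ring) hc⟩

lemma IsLocSym.of_moderate {r j : ℝ} {W : EuclideanSpace ℝ (Fin n) → ℝ}
    {B : EuclideanSpace ℝ (Fin n) → EuclideanSpace ℝ (Fin n) → ℂ} (hB : IsLocSym r j W B)
    (hW : Moderate W) : ∃ D : ℕ, IsLocSym r j (fun ζ => (1 + ‖ζ‖) ^ D) B := by
  obtain ⟨C, D, hC, h⟩ := hW.le_pow
  exact ⟨D, hB.mono hC h⟩

lemma isLocSym_of_symCls {r j : ℝ} {P : EuclideanSpace ℝ (Fin n) → ℂ}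
    (hP : SymCls Set.univ (fun w : EuclideanSpace ℝ (Fin n) => w) (tWeight r j) (fun _ => P)) :
    IsLocSym r j (fun _ => 1) (fun w _ => P w) :=
  ⟨hP.contDiff.comp contDiff_fst, by
    simpa using hP.reindex (fun a : EuclideanSpace ℝ (Fin n) × EuclideanSpace ℝ (Fin n) => a.1)⟩

section Amplitudes

variable {m P : EuclideanSpace ℝ (Fin n) → ℂ} {r j r' j' : ℝ}
    {B Q : EuclideanSpace ℝ (Fin n) → EuclideanSpace ℝ (Fin n) → ℂ}
    (hm : SymCls Set.univ (fun w : EuclideanSpace ℝ (Fin n) => w) (tWeight r' j') (fun _ => m))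
    (hr : r' + r = 0) (hj : j' + j = 0)
    {ψ : EuclideanSpace ℝ (Fin n) → ℝ} (hψ : ContDiff ℝ ∞ ψ) (hψc : HasCompactSupport ψ)

include hm hr hj hψ hψc in
lemma IsLocSym.isAmp {D : ℕ} (hB : IsLocSym r j (fun ζ => (1 + ‖ζ‖) ^ D) B) :
    IsAmp (fun w' w ζ => m w' * ψ (w - w') * B w ζ) := by
  obtain ⟨R, hR⟩ := hψc.exists_norm_le
  refine ⟨?_, ⟨R, fun w' w ζ h => hR _ fun h0 => h (by simp [h0])⟩, D, ?_⟩
  · have h1 : ContDiff ℝ ∞ fun q : E × E × E => m q.1 := hm.contDiff.comp contDiff_fst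
    have h2 : ContDiff ℝ ∞ fun q : E × E × E => (ψ (q.2.1 - q.1) : ℂ) :=
      Complex.ofRealCLM.contDiff.comp (hψ.comp (by fun_prop))
    have h3 : ContDiff ℝ ∞ fun q : E × E × E => B q.2.1 q.2.2 := hB.smooth.comp contDiff_snd
    exact (h1.mul h2).mul h3
  · exact SymCls.sandwich (p := fun a : E × E × E => (a.1, a.2.1))
      (ContinuousLinearMap.fst ℝ E E) (ContinuousLinearMap.snd ℝ E E) hm hr hj hψ hψc
      (W := fun a : E × E × E => (1 + ‖a.2.2‖) ^ D) (fun _ => by positivity)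
      (F := fun (a : E × E × E) w => B w a.2.2)
      (hB.cls.reindex fun a : E × E × E => a.2)

include hψ hψc in
lemma IsLocSym.isAmp_left {D : ℕ} (hQ : IsLocSym 0 0 (fun ζ => (1 + ‖ζ‖) ^ D) Q) :
    IsAmp (fun w' w ζ => Q w' ζ * ψ (w - w')) := by
  obtain ⟨R, hR⟩ := hψc.exists_norm_le
  refine ⟨?_, ⟨R, fun w' w ζ h => hR _ fun h0 => h (by simp [h0])⟩, D, ?_⟩
  · have h2 : ContDiff ℝ ∞ fun q : E × E × E => (ψ (q.2.1 - q.1) : ℂ) :=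
      Complex.ofRealCLM.contDiff.comp (hψ.comp (by fun_prop))
    have h3 : ContDiff ℝ ∞ fun q : E × E × E => Q q.1 q.2.2 :=
      hQ.smooth.comp (contDiff_fst.prodMk contDiff_snd.snd)
    exact h3.mul h2
  · have h2 : SymCls Set.univ (fun a : E × E × E => (a.1, a.2.1)) (fun _ => 1)
        (fun _ q => (ψ (q.2 - q.1) : ℂ)) :=
      (((symCls_of_hasCompactSupport hψ hψc).ofReal).reindex (fun a : E × E × E =>
        (ContinuousLinearMap.snd ℝ E E - ContinuousLinearMap.fst ℝ E E) (a.1, a.2.1))).comp_clm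
        (ContinuousLinearMap.snd ℝ E E - ContinuousLinearMap.fst ℝ E E) (fun _ _ => rfl)
    have h3 : SymCls Set.univ (fun a : E × E × E => (a.1, a.2.1))
        (fun a => tWeight 0 0 a.1 * (1 + ‖a.2.2‖) ^ D) (fun a q => Q q.1 a.2.2) :=
      (hQ.cls.reindex (fun a : E × E × E => (a.1, a.2.2))).comp_clm
        (ContinuousLinearMap.fst ℝ E E) (fun _ _ => rfl)
    refine (h3.mul h2).mono (c := 1) (fun a _ => ?_) one_pos
    simp [tWeight_zero]

lemma ampOp_const_mul (p : E → E → E → ℂ) (c : E → ℂ) (f : E → ℂ) (w' : E) :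
    ampOp (fun w' w ζ => c w' * p w' w ζ) f w' = c w' * ampOp p f w' := by
  unfold ampOp
  rw [← integral_const_mul]
  refine integral_congr_ae (Filter.Eventually.of_forall fun ζ => ?_)
  simp only
  rw [← integral_const_mul]
  refine integral_congr_ae (Filter.Eventually.of_forall fun w => ?_)
  simp only [Circle.smul_def, smul_eq_mul]
  ring

include hm hr hj hψ hψc in
/-- Weighted `L²` bounds for a composition of two quantizations minus a multiplication
operator. -/
theorem wsq_sandwich_le (hψ1 : ψ 0 = 1) {D₁ D₂ N : ℕ}
    (hB : IsLocSym r j (fun ζ => (1 + ‖ζ‖) ^ D₁) B)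
    (hQ : IsLocSym 0 0 (fun ζ => (1 + ‖ζ‖) ^ D₂) Q)
    (hP : SymCls Set.univ (fun w : EuclideanSpace ℝ (Fin n) => w) (tWeight r j) (fun _ => P))
    {M M₂ : EuclideanSpace ℝ (Fin n) → ℝ} (hM : Moderate M) (hM₂ : Moderate M₂)
    (hBr : SymCls Set.univ (fun a : EuclideanSpace ℝ (Fin n) × EuclideanSpace ℝ (Fin n) ×
        EuclideanSpace ℝ (Fin n) => a.1)
      (fun a => tWeight r j a.1 * (M a.2.1 * (1 + ‖a.2.1 - a.2.2‖) ^ N))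
      (fun a w => B w a.2.1 * Q w a.2.2 - P w)) :
    ∃ C : ENNReal, C ≠ ⊤ ∧ ∀ φ Ψ : 𝓢(EuclideanSpace ℝ (Fin n), ℂ), IsBT (fun w => φ w) →
      (∀ w, Ψ w = m w * (ampOp (fun w' w ζ => ψ (w - w') * B w ζ)
        (ampOp (fun w' w ζ => Q w' ζ * ψ (w - w')) (fun w => φ w)) w - P w * φ w)) →
      wsq M₂ Ψ ≤ C * wsq (fun ξ => M₂ ξ * M ξ) φ := by
  have hp₁ := hB.isAmp hm hr hj hψ hψc
  have hq₁ := hQ.isAmp_left hψ hψc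
  have hP' : IsLocSym r j (fun ζ => (1 + ‖ζ‖) ^ 0) (fun w _ => P w) := by
    simpa using isLocSym_of_symCls hP
  have h1' : SymCls Set.univ (fun w : E => w) (tWeight 0 0) (fun _ _ => (1 : ℂ)) :=
    SymCls.const _ fun w _ => by simp [tWeight_zero]
  -- Multiplication by `P` is also a composition of two amplitude operators, with symbols
  -- independent of the fibre variable; in this form it can be subtracted from the first composition
  -- before estimating.
  have hI : IsLocSym 0 0 (fun ζ : E => (1 + ‖ζ‖) ^ 0) (fun _ _ => (1 : ℂ)) := by
    simpa using isLocSym_of_symCls h1'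
  have hp₂ := hP'.isAmp hm hr hj hψ hψc
  have hq₂ := hI.isAmp_left hψ hψc
  obtain ⟨R, hR⟩ := hψc.exists_norm_le
  have he : SymCls Set.univ (fun a : ((E × E) × E) × E × E => a.1)
      (fun a => M a.2.1 * (1 + ‖a.2.1 - a.2.2‖) ^ N)
      (fun a z => (m z.1.1 * ψ (z.1.2 - z.1.1) * B z.1.2 a.2.1) * (Q z.1.2 a.2.2 * ψ (z.2 - z.1.2)) -
        (m z.1.1 * ψ (z.1.2 - z.1.1) * P z.1.2) * ((1 : ℂ) * ψ (z.2 - z.1.2))) := by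
    let F1 := ContinuousLinearMap.fst ℝ (E × E) E
    let L₁ : (E × E) × E →L[ℝ] E := (ContinuousLinearMap.fst ℝ E E).comp F1
    let L₂ : (E × E) × E →L[ℝ] E := (ContinuousLinearMap.snd ℝ E E).comp F1
    let L₃ : (E × E) × E →L[ℝ] E := ContinuousLinearMap.snd ℝ (E × E) E
    have h1 := SymCls.sandwich (p := fun a : ((E × E) × E) × E × E => a.1) L₁ L₂ hm hr hj hψ hψc
      (W := fun a : ((E × E) × E) × E × E => M a.2.1 * (1 + ‖a.2.1 - a.2.2‖) ^ N)
      (fun a => mul_nonneg (hM.pos _).le (by positivity))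
      (F := fun (a : ((E × E) × E) × E × E) w => B w a.2.1 * Q w a.2.2 - P w)
      (hBr.reindex fun a : ((E × E) × E) × E × E => (a.1.1.2, a.2))
    have h2 : SymCls Set.univ (fun a : ((E × E) × E) × E × E => a.1) (fun _ => 1)
        (fun _ z => (ψ (z.2 - z.1.2) : ℂ)) :=
      (((symCls_of_hasCompactSupport hψ hψc).ofReal).reindex
        (fun a : ((E × E) × E) × E × E => (L₃ - L₂) a.1)).comp_clm (L₃ - L₂) (fun _ _ => rfl)
    refine ((h1.mul h2).mono (c := 1) (fun a _ => by simp) one_pos).congr fun a _ =>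
      Filter.Eventually.of_forall fun z => ?_
    simp only [L₁, L₂, F1, ContinuousLinearMap.comp_apply, ContinuousLinearMap.coe_fst',
      ContinuousLinearMap.coe_snd']
    ring
  obtain ⟨C, hC, h⟩ := wsq_ampOp_sub_le hp₁ hq₁ hp₂ hq₂ hM hM₂ he
  refine ⟨C, hC, fun φ Ψ hφ hΨ => h φ Ψ hφ fun w => ?_⟩
  rw [hΨ]
  have hsm : ContDiff ℝ ∞ fun q : E × E => (ψ (q.2 - q.1) : ℂ) :=
    Complex.ofRealCLM.contDiff.comp (hψ.comp (by fun_prop))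
  have e1 : ampOp (fun w' w (_ : E) => (1 : ℂ) * ψ (w - w')) (fun w => φ w) = fun w => φ w := by
    funext w
    rw [ampOp_eq_mul (h := fun w' w => (1 : ℂ) * ψ (w - w')) (contDiff_const.mul hsm) (R := R)
      (fun w' w h => hR _ fun h0 => h (by simp [h0])) hφ.smooth]
    simp [hψ1]
  have e2 : ampOp (fun w' w (_ : E) => m w' * ψ (w - w') * P w) (fun w => φ w) w =
      m w * (P w * φ w) := by
    rw [ampOp_eq_mul (h := fun w' w => m w' * ψ (w - w') * P w)
      (((hm.contDiff.comp contDiff_fst).mul hsm).mul (hP.contDiff.comp contDiff_snd)) (R := R)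
      (fun w' w h => hR _ fun h0 => h (by simp [h0])) hφ.smooth]
    simp [hψ1, mul_assoc]
  have e3 : ∀ f : E → ℂ, ampOp (fun w' w ζ => m w' * ψ (w - w') * B w ζ) f w =
      m w * ampOp (fun w' w ζ => ψ (w - w') * B w ζ) f w := fun f => by
    rw [← ampOp_const_mul]
    simp only [mul_assoc]
  change _ = ampOp (fun w' w ζ => m w' * ψ (w - w') * B w ζ) _ w -
    ampOp (fun w' w (_ : E) => m w' * ψ (w - w') * P w)
      (ampOp (fun w' w (_ : E) => (1 : ℂ) * ψ (w - w')) fun w => φ w) w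
  rw [e1, e2, e3]
  ring

end Amplitudes

end Sandwich
end

noncomputable section


/-! ### The symbol `a`, the quotient symbol and the splitting of `a` -/

section SymbolGeometry

variable {n : ℕ} [NeZero n]

local notation "E" => EuclideanSpace ℝ (Fin n)

lemma IsLocSym.add {r j : ℝ} {W : EuclideanSpace ℝ (Fin n) → ℝ}
    {B B' : EuclideanSpace ℝ (Fin n) → EuclideanSpace ℝ (Fin n) → ℂ} (hB : IsLocSym r j W B)
    (hB' : IsLocSym r j W B') : IsLocSym r j W (fun w ζ => B w ζ + B' w ζ) :=
  ⟨hB.smooth.add hB'.smooth, hB.cls.add hB'.cls⟩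

lemma IsLocSym.mul_right {r j r' j' : ℝ} {W : EuclideanSpace ℝ (Fin n) → ℝ}
    {B : EuclideanSpace ℝ (Fin n) → EuclideanSpace ℝ (Fin n) → ℂ} (hB : IsLocSym r j W B)
    {P : EuclideanSpace ℝ (Fin n) → ℂ}
    (hP : SymCls Set.univ (fun w : EuclideanSpace ℝ (Fin n) => w) (tWeight r' j') (fun _ => P)) :
    IsLocSym (r + r') (j + j') W (fun w ζ => B w ζ * P w) := by
  refine ⟨hB.smooth.mul (hP.contDiff.comp contDiff_fst), ?_⟩
  refine (hB.cls.mul (hP.reindex (fun a : E × E => a.1))).mono (c := 1) (fun a _ => ?_) one_pos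
  rw [← tWeight_mul]
  exact le_of_eq (by ring)

lemma IsLogSymbol.isLocSym {m ℓ j : ℝ}
    {b : EuclideanSpace ℝ (Fin n) → EuclideanSpace ℝ (Fin n) → ℂ} (hb : IsLogSymbol m ℓ j b) :
    IsLocSym 0 j (logWeight m ℓ) b := ⟨hb.1, hb.symCls⟩

lemma IsLocSym.scaled_logWeight {r j m ℓ : ℝ}
    {B : EuclideanSpace ℝ (Fin n) → EuclideanSpace ℝ (Fin n) → ℂ}
    (hB : IsLocSym r j (logWeight m ℓ) B) : IsLocSym r j (logWeight m ℓ) (scaled B) := by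
  have h : IsLocSym r j (fun ζ => logWeight m ℓ ((-(2 * Real.pi)) • ζ)) (scaled B) :=
    ⟨contDiff_scaled hB.smooth, hB.cls.reindex fun a : E × E => (a.1, (-(2 * Real.pi)) • a.2)⟩
  have hne : -(2 * Real.pi) ≠ 0 := by simp [Real.pi_ne_zero]
  obtain ⟨C, hC, hC'⟩ : ∃ C > 0, ∀ ζ : EuclideanSpace ℝ (Fin n),
      logWeight m ℓ ((-(2 * Real.pi)) • ζ) ≤ C * logWeight m ℓ ζ := logWeight_smul_le m ℓ hne
  exact h.mono hC hC'

variable {M : Type*} [TopologicalSpace M] [ChartedSpace (EuclideanHalfSpace n) M]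
  {κ : OpenPartialHomeomorph M (EuclideanHalfSpace n)}
  (hκ : κ ∈ IsManifold.maximalAtlas (𝓡∂ n) ∞ M) {χ : M → ℝ} (hχ : IsCutoff κ χ)

include hκ hχ in
-- The cutoff makes the product vanish near every point outside the chart domain, so bounds over its
-- compact support are global bounds.
lemma IsCutoff.isLocSym {H : EuclideanSpace ℝ (Fin n) → EuclideanSpace ℝ (Fin n) → ℝ} {r j : ℝ}
    {W : EuclideanSpace ℝ (Fin n) → ℝ} (hW : ∀ ζ, 0 ≤ W ζ)
    (hs : ContDiffOn ℝ ∞ (fun q : EuclideanSpace ℝ (Fin n) × EuclideanSpace ℝ (Fin n) => H q.1 q.2)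
      (logDomain κ ×ˢ Set.univ))
    (hH : SymCls (logOver κ (tsupport χ) ×ˢ Set.univ)
      (fun a : EuclideanSpace ℝ (Fin n) × EuclideanSpace ℝ (Fin n) => a.1)
      (fun a => tWeight r j a.1 * W a.2) (fun a w => H w a.2)) :
    IsLocSym r j W (fun w ζ => ((logLift κ χ w * H w ζ : ℝ) : ℂ)) := by
  have hl := hχ.symCls_logLift hκ
  have h0 : ∀ w, w ∉ logOver κ (tsupport χ) → logLift κ χ w = 0 := fun w hw =>
    logLift_eq_zero (fun p hp => image_eq_zero_of_notMem_tsupport hp) hw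
  refine ⟨Complex.ofRealCLM.contDiff.comp (contDiff_iff_contDiffAt.2 fun q => ?_), ?_⟩
  · by_cases hq : q.1 ∈ logDomain κ
    · exact (hl.contDiff.comp contDiff_fst).contDiffAt.mul
        (hs.contDiffAt (((isOpen_logDomain κ).prod isOpen_univ).mem_nhds ⟨hq, trivial⟩))
    · have h1 : ∀ᶠ q' : E × E in 𝓝 q, q'.1 ∉ logOver κ (tsupport χ) :=
        continuous_fst.continuousAt.eventually
          ((isClosed_logOver hχ.compact hχ.subset).isOpen_compl.mem_nhds fun h => hq h.1)
      refine (contDiffAt_const (c := (0 : ℝ))).congr_of_eventuallyEq ?_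
      filter_upwards [h1] with q' hq'
      change logLift κ χ q'.1 * H q'.1 q'.2 = 0
      rw [h0 _ hq', zero_mul]
  · refine SymCls.ofReal ?_
    refine SymCls.of_logOver (f := fun ζ w => logLift κ χ w * H w ζ) hχ.compact hχ.subset ?_
      (fun a => mul_nonneg (tWeight_pos _ _ _).le (hW _)) fun ζ w hw => by rw [h0 w hw, zero_mul]
    have h1 : SymCls (logOver κ (tsupport χ) ×ˢ Set.univ) (fun a : E × E => a.1) (fun _ => 1)
        (fun _ => logLift κ χ) :=
      hl.comp_index (fun a : E × E => a.1) fun _ _ => trivial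
    exact (h1.mul hH).mono (c := 1) (fun a _ => by simp) one_pos

variable [IsManifold (𝓡∂ n) ∞ M] {x : M → ℝ} (hx : IsBoundaryDefining n x)

/-- The function `log x⁻¹` in logarithmic coordinates. -/
def logx (x : M → ℝ) (κ : OpenPartialHomeomorph M (EuclideanHalfSpace n))
    (w : EuclideanSpace ℝ (Fin n)) : ℝ := Real.log ((x (logInv κ w))⁻¹)

/-- The function `log ρ⁻¹` in logarithmic coordinates. -/
def logρ {g : BMetric n M} (ρ : BInvNorm g) (κ : OpenPartialHomeomorph M (EuclideanHalfSpace n))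
    (w ζ : EuclideanSpace ℝ (Fin n)) : ℝ := -Real.log (ρ.val κ (expPt w) ζ)

variable {g : BMetric n M} (ρ : BInvNorm g)

include hκ hx

lemma logx_pos {w : E} (hw : w ∈ logDomain κ) : 0 < logx x κ w :=
  (Real.log_pos (by norm_num)).trans_le (hx.log_inv_pos hκ hw)

omit hx in
lemma logρ_pos {w : E} (hw : w ∈ logDomain κ) (ζ : E) : 0 < logρ ρ κ w ζ :=
  (Real.log_pos (by norm_num)).trans_le (ρ.log_two_le hκ hw ζ)

lemma contDiffOn_logx : ContDiffOn ℝ ∞ (fun q : E × E => logx x κ q.1)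
    (logDomain κ ×ˢ Set.univ) := by
  have h1 : ContDiffOn ℝ ∞ (fun q : E × E => x (logInv κ q.1)) (logDomain κ ×ˢ Set.univ) :=
    (contDiffOn_comp_logInv hκ hx.smooth).comp contDiff_fst.contDiffOn fun q hq => hq.1
  exact (h1.inv fun q hq => (hx.pos hκ hq.1).ne').log
    fun q hq => (inv_pos.2 (hx.pos hκ hq.1)).ne'

lemma doubleLogSymbol_eq {ℓ v μ : ℝ} {w : E} (hw : w ∈ logDomain κ) (ζ : E) :
    doubleLogSymbol x ρ ℓ v μ κ w ζ = (v * logx x κ w + μ * logρ ρ κ w ζ) ^ ℓ := by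
  have h1 := hx.pos hκ hw
  have h2 := ρ.pos κ hκ _ hw ζ
  unfold doubleLogSymbol logx logρ
  rw [Real.log_mul (Real.rpow_pos_of_pos h1 _).ne' (Real.rpow_pos_of_pos h2 _).ne',
    Real.log_rpow h1, Real.log_rpow h2, Real.log_inv]
  congr 1
  ring

variable {S : Set M} (hS : IsCompact S) (h : S ⊆ κ.source)

section Classes
include hS h

lemma symCls_logx : SymCls (logOver κ S ×ˢ Set.univ) (fun a : E × E => a.1)
    (fun a => japanese (a.1 0)) (fun _ w => logx x κ w) :=
  (hx.symCls_log hκ hS h).comp_index (fun a : E × E => a.1) fun _ ha => ha.1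

lemma symCls_logx_rpow (t : ℝ) : SymCls (logOver κ S ×ˢ Set.univ) (fun a : E × E => a.1)
    (fun a => japanese (a.1 0) ^ t) (fun _ w => logx x κ w ^ t) := by
  obtain ⟨c, hc, hc'⟩ := hx.exists_le_log hκ hS h
  exact (symCls_logx hκ hx hS h).rpow hc (fun _ _ => japanese_pos _) (fun a ha => hc' a.1 ha.1) t

omit hx in
lemma symCls_logρ_rpow (t : ℝ) : SymCls (logOver κ S ×ˢ Set.univ) (fun a : E × E => a.1)
    (fun a => logBracket a.2 ^ t) (fun a w => logρ ρ κ w a.2 ^ t) := by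
  obtain ⟨c, hc, hc'⟩ := ρ.exists_le_log hκ hS h
  exact (ρ.symCls_log hκ hS h).rpow hc (fun _ _ => logBracket_pos _)
    (fun a ha => hc' a.1 ha.1 a.2) t

/-- Powers of `log (x^{-v} ρ^{-μ})`. -/
lemma symCls_sum_rpow {v μ : ℝ} (hv : 0 < v) (hμ : 0 < μ) (t : ℝ) :
    SymCls (logOver κ S ×ˢ Set.univ) (fun a : E × E => a.1)
      (fun a => (japanese (a.1 0) + logBracket a.2) ^ t)
      (fun a w => (v * logx x κ w + μ * logρ ρ κ w a.2) ^ t) := by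
  obtain ⟨c, hc, hc'⟩ := hx.exists_le_log hκ hS h
  obtain ⟨d, hd, hd'⟩ := ρ.exists_le_log hκ hS h
  have hJ : ∀ a : E × E, 0 < japanese (a.1 0) := fun _ => japanese_pos _
  have hB : ∀ a : E × E, 0 < logBracket a.2 := fun _ => logBracket_pos _
  have h1 : SymCls (logOver κ S ×ˢ Set.univ) (fun a : E × E => a.1)
      (fun a => japanese (a.1 0) + logBracket a.2)
      (fun a w => v * logx x κ w + μ * logρ ρ κ w a.2) :=
    (((symCls_logx hκ hx hS h).const_mul' v).mono (c := 1)
      (fun a _ => by linarith [hB a]) one_pos).add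
    (((ρ.symCls_log hκ hS h).const_mul' μ).mono (c := 1)
      (fun a _ => by linarith [hJ a]) one_pos)
  refine h1.rpow (c := min (v * c) (μ * d)) (by positivity)
    (fun a _ => add_pos (hJ a) (hB a)) (fun a ha => ?_) t
  have h2 := hc' a.1 ha.1
  have h3 := hd' a.1 ha.1 a.2
  calc _ = min (v * c) (μ * d) * japanese (a.1 0) + min (v * c) (μ * d) * logBracket a.2 := by ring
    _ ≤ v * c * japanese (a.1 0) + μ * d * logBracket a.2 := by
      gcongr
      · exact (hJ a).le
      · exact min_le_left _ _
      · exact (hB a).le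
      · exact min_le_right _ _
    _ = v * (c * japanese (a.1 0)) + μ * (d * logBracket a.2) := by ring
    _ ≤ v * logx x κ a.1 + μ * logρ ρ κ a.1 a.2 := by
      gcongr
      · exact h2
      · exact h3

end Classes

lemma sum_pos {v μ : ℝ} (hv : 0 < v) (hμ : 0 < μ) {w : E} (hw : w ∈ logDomain κ) (ζ : E) :
    0 < v * logx x κ w + μ * logρ ρ κ w ζ :=
  add_pos (mul_pos hv (logx_pos hκ hx hw)) (mul_pos hμ (logρ_pos hκ ρ hw ζ))

lemma contDiffOn_logx_rpow (t : ℝ) : ContDiffOn ℝ ∞ (fun q : E × E => logx x κ q.1 ^ t)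
    (logDomain κ ×ˢ Set.univ) :=
  (contDiffOn_logx hκ hx).rpow_const_of_ne fun _ hq => (logx_pos hκ hx hq.1).ne'

omit hx in
lemma contDiffOn_logρ_rpow (t : ℝ) : ContDiffOn ℝ ∞ (fun q : E × E => logρ ρ κ q.1 q.2 ^ t)
    (logDomain κ ×ˢ Set.univ) :=
  (ρ.contDiffOn_log hκ).rpow_const_of_ne fun q hq => (logρ_pos hκ ρ hq.1 q.2).ne'

lemma contDiffOn_sum_rpow {v μ : ℝ} (hv : 0 < v) (hμ : 0 < μ) (t : ℝ) :
    ContDiffOn ℝ ∞ (fun q : E × E => (v * logx x κ q.1 + μ * logρ ρ κ q.1 q.2) ^ t)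
      (logDomain κ ×ˢ Set.univ) :=
  ((contDiffOn_const.mul (contDiffOn_logx hκ hx)).add
    (contDiffOn_const.mul (ρ.contDiffOn_log hκ))).rpow_const_of_ne
      fun q hq => (sum_pos hκ hx ρ hv hμ hq.1 q.2).ne'

lemma logLift_mul_doubleLogSymbol {ℓ v μ : ℝ} (θ : M → ℝ) (w ζ : E) :
    chartMul κ θ (fun w' => (doubleLogSymbol x ρ ℓ v μ κ w' ζ : ℂ)) w =
      ((logLift κ θ w * (v * logx x κ w + μ * logρ ρ κ w ζ) ^ ℓ : ℝ) : ℂ) := by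
  rw [chartMul_eq]
  by_cases hw : w ∈ logDomain κ
  · simp only [doubleLogSymbol_eq hκ hx ρ hw, Complex.ofReal_mul]
  · simp [logLift, hw]

include hχ

/-- The symbol `χ log^{(1-α)ℓ}(x⁻¹) / a`. -/
lemma isLocSym_quotient {v μ : ℝ} (hv : 0 < v) (hμ : 0 < μ) {ℓ α : ℝ} (hℓ : 0 < ℓ)
    (hα : α ∈ Set.Icc (0 : ℝ) 1) :
    IsLocSym 0 0 (logWeight 0 (-(α * ℓ))) (fun w ζ => ((logLift κ χ w *
      (logx x κ w ^ ((1 - α) * ℓ) * (v * logx x κ w + μ * logρ ρ κ w ζ) ^ (-ℓ)) : ℝ) : ℂ)) := by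
  refine hχ.isLocSym hκ (fun ζ => (logWeight_pos _ _ _).le)
    ((contDiffOn_logx_rpow hκ hx _).mul (contDiffOn_sum_rpow hκ hx ρ hv hμ _)) ?_
  refine ((symCls_logx_rpow hκ hx hχ.compact hχ.subset _).mul
    (symCls_sum_rpow hκ hx ρ hχ.compact hχ.subset hv hμ _)).mono (c := 1) (fun a _ => ?_) one_pos
  rw [tWeight_zero, one_mul, one_mul, ← logBracket_rpow]
  have hJ := japanese_pos (a.1 0)
  have hB := logBracket_pos a.2
  rw [Real.rpow_neg (by positivity), Real.rpow_neg hB.le, ← div_eq_mul_inv,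
    div_le_iff₀ (by positivity), inv_mul_eq_div, le_div_iff₀ (by positivity)]
  -- Here `0 ≤ α ≤ 1` enters: both exponents are nonnegative and add up to `ℓ`, so each bracket may
  -- be enlarged to the sum.
  calc _ ≤ (japanese (a.1 0) + logBracket a.2) ^ ((1 - α) * ℓ) *
        (japanese (a.1 0) + logBracket a.2) ^ (α * ℓ) := by
        have h1 : 0 ≤ (1 - α) * ℓ := mul_nonneg (by linarith [hα.2]) hℓ.le
        have h2 : 0 ≤ α * ℓ := mul_nonneg hα.1 hℓ.le
        gcongr
        · linarith
        · linarith
    _ = _ := by rw [← Real.rpow_add (by positivity)]; congr 1; ring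

/-- Splitting of `χ a` into a part bounded by `log^ℓ(x⁻¹)` and a part bounded
by `log^ℓ(ρ⁻¹)`. -/
lemma exists_splitting {v μ : ℝ} (hv : 0 < v) (hμ : 0 < μ) {ℓ : ℝ} (hℓ : 0 < ℓ) :
    ∃ a₁ a₂ : EuclideanSpace ℝ (Fin n) → EuclideanSpace ℝ (Fin n) → ℂ,
      IsLocSym 0 ℓ (logWeight 0 0) a₁ ∧ IsLocSym 0 0 (logWeight 0 ℓ) a₂ ∧
      ∀ w ζ, a₁ w ζ + a₂ w ζ =
        ((logLift κ χ w * (v * logx x κ w + μ * logρ ρ κ w ζ) ^ ℓ : ℝ) : ℂ) := by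
  have hS := hχ.compact
  have hsub := hχ.subset
  obtain ⟨c, hc, hc'⟩ := hx.exists_le_log hκ hS hsub
  obtain ⟨d, hd, hd'⟩ := ρ.exists_le_log hκ hS hsub
  -- The smooth weights `log^ℓ(x⁻¹) / D` and `log^ℓ(ρ⁻¹) / D` add up to `1`. Since `a` is bounded by
  -- a multiple of `D`, multiplying by them yields the two parts.
  set D : E → E → ℝ := fun w ζ => logx x κ w ^ ℓ + logρ ρ κ w ζ ^ ℓ with hDdef
  have hDpos : ∀ w ∈ logDomain κ, ∀ ζ, 0 < D w ζ := fun w hw ζ =>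
    add_pos (Real.rpow_pos_of_pos (logx_pos hκ hx hw) _)
      (Real.rpow_pos_of_pos (logρ_pos hκ ρ hw ζ) _)
  have hJ : ∀ a : E × E, 0 < japanese (a.1 0) ^ ℓ := fun _ =>
    Real.rpow_pos_of_pos (japanese_pos _) _
  have hB : ∀ a : E × E, 0 < logBracket a.2 ^ ℓ := fun _ =>
    Real.rpow_pos_of_pos (logBracket_pos _) _
  have hDs : ContDiffOn ℝ ∞ (fun q : E × E => D q.1 q.2) (logDomain κ ×ˢ Set.univ) :=
    (contDiffOn_logx_rpow hκ hx ℓ).add (contDiffOn_logρ_rpow hκ ρ ℓ)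
  have hDc : SymCls (logOver κ (tsupport χ) ×ˢ Set.univ) (fun a : E × E => a.1)
      (fun a => japanese (a.1 0) ^ ℓ + logBracket a.2 ^ ℓ) (fun a w => D w a.2) :=
    ((symCls_logx_rpow hκ hx hS hsub ℓ).mono (c := 1)
      (fun a _ => by linarith [hB a]) one_pos).add
    ((symCls_logρ_rpow hκ ρ hS hsub ℓ).mono (c := 1)
      (fun a _ => by linarith [hJ a]) one_pos)
  have hDi := hDc.inv (c := min (c ^ ℓ) (d ^ ℓ))
    (lt_min (Real.rpow_pos_of_pos hc _) (Real.rpow_pos_of_pos hd _))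
    (fun a _ => add_pos (hJ a) (hB a)) (fun a ha => by
      have h1 := Real.rpow_le_rpow (by positivity [japanese_pos (a.1 0)]) (hc' a.1 ha.1) hℓ.le
      have h2 := Real.rpow_le_rpow (by positivity [logBracket_pos a.2]) (hd' a.1 ha.1 a.2) hℓ.le
      rw [Real.mul_rpow hc.le (japanese_pos _).le] at h1
      rw [Real.mul_rpow hd.le (logBracket_pos _).le] at h2
      have h3 := mul_le_mul_of_nonneg_right (min_le_left (c ^ ℓ) (d ^ ℓ)) (hJ a).le
      have h4 := mul_le_mul_of_nonneg_right (min_le_right (c ^ ℓ) (d ^ ℓ)) (hB a).le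
      rw [mul_add]
      exact add_le_add (h3.trans h1) (h4.trans h2))
  have hw : ∀ a : E × E, (japanese (a.1 0) + logBracket a.2) ^ ℓ ≤
      2 ^ ℓ * (japanese (a.1 0) ^ ℓ + logBracket a.2 ^ ℓ) := fun a => by
    have h1 := japanese_pos (a.1 0)
    have h2 := logBracket_pos a.2
    have h3 : japanese (a.1 0) + logBracket a.2 ≤ 2 * max (japanese (a.1 0)) (logBracket a.2) := by
      linarith [le_max_left (japanese (a.1 0)) (logBracket a.2),
        le_max_right (japanese (a.1 0)) (logBracket a.2)]
    refine (Real.rpow_le_rpow (by positivity) h3 hℓ.le).trans ?_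
    rw [Real.mul_rpow (by norm_num) (by positivity)]
    refine mul_le_mul_of_nonneg_left ?_ (by positivity)
    rcases max_cases (japanese (a.1 0)) (logBracket a.2) with hm | hm <;> rw [hm.1]
    · linarith [hB a]
    · linarith [hJ a]
  have hsum := symCls_sum_rpow hκ hx ρ hS hsub hv hμ ℓ
  have key : ∀ {T : ℝ}, 0 ≤ T → ∀ a : E × E, (japanese (a.1 0) + logBracket a.2) ^ ℓ * T *
      (japanese (a.1 0) ^ ℓ + logBracket a.2 ^ ℓ)⁻¹ ≤ 2 ^ ℓ * T := fun {T} hT a => by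
    rw [← div_eq_mul_inv, div_le_iff₀ (add_pos (hJ a) (hB a))]
    calc _ ≤ 2 ^ ℓ * (japanese (a.1 0) ^ ℓ + logBracket a.2 ^ ℓ) * T :=
          mul_le_mul_of_nonneg_right (hw a) hT
      _ = _ := by ring
  refine ⟨_, _, hχ.isLocSym hκ (r := 0) (j := ℓ) (W := logWeight 0 0)
    (H := fun w ζ => (v * logx x κ w + μ * logρ ρ κ w ζ) ^ ℓ * logx x κ w ^ ℓ * (D w ζ)⁻¹)
    (fun ζ => (logWeight_pos _ _ _).le)
    (((contDiffOn_sum_rpow hκ hx ρ hv hμ ℓ).mul (contDiffOn_logx_rpow hκ hx ℓ)).mul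
      (hDs.inv fun q hq => (hDpos q.1 hq.1 q.2).ne')) ?_,
    hχ.isLocSym hκ (r := 0) (j := 0) (W := logWeight 0 ℓ)
    (H := fun w ζ => (v * logx x κ w + μ * logρ ρ κ w ζ) ^ ℓ * logρ ρ κ w ζ ^ ℓ * (D w ζ)⁻¹)
    (fun ζ => (logWeight_pos _ _ _).le)
    (((contDiffOn_sum_rpow hκ hx ρ hv hμ ℓ).mul (contDiffOn_logρ_rpow hκ ρ ℓ)).mul
      (hDs.inv fun q hq => (hDpos q.1 hq.1 q.2).ne')) ?_, ?_⟩
  · refine ((hsum.mul (symCls_logx_rpow hκ hx hS hsub ℓ)).mul hDi).mono (c := 2 ^ ℓ)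
      (fun a _ => ?_) (by positivity)
    have : tWeight 0 ℓ a.1 * logWeight 0 0 a.2 = japanese (a.1 0) ^ ℓ := by
      simp [tWeight, logWeight]
    rw [this]
    exact key (hJ a).le a
  · refine ((hsum.mul (symCls_logρ_rpow hκ ρ hS hsub ℓ)).mul hDi).mono (c := 2 ^ ℓ)
      (fun a _ => ?_) (by positivity)
    rw [tWeight_zero, one_mul, ← logBracket_rpow]
    exact key (hB a).le a
  · intro w ζ
    rw [← Complex.ofReal_add]
    congr 1
    by_cases hw' : w ∈ logDomain κ
    · have hne := (hDpos w hw' ζ).ne'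
      simp only [hDdef] at hne ⊢
      field_simp
    · simp [logLift, hw']

end SymbolGeometry
end

noncomputable section


/-! ### Bounded functionals on test functions -/

section WBounded

open MeasureTheory

variable {n : ℕ} [NeZero n]

local notation "E" => EuclideanSpace ℝ (Fin n)

/-- Functionals of test functions that are bounded with respect to a weighted `L²` norm. -/
def WBounded (M : EuclideanSpace ℝ (Fin n) → ℝ) (F : (EuclideanSpace ℝ (Fin n) → ℂ) → ℂ) : Prop :=
  ∃ C : ENNReal, C ≠ ⊤ ∧ ∀ φ : 𝓢(EuclideanSpace ℝ (Fin n), ℂ), IsBT (fun w => φ w) →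
    ‖F (fun w => φ w)‖ₑ ^ 2 ≤ C * wsq M φ

variable {M M' : EuclideanSpace ℝ (Fin n) → ℝ} {F G : (EuclideanSpace ℝ (Fin n) → ℂ) → ℂ}

lemma WBounded.mono (hF : WBounded M F) {c : ℝ} (hc : 0 ≤ c) (h : ∀ ξ, M ξ ≤ c * M' ξ) :
    WBounded M' F := by
  obtain ⟨C, hC, hb⟩ := hF
  refine ⟨C * ENNReal.ofReal c ^ 2, by finiteness, fun φ hφ => (hb φ hφ).trans ?_⟩
  rw [mul_assoc]
  exact mul_le_mul_right (wsq_mono hc h φ) C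

lemma WBounded.congr (hF : WBounded M F) (h : ∀ φ, IsBT φ → F φ = G φ) : WBounded M G := by
  obtain ⟨C, hC, hb⟩ := hF
  exact ⟨C, hC, fun φ hφ => h _ hφ ▸ hb φ hφ⟩

lemma WBounded.add (hF : WBounded M F) (hG : WBounded M G) :
    WBounded M (fun φ => F φ + G φ) := by
  obtain ⟨C, hC, hb⟩ := hF
  obtain ⟨D, hD, hd⟩ := hG
  refine ⟨4 * (C + D), by finiteness, fun φ hφ => ?_⟩
  calc ‖F φ + G φ‖ₑ ^ 2 ≤ (‖F φ‖ₑ + ‖G φ‖ₑ) ^ 2 := by gcongr; exact enorm_add_le _ _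
    _ ≤ 4 * (‖F φ‖ₑ ^ 2 + ‖G φ‖ₑ ^ 2) := by
      have h4 : ∀ a : ENNReal, (a + a) ^ 2 = 4 * a ^ 2 := fun a => by ring
      rcases le_total ‖F φ‖ₑ ‖G φ‖ₑ with h | h
      · calc _ ≤ (‖G φ‖ₑ + ‖G φ‖ₑ) ^ 2 := by gcongr
          _ ≤ _ := by rw [h4]; gcongr; exact le_add_self
      · calc _ ≤ (‖F φ‖ₑ + ‖F φ‖ₑ) ^ 2 := by gcongr
          _ ≤ _ := by rw [h4]; gcongr; exact le_self_add
    _ ≤ 4 * (C * wsq M φ + D * wsq M φ) := by gcongr; exacts [hb φ hφ, hd φ hφ]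
    _ = _ := by ring

lemma WBounded.neg (hF : WBounded M F) : WBounded M (fun φ => -F φ) := by
  obtain ⟨C, hC, hb⟩ := hF
  exact ⟨C, hC, fun φ hφ => by rw [enorm_neg]; exact hb φ hφ⟩

lemma WBounded.sum {N : ℕ} {F : Fin N → (EuclideanSpace ℝ (Fin n) → ℂ) → ℂ}
    (hF : ∀ i, WBounded M (F i)) : WBounded M (fun φ => ∑ i, F i φ) := by
  induction N with
  | zero => exact ⟨0, by simp, fun φ _ => by simp⟩
  | succ N ih =>
    exact ((ih fun i => hF i.castSucc).add (hF (Fin.last N))).congr fun φ _ => by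
      rw [Fin.sum_univ_castSucc]

/-- Composition of a bounded functional with an operator. -/
lemma WBounded.comp (hF : WBounded M F) {T : (EuclideanSpace ℝ (Fin n) → ℂ) → EuclideanSpace ℝ (Fin n) → ℂ}
    (hT : ∀ φ, IsBT φ → IsBT (T φ)) (hb : ∃ C : ENNReal, C ≠ ⊤ ∧
      ∀ φ Ψ : 𝓢(EuclideanSpace ℝ (Fin n), ℂ), IsBT (fun w => φ w) →
        (∀ w, Ψ w = T (fun w => φ w) w) → wsq M Ψ ≤ C * wsq M' φ) :
    WBounded M' (fun φ => F (T φ)) := by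
  obtain ⟨C, hC, h⟩ := hF
  obtain ⟨D, hD, hd⟩ := hb
  refine ⟨C * D, by finiteness, fun φ hφ => ?_⟩
  obtain ⟨Φ, hΦ⟩ := (hT _ hφ).exists_schwartz
  have e : T (fun w => φ w) = fun w => Φ w := funext fun w => (hΦ w).symm
  have h1 := h Φ (e ▸ hT _ hφ)
  rw [← e] at h1
  rw [mul_assoc]
  exact h1.trans (mul_le_mul_right (hd φ Φ hφ hΦ) C)

lemma IsAmp.integrable_inner {p : E → E → E → ℂ} (hp : IsAmp p) {f : E → ℂ} (hf : IsBT f) (w' : E) :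
    Integrable fun ζ => ∫ w : E, Real.fourierChar (-(inner ℝ (w - w') ζ)) • (p w' w ζ * f w) := by
  obtain ⟨C, hC, hb⟩ := hp.inner_bound hf (n + 1)
  refine ((integrable_inv_pow (n := n)).const_mul C).mono' ?_
    (Filter.Eventually.of_forall fun ζ => hb w' ζ)
  refine (aestronglyMeasurable_inner (hp.isOsc hf) w').congr
    (Filter.Eventually.of_forall fun ζ => ?_)
  have h := integral_add_left_eq_self (μ := (volume : Measure E))
    (fun w => Real.fourierChar (-(inner ℝ (w - w') ζ)) • (p w' w ζ * f w)) w'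
  simpa using h

lemma IsAmp.integrable_slice {p : E → E → E → ℂ} (hp : IsAmp p) {f : E → ℂ} (hf : IsBT f)
    (w' ζ : E) :
    Integrable fun w => Real.fourierChar (-(inner ℝ (w - w') ζ)) • (p w' w ζ * f w) := by
  obtain ⟨R, hR⟩ := hp.supp
  refine Continuous.integrable_of_hasCompactSupport ?_
    (HasCompactSupport.intro (isCompact_closedBall w' R) fun w hw => ?_)
  · have h1 : Continuous fun w => p w' w ζ := hp.smooth.continuous.comp
      (continuous_const.prodMk (continuous_id.prodMk continuous_const))
    have := Real.continuous_fourierChar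
    exact Continuous.smul (by fun_prop) (h1.mul hf.smooth.continuous)
  · have : p w' w ζ = 0 := by
      by_contra h
      exact hw (by simpa [dist_eq_norm] using hR _ _ _ h)
    simp [this]

lemma ampOp_add {p q : E → E → E → ℂ} (hp : IsAmp p) (hq : IsAmp q) {f : E → ℂ} (hf : IsBT f)
    (w' : E) :
    ampOp (fun w' w ζ => p w' w ζ + q w' w ζ) f w' = ampOp p f w' + ampOp q f w' := by
  unfold ampOp
  rw [← integral_add (hp.integrable_inner hf w') (hq.integrable_inner hf w')]
  refine integral_congr_ae (Filter.Eventually.of_forall fun ζ => ?_)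
  simp only
  rw [← integral_add (hp.integrable_slice hf w' ζ) (hq.integrable_slice hf w' ζ)]
  refine integral_congr_ae (Filter.Eventually.of_forall fun w => ?_)
  simp only [add_mul, smul_add]

end WBounded

/-! ### Pairing distributions with quantizations -/

section Pairing

variable {n : ℕ} [NeZero n]

local notation "E" => EuclideanSpace ℝ (Fin n)

variable {M : Type*} [TopologicalSpace M] [T2Space M]
  [SecondCountableTopology M] [ChartedSpace (EuclideanHalfSpace n) M]
  {κ κ' : OpenPartialHomeomorph M (EuclideanHalfSpace n)} [IsManifold (𝓡∂ n) ∞ M]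
  {x : M → ℝ} (hx : IsBoundaryDefining n x)
  (hκ : κ ∈ IsManifold.maximalAtlas (𝓡∂ n) ∞ M)

lemma isLocSym_one : IsLocSym 0 0 (fun ζ : EuclideanSpace ℝ (Fin n) => (1 + ‖ζ‖) ^ 0)
    (fun _ _ => 1) := by
  have h1 : SymCls Set.univ (fun w : E => w) (tWeight 0 0) (fun _ _ => (1 : ℂ)) :=
    SymCls.const _ fun w _ => by simp [tWeight_zero]
  simpa using isLocSym_of_symCls h1

lemma ampOp_cutoff {ψ : EuclideanSpace ℝ (Fin n) → ℝ} (hψ : ContDiff ℝ ∞ ψ)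
    (hψc : HasCompactSupport ψ) (hψ1 : ψ 0 = 1) {f : E → ℂ} (hf : ContDiff ℝ ∞ f) :
    ampOp (fun w' w _ => (1 : ℂ) * ψ (w - w')) f = f := by
  obtain ⟨R, hR⟩ := hψc.exists_norm_le
  have hsm : ContDiff ℝ ∞ fun q : E × E => (ψ (q.2 - q.1) : ℂ) :=
    Complex.ofRealCLM.contDiff.comp (hψ.comp (by fun_prop))
  funext w
  rw [ampOp_eq_mul (h := fun w' w => (1 : ℂ) * ψ (w - w')) (contDiff_const.mul hsm) (R := R)
    (fun w' w h => hR _ fun h0 => h (by simp [h0])) hf]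
  simp [hψ1]

/-- The bound for compositions with the identity as left factor and `P = 0`. The weight of `Q`,
given at the inner frequency, is moved to the outer one by moderateness. -/
lemma wsq_quotient_le {ψ : EuclideanSpace ℝ (Fin n) → ℝ} (hψ : ContDiff ℝ ∞ ψ)
    (hψc : HasCompactSupport ψ) (hψ1 : ψ 0 = 1)
    {Q : EuclideanSpace ℝ (Fin n) → EuclideanSpace ℝ (Fin n) → ℂ} {m ℓ : ℝ}
    (hQ : IsLocSym 0 0 (logWeight m ℓ) Q) {M₂ : EuclideanSpace ℝ (Fin n) → ℝ} (hM₂ : Moderate M₂) :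
    ∃ C : ENNReal, C ≠ ⊤ ∧ ∀ φ Ψ : 𝓢(EuclideanSpace ℝ (Fin n), ℂ), IsBT (fun w => φ w) →
      (∀ w, Ψ w = ampOp (fun w' w ζ => Q w' ζ * ψ (w - w')) (fun w => φ w) w) →
      wsq M₂ Ψ ≤ C * wsq (fun ξ => M₂ ξ * logWeight m ℓ ξ) φ := by
  have hM : Moderate (logWeight m ℓ : E → ℝ) := moderate_logWeight _ _
  obtain ⟨D, hD⟩ := hQ.of_moderate hM
  obtain ⟨c, N, hc, hN⟩ := hM.bound
  have h1 : SymCls Set.univ (fun w : E => w) (tWeight 0 0) (fun _ _ => (1 : ℂ)) :=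
    SymCls.const _ fun w _ => by simp [tWeight_zero]
  have h0 : SymCls Set.univ (fun w : E => w) (tWeight 0 0) (fun _ _ => (0 : ℂ)) :=
    SymCls.const _ fun w _ => by simp [tWeight_zero]
  have hBr : SymCls Set.univ (fun a : E × E × E => a.1)
      (fun a => tWeight 0 0 a.1 * (logWeight m ℓ a.2.1 * (1 + ‖a.2.1 - a.2.2‖) ^ N))
      (fun a w => (1 : ℂ) * Q w a.2.2 - 0) := by
    simp only [one_mul, sub_zero]
    refine (hQ.cls.reindex fun a : E × E × E => (a.1, a.2.2)).mono (c := c) (fun a _ => ?_) hc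
    have h2 := hN a.2.2 a.2.1
    rw [norm_sub_rev] at h2
    rw [tWeight_zero, one_mul, one_mul, ← mul_assoc]
    exact h2
  obtain ⟨C, hC, h⟩ := wsq_sandwich_le h1 (add_zero 0) (add_zero 0) hψ hψc hψ1 isLocSym_one hD h0
    hM hM₂ hBr
  refine ⟨C, hC, fun φ Ψ hφ hΨ => h φ Ψ hφ fun w => ?_⟩
  have hb := (hD.isAmp_left hψ hψc).isBT_ampOp hφ
  have e : ampOp (fun w' w (_ : E) => (ψ (w - w') : ℂ) * 1)
      (ampOp (fun w' w ζ => Q w' ζ * ψ (w - w')) fun w => φ w) =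
      ampOp (fun w' w ζ => Q w' ζ * ψ (w - w')) fun w => φ w := by
    simpa only [mul_one, one_mul] using ampOp_cutoff hψ hψc hψ1 hb.smooth
  rw [hΨ, e]
  ring

lemma MemHbAt.wBounded {χ : M → ℝ} {u : BDistribution n M} {s ℓ r j : ℝ}
    (h : MemHbAt x s ℓ r j u κ χ) : WBounded (logWeight (-s) (-ℓ))
      (fun φ => u.pairing κ (fun w => (cutLift κ x χ (-r) j w : ℂ) * φ w)) := h.bound

section Sandwich

variable {X Y : M → ℝ} (hX : IsCutoff κ X) (hY : IsCutoff κ Y)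
  (hXY : ∀ᶠ p in 𝓝ˢ (tsupport X), Y p = 1)
  {u : BDistribution n M} {s ℓ' r j : ℝ}
  {ψ : EuclideanSpace ℝ (Fin n) → ℝ} (hψ : ContDiff ℝ ∞ ψ)
  (hψc : HasCompactSupport ψ) (hψ1 : ψ 0 = 1)
  {P : EuclideanSpace ℝ (Fin n) → ℂ}
  {B Q : EuclideanSpace ℝ (Fin n) → EuclideanSpace ℝ (Fin n) → ℂ} {D₁ D₂ N : ℕ}
  (hB : IsLocSym (-r) j (fun ζ => (1 + ‖ζ‖) ^ D₁) B)
  (hQ : IsLocSym 0 0 (fun ζ => (1 + ‖ζ‖) ^ D₂) Q)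
  (hP : SymCls Set.univ (fun w : EuclideanSpace ℝ (Fin n) => w) (tWeight (-r) j) (fun _ => P))

include hx hκ hXY in
-- Distributes a cutoff into the weight belonging to the space of `u` and the opposite weight, which
-- is left with the operator and cancels the growth of its symbol.
lemma logLift_eq_cutLift_mul (r j : ℝ) (w : E) :
    logLift κ X w = cutLift κ x Y (-r) j w * cutLift κ x X r (-j) w := by
  rw [mul_comm, cutLift_mul hx hκ hXY, add_neg_cancel, neg_add_cancel, cutLift_zero_zero hx hκ]

include hx hκ hX hψ hψc hB hQ hP in
lemma isBT_sandwich {φ : E → ℂ} (hφ : IsBT φ) :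
    IsBT (fun w => (cutLift κ x X r (-j) w : ℂ) * (ampOp (fun w' w ζ => ψ (w - w') * B w ζ)
      (ampOp (fun w' w ζ => Q w' ζ * ψ (w - w')) φ) w - P w * φ w)) := by
  have hm := (hX.symCls_cutLift hx hκ r (-j)).ofReal
  have h1 := (hB.isAmp hm (add_neg_cancel r) (neg_add_cancel j) hψ hψc).isBT_ampOp
    ((hQ.isAmp_left hψ hψc).isBT_ampOp hφ)
  have h2 := ((hφ.mul_symCls hP).mul_symCls hm).const_mul (-1)
  refine (congrArg IsBT (funext fun w => ?_)).mp (h1.add h2)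
  have e := ampOp_const_mul (fun w' w ζ => ψ (w - w') * B w ζ)
    (fun w => (cutLift κ x X r (-j) w : ℂ)) (ampOp (fun w' w ζ => Q w' ζ * ψ (w - w')) φ) w
  simp only [← mul_assoc] at e ⊢
  rw [e]
  ring

include hx hκ hX hY hXY hψ hψc hB hQ hP in
lemma isBTest_sandwich {φ : E → ℂ} (hφ : IsBT φ) :
    IsBTest (κ.extend (𝓡∂ n)).target
      (fun w => (logLift κ X w : ℂ) * (ampOp (fun w' w ζ => ψ (w - w') * B w ζ)
        (ampOp (fun w' w ζ => Q w' ζ * ψ (w - w')) φ) w - P w * φ w)) := by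
  simp only [logLift_eq_cutLift_mul hx hκ hXY r j, Complex.ofReal_mul, mul_assoc]
  exact hY.isBTest_cutLift_mul hx hκ _ _ (isBT_sandwich hx hκ hX hψ hψc hB hQ hP hφ)

include hx hκ hX hXY hψ hψc hB hQ hP hψ1 in
/-- Pairings of a distribution with a composition of two quantizations minus a multiplication
operator. -/
lemma wBounded_sandwich {W : EuclideanSpace ℝ (Fin n) → ℝ} (hW : Moderate W)
    (hBr : SymCls Set.univ (fun a : EuclideanSpace ℝ (Fin n) × EuclideanSpace ℝ (Fin n) ×
        EuclideanSpace ℝ (Fin n) => a.1)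
      (fun a => tWeight (-r) j a.1 * (W a.2.1 * (1 + ‖a.2.1 - a.2.2‖) ^ N))
      (fun a w => B w a.2.1 * Q w a.2.2 - P w))
    (hu : MemHbAt x s ℓ' r j u κ Y) :
    WBounded (fun ξ => logWeight (-s) (-ℓ') ξ * W ξ) (fun φ => u.pairing κ
      (fun w => (logLift κ X w : ℂ) * (ampOp (fun w' w ζ => ψ (w - w') * B w ζ)
        (ampOp (fun w' w ζ => Q w' ζ * ψ (w - w')) φ) w - P w * φ w))) := by
  simp only [logLift_eq_cutLift_mul hx hκ hXY r j, Complex.ofReal_mul, mul_assoc]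
  exact hu.wBounded.comp
    (T := fun φ w => (cutLift κ x X r (-j) w : ℂ) * (ampOp (fun w' w ζ => ψ (w - w') * B w ζ)
      (ampOp (fun w' w ζ => Q w' ζ * ψ (w - w')) φ) w - P w * φ w))
    (fun φ hφ => isBT_sandwich hx hκ hX hψ hψc hB hQ hP hφ)
    (wsq_sandwich_le (hX.symCls_cutLift hx hκ r (-j)).ofReal (add_neg_cancel r)
      (neg_add_cancel j) hψ hψc hψ1 hB hQ hP hW (moderate_logWeight _ _) hBr)

end Sandwich

lemma opTranspose_mul (b : E → E → ℂ) (ψ : E → ℝ) (c f : E → ℂ) :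
    opTranspose b ψ (fun w => c w * f w) =
      ampOp (fun w' w ζ => ψ (w - w') * (scaled b w ζ * c w)) f := by
  funext w'
  rw [opTranspose_eq_ampOp]
  unfold ampOp
  simp only [mul_assoc]

end Pairing
end

noncomputable section


/-! ### The principal part of the composition of `A` with the quotient -/

section Regularity

variable {n : ℕ} [NeZero n]

local notation "E" => EuclideanSpace ℝ (Fin n)

lemma IsLocSym.weight_mono {r j j' : ℝ} {W : EuclideanSpace ℝ (Fin n) → ℝ}
    {B : EuclideanSpace ℝ (Fin n) → EuclideanSpace ℝ (Fin n) → ℂ} (hB : IsLocSym r j W B)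
    (hW : ∀ ζ, 0 ≤ W ζ) (hj : j ≤ j') : IsLocSym r j' W B :=
  ⟨hB.smooth, hB.cls.mono (c := 1) (fun a _ => by
    rw [one_mul]
    refine mul_le_mul_of_nonneg_right ?_ (hW _)
    exact mul_le_mul_of_nonneg_left (Real.rpow_le_rpow_of_exponent_le (one_le_japanese _) hj)
      (by positivity)) one_pos⟩

lemma tWeight_mono_right (r : ℝ) {j j' : ℝ} (hj : j ≤ j') (w : E) :
    tWeight r j w ≤ tWeight r j' w :=
  mul_le_mul_of_nonneg_left (Real.rpow_le_rpow_of_exponent_le (one_le_japanese _) hj)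
    (by positivity)

variable {M : Type*} [TopologicalSpace M] [T2Space M]
  [SecondCountableTopology M] [ChartedSpace (EuclideanHalfSpace n) M]
  {κ : OpenPartialHomeomorph M (EuclideanHalfSpace n)} [IsManifold (𝓡∂ n) ∞ M]
  {x : M → ℝ} (hx : IsBoundaryDefining n x)
  (hκ : κ ∈ IsManifold.maximalAtlas (𝓡∂ n) ∞ M)
  {g : BMetric n M} (ρ : BInvNorm g)

lemma chartMul_cutLift (hx : IsBoundaryDefining n x)
    (hκ : κ ∈ IsManifold.maximalAtlas (𝓡∂ n) ∞ M) {χ X : M → ℝ}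
    (h : ∀ᶠ p in 𝓝ˢ (tsupport χ), X p = 1) (r j : ℝ) (f : E → ℂ) :
    chartMul κ χ (fun w => (cutLift κ x X r j w : ℂ) * f w) =
      fun w => (cutLift κ x χ r j w : ℂ) * f w := by
  rw [chartMul_eq]
  funext w
  have e := cutLift_mul hx hκ h 0 0 r j w
  rw [zero_add, zero_add, cutLift_zero_zero hx hκ] at e
  rw [← mul_assoc, ← Complex.ofReal_mul, e]

include hx hκ in
/-- The principal part of the composition of `A` with the quotient symbol. -/
lemma exists_symCls_bracket {χ χA : M → ℝ} (hχ : IsCutoff κ χ)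
    (hA : ∀ᶠ p in 𝓝ˢ (tsupport χ), χA p = 1) {ℓ v μ α : ℝ} (hℓ : 0 < ℓ) (hv : 0 < v) (hμ : 0 < μ)
    (hα : α ∈ Set.Icc (0 : ℝ) 1) {b : EuclideanSpace ℝ (Fin n) → EuclideanSpace ℝ (Fin n) → ℂ}
    (hb : IsLogSymbol 0 ℓ ℓ b)
    (hba : IsLogSymbol (-1) ℓ ℓ (fun w ζ => b w ζ -
        chartMul κ χA (fun w' => (doubleLogSymbol x ρ ℓ v μ κ w' ζ : ℂ)) w))
    {q : EuclideanSpace ℝ (Fin n) → EuclideanSpace ℝ (Fin n) → ℂ}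
    (hq : ∀ w ζ, q w ζ = ((logLift κ χ w * (logx x κ w ^ ((1 - α) * ℓ) *
      (v * logx x κ w + μ * logρ ρ κ w ζ) ^ (-ℓ)) : ℝ) : ℂ)) :
    ∃ N : ℕ, SymCls Set.univ (fun a : EuclideanSpace ℝ (Fin n) × EuclideanSpace ℝ (Fin n) ×
        EuclideanSpace ℝ (Fin n) => a.1)
      (fun a => tWeight 0 ℓ a.1 * (logWeight (-1) ℓ a.2.1 * (1 + ‖a.2.1 - a.2.2‖) ^ N))
      (fun a w => b w a.2.1 * q w a.2.2 - (cutLift κ x χ 0 ((1 - α) * ℓ) w : ℂ)) := by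
  have hqc : IsLocSym 0 0 (logWeight 0 (-(α * ℓ))) q := by
    have := isLocSym_quotient hκ hχ hx ρ hv hμ hℓ hα
    have e : q = _ := funext fun w => funext fun ζ => hq w ζ
    rw [e]; exact this
  have hqb : IsLocSym 0 0 (fun _ => 1) q := hqc.mono (c := 1) one_pos fun ζ => by
    have h1 := logWeight_mono (le_refl (0 : ℝ)) (neg_nonpos.2 (mul_nonneg hα.1 hℓ.le)) ζ
    simpa [logWeight] using h1
  have hq' : SymCls Set.univ (fun a : E × E × E => a.1) (fun _ => 1) (fun a w => q w a.2.2) :=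
    (hqb.cls.reindex fun a : E × E × E => (a.1, a.2.2)).mono (c := 1)
      (fun a _ => by simp [tWeight_zero]) one_pos
  obtain ⟨N, hN⟩ := hb.exists_symCls_sub
  have hmod : Moderate (logWeight (-1) ℓ : E → ℝ) := moderate_logWeight _ _
  obtain ⟨c, N', hc, hN'⟩ := hmod.bound
  have hge : ∀ a : E × E × E, 1 ≤ 1 + ‖a.2.1 - a.2.2‖ := fun a => by
    linarith [norm_nonneg (a.2.1 - a.2.2)]
  -- Decomposition `b(ζ) q(η) - P = (b(ζ) - b(η)) q(η) + (b(η) - χA a(η)) q(η)`, valid because `χA a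
  -- q` is exactly the multiplier `P`. Both summands are one order lower: the first by variation in
  -- the fibre, the second by the assumption on the principal symbol.
  have h1 : SymCls Set.univ (fun a : E × E × E => a.1)
      (fun a => tWeight 0 ℓ a.1 * (logWeight (-1) ℓ a.2.1 * (1 + ‖a.2.1 - a.2.2‖) ^ (N + N')))
      (fun a w => (b w a.2.1 - b w a.2.2) * q w a.2.2) :=
    (hN.mul hq').mono (c := 1) (fun a _ => by
      have h2 := tWeight_pos 0 ℓ a.1
      have h3 := logWeight_pos (-1) ℓ a.2.1
      rw [zero_sub, mul_one, one_mul]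
      gcongr
      · exact hge a
      · omega) one_pos
  have h2 : SymCls Set.univ (fun a : E × E × E => a.1)
      (fun a => tWeight 0 ℓ a.1 * (logWeight (-1) ℓ a.2.1 * (1 + ‖a.2.1 - a.2.2‖) ^ (N + N')))
      (fun a w => (b w a.2.2 -
        chartMul κ χA (fun w' => (doubleLogSymbol x ρ ℓ v μ κ w' a.2.2 : ℂ)) w) * q w a.2.2) :=
    ((hba.symCls.reindex fun a : E × E × E => (a.1, a.2.2)).mul hq').mono (c := c) (fun a _ => by
      have h2 := tWeight_pos 0 ℓ a.1
      have h3 := logWeight_pos (-1) ℓ a.2.1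
      have h4 := hN' a.2.2 a.2.1
      rw [norm_sub_rev] at h4
      calc tWeight 0 ℓ a.1 * logWeight (-1) ℓ a.2.2 * 1
          ≤ tWeight 0 ℓ a.1 * (c * logWeight (-1) ℓ a.2.1 * (1 + ‖a.2.1 - a.2.2‖) ^ (N + N')) := by
            rw [mul_one]
            refine mul_le_mul_of_nonneg_left (h4.trans ?_) h2.le
            gcongr
            · exact hge a
            · omega
        _ = _ := by ring) hc
  refine ⟨N + N', (h1.add h2).congr fun a _ => Filter.Eventually.of_forall fun w => ?_⟩
  have e : chartMul κ χA (fun w' => (doubleLogSymbol x ρ ℓ v μ κ w' a.2.2 : ℂ)) w * q w a.2.2 =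
      (cutLift κ x χ 0 ((1 - α) * ℓ) w : ℂ) := by
    rw [logLift_mul_doubleLogSymbol hκ hx ρ, hq, ← Complex.ofReal_mul]
    congr 1
    by_cases hw : w ∈ logDomain κ
    · have h3 := (Real.rpow_pos_of_pos (sum_pos hκ hx ρ hv hμ hw a.2.2) ℓ).ne'
      rw [Real.rpow_neg (sum_pos hκ hx ρ hv hμ hw a.2.2).le]
      unfold cutLift
      rw [logLift_of_mem _ hw, logLift_of_mem _ hw, logLift_of_mem _ hw, Real.rpow_zero, one_mul]
      have h4 := mul_eq_of_eventually_one hA (logInv κ w)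
      change _ = _ * logx x κ w ^ ((1 - α) * ℓ)
      field_simp
      linear_combination logx x κ w ^ ((1 - α) * ℓ) * h4
    · simp [cutLift, logLift, hw]
  simp only
  rw [← e]
  ring

/-- The class survives the rescaling of frequencies by `-2π` and multiplication by the weight of the
space, which carries the power of `x`. -/
lemma symCls_scaled_bracket {b q : EuclideanSpace ℝ (Fin n) → EuclideanSpace ℝ (Fin n) → ℂ}
    {P : EuclideanSpace ℝ (Fin n) → ℂ} {r j m ℓ : ℝ} {N : ℕ}
    (h : SymCls Set.univ (fun a : EuclideanSpace ℝ (Fin n) × EuclideanSpace ℝ (Fin n) ×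
        EuclideanSpace ℝ (Fin n) => a.1)
      (fun a => tWeight 0 j a.1 * (logWeight m ℓ a.2.1 * (1 + ‖a.2.1 - a.2.2‖) ^ N))
      (fun a w => b w a.2.1 * q w a.2.2 - P w))
    {X : EuclideanSpace ℝ (Fin n) → ℂ}
    (hX : SymCls Set.univ (fun w : EuclideanSpace ℝ (Fin n) => w) (tWeight r 0) (fun _ => X)) :
    SymCls Set.univ (fun a : EuclideanSpace ℝ (Fin n) × EuclideanSpace ℝ (Fin n) ×
        EuclideanSpace ℝ (Fin n) => a.1)
      (fun a => tWeight r j a.1 * (logWeight m ℓ a.2.1 * (1 + ‖a.2.1 - a.2.2‖) ^ N))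
      (fun a w => scaled b w a.2.1 * X w * scaled q w a.2.2 - P w * X w) := by
  have hne : -(2 * Real.pi) ≠ 0 := by simp [Real.pi_ne_zero]
  obtain ⟨C, hC, hC'⟩ : ∃ C > 0, ∀ ζ : E,
      logWeight m ℓ ((-(2 * Real.pi)) • ζ) ≤ C * logWeight m ℓ ζ := logWeight_smul_le m ℓ hne
  have h1 := (h.reindex fun a : E × E × E =>
    (a.1, (-(2 * Real.pi)) • a.2.1, (-(2 * Real.pi)) • a.2.2)).mul
      (hX.reindex fun a : E × E × E => a.1)
  refine (h1.mono (c := C * (1 + 2 * Real.pi) ^ N) (fun a _ => ?_) (by positivity)).congr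
    fun a _ => Filter.Eventually.of_forall fun w => ?_
  · simp only
    have h2 : ‖(-(2 * Real.pi)) • a.2.1 - (-(2 * Real.pi)) • a.2.2‖ =
        2 * Real.pi * ‖a.2.1 - a.2.2‖ := by
      rw [← smul_sub, norm_smul, norm_neg, Real.norm_of_nonneg (by positivity)]
    have h3 : 1 + 2 * Real.pi * ‖a.2.1 - a.2.2‖ ≤ (1 + 2 * Real.pi) * (1 + ‖a.2.1 - a.2.2‖) := by
      have := Real.pi_pos
      have := norm_nonneg (a.2.1 - a.2.2)
      nlinarith
    have h4 : tWeight r j a.1 = tWeight 0 j a.1 * tWeight r 0 a.1 := by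
      rw [tWeight_mul, zero_add, add_zero]
    have h5 := tWeight_pos 0 j a.1
    have h6 := tWeight_pos r 0 a.1
    have h7 := logWeight_pos m ℓ a.2.1
    rw [h2, h4]
    calc _ ≤ tWeight 0 j a.1 * (C * logWeight m ℓ a.2.1 *
          ((1 + 2 * Real.pi) * (1 + ‖a.2.1 - a.2.2‖)) ^ N) * tWeight r 0 a.1 := by
          gcongr
          exact hC' _
      _ = _ := by rw [mul_pow]; ring
  · simp only [scaled]
    ring

end Regularity

/-! ### One step of elliptic regularity -/

section MainResults

variable {n : ℕ} [NeZero n]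

local notation "E" => EuclideanSpace ℝ (Fin n)

variable {M : Type*} [TopologicalSpace M] [T2Space M]
  [SecondCountableTopology M] [ChartedSpace (EuclideanHalfSpace n) M]
  {κ : OpenPartialHomeomorph M (EuclideanHalfSpace n)} [IsManifold (𝓡∂ n) ∞ M]
  {x : M → ℝ} (hx : IsBoundaryDefining n x)
  (hκ : κ ∈ IsManifold.maximalAtlas (𝓡∂ n) ∞ M)
  {g : BMetric n M} {ρ : BInvNorm g} {ℓ v μ : ℝ} (hℓ : 0 < ℓ) (hv : 0 < v) (hμ : 0 < μ)
  {A : BDistribution n M → BDistribution n M} (hA : IsQuantization x ρ ℓ v μ A)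
  {u : BDistribution n M} {s r : ℝ}

include hx hκ in
lemma wBounded_residual {N : ℕ} {κs : Fin N → OpenPartialHomeomorph M (EuclideanHalfSpace n)}
    {K : Fin N → EuclideanSpace ℝ (Fin n) → EuclideanSpace ℝ (Fin n) → ℂ}
    (hK : ∀ i, κs i ∈ IsManifold.maximalAtlas (𝓡∂ n) ∞ M ∧ IsResidualKernel ℓ κ (κs i) (K i))
    {X : M → ℝ} (hX : IsCutoff κ X) (hu : MemHbLocNegInf x r ℓ u)
    {W : EuclideanSpace ℝ (Fin n) → ℝ} (hW : Moderate W) :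
    WBounded W (fun φ => ∑ i, u.pairing (κs i) (fun w' => ∫ w, K i w w' *
      ((cutLift κ x X (-r) 0 w : ℂ) * φ w))) :=
  WBounded.sum fun i => residual_pairing_bound hx hκ (hK i).1 (hK i).2 hX hu hW

include hx hκ hℓ hv hμ hA in
/-- A step in the elliptic regularity argument. -/
lemma MemHbAt.improve (hneg : MemHbLocNegInf x r ℓ u) (hAu : MemHbLoc x s 0 r 0 (A u)) {α : ℝ}
    (hα : α ∈ Set.Icc (0 : ℝ) 1) {χ Y : M → ℝ} (hχ : IsCutoff κ χ) (hY : IsCutoff κ Y)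
    (hχY : ∀ᶠ p in 𝓝ˢ (tsupport χ), Y p = 1) {m s' : ℝ} (hu : MemHbAt x m 0 r ℓ u κ Y)
    (hs : s' ≤ s) (hm : s' < m + 1) : MemHbAt x s' (α * ℓ) r ((1 - α) * ℓ) u κ χ := by
  -- A chain of cutoffs `χ, χA, X, Y`, each equal to `1` near the support of the preceding one: `χA`
  -- localizes `A`, `X` the input of its transpose, and `Y` is where `u` is already under control.
  obtain ⟨X, hX, hχX, hXY⟩ := hχ.exists_between hχY
  obtain ⟨χA, hχA, hχχA, hAX⟩ := hχ.exists_between hχX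
  obtain ⟨b, ψ, N, κs, K, hb, -, hba, hψ, hψc, hψ1, hK, hop⟩ := hA κ hκ χA X hχA hX hAX
  replace hψ1 : ψ 0 = 1 := hψ1.self_of_nhds
  set q : E → E → ℂ := fun w ζ => ((logLift κ χ w * (logx x κ w ^ ((1 - α) * ℓ) *
      (v * logx x κ w + μ * logρ ρ κ w ζ) ^ (-ℓ)) : ℝ) : ℂ) with hqdef
  have hq : IsLocSym 0 0 (logWeight 0 (-(α * ℓ))) q :=
    isLocSym_quotient hκ hχ hx ρ hv hμ hℓ hα
  obtain ⟨N', hBr⟩ := exists_symCls_bracket hx hκ ρ hχ hχχA hℓ hv hμ hα hb hba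
    (q := q) fun _ _ => rfl
  have hXc := (hX.symCls_cutLift hx hκ (-r) 0).ofReal
  have hBr' := symCls_scaled_bracket hBr hXc
  have hPX : ∀ w, (cutLift κ x χ 0 ((1 - α) * ℓ) w : ℂ) * (cutLift κ x X (-r) 0 w : ℂ) =
      (cutLift κ x χ (-r) ((1 - α) * ℓ) w : ℂ) := fun w => by
    rw [← Complex.ofReal_mul, cutLift_mul hx hκ hχX, zero_add, add_zero]
  simp only [hPX] at hBr'
  have hαℓ : 0 ≤ α * ℓ := mul_nonneg hα.1 hℓ.le
  -- The multiplier is placed in the larger class with exponent `ℓ`, the one of `b`, so that the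
  -- difference with the composition is estimated in a single class.
  have hP : SymCls Set.univ (fun w : E => w) (tWeight (-r) ℓ)
      (fun _ w => (cutLift κ x χ (-r) ((1 - α) * ℓ) w : ℂ)) :=
    (hχ.symCls_cutLift hx hκ (-r) ((1 - α) * ℓ)).ofReal.mono (c := 1) (fun w _ => by
      rw [one_mul]; exact tWeight_mono_right _ (by linarith) w) one_pos
  have hmod : ∀ s ℓ : ℝ, Moderate (logWeight s ℓ : E → ℝ) := fun s ℓ => moderate_logWeight s ℓ
  obtain ⟨D₁, hB⟩ := (hb.isLocSym.scaled_logWeight.mul_right hXc).of_moderate (hmod _ _)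
  rw [zero_add, add_zero] at hB
  have hQ := hq.scaled_logWeight
  obtain ⟨D₂, hQ'⟩ := hQ.of_moderate (hmod _ _)
  have hQBT : ∀ φ : E → ℂ, IsBT φ →
      IsBT (ampOp (fun w' w ζ => scaled q w' ζ * ψ (w - w')) φ) := fun φ hφ =>
    (hQ'.isAmp_left hψ hψc).isBT_ampOp hφ
  have hQb : ∀ t : ℝ, _ := fun t => wsq_quotient_le hψ hψc hψ1 hQ (hmod t 0)
  have hwt : ∀ t : ℝ, s' ≤ -t → ∀ ξ : E, logWeight t 0 ξ * logWeight 0 (-(α * ℓ)) ξ ≤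
      1 * logWeight (-s') (-(α * ℓ)) ξ := fun t ht ξ => by
    rw [logWeight_mul, add_zero, zero_add, one_mul]
    exact logWeight_mono (by linarith) le_rfl ξ
  -- The main term: order `s` from `Au` together with the `αℓ log` contributed by the quotient.
  have F1 : WBounded (logWeight (-s') (-(α * ℓ))) (fun φ => (A u).pairing κ (fun w =>
      (cutLift κ x χA (-r) 0 w : ℂ) *
        ampOp (fun w' w ζ => scaled q w' ζ * ψ (w - w')) φ w)) := by
    have h1 := (hAu κ hκ χA hχA).wBounded
    rw [neg_zero] at h1
    exact (h1.comp hQBT (hQb (-s))).mono zero_le_one (hwt (-s) (by linarith))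
  have F2 : WBounded (logWeight (-s') (-(α * ℓ))) (fun φ => ∑ i, u.pairing (κs i)
      (fun w' => ∫ w, K i w w' * ((cutLift κ x X (-r) 0 w : ℂ) *
        ampOp (fun w' w ζ => scaled q w' ζ * ψ (w - w')) φ w))) :=
    ((wBounded_residual hx hκ hK hX hneg (hmod (-s') 0)).comp hQBT (hQb (-s'))).mono
      zero_le_one (hwt (-s') (by linarith))
  -- The error has size `log^ℓ(x⁻¹)`, matched by the weight of `u`, and order `-1 + ℓ log`.
  have F3 := wBounded_sandwich hx hκ hX hXY hψ hψc hψ1 hB hQ' hP (hmod (-1) ℓ) hBr' hu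
  -- The strict inequality `s' < m + 1` pays for the logarithms: the gain is slightly less than one
  -- derivative.
  obtain ⟨c, hc, hc'⟩ : ∃ c > 0, ∀ ξ : E, logWeight (-m + -1) (-0 + ℓ) ξ ≤
      c * logWeight (-s') (-(α * ℓ)) ξ := logWeight_le_of_lt (by linarith) _ _
  replace F3 := F3.mono (M' := logWeight (-s') (-(α * ℓ))) hc.le fun ξ => by
    rw [logWeight_mul]; exact hc' ξ
  -- The pairing to be bounded is `F1 - F2 - F3`: the identity defining `A` on the test function
  -- `Qφ` with its weight, after separating the multiplication operator from the composition.
  obtain ⟨C, hC, hbd⟩ := ((F1.add F2.neg).add F3.neg).congr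
    (G := fun φ => u.pairing κ (fun w => (cutLift κ x χ (-r) ((1 - α) * ℓ) w : ℂ) * φ w))
    fun φ hφ => by
      have h1 := hop u _ (hX.isBT_cutLift_mul hx hκ (-r) 0 (hQBT φ hφ)).isBTest
      rw [chartMul_cutLift hx hκ hAX, opTranspose_mul, chartMul_eq] at h1
      have h2 := isBTest_sandwich hx hκ hX hY hXY hψ hψc hB hQ' hP hφ
      have h3 := hχ.isBTest_cutLift_mul hx hκ (-r) ((1 - α) * ℓ) hφ
      have h4 := u.map_add κ hκ _ _ h2 h3
      have h5 : ∀ w, (logLift κ X w : ℂ) * (cutLift κ x χ (-r) ((1 - α) * ℓ) w : ℂ) =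
          (cutLift κ x χ (-r) ((1 - α) * ℓ) w : ℂ) := fun w => by
        rw [← cutLift_zero_zero hx hκ, mul_comm, ← Complex.ofReal_mul, cutLift_mul hx hκ hχX,
          add_zero, add_zero]
      have h6 : (fun w => (logLift κ X w : ℂ) *
          ampOp (fun w' w ζ => ψ (w - w') * (scaled b w ζ * (cutLift κ x X (-r) 0 w : ℂ)))
            (ampOp (fun w' w ζ => scaled q w' ζ * ψ (w - w')) φ) w) =
          (fun w => (logLift κ X w : ℂ) *
          (ampOp (fun w' w ζ => ψ (w - w') * (scaled b w ζ * (cutLift κ x X (-r) 0 w : ℂ)))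
            (ampOp (fun w' w ζ => scaled q w' ζ * ψ (w - w')) φ) w -
              (cutLift κ x χ (-r) ((1 - α) * ℓ) w : ℂ) * φ w)) +
          fun w => (cutLift κ x χ (-r) ((1 - α) * ℓ) w : ℂ) * φ w := by
        funext w
        rw [Pi.add_apply, mul_sub, ← mul_assoc (logLift κ X w : ℂ) (cutLift κ x χ _ _ w : ℂ), h5]
        ring
      rw [h6, h4] at h1
      rw [h1]
      ring
  exact memHbAt_of_bound hx hκ hχ hC hbd

end MainResults
end

noncomputable section


/-! ### Bootstrap, converse mapping property and conclusion -/

section MainResults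

variable {n : ℕ} [NeZero n]

local notation "E" => EuclideanSpace ℝ (Fin n)

variable {M : Type*} [TopologicalSpace M] [T2Space M]
  [SecondCountableTopology M] [ChartedSpace (EuclideanHalfSpace n) M]
  {κ : OpenPartialHomeomorph M (EuclideanHalfSpace n)} [IsManifold (𝓡∂ n) ∞ M]
  {x : M → ℝ} (hx : IsBoundaryDefining n x)
  (hκ : κ ∈ IsManifold.maximalAtlas (𝓡∂ n) ∞ M)
  {g : BMetric n M} {ρ : BInvNorm g} {ℓ v μ : ℝ} (hℓ : 0 < ℓ) (hv : 0 < v) (hμ : 0 < μ)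
  {A : BDistribution n M → BDistribution n M} (hA : IsQuantization x ρ ℓ v μ A)
  {u : BDistribution n M} {s r : ℝ}

include hx hℓ hv hμ hA

include hκ in
-- Half-order steps keep a margin below the gain of almost one derivative. The parameter is `α = 0`
-- throughout: only then does the output carry the weight `r + ℓ log` required as input of the next
-- step.
lemma MemHbAt.iterate (hneg : MemHbLocNegInf x r ℓ u) (hAu : MemHbLoc x s 0 r 0 (A u)) (k : ℕ) :
    ∀ {χ Y : M → ℝ}, IsCutoff κ χ → IsCutoff κ Y → (∀ᶠ p in 𝓝ˢ (tsupport χ), Y p = 1) →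
      ∀ {m : ℝ}, MemHbAt x m 0 r ℓ u κ Y → MemHbAt x (min s (m + k / 2)) 0 r ℓ u κ χ := by
  have h0 : (0 : ℝ) ∈ Set.Icc (0 : ℝ) 1 := by simp
  induction k with
  | zero =>
    intro χ Y hχ hY hχY m hu
    -- Even without gain the step is used, to pass from the cutoff `Y` to `χ`.
    have h1 := hu.improve hx hκ hℓ hv hμ hA hneg hAu h0 hχ hY hχY
      (s' := min s (m + (0 : ℕ) / 2)) (min_le_left _ _)
      ((min_le_right _ _).trans_lt (by simp))
    simpa using h1
  | succ k ih =>
    intro χ Y hχ hY hχY m hu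
    obtain ⟨X, hX, hχX, hXY⟩ := hχ.exists_between hχY
    have h1 := (ih hX hY hXY hu).improve hx hκ hℓ hv hμ hA hneg hAu h0 hχ hX hχX
      (s' := min s (m + (k + 1 : ℕ) / 2)) (min_le_left _ _) (by
        push_cast
        rcases min_cases s (m + k / 2 : ℝ) with h | h <;> rw [h.1]
        · exact (min_le_left _ _).trans_lt (by linarith)
        · exact (min_le_right _ _).trans_lt (by linarith))
    simpa using h1

/-- Regularity of solutions. -/
theorem memHbLoc_of_apply (hneg : MemHbLocNegInf x r ℓ u) (hAu : MemHbLoc x s 0 r 0 (A u))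
    {α : ℝ} (hα : α ∈ Set.Icc (0 : ℝ) 1) : MemHbLoc x s (α * ℓ) r ((1 - α) * ℓ) u := by
  intro κ hκ χ hχ
  obtain ⟨X, hX, hχX⟩ := hχ.exists_larger
  obtain ⟨Y, hY, hXY⟩ := hX.exists_larger
  obtain ⟨m, hm⟩ := hneg κ hκ Y hY
  -- So many half steps that `m + k / 2 ≥ s`.
  obtain ⟨k, hk⟩ := exists_nat_ge (2 * (s - m))
  have h1 := MemHbAt.iterate hx hκ hℓ hv hμ hA hneg hAu k hX hY hXY hm
  rw [min_eq_left (by linarith)] at h1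
  exact h1.improve hx hκ hℓ hv hμ hA hneg hAu hα hχ hX hχX le_rfl (by linarith)

omit hℓ hv hμ hA in
include hκ in
/-- Pairings with the quantization of a symbol. -/
lemma wBounded_quantization {X Y : M → ℝ} (hX : IsCutoff κ X)
    (hXY : ∀ᶠ p in 𝓝ˢ (tsupport X), Y p = 1) {ℓ' j m k : ℝ}
    {ψ : EuclideanSpace ℝ (Fin n) → ℝ} (hψ : ContDiff ℝ ∞ ψ) (hψc : HasCompactSupport ψ)
    (hψ1 : ψ 0 = 1) {B : EuclideanSpace ℝ (Fin n) → EuclideanSpace ℝ (Fin n) → ℂ}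
    (hB : IsLocSym (-r) j (logWeight m k) B) (hu : MemHbAt x s ℓ' r j u κ Y) :
    WBounded (logWeight (-s + m) (-ℓ' + k)) (fun φ => u.pairing κ
      (fun w => (logLift κ X w : ℂ) * ampOp (fun w' w ζ => ψ (w - w') * B w ζ) φ w)) := by
  have hmod : Moderate (logWeight m k : E → ℝ) := moderate_logWeight _ _
  obtain ⟨D, hD⟩ := hB.of_moderate hmod
  have h0 : SymCls Set.univ (fun w : E => w) (tWeight (-r) j) (fun _ _ => (0 : ℂ)) :=
    SymCls.const _ fun w _ => by simpa using (tWeight_pos (-r) j w).le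
  have hBr : SymCls Set.univ (fun a : E × E × E => a.1)
      (fun a => tWeight (-r) j a.1 * (logWeight m k a.2.1 * (1 + ‖a.2.1 - a.2.2‖) ^ 0))
      (fun a w => B w a.2.1 * (1 : ℂ) - 0) := by
    simpa using hB.cls.reindex fun a : E × E × E => (a.1, a.2.1)
  have h1 := wBounded_sandwich hx hκ hX hXY hψ hψc hψ1 hD isLocSym_one h0 hmod hBr hu
  simp only [logWeight_mul] at h1
  refine h1.congr fun φ hφ => ?_
  rw [ampOp_cutoff hψ hψc hψ1 hφ.smooth]
  simp

omit hℓ hv hμ hA in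
include hκ in
lemma isBTest_quantization {X Y : M → ℝ} (hX : IsCutoff κ X) (hY : IsCutoff κ Y)
    (hXY : ∀ᶠ p in 𝓝ˢ (tsupport X), Y p = 1) {j m k : ℝ}
    {ψ : EuclideanSpace ℝ (Fin n) → ℝ} (hψ : ContDiff ℝ ∞ ψ) (hψc : HasCompactSupport ψ)
    (hψ1 : ψ 0 = 1) {B : EuclideanSpace ℝ (Fin n) → EuclideanSpace ℝ (Fin n) → ℂ}
    (hB : IsLocSym (-r) j (logWeight m k) B) {φ : E → ℂ} (hφ : IsBT φ) :
    IsBTest (κ.extend (𝓡∂ n)).target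
      (fun w => (logLift κ X w : ℂ) * ampOp (fun w' w ζ => ψ (w - w') * B w ζ) φ w) := by
  have hmod : Moderate (logWeight m k : E → ℝ) := moderate_logWeight _ _
  obtain ⟨D, hD⟩ := hB.of_moderate hmod
  have h0 : SymCls Set.univ (fun w : E => w) (tWeight (-r) j) (fun _ _ => (0 : ℂ)) :=
    SymCls.const _ fun w _ => by simpa using (tWeight_pos (-r) j w).le
  have h1 := isBTest_sandwich hx hκ hX hY hXY hψ hψc hD isLocSym_one h0 hφ
  rw [ampOp_cutoff hψ hψc hψ1 hφ.smooth] at h1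
  simpa using h1

omit hℓ hv hμ hA in
include hκ in
lemma logLift_mul_ampOp_add {X Y : M → ℝ} (hX : IsCutoff κ X)
    (hXY : ∀ᶠ p in 𝓝ˢ (tsupport X), Y p = 1) {j m k m' k' : ℝ}
    {ψ : EuclideanSpace ℝ (Fin n) → ℝ} (hψ : ContDiff ℝ ∞ ψ) (hψc : HasCompactSupport ψ)
    {B B' : EuclideanSpace ℝ (Fin n) → EuclideanSpace ℝ (Fin n) → ℂ}
    (hB : IsLocSym (-r) j (logWeight m k) B) (hB' : IsLocSym (-r) j (logWeight m' k') B')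
    {φ : E → ℂ} (hφ : IsBT φ) (w : E) :
    (logLift κ X w : ℂ) * ampOp (fun w' w ζ => ψ (w - w') * (B w ζ + B' w ζ)) φ w =
      (logLift κ X w : ℂ) * ampOp (fun w' w ζ => ψ (w - w') * B w ζ) φ w +
      (logLift κ X w : ℂ) * ampOp (fun w' w ζ => ψ (w - w') * B' w ζ) φ w := by
  have hmod : ∀ s ℓ : ℝ, Moderate (logWeight s ℓ : E → ℝ) := fun s ℓ => moderate_logWeight s ℓ
  obtain ⟨D, hD⟩ := hB.of_moderate (hmod _ _)
  obtain ⟨D', hD'⟩ := hB'.of_moderate (hmod _ _)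
  have hm := (hX.symCls_cutLift hx hκ r (-j)).ofReal
  have h1 := ampOp_add (hD.isAmp hm (add_neg_cancel r) (neg_add_cancel j) hψ hψc)
    (hD'.isAmp hm (add_neg_cancel r) (neg_add_cancel j) hψ hψc) hφ w
  have e := fun p : E → E → E → ℂ =>
    ampOp_const_mul p (fun w => (cutLift κ x X r (-j) w : ℂ)) φ w
  simp only [mul_assoc, ← mul_add] at h1
  simp only [e] at h1
  rw [logLift_eq_cutLift_mul hx hκ hXY r j, Complex.ofReal_mul, mul_assoc, h1]
  ring

/-- Mapping properties. -/
theorem memHbLoc_apply (h1 : MemHbLoc x s ℓ r 0 u) (h2 : MemHbLoc x s 0 r ℓ u) :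
    MemHbLoc x s 0 r 0 (A u) := by
  intro κ hκ χ hχ
  obtain ⟨X, hX, hχX⟩ := hχ.exists_larger
  obtain ⟨Y, hY, hXY⟩ := hX.exists_larger
  obtain ⟨b, ψ, N, κs, K, -, -, hba, hψ, hψc, hψ1, hK, hop⟩ := hA κ hκ χ X hχ hX hχX
  replace hψ1 : ψ 0 = 1 := hψ1.self_of_nhds
  -- The first part is matched with the extra logarithmic weight of `u`, the second with its extra
  -- logarithmic regularity.
  obtain ⟨a₁, a₂, ha₁, ha₂, ha⟩ := exists_splitting hκ hχ hx ρ hv hμ hℓ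
  have hneg : MemHbLocNegInf x r ℓ u := fun κ hκ χ hχ => ⟨s, h2 κ hκ χ hχ⟩
  have hXc := (hX.symCls_cutLift hx hκ (-r) 0).ofReal
  have hba' : IsLocSym 0 ℓ (logWeight 0 0) (fun w ζ => b w ζ -
      chartMul κ χ (fun w' => (doubleLogSymbol x ρ ℓ v μ κ w' ζ : ℂ)) w) := by
    obtain ⟨c, hc, hc'⟩ : ∃ c > 0, ∀ ξ : E, logWeight (-1) ℓ ξ ≤ c * logWeight 0 0 ξ :=
      logWeight_le_of_lt (by norm_num) _ _
    exact hba.isLocSym.mono hc hc'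
  -- The remainder `b - χ a`, of order `-1 + ℓ log` and size `log^ℓ(x⁻¹)`, is in particular of order
  -- `0` and joins the first part.
  have hB₁ := ((hba'.add ha₁).scaled_logWeight).mul_right hXc
  have hB₂ := (ha₂.scaled_logWeight).mul_right hXc
  rw [zero_add, add_zero] at hB₁
  rw [zero_add, zero_add] at hB₂
  -- Only to have a common weight class for the additivity of quantizations; the estimate of this
  -- part uses the sharper class.
  have hB₂' := hB₂.weight_mono (fun ζ => (logWeight_pos _ _ _).le) hℓ.le
  have hsum : ∀ w ζ, scaled b w ζ * (cutLift κ x X (-r) 0 w : ℂ) =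
      scaled (fun w ζ => b w ζ - chartMul κ χ
        (fun w' => (doubleLogSymbol x ρ ℓ v μ κ w' ζ : ℂ)) w + a₁ w ζ) w ζ *
          (cutLift κ x X (-r) 0 w : ℂ) + scaled a₂ w ζ * (cutLift κ x X (-r) 0 w : ℂ) :=
    fun w ζ => by
      simp only [scaled]
      rw [← add_mul, add_assoc, ha, logLift_mul_doubleLogSymbol hκ hx ρ, sub_add_cancel]
  have hmod : Moderate (logWeight (-s) 0 : E → ℝ) := moderate_logWeight _ _
  have F1 := wBounded_quantization hx hκ hX hXY hψ hψc hψ1 hB₁ (h2 κ hκ Y hY)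
  have F2 := wBounded_quantization hx hκ hX hXY hψ hψc hψ1 hB₂ (h1 κ hκ Y hY)
  rw [add_zero, add_zero, neg_zero] at F1
  rw [add_zero, neg_add_cancel] at F2
  have F3 := wBounded_residual hx hκ hK hX hneg (r := r) hmod
  obtain ⟨C, hC, hbd⟩ := ((F1.add F2).add F3).congr
    (G := fun φ => (A u).pairing κ (fun w => (cutLift κ x χ (-r) 0 w : ℂ) * φ w)) fun φ hφ => by
      have e1 := hop u _ (hX.isBT_cutLift_mul hx hκ (-r) 0 hφ).isBTest
      rw [chartMul_cutLift hx hκ hχX, opTranspose_mul, chartMul_eq] at e1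
      simp only [hsum, logLift_mul_ampOp_add hx hκ hX hXY hψ hψc hB₁ hB₂' hφ] at e1
      have e2 := u.map_add κ hκ _ _
        (isBTest_quantization hx hκ hX hY hXY hψ hψc hψ1 hB₁ hφ)
        (isBTest_quantization hx hκ hX hY hXY hψ hψc hψ1 hB₂ hφ)
      rw [e1, ← e2]
      rfl
  exact memHbAt_of_bound hx hκ hχ hC (by simpa only [neg_zero] using hbd)

end MainResults
end

theorem mainTheorem6 {n : ℕ} [NeZero n] {M : Type*} [TopologicalSpace M] [T2Space M]
    [SecondCountableTopology M] [ChartedSpace (EuclideanHalfSpace n) M]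
    [IsManifold (𝓡∂ n) ∞ M]
    (x : M → ℝ) (hx : IsBoundaryDefining n x) (g : BMetric n M) (ρ : BInvNorm g)
    (ℓ v μ : ℝ) (hℓ : 0 < ℓ) (hv : 0 < v) (hμ : 0 < μ)
    (A : BDistribution n M → BDistribution n M) (hA : IsQuantization x ρ ℓ v μ A) (s r : ℝ) :
    (∀ u : BDistribution n M, MemHbLocNegInf x r ℓ u → MemHbLoc x s 0 r 0 (A u) →
      ∀ α ∈ Set.Icc (0 : ℝ) 1, MemHbLoc x s (α * ℓ) r ((1 - α) * ℓ) u) ∧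
    (∀ u : BDistribution n M, MemHbLoc x s ℓ r 0 u → MemHbLoc x s 0 r ℓ u →
      MemHbLoc x s 0 r 0 (A u)) ∧
    (∀ u : BDistribution n M, MemHbLoc x s ℓ r 0 u → MemHbLoc x s 0 r ℓ u →
      ∀ α ∈ Set.Icc (0 : ℝ) 1, MemHbLoc x s (α * ℓ) r ((1 - α) * ℓ) u) := by
  refine ⟨fun u h1 h2 α hα => memHbLoc_of_apply hx hℓ hv hμ hA h1 h2 hα,
    fun u h1 h2 => memHbLoc_apply hx hℓ hv hμ hA h1 h2, fun u h1 h2 α hα => ?_⟩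
  -- The second assumption supplies the a priori regularity with `m = s`, and the mapping property
  -- supplies the regularity of `Au`.
  exact memHbLoc_of_apply hx hℓ hv hμ hA (fun κ hκ χ hχ => ⟨s, h2 κ hκ χ hχ⟩)
    (memHbLoc_apply hx hℓ hv hμ hA h1 h2) hα
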